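/- Let $M$ be a smooth manifold (finite-dimensional, Hausdorff, second countable), let $A\to M$ be a real vector bundle of finite rank with a Lie algebroid structure (anchor $\rho:A\to TM$, bracket $[\cdot,\cdot]$ on $\Gamma(A)$ with $[\alpha,f\beta]=f[\alpha,\beta]+(\rho(\alpha)f)\beta$), and let $\nabla$ be a connection on the vector bundle $A$, with curvature $R_\nabla$. Put $$\nabla^{\rm bas}_\alpha\beta=\nabla_{\rho(\beta)}\alpha+[\alpha,\beta],\qquad \nabla^{\rm bas}_\alpha X=\rho(\nabla_X\alpha)+[\rho(\alpha),X],$$ $$R^{\rm bas}_\nabla(\alpha,\beta)X=\nabla_X[\alpha,\beta]-[\nabla_X\alpha,\beta]-[\alpha,\nabla_X\beta]-\nabla_{\nabla^{\rm bas}_\beta X}\alpha+\nabla_{\nabla^{\rm bas}_\alpha X}\beta .$$ Let $$W(A,\nabla)=\bigoplus_{u,v,w\ge 0}\Gamma(\Lambda^uT^*M\otimes S^vA^*\otimes\Lambda^wA^*),$$ the graded commutative algebra over $C^\infty(M)$ in which $T^*M$ and $\Lambda^1A^*$ are odd and $S^1A^*$ is even, and let $W^{p,q}$ be the sum of the terms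 with $p=v+w$, $q=u+v$. For $\eta\in\Gamma(A^*)$ write $\theta_\eta\in\Gamma(\Lambda^1A^*)$ and $\mu_\eta\in\Gamma(S^1A^*)$ for the corresponding elements. A graded derivation of $W(A,\nabla)$ is an $\mathbb R$-linear map $d$ with $d(ab)=d(a)b+(-1)^{p+q}a\,d(b)$ for $a\in W^{p,q}$. (i) There is a unique graded derivation $d^{\rm ver}_\nabla$ of $W(A,\nabla)$ which on $\Omega^0(M)$ and $\Omega^1(M)$ is the de Rham differential and satisfies $$d^{\rm ver}_\nabla\theta_\eta=\mu_\eta+d_{\nabla^*}\theta_\eta,\qquad d^{\rm ver}_\nabla\mu_\eta=d_{\nabla^*}\mu_\eta+\eta\circ R_\nabla\qquad(\eta\in\Gamma(A^*)),$$ where $\nabla^*$ is the dual connection, $d_{\nabla^*}$ takes values in $\Omega^1(M;A^*)$ (with coefficients in the respective copy of $A^*$) and $\eta\circ R_\nabla\in\Omega^2(M;\Lambda^1A^*)$. It is the structure operator on $W(A,\nabla)=\Omega(M;S\mathcal D^*)$ obtained by dualizing the representation up to homotopy of $TM$ on the double $\mathcal D=(A\xrightarrow{\rm Id}A)$ and extending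 it to symmetric powers. There is a unique graded derivation $d^{\rm hor}_\nabla$ of $W(A,\nabla)$ which on $C^\infty(M)$ and $\Gamma(\Lambda^1A^*)$ is the differential $d_A$ of the algebroid and satisfies $$d^{\rm hor}_\nabla\xi=-\mu_{\xi\circ\rho}+d_{(\nabla^{\rm bas})^*}\xi\quad(\xi\in\Omega^1(M)),\qquad d^{\rm hor}_\nabla\mu_\eta=d_{(\nabla^{\rm bas})^*}\mu_\eta+\eta\circ R^{\rm bas}_\nabla\quad(\eta\in\Gamma(A^*)),$$ with values in $\Gamma(S^1A^*)\oplus\Omega^1(A;T^*M)$ and in $\Omega^1(A;S^1A^*)\oplus\Omega^2(A;T^*M)$ respectively. It is the structure operator on $W(A,\nabla)=\Omega(A;S\,{\rm Ad}^*)$ obtained from the conjugate $-\rho^*+(\nabla^{\rm bas})^*+(R^{\rm bas}_\nabla)^*$ of the coadjoint representation. (ii) With these operators $W(A,\nabla)=\bigoplus_{p,q}W^{p,q}$ is a differential bigraded algebra: $W^{p,q}\cdot W^{p',q'}\subset W^{p+p',q+q'}$, $d^{\rm hor}_\nabla(W^{p,q})\subset W^{p+1,q}$, $d^{\rm ver}_\nabla(W^{p,q})\subset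 W^{p,q+1}$, both are graded derivations of square zero, and $d^{\rm hor}_\nabla d^{\rm ver}_\nabla+d^{\rm ver}_\nabla d^{\rm hor}_\nabla=0$. (iii) The cohomology of $W(A,\nabla)$, graded by the total degree $p+q$, with respect to $d_\nabla=d^{\rm hor}_\nabla+d^{\rm ver}_\nabla$ is isomorphic, as a graded algebra, to the de Rham cohomology of $M$. (iv) If $\nabla'$ is another connection on $A$, there is an isomorphism of algebras $W(A,\nabla)\to W(A,\nabla')$ that preserves the bigrading and intertwines $d^{\rm hor}_\nabla$ with $d^{\rm hor}_{\nabla'}$ and $d^{\rm ver}_\nabla$ with $d^{\rm ver}_{\nabla'}$. -/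

import Mathlib

open Bundle VectorField
open scoped Manifold ContDiff TensorProduct Topology

set_option linter.unusedSectionVars false

noncomputable section

namespace WeilModel

/-! ### Lie algebroids and connections

Throughout, `M` is a smooth manifold modelled on the finite-dimensional space `E`, and `B`, `V`,
`A` denote smooth real vector bundles over `M`. -/

section Algebroids

variable (E : Type*) [NormedAddCommGroup E] [NormedSpace ℝ E] [FiniteDimensional ℝ E]
  {M : Type*} [TopologicalSpace M] [ChartedSpace E M] [IsManifold 𝓘(ℝ, E) ∞ M]

/-- The space `Γ(V)` of smooth sections of a vector bundle `V` with typical fibre `F`. -/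
abbrev Sec (F : Type*) [NormedAddCommGroup F] [NormedSpace ℝ F]
    (V : M → Type*) [TopologicalSpace (TotalSpace F V)] [∀ x, AddCommGroup (V x)]
    [∀ x, Module ℝ (V x)] [∀ x, TopologicalSpace (V x)] [FiberBundle F V] :=
  ContMDiffSection 𝓘(ℝ, E) F ∞ V

variable (M) in
/-- Smooth vector fields on `M`. -/
abbrev VF := Sec (M := M) E E (TangentSpace 𝓘(ℝ, E) : M → Type _)

variable (M) in
/-- Smooth functions on `M`. -/
abbrev Fn := C^∞⟮𝓘(ℝ, E), M; ℝ⟯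

variable {E}

/-- The derivative of the function `f` along the tangent vector `v` at `x`. -/
def dirDeriv (f : M → ℝ) {x : M} (v : TangentSpace 𝓘(ℝ, E) x) : ℝ :=
  mvfderiv 𝓘(ℝ, E) f x v

/-- The product `f • s` of a smooth function and a smooth section. -/
def smulSec {F : Type*} [NormedAddCommGroup F] [NormedSpace ℝ F]
    {V : M → Type*} [TopologicalSpace (TotalSpace F V)] [∀ x, AddCommGroup (V x)]
    [∀ x, Module ℝ (V x)] [∀ x, TopologicalSpace (V x)] [FiberBundle F V] [VectorBundle ℝ F V]
    (f : Fn E M) (s : Sec E F V) : Sec E F V :=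
  ⟨(f : M → ℝ) • (s : ∀ x, V x), f.contMDiff.smul_section s.contMDiff⟩

variable (E)

/-- A Lie algebroid structure on the vector bundle `B`: a smooth bundle map `anchor : B → TM` and
a Lie bracket on `Γ(B)` satisfying the Leibniz identity. -/
structure LieAlgebroid (F : Type*) [NormedAddCommGroup F] [NormedSpace ℝ F]
    (B : M → Type*) [TopologicalSpace (TotalSpace F B)] [∀ x, AddCommGroup (B x)]
    [∀ x, Module ℝ (B x)] [∀ x, TopologicalSpace (B x)] [FiberBundle F B]
    [VectorBundle ℝ F B] where
  anchor : ∀ x, B x →ₗ[ℝ] TangentSpace 𝓘(ℝ, E) x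
  anchor_smooth : ∀ s : Sec E F B, CMDiff ∞ (T% fun x => anchor x (s x))
  bracket : Sec E F B →ₗ[ℝ] Sec E F B →ₗ[ℝ] Sec E F B
  bracket_self : ∀ s, bracket s s = 0
  jacobi : ∀ r s t, bracket r (bracket s t) = bracket (bracket r s) t + bracket s (bracket r t)
  leibniz : ∀ (s t : Sec E F B) (f : Fn E M) (x : M),
    bracket s (smulSec f t) x = f x • bracket s t x + dirDeriv f (anchor x (s x)) • t x


variable (M) in
/-- The tangent bundle, with the identity as anchor and the Lie bracket of vector fields. -/
def LieAlgebroid.tangent :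
    LieAlgebroid E E (TangentSpace 𝓘(ℝ, E) : M → Type _) where
  anchor _ := LinearMap.id
  anchor_smooth s := s.contMDiff
  bracket := LinearMap.mk₂ ℝ
    (fun X Y => (⟨mlieBracket 𝓘(ℝ, E) X Y, by
      have : IsManifold 𝓘(ℝ, E) (((⊤ : ℕ∞) : ℕ∞ω) + 1) M := ‹IsManifold 𝓘(ℝ, E) ∞ M›
      have : IsManifold 𝓘(ℝ, E) (minSmoothness ℝ 2) M := by
        rw [minSmoothness_of_isRCLikeNormedField]
        infer_instance
      exact fun x => (X.contMDiff x).mlieBracket_vectorField (n := ⊤) (m := ⊤) (Y.contMDiff x)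
        (by simp)⟩ : VF E M))
    (fun X X' Y => ContMDiffSection.ext fun x => mlieBracket_add_left
      ((X.contMDiff x).mdifferentiableAt (by simp)) ((X'.contMDiff x).mdifferentiableAt (by simp)))
    (fun c X Y => ContMDiffSection.ext fun x => mlieBracket_const_smul_left
      ((X.contMDiff x).mdifferentiableAt (by simp)))
    (fun X Y Y' => ContMDiffSection.ext fun x => mlieBracket_add_right
      ((Y.contMDiff x).mdifferentiableAt (by simp)) ((Y'.contMDiff x).mdifferentiableAt (by simp)))
    (fun c X Y => ContMDiffSection.ext fun x => mlieBracket_const_smul_right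
      ((Y.contMDiff x).mdifferentiableAt (by simp)))
  bracket_self X := ContMDiffSection.ext fun x => congrFun (mlieBracket_self (V := X)) x
  jacobi X Y Z := ContMDiffSection.ext fun x => by
    have : IsManifold 𝓘(ℝ, E) (minSmoothness ℝ 3) M := by
      rw [minSmoothness_of_isRCLikeNormedField]
      infer_instance
    have h2 : minSmoothness ℝ 2 ≤ ∞ := by
      rw [minSmoothness_of_isRCLikeNormedField]
      exact WithTop.coe_le_coe.2 (le_top : (2 : ℕ∞) ≤ ⊤)
    exact leibniz_identity_mlieBracket_apply ((X.contMDiff x).of_le h2)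
      ((Y.contMDiff x).of_le h2) ((Z.contMDiff x).of_le h2)
  leibniz X Y f x := by
    have h := mlieBracket_smul_right (V := X) (x := x)
      ((f.contMDiff x).mdifferentiableAt (by simp)) ((Y.contMDiff x).mdifferentiableAt (by simp))
    exact h.trans (add_comm _ _)

variable {E}

section Bundles

variable {FB : Type*} [NormedAddCommGroup FB] [NormedSpace ℝ FB]
  {B : M → Type*} [TopologicalSpace (TotalSpace FB B)] [∀ x, AddCommGroup (B x)]
  [∀ x, Module ℝ (B x)] [∀ x, TopologicalSpace (B x)] [FiberBundle FB B] [VectorBundle ℝ FB B]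

/-- The smooth vector field `ρ(s)`. -/
def LieAlgebroid.rho (L : LieAlgebroid E FB B) (s : Sec E FB B) : VF E M :=
  ⟨fun x => L.anchor x (s x), L.anchor_smooth s⟩

/-- A `B`-connection on the vector bundle `V`, for a Lie algebroid `B`. -/
structure Connection (L : LieAlgebroid E FB B) (FV : Type*) [NormedAddCommGroup FV]
    [NormedSpace ℝ FV] (V : M → Type*) [TopologicalSpace (TotalSpace FV V)]
    [∀ x, AddCommGroup (V x)] [∀ x, Module ℝ (V x)] [∀ x, TopologicalSpace (V x)]
    [FiberBundle FV V] [VectorBundle ℝ FV V] where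
  conn : Sec E FB B →ₗ[ℝ] Sec E FV V →ₗ[ℝ] Sec E FV V
  conn_smul : ∀ (f : Fn E M) (b : Sec E FB B) (s : Sec E FV V),
    conn (smulSec f b) s = smulSec f (conn b s)
  conn_leibniz : ∀ (f : Fn E M) (b : Sec E FB B) (s : Sec E FV V) (x : M),
    conn b (smulSec f s) x = f x • conn b s x + dirDeriv f (L.anchor x (b x)) • s x

end Bundles

/-! ### The dual structure operator of a representation of length one -/

section TwoTerm

variable {FB : Type*} [NormedAddCommGroup FB] [NormedSpace ℝ FB]
  {B : M → Type*} [TopologicalSpace (TotalSpace FB B)] [∀ x, AddCommGroup (B x)]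
  [∀ x, Module ℝ (B x)] [∀ x, TopologicalSpace (B x)] [FiberBundle FB B] [VectorBundle ℝ FB B]

variable (FB B) in
/-- A smooth section of the dual bundle `B*`. -/
def IsSmoothDual (ν : ∀ x, Module.Dual ℝ (B x)) : Prop :=
  ∀ s : Sec E FB B, CMDiff ∞ (fun x => ν x (s x))

variable (FB B) in
/-- A basis of the fibre `B x`, together with smooth sections of `B` extending it. -/
structure FrameAt (x : M) where
  sec : Fin (Module.finrank ℝ FB) → Sec E FB B
  basis : Module.Basis (Fin (Module.finrank ℝ FB)) ℝ (B x)
  sec_apply : ∀ i, sec i x = basis i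

variable {F₀ : Type*} [NormedAddCommGroup F₀] [NormedSpace ℝ F₀]
  {V₀ : M → Type*} [TopologicalSpace (TotalSpace F₀ V₀)] [∀ x, AddCommGroup (V₀ x)]
  [∀ x, Module ℝ (V₀ x)] [∀ x, TopologicalSpace (V₀ x)] [FiberBundle F₀ V₀] [VectorBundle ℝ F₀ V₀]
  {F₁ : Type*} [NormedAddCommGroup F₁] [NormedSpace ℝ F₁]
  {V₁ : M → Type*} [TopologicalSpace (TotalSpace F₁ V₁)] [∀ x, AddCommGroup (V₁ x)]
  [∀ x, Module ℝ (V₁ x)] [∀ x, TopologicalSpace (V₁ x)] [FiberBundle F₁ V₁] [VectorBundle ℝ F₁ V₁]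

variable (E FB B F₀ V₀ F₁ V₁) in
/-- The components `D = ∂ + ∇ + K` of an operator on `Ω(B; V₀ ⊕ V₁)`, with `V₀` in degree `0` and
`V₁` in degree `1`: the map `∂ : V₀ → V₁`, the `B`-connections on `V₀` and `V₁`, and the
`2`-form `K` on `B` with values in `Hom(V₁, V₀)`. -/
structure TwoTermOperator where
  bd : ∀ x, V₀ x →ₗ[ℝ] V₁ x
  conn₀ : Sec E FB B → Sec E F₀ V₀ → Sec E F₀ V₀
  conn₁ : Sec E FB B → Sec E F₁ V₁ → Sec E F₁ V₁
  K : Sec E FB B → Sec E FB B → Sec E F₁ V₁ → Sec E F₀ V₀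

/-- The conjugate `-∂ + ∇ - K` of `∂ + ∇ + K`. -/
def TwoTermOperator.conj (D : TwoTermOperator E FB B F₀ V₀ F₁ V₁) :
    TwoTermOperator E FB B F₀ V₀ F₁ V₁ where
  bd x := -D.bd x
  conn₀ := D.conn₀
  conn₁ := D.conn₁
  K a b s := -D.K a b s

/-- The curvature of a `B`-connection. -/
def Connection.curvature {L : LieAlgebroid E FB B} (nab : Connection L F₀ V₀)
    (a b : Sec E FB B) (s : Sec E F₀ V₀) : Sec E F₀ V₀ :=
  nab.conn a (nab.conn b s) - nab.conn b (nab.conn a s) - nab.conn (L.bracket a b) s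

/-- The representation up to homotopy `Id + ∇ + K` on the double `V₀ → V₀` (in degrees `0`, `1`).
The equation `∂K + K∂ + R_∇ = 0` for the `2`-form component gives `K = -R_∇`. -/
def double {L : LieAlgebroid E FB B} (nab : Connection L F₀ V₀) :
    TwoTermOperator E FB B F₀ V₀ F₀ V₀ where
  bd _ := LinearMap.id
  conn₀ := fun a s => nab.conn a s
  conn₁ := fun a s => nab.conn a s
  K a b s := -nab.curvature a b s

end TwoTerm

section Adjoint

variable {FA : Type*} [NormedAddCommGroup FA] [NormedSpace ℝ FA]
  {A : M → Type*} [TopologicalSpace (TotalSpace FA A)] [∀ x, AddCommGroup (A x)]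
  [∀ x, Module ℝ (A x)] [∀ x, TopologicalSpace (A x)] [FiberBundle FA A] [VectorBundle ℝ FA A]
  (L : LieAlgebroid E FA A) (nab : Connection (LieAlgebroid.tangent E M) FA A)

/-- The basic `A`-connection on `A`. -/
def basicConnA (α β : Sec E FA A) : Sec E FA A :=
  nab.conn (L.rho β) α + L.bracket α β

/-- The basic `A`-connection on `TM`. -/
def basicConnT (α : Sec E FA A) (X : VF E M) : VF E M :=
  L.rho (nab.conn X α) + (LieAlgebroid.tangent E M).bracket (L.rho α) X

/-- The basic curvature. -/
def basicCurvature (α β : Sec E FA A) (X : VF E M) : Sec E FA A :=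
  nab.conn X (L.bracket α β) - L.bracket (nab.conn X α) β - L.bracket α (nab.conn X β)
    - nab.conn (basicConnT L nab β X) α + nab.conn (basicConnT L nab α X) β

/-- The adjoint representation `ρ + ∇^bas + R^bas` on `A → TM`. -/
def adjoint : TwoTermOperator E FA A FA A E (TangentSpace 𝓘(ℝ, E) : M → Type _) where
  bd := L.anchor
  conn₀ := basicConnA L nab
  conn₁ := basicConnT L nab
  K := basicCurvature L nab

end Adjoint

/-! ### Cohomology of Lie algebroids, and de Rham cohomology -/

section Cohomology

variable {FB : Type*} [NormedAddCommGroup FB] [NormedSpace ℝ FB]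
  {B : M → Type*} [TopologicalSpace (TotalSpace FB B)] [∀ x, AddCommGroup (B x)]
  [∀ x, Module ℝ (B x)] [∀ x, TopologicalSpace (B x)] [FiberBundle FB B] [VectorBundle ℝ FB B]

variable (B) in
/-- Families of alternating `n`-forms on the fibres of `B`. -/
def RawForm (n : ℕ) : Type _ := ∀ x, B x [⋀^Fin n]→ₗ[ℝ] ℝ

instance (n : ℕ) : AddCommGroup (RawForm B n) :=
  inferInstanceAs (AddCommGroup (∀ x, B x [⋀^Fin n]→ₗ[ℝ] ℝ))

instance (n : ℕ) : Module ℝ (RawForm B n) :=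
  inferInstanceAs (Module ℝ (∀ x, B x [⋀^Fin n]→ₗ[ℝ] ℝ))

theorem RawForm.add_apply {n : ℕ} (τ τ' : RawForm B n) (x : M) (v : Fin n → B x) :
    (τ + τ') x v = τ x v + τ' x v := rfl

theorem RawForm.smul_apply {n : ℕ} (c : ℝ) (τ : RawForm B n) (x : M) (v : Fin n → B x) :
    (c • τ) x v = c * τ x v := rfl

variable (E FB B) in
/-- `Ωⁿ(B) = Γ(Λⁿ B*)`: fibrewise alternating forms whose value on smooth sections is smooth. -/
def FormSpace (n : ℕ) : Submodule ℝ (RawForm B n) where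
  carrier := {τ | ∀ s : Fin n → Sec E FB B, CMDiff ∞ (fun x => τ x (fun i => s i x))}
  add_mem' h h' s := (h s).add (h' s)
  zero_mem' _ := contMDiff_const
  smul_mem' c _ h s :=
    (contMDiff_const (I := 𝓘(ℝ, E)) (I' := 𝓘(ℝ, ℝ)) (c := c)).smul (h s)

/-- The bracket terms `∑_{i<j} (-1)^{i+j} τ([sᵢ, sⱼ], s₀, …, ŝᵢ, …, ŝⱼ, …, sₙ)` of the Koszul
formula. -/
def koszulBracket (L : LieAlgebroid E FB B) : (n : ℕ) → RawForm B n →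
    (Fin (n + 1) → Sec E FB B) → M → ℝ
  | 0, _, _, _ => 0
  | n + 1, τ, s, x =>
    -- the pair `(i, j)` with `i ≤ j` stands for the pair `i < j + 1` of positions
    ∑ i : Fin (n + 1), ∑ j ∈ Finset.Ici i, (-1) ^ (i.val + (j.val + 1)) *
      τ x (Fin.cons (L.bracket (s i.castSucc) (s j.succ) x)
        (j.removeNth (i.castSucc.removeNth (fun k => s k x))))

/-- The Koszul formula for `(d_B τ)(s₀, …, sₙ)` at the point `x`. -/
def koszulFun (L : LieAlgebroid E FB B) {n : ℕ} (τ : RawForm B n)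
    (s : Fin (n + 1) → Sec E FB B) (x : M) : ℝ :=
  ∑ i : Fin (n + 1), (-1) ^ i.val *
    dirDeriv (fun y => τ y (fun k => s (i.succAbove k) y)) (L.anchor x (s i x))
  + koszulBracket L n τ s x

/-- The Koszul differential, with `d_B τ` regarded as a function of sections. -/
def koszul (L : LieAlgebroid E FB B) (n : ℕ) :
    FormSpace E FB B n →ₗ[ℝ] ((Fin (n + 1) → Sec E FB B) → M → ℝ) where
  toFun τ := koszulFun L τ.1
  map_add' τ τ' := by
    funext s x
    have h1 : ∀ i : Fin (n + 1), dirDeriv (fun y => (τ + τ').1 y (fun k => s (i.succAbove k) y))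
        (L.anchor x (s i x)) = dirDeriv (fun y => τ.1 y (fun k => s (i.succAbove k) y))
        (L.anchor x (s i x)) + dirDeriv (fun y => τ'.1 y (fun k => s (i.succAbove k) y))
        (L.anchor x (s i x)) := fun i =>
      congrArg (fun l => l (L.anchor x (s i x))) (mvfderiv_fun_add (x := x)
        ((τ.2 (fun k => s (i.succAbove k)) x).mdifferentiableAt (by simp))
        ((τ'.2 (fun k => s (i.succAbove k)) x).mdifferentiableAt (by simp)))
    have h2 : koszulBracket L n (τ + τ').1 s x =
        koszulBracket L n τ.1 s x + koszulBracket L n τ'.1 s x := by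
      cases n with
      | zero => simp [koszulBracket]
      | succ n => simp [koszulBracket, RawForm.add_apply, mul_add, Finset.sum_add_distrib]
    simp only [koszulFun, h1, h2, mul_add, Finset.sum_add_distrib, Pi.add_apply]
    ring
  map_smul' c τ := by
    funext s x
    have h1 : ∀ i : Fin (n + 1), dirDeriv (fun y => (c • τ).1 y (fun k => s (i.succAbove k) y))
        (L.anchor x (s i x)) = c * dirDeriv (fun y => τ.1 y (fun k => s (i.succAbove k) y))
        (L.anchor x (s i x)) := fun i => by
      have h := congrArg (fun l => l (L.anchor x (s i x))) (mvfderiv_fun_mul (x := x)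
        (mdifferentiableAt_const (c := c))
        ((τ.2 (fun k => s (i.succAbove k)) x).mdifferentiableAt (by simp)))
      simpa [dirDeriv, mvfderiv_const, RawForm.smul_apply] using h
    have h2 : koszulBracket L n (c • τ).1 s x = c * koszulBracket L n τ.1 s x := by
      cases n with
      | zero => simp [koszulBracket]
      | succ n => simp [koszulBracket, RawForm.smul_apply, Finset.mul_sum, mul_left_comm]
    simp only [koszulFun, h1, h2, Pi.smul_apply, smul_eq_mul, RingHom.id_apply, mul_add,
      Finset.mul_sum, mul_left_comm]

variable (FB B) in
/-- A form as a function of sections. -/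
def evalForm (n : ℕ) : FormSpace E FB B n →ₗ[ℝ] ((Fin n → Sec E FB B) → M → ℝ) where
  toFun τ s x := τ.1 x (fun i => s i x)
  map_add' _ _ := rfl
  map_smul' _ _ := rfl

/-- The closed `n`-forms of `B`. -/
def closedForms (L : LieAlgebroid E FB B) (n : ℕ) : Submodule ℝ (FormSpace E FB B n) :=
  LinearMap.ker (koszul L n)

/-- The exact `n`-forms of `B`. -/
def exactForms (L : LieAlgebroid E FB B) : (n : ℕ) → Submodule ℝ (FormSpace E FB B n)
  | 0 => ⊥
  | n + 1 => (LinearMap.range (koszul L n)).comap (evalForm FB B (n + 1))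

/-- The cohomology `Hⁿ(B)`; for `B = TM` this is the de Rham cohomology of `M`. -/
abbrev AlgebroidCohomology (L : LieAlgebroid E FB B) (n : ℕ) :=
  closedForms L n ⧸ (exactForms L n).submoduleOf (closedForms L n)

/-- The wedge product of forms. -/
def wedge {m n : ℕ} (σ : RawForm B m) (τ : RawForm B n) : RawForm B (m + n) := fun x =>
  ((LinearMap.mul' ℝ ℝ).compAlternatingMap ((σ x).domCoprod (τ x))).domDomCongr finSumFinEquiv

end Cohomology
end Algebroids

/-! ### The bigraded algebra `W(A, ∇)` -/

section Weil

variable (E : Type*) [NormedAddCommGroup E] [NormedSpace ℝ E] [FiniteDimensional ℝ E]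
  {M : Type*} [TopologicalSpace M] [ChartedSpace E M] [IsManifold 𝓘(ℝ, E) ∞ M]
  (FA : Type*) [NormedAddCommGroup FA] [NormedSpace ℝ FA]
  (A : M → Type*) [TopologicalSpace (TotalSpace FA A)] [∀ x, AddCommGroup (A x)]
  [∀ x, Module ℝ (A x)] [∀ x, TopologicalSpace (A x)] [FiberBundle FA A] [VectorBundle ℝ FA A]

/-- The fibre at `x` of `Λ T*M ⊗ S A* ⊗ Λ A*`, as a graded commutative algebra: the graded tensor
product of `Λ T*M` and `Λ A*` is realised as `Λ (T*M ⊕ A*)`, and `S A*` is even. -/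
def WeilFiber (x : M) : Type _ :=
  ExteriorAlgebra ℝ (Module.Dual ℝ (TangentSpace 𝓘(ℝ, E) x) × Module.Dual ℝ (A x)) ⊗[ℝ]
    SymmetricAlgebra ℝ (Module.Dual ℝ (A x))

instance (x : M) : Ring (WeilFiber E A x) :=
  inferInstanceAs (Ring (ExteriorAlgebra ℝ
    (Module.Dual ℝ (TangentSpace 𝓘(ℝ, E) x) × Module.Dual ℝ (A x)) ⊗[ℝ]
      SymmetricAlgebra ℝ (Module.Dual ℝ (A x))))

instance (x : M) : Algebra ℝ (WeilFiber E A x) :=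
  inferInstanceAs (Algebra ℝ (ExteriorAlgebra ℝ
    (Module.Dual ℝ (TangentSpace 𝓘(ℝ, E) x) × Module.Dual ℝ (A x)) ⊗[ℝ]
      SymmetricAlgebra ℝ (Module.Dual ℝ (A x))))

/-- The inclusion of `Λ (T*M ⊕ A*)` in the fibre at `x`. -/
def inclΛ (x : M) : ExteriorAlgebra ℝ
    (Module.Dual ℝ (TangentSpace 𝓘(ℝ, E) x) × Module.Dual ℝ (A x)) →ₐ[ℝ] WeilFiber E A x :=
  Algebra.TensorProduct.includeLeft

/-- The inclusion of `S A*` in the fibre at `x`. -/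
def inclS (x : M) : SymmetricAlgebra ℝ (Module.Dual ℝ (A x)) →ₐ[ℝ] WeilFiber E A x :=
  Algebra.TensorProduct.includeRight

theorem inclΛ_mul_inclS (x : M) (a : ExteriorAlgebra ℝ
    (Module.Dual ℝ (TangentSpace 𝓘(ℝ, E) x) × Module.Dual ℝ (A x)))
    (b : SymmetricAlgebra ℝ (Module.Dual ℝ (A x))) :
    inclΛ E A x a * inclS E A x b = inclS E A x b * inclΛ E A x a :=
  (Algebra.TensorProduct.tmul_mul_tmul a 1 1 b).trans
    ((by simp : (a * 1) ⊗ₜ[ℝ] (1 * b) = (1 * a) ⊗ₜ[ℝ] (b * 1)).trans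
      (Algebra.TensorProduct.tmul_mul_tmul 1 a b 1).symm)

/-- The generators in `T*M`. -/
def genT (x : M) : Module.Dual ℝ (TangentSpace 𝓘(ℝ, E) x) →ₗ[ℝ] WeilFiber E A x :=
  (inclΛ E A x).toLinearMap ∘ₗ ExteriorAlgebra.ι ℝ ∘ₗ LinearMap.inl ℝ _ _

/-- The generators in `Λ¹ A*`. -/
def genΛ (x : M) : Module.Dual ℝ (A x) →ₗ[ℝ] WeilFiber E A x :=
  (inclΛ E A x).toLinearMap ∘ₗ ExteriorAlgebra.ι ℝ ∘ₗ LinearMap.inr ℝ _ _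

/-- The generators in `S¹ A*`. -/
def genS (x : M) : Module.Dual ℝ (A x) →ₗ[ℝ] WeilFiber E A x :=
  (inclS E A x).toLinearMap ∘ₗ SymmetricAlgebra.ι ℝ _

/-- The fibre at `x` of `Λᵘ T*M ⊗ Sᵛ A* ⊗ Λʷ A*`: the span of the products of `u` elements of
`T*M`, `v` elements of `S¹ A*` and `w` elements of `Λ¹ A*`. -/
def fiberPiece (u v w : ℕ) (x : M) : Submodule ℝ (WeilFiber E A x) :=
  LinearMap.range (genT E A x) ^ u * LinearMap.range (genS E A x) ^ v *
    LinearMap.range (genΛ E A x) ^ w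

/-- The algebra of all (not necessarily continuous) sections of the bundle of algebras, with
pointwise operations. -/
def RawWeil : Type _ := ∀ x, WeilFiber E A x

instance : Ring (RawWeil E A) := inferInstanceAs (Ring (∀ x, WeilFiber E A x))

instance : Algebra ℝ (RawWeil E A) := inferInstanceAs (Algebra ℝ (∀ x, WeilFiber E A x))

theorem RawWeil.add_apply (s t : RawWeil E A) (x : M) : (s + t) x = s x + t x := rfl

theorem RawWeil.mul_apply (s t : RawWeil E A) (x : M) : (s * t) x = s x * t x := rfl

theorem RawWeil.smul_apply (c : ℝ) (s : RawWeil E A) (x : M) : (c • s) x = c • s x := rfl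

/-- The sections of the bundle of algebras that are polynomial expressions in smooth functions,
smooth `1`-forms on `M` and smooth sections of the two copies of `A*`. -/
def polySections : Subalgebra ℝ (RawWeil E A) :=
  Algebra.adjoin ℝ
    ({s | ∃ f : Fn E M, s = fun x => algebraMap ℝ (WeilFiber E A x) (f x)} ∪
     {s | ∃ ν, IsSmoothDual (E := E) E (TangentSpace 𝓘(ℝ, E) : M → Type _) ν ∧
       s = fun x => genT E A x (ν x)} ∪
     {s | ∃ ν, IsSmoothDual (E := E) FA A ν ∧ s = fun x => genΛ E A x (ν x)} ∪
     {s | ∃ ν, IsSmoothDual (E := E) FA A ν ∧ s = fun x => genS E A x (ν x)})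

/-- `Γ(Λᵘ T*M ⊗ Sᵛ A* ⊗ Λʷ A*)`. A section is smooth if near every point it is a combination,
with smooth coefficients, of products of smooth sections of `T*M` and of `A*`. -/
def weilSections (u v w : ℕ) : Submodule ℝ (RawWeil E A) where
  carrier := {s | (∀ x, s x ∈ fiberPiece E A u v w x) ∧
    ∀ x, ∃ t ∈ polySections E FA A, ∀ᶠ y in 𝓝 x, s y = t y}
  add_mem' h h' := ⟨fun x => add_mem (h.1 x) (h'.1 x), fun x => by
    obtain ⟨t, ht, e⟩ := h.2 x
    obtain ⟨t', ht', e'⟩ := h'.2 x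
    exact ⟨t + t', add_mem ht ht', by
      filter_upwards [e, e'] with y hy hy'
      rw [RawWeil.add_apply, RawWeil.add_apply, hy, hy']⟩⟩
  zero_mem' := ⟨fun x => zero_mem _, fun x => ⟨0, zero_mem _, by simp⟩⟩
  smul_mem' c _ h := ⟨fun x => Submodule.smul_mem _ c (h.1 x), fun x => by
    obtain ⟨t, ht, e⟩ := h.2 x
    exact ⟨c • t, Subalgebra.smul_mem _ ht c, by filter_upwards [e] with y hy; simp only [RawWeil.smul_apply, hy]⟩⟩

theorem triple_pow_mul {S : Type*} [Semiring S] [Algebra ℝ S] {X Y Z : Submodule ℝ S}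
    (hXZ : X * Z = Z * X) (hXY : X * Y = Y * X) (hZY : Z * Y = Y * Z) (u v w u' v' w' : ℕ) :
    X ^ u * Y ^ v * Z ^ w * (X ^ u' * Y ^ v' * Z ^ w') =
      X ^ (u + u') * Y ^ (v + v') * Z ^ (w + w') := by
  have h1 := (Commute.symm hXZ).pow_pow w u'
  have h2 := (Commute.symm hXY).pow_pow v u'
  have h3 := (show Commute Z Y from hZY).pow_pow w v'
  simp only [pow_add]
  calc X ^ u * Y ^ v * Z ^ w * (X ^ u' * Y ^ v' * Z ^ w')
      = X ^ u * Y ^ v * (Z ^ w * X ^ u') * Y ^ v' * Z ^ w' := by simp only [mul_assoc]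
    _ = X ^ u * (Y ^ v * X ^ u') * (Z ^ w * Y ^ v') * Z ^ w' := by
        rw [h1.eq]; simp only [mul_assoc]
    _ = X ^ u * X ^ u' * (Y ^ v * Y ^ v') * (Z ^ w * Z ^ w') := by
        rw [h2.eq, h3.eq]; simp only [mul_assoc]

theorem one_mem_triple {S : Type*} [Semiring S] [Algebra ℝ S] (X Y Z : Submodule ℝ S) :
    1 ∈ X ^ 0 * Y ^ 0 * Z ^ 0 := by
  simp only [pow_zero, mul_one]
  exact Submodule.one_le.1 le_rfl

variable {E} in
theorem commute_T_Λ (x : M) :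
    LinearMap.range (genT E A x) * LinearMap.range (genΛ E A x) =
      LinearMap.range (genΛ E A x) * LinearMap.range (genT E A x) := by
  have key : ∀ a b, genT E A x a * genΛ E A x b = -(genΛ E A x b * genT E A x a) := by
    intro a b
    have h := ExteriorAlgebra.ι_add_mul_swap (R := ℝ)
      ((a, 0) : Module.Dual ℝ (TangentSpace 𝓘(ℝ, E) x) × Module.Dual ℝ (A x)) (0, b)
    rw [← add_eq_zero_iff_eq_neg]
    have h' := congrArg (inclΛ E A x) h
    rw [map_add, map_mul, map_mul, map_zero] at h'
    exact h'
  refine le_antisymm (Submodule.mul_le.2 ?_) (Submodule.mul_le.2 ?_)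
  · rintro _ ⟨a, rfl⟩ _ ⟨b, rfl⟩
    rw [key]
    exact neg_mem (Submodule.mul_mem_mul ⟨b, rfl⟩ ⟨a, rfl⟩)
  · rintro _ ⟨b, rfl⟩ _ ⟨a, rfl⟩
    rw [← neg_eq_iff_eq_neg.2 (key a b)]
    exact neg_mem (Submodule.mul_mem_mul ⟨a, rfl⟩ ⟨b, rfl⟩)

theorem commute_S (x : M) (P : Submodule ℝ (WeilFiber E A x))
    (hP : ∀ p ∈ P, ∃ a : ExteriorAlgebra ℝ
      (Module.Dual ℝ (TangentSpace 𝓘(ℝ, E) x) × Module.Dual ℝ (A x)), p = inclΛ E A x a) :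
    P * LinearMap.range (genS E A x) = LinearMap.range (genS E A x) * P := by
  have key : ∀ p ∈ P, ∀ b, p * genS E A x b = genS E A x b * p := by
    intro p hp b
    obtain ⟨a, rfl⟩ := hP p hp
    exact inclΛ_mul_inclS E A x a _
  refine le_antisymm (Submodule.mul_le.2 ?_) (Submodule.mul_le.2 ?_)
  · rintro p hp _ ⟨b, rfl⟩
    rw [key p hp]
    exact Submodule.mul_mem_mul ⟨b, rfl⟩ hp
  · rintro _ ⟨b, rfl⟩ p hp
    rw [← key p hp]
    exact Submodule.mul_mem_mul hp ⟨b, rfl⟩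

theorem one_mem_fiberPiece (x : M) : 1 ∈ fiberPiece E A 0 0 0 x :=
  one_mem_triple _ _ _

theorem fiberPiece_mul (x : M) (u v w u' v' w' : ℕ) :
    fiberPiece E A u v w x * fiberPiece E A u' v' w' x =
      fiberPiece E A (u + u') (v + v') (w + w') x :=
  triple_pow_mul (commute_T_Λ A x)
    (commute_S E A x _ (by rintro _ ⟨a, rfl⟩; exact ⟨_, rfl⟩))
    (commute_S E A x _ (by rintro _ ⟨a, rfl⟩; exact ⟨_, rfl⟩)) u v w u' v' w'

theorem weilSections_mul {u v w u' v' w' : ℕ} {s s' : RawWeil E A}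
    (h : s ∈ weilSections E FA A u v w) (h' : s' ∈ weilSections E FA A u' v' w') :
    s * s' ∈ weilSections E FA A (u + u') (v + v') (w + w') :=
  ⟨fun x => fiberPiece_mul E A x u v w u' v' w' ▸ Submodule.mul_mem_mul (h.1 x) (h'.1 x),
   fun x => by
    obtain ⟨t, ht, e⟩ := h.2 x
    obtain ⟨t', ht', e'⟩ := h'.2 x
    exact ⟨t * t', mul_mem ht ht', by
      filter_upwards [e, e'] with y hy hy'
      rw [RawWeil.mul_apply, RawWeil.mul_apply, hy, hy']⟩⟩

/-- The algebra `W(A, ∇) = ⨁_{u,v,w} Γ(Λᵘ T*M ⊗ Sᵛ A* ⊗ Λʷ A*)`, as an algebra of sections. -/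
def Weil : Subalgebra ℝ (RawWeil E A) :=
  Submodule.toSubalgebra (⨆ t : ℕ × ℕ × ℕ, weilSections E FA A t.1 t.2.1 t.2.2)
    (Submodule.mem_iSup_of_mem (0, 0, 0)
      ⟨one_mem_fiberPiece E A, fun x => ⟨1, one_mem _, by simp⟩⟩)
    (fun s s' hs hs' => by
      refine Submodule.mul_le.1 ?_ s hs s' hs'
      rw [Submodule.iSup_mul]
      refine iSup_le fun t => ?_
      rw [Submodule.mul_iSup]
      exact iSup_le fun t' => Submodule.mul_le.2 fun a ha b hb =>
        Submodule.mem_iSup_of_mem (t + t') (weilSections_mul E FA A ha hb))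

/-- The part `W^{p,q}` of bidegree `p = v + w`, `q = u + v`. -/
def weilPiece (p q : ℕ) : Submodule ℝ (Weil E FA A) :=
  (⨆ t : ℕ × ℕ × ℕ, ⨆ _ : t.2.1 + t.2.2 = p ∧ t.1 + t.2.1 = q,
    weilSections E FA A t.1 t.2.1 t.2.2).comap (Weil E FA A).val.toLinearMap

variable {E FA A}

/-- `d` is a graded derivation of the algebra of sections of `W`, with respect to total parity. -/
def IsGradedDerivation (d : Weil E FA A →ₗ[ℝ] Weil E FA A) : Prop :=
  ∀ p q a b, a ∈ weilPiece E FA A p q → d (a * b) = d a * b + (-1 : ℝ) ^ (p + q) • (a * d b)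

section StructureOperator

variable {FB : Type*} [NormedAddCommGroup FB] [NormedSpace ℝ FB]
  {B : M → Type*} [TopologicalSpace (TotalSpace FB B)] [∀ x, AddCommGroup (B x)]
  [∀ x, Module ℝ (B x)] [∀ x, TopologicalSpace (B x)] [FiberBundle FB B] [VectorBundle ℝ FB B]
  {F₀ : Type*} [NormedAddCommGroup F₀] [NormedSpace ℝ F₀]
  {V₀ : M → Type*} [TopologicalSpace (TotalSpace F₀ V₀)] [∀ x, AddCommGroup (V₀ x)]
  [∀ x, Module ℝ (V₀ x)] [∀ x, TopologicalSpace (V₀ x)] [FiberBundle F₀ V₀] [VectorBundle ℝ F₀ V₀]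
  {F₁ : Type*} [NormedAddCommGroup F₁] [NormedSpace ℝ F₁]
  {V₁ : M → Type*} [TopologicalSpace (TotalSpace F₁ V₁)] [∀ x, AddCommGroup (V₁ x)]
  [∀ x, Module ℝ (V₁ x)] [∀ x, TopologicalSpace (V₁ x)] [FiberBundle F₁ V₁] [VectorBundle ℝ F₁ V₁]

/-- Let `W` be viewed as `Ω(B; S(V*))`, where `V = V₀ ⊕ V₁` has degrees `0` and `1`, by means of
the generators `gB` in `B*` (forms), `g₀` in `V₀*` and `g₁` in `V₁*`. Then `d` is the structure
operator on `S(V*)` induced by the operator `D = ∂ + ∇ + K` on `V`: it is a graded derivation which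
is `d_B` on `Ω(B)` and the dual operator `D* = ∂* + ∇* - K*` on `Γ(V*)`, where

* `(∂* η)(v) = η(∂ v)` for `η` in `V₁*` and `∂* = 0` on `V₀*`,
* `(∇*_b η)(v) = ρ(b)(η(v)) - η(∇_b v)`,
* `(K*(b, b') η)(v) = η(K(b, b') v)` for `η` in `V₀*` and `v` in `V₁`.

The elements of `Ω¹(B; V*)`, `Ω²(B)` and `Ω²(B; V₁*)` are written out at each point `x` in terms of
bases of the fibres at `x`. -/
structure IsDualStructureOperator (L : LieAlgebroid E FB B)
    (D : TwoTermOperator E FB B F₀ V₀ F₁ V₁)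
    (gB : ∀ x, Module.Dual ℝ (B x) →ₗ[ℝ] WeilFiber E A x)
    (g₀ : ∀ x, Module.Dual ℝ (V₀ x) →ₗ[ℝ] WeilFiber E A x)
    (g₁ : ∀ x, Module.Dual ℝ (V₁ x) →ₗ[ℝ] WeilFiber E A x)
    (d : Weil E FA A →ₗ[ℝ] Weil E FA A) : Prop where
  derivation : IsGradedDerivation d
  on_functions : ∀ (f : Fn E M) (w : Weil E FA A),
    (∀ x, w.1 x = algebraMap ℝ (WeilFiber E A x) (f x)) →
    ∀ x (b : FrameAt (E := E) FB B x),
      (d w).1 x = ∑ i, dirDeriv f (L.anchor x (b.basis i)) • gB x (b.basis.coord i)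
  on_forms : ∀ (ν : ∀ x, Module.Dual ℝ (B x)) (w : Weil E FA A), IsSmoothDual (E := E) FB B ν →
    (∀ x, w.1 x = gB x (ν x)) →
    ∀ x (b : FrameAt (E := E) FB B x),
      (d w).1 x = (1 / 2 : ℝ) • ∑ i, ∑ j,
        (dirDeriv (fun y => ν y (b.sec j y)) (L.anchor x (b.basis i))
          - dirDeriv (fun y => ν y (b.sec i y)) (L.anchor x (b.basis j))
          - ν x (L.bracket (b.sec i) (b.sec j) x)) •
        (gB x (b.basis.coord i) * gB x (b.basis.coord j))
  on_dual₁ : ∀ (η : ∀ x, Module.Dual ℝ (V₁ x)) (w : Weil E FA A),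
    IsSmoothDual (E := E) F₁ V₁ η → (∀ x, w.1 x = g₁ x (η x)) →
    ∀ x (b : FrameAt (E := E) FB B x) (v : FrameAt (E := E) F₁ V₁ x),
      (d w).1 x = g₀ x (η x ∘ₗ D.bd x) + ∑ i, ∑ j,
        (dirDeriv (fun y => η y (v.sec j y)) (L.anchor x (b.basis i))
          - η x (D.conn₁ (b.sec i) (v.sec j) x)) •
        (gB x (b.basis.coord i) * g₁ x (v.basis.coord j))
  on_dual₀ : ∀ (η : ∀ x, Module.Dual ℝ (V₀ x)) (w : Weil E FA A),
    IsSmoothDual (E := E) F₀ V₀ η → (∀ x, w.1 x = g₀ x (η x)) →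
    ∀ x (b : FrameAt (E := E) FB B x) (v : FrameAt (E := E) F₀ V₀ x)
      (v' : FrameAt (E := E) F₁ V₁ x),
      (d w).1 x = ∑ i, ∑ j,
        (dirDeriv (fun y => η y (v.sec j y)) (L.anchor x (b.basis i))
          - η x (D.conn₀ (b.sec i) (v.sec j) x)) •
        (gB x (b.basis.coord i) * g₀ x (v.basis.coord j))
        - (1 / 2 : ℝ) • ∑ i, ∑ k, ∑ j, η x (D.K (b.sec i) (b.sec k) (v'.sec j) x) •
          (gB x (b.basis.coord i) * gB x (b.basis.coord k) * g₁ x (v'.basis.coord j))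

end StructureOperator

/-- `d` is the vertical differential `d_∇^ver`: the structure operator on
`W = Ω(M; S(𝒟*))` induced by the double `𝒟 = (A → A)` of `A`. Here `A*` in degree `-1` is the copy
that generates `Λ A*`, and `A*` in degree `0` the copy that generates `S A*`. -/
def IsVerticalDifferential (nab : Connection (LieAlgebroid.tangent E M) FA A)
    (d : Weil E FA A →ₗ[ℝ] Weil E FA A) : Prop :=
  IsDualStructureOperator (LieAlgebroid.tangent E M) (double nab)
    (genT E A) (genS E A) (genΛ E A) d

/-- `d` is the horizontal differential `d_∇^hor`: the structure operator on
`W = Ω(A; S(Ad*))` induced by the conjugate `-ρ* + (∇^bas)* + (R^bas)*` of the coadjoint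
representation. -/
def IsHorizontalDifferential (L : LieAlgebroid E FA A)
    (nab : Connection (LieAlgebroid.tangent E M) FA A)
    (d : Weil E FA A →ₗ[ℝ] Weil E FA A) : Prop :=
  IsDualStructureOperator L (adjoint L nab).conj (genΛ E A) (genS E A) (genT E A) d

/-- `W = ⨁ W^{p,q}` with the operators `dhor` and `dver` is a differential bigraded algebra. -/
structure IsDifferentialBigradedAlgebra (dhor dver : Weil E FA A →ₗ[ℝ] Weil E FA A) : Prop where
  graded : SetLike.GradedMonoid (fun pq : ℕ × ℕ => weilPiece E FA A pq.1 pq.2)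
  internal : DirectSum.IsInternal (fun pq : ℕ × ℕ => weilPiece E FA A pq.1 pq.2)
  hor_mem : ∀ p q a, a ∈ weilPiece E FA A p q → dhor a ∈ weilPiece E FA A (p + 1) q
  ver_mem : ∀ p q a, a ∈ weilPiece E FA A p q → dver a ∈ weilPiece E FA A p (q + 1)
  hor_derivation : IsGradedDerivation dhor
  ver_derivation : IsGradedDerivation dver
  hor_hor : ∀ a, dhor (dhor a) = 0
  ver_ver : ∀ a, dver (dver a) = 0
  hor_ver : ∀ a, dhor (dver a) + dver (dhor a) = 0

variable (E FA A) in
/-- The part `Wⁿ` of total degree `n = p + q = u + 2v + w`. -/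
def weilDegree (n : ℕ) : Submodule ℝ (Weil E FA A) :=
  ⨆ pq : ℕ × ℕ, ⨆ _ : pq.1 + pq.2 = n, weilPiece E FA A pq.1 pq.2

/-- The cocycles of degree `n` of an operator `d` on `W`. -/
def weilCocycles (d : Weil E FA A →ₗ[ℝ] Weil E FA A) (n : ℕ) : Submodule ℝ (Weil E FA A) :=
  LinearMap.ker d ⊓ weilDegree E FA A n

/-- The coboundaries of degree `n` of an operator `d` on `W`. -/
def weilCoboundaries (d : Weil E FA A →ₗ[ℝ] Weil E FA A) : ℕ → Submodule ℝ (Weil E FA A)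
  | 0 => ⊥
  | n + 1 => (weilDegree E FA A n).map d

/-- The cohomology of degree `n` of an operator `d` on `W`. -/
abbrev WeilCohomology (d : Weil E FA A →ₗ[ℝ] Weil E FA A) (n : ℕ) :=
  weilCocycles d n ⧸ (weilCoboundaries d n).submoduleOf (weilCocycles d n)

variable (E M) in
/-- The de Rham cohomology of `M`. -/
abbrev DeRham (n : ℕ) := AlgebroidCohomology (LieAlgebroid.tangent E M) n

/-- A multiplicative linear isomorphism `Hⁿ(W, d) ≃ Hⁿ_dR(M)` in all degrees `n`, that is, an
isomorphism of graded algebras (products of classes being computed on representatives). -/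
def CohomologyIsDeRham (d : Weil E FA A →ₗ[ℝ] Weil E FA A) : Prop :=
  ∃ Φ : ∀ n, WeilCohomology d n ≃ₗ[ℝ] DeRham E M n,
    ∀ (m n : ℕ) (a : weilCocycles d m) (b : weilCocycles d n) (c : weilCocycles d (m + n))
      (σ : closedForms (LieAlgebroid.tangent E M) m) (τ : closedForms (LieAlgebroid.tangent E M) n)
      (υ : closedForms (LieAlgebroid.tangent E M) (m + n)),
      c.1 = a.1 * b.1 → υ.1.1 = wedge σ.1.1 τ.1.1 →
      Φ m (Submodule.Quotient.mk a) = Submodule.Quotient.mk σ →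
      Φ n (Submodule.Quotient.mk b) = Submodule.Quotient.mk τ →
      Φ (m + n) (Submodule.Quotient.mk c) = Submodule.Quotient.mk υ

end Weil
end WeilModel
end

set_option linter.unusedVariables false

noncomputable section

/-! Locally `W` is freely generated over the smooth functions `f` by odd covectors `ξ` on `M`, odd
elements `θ_η` and even elements `μ_η`. A graded derivation is local, because bump functions are
available, so it is determined by its values on functions and generators. This gives uniqueness
(`IsOddDer.ext`). Conversely, values of the right parity that obey the Leibniz rule under
multiplication by functions extend to a derivation. Near a point a frame turns a section into a
function with values in one fixed fibre algebra. The derivation then differentiates the coefficients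
and applies an odd derivation of the fibre (`DerivationData.exists_derivation`). The prescribed
values of both differentials obey these rules because the double and the adjoint representation are
tensorial up to the Leibniz terms of their connections.

For the identities the decisive remark is that `μ_η = d_ver θ_η - d_{∇*} θ_η`, and that every
covector at a point is the value of some `df = d_ver f`. Hence a local operator that is compatible
with products and with `d_ver` has to be examined only on functions and on `θ_η`. Once `d_ver² = 0`
is known, the anticommutator `[d_hor, d_ver]` commutes with `d_ver`, and once the anticommutator
vanishes, `d_hor²` commutes with `d_ver`. So neither the Bianchi identity nor the structure
equations of the adjoint representation have to be proved separately (`IsVerticalDifferential.sq`,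
`anticomm`, `IsHorizontalDifferential.sq`).

The remaining checks on `θ_η` use Cartan calculus. Contractions with vector fields and with sections
of `A` detect all components that contain an odd generator. The one component they miss, `S¹A*` in
bidegree `(1,1)`, is detected by the odd derivation `h` with `h μ_η = θ_η` that kills the other
generators (`eq_zero_of_cT_hOp`, `eq_zero_of_cΛ_hOp`). After contraction each identity becomes an
identity between dual sections, which is the definition of the curvature, of the basic connections
or of the basic curvature.

The same `h` is a homotopy: `h d_ver + d_ver h` is multiplication by `p` on `W^{p,q}`
(`IsVerticalDifferential.euler`), since the difference of the two sides is an even derivation that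
commutes with `d_ver` and kills `f` and `θ_η`. So the rows with `p > 0` are exact for `d_ver`, and
correcting one value of `p` after another shows that the part `p ≥ 1` is acyclic for the total
differential (`exists_primitive`). The projection of `W` onto its row `p = 0` is an algebra map
whose kernel is this part. Evaluation on vector fields identifies the row with the differential
forms on `M`, products with wedge products (`weilForm_mul`) and `d_ver` with the Koszul differential
(`IsVerticalDifferential.weilForm_d`).

For two connections, `(d_{∇'*} - d_{∇*}) θ_η` is linear over functions in `η`. Hence `μ_η ↦ μ_η +
(d_{∇'*} - d_{∇*}) θ_η` defines an algebra automorphism fixing `f`, `ξ` and `θ`. It is designed to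
intertwine the vertical differentials on `θ`. On `ξ` it intertwines the horizontal ones because
`d_{(∇^bas)*} ξ + d_{∇*} θ_{ξ∘ρ}` does not depend on `∇` (`basT_add_covΛ`). -/

namespace WeilModel

/-! ### The fibre algebra -/

section Fibre

variable {E : Type*} [NormedAddCommGroup E] [NormedSpace ℝ E] [FiniteDimensional ℝ E]
  {M : Type*} [TopologicalSpace M] [ChartedSpace E M] [IsManifold 𝓘(ℝ, E) ∞ M]
  {A : M → Type*} [∀ x, AddCommGroup (A x)] [∀ x, Module ℝ (A x)] [∀ x, TopologicalSpace (A x)]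
  {x : M}

/-- The space of covectors at `x`. -/
abbrev Cotan (E : Type*) [NormedAddCommGroup E] [NormedSpace ℝ E]
    {M : Type*} [TopologicalSpace M] [ChartedSpace E M] (x : M) : Type _ :=
  Module.Dual ℝ (TangentSpace 𝓘(ℝ, E) x)

/-- The target need not be commutative, so the lift is made into the subalgebra generated by the
values of `f`, which is commutative because the values commute. The second conclusion remembers this
subalgebra; it is what makes the lift commute with a lift of the exterior factor. -/
theorem exists_symmetricAlgebra_lift {U H : Type*} [AddCommGroup U] [Module ℝ U] [Ring H]
    [Algebra ℝ H] (f : U →ₗ[ℝ] H) (hf : ∀ u v, f u * f v = f v * f u) :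
    ∃ φ : SymmetricAlgebra ℝ U →ₐ[ℝ] H, (∀ u, φ (SymmetricAlgebra.ι ℝ U u) = f u) ∧
      ∀ a, φ a ∈ Algebra.adjoin ℝ (Set.range f) := by
  have hc : IsMulCommutative (Algebra.adjoin ℝ (Set.range f)) :=
    Algebra.isMulCommutative_adjoin ℝ (by rintro _ ⟨u, rfl⟩ _ ⟨v, rfl⟩; exact hf u v)
  let _ : CommRing (Algebra.adjoin ℝ (Set.range f)) :=
    { (inferInstance : Ring (Algebra.adjoin ℝ (Set.range f))) with
      mul_comm := hc.is_comm.comm }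
  let g : U →ₗ[ℝ] Algebra.adjoin ℝ (Set.range f) :=
    f.codRestrict (Subalgebra.toSubmodule (Algebra.adjoin ℝ (Set.range f)))
      (fun u => Algebra.subset_adjoin ⟨u, rfl⟩)
  refine ⟨(Algebra.adjoin ℝ (Set.range f)).val.comp (SymmetricAlgebra.lift g), fun u => ?_,
    fun a => ?_⟩
  · rw [AlgHom.comp_apply, SymmetricAlgebra.lift_ι_apply]; rfl
  · exact (SymmetricAlgebra.lift g a).2

/-- The universal property of the fibre: `hsq` polarizes to all anticommutation relations among odd
generators, and the other hypotheses make the even generators commute with everything. Fibre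
algebras, subalgebras, matrix algebras (for derivations), monoid algebras (for gradings) and `ℝ`
(for the augmentation) all occur as `H`. -/
theorem exists_weilLift {H : Type*} [Ring H] [Algebra ℝ H]
    (fT : Cotan E x →ₗ[ℝ] H) (fΛ fS : Module.Dual ℝ (A x) →ₗ[ℝ] H)
    (hsq : ∀ ξ η, (fT ξ + fΛ η) * (fT ξ + fΛ η) = 0)
    (hSS : ∀ η η', fS η * fS η' = fS η' * fS η)
    (hTS : ∀ ξ η, fT ξ * fS η = fS η * fT ξ) (hΛS : ∀ η η', fΛ η * fS η' = fS η' * fΛ η) :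
    ∃ φ : WeilFiber E A x →ₐ[ℝ] H, (∀ ξ, φ (genT E A x ξ) = fT ξ) ∧
      (∀ η, φ (genΛ E A x η) = fΛ η) ∧ (∀ η, φ (genS E A x η) = fS η) := by
  obtain ⟨ψ, hψ, hψ'⟩ := exists_symmetricAlgebra_lift fS hSS
  let χ := ExteriorAlgebra.lift ℝ ⟨fT.coprod fΛ, fun m => hsq m.1 m.2⟩
  have hgen : ∀ m s, Commute (fT.coprod fΛ m) (ψ s) := by
    intro m s
    have hle : Algebra.adjoin ℝ (Set.range fS) ≤ Subalgebra.centralizer ℝ {fT.coprod fΛ m} := by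
      refine Algebra.adjoin_le ?_
      rintro _ ⟨u, rfl⟩
      refine Subalgebra.mem_centralizer_iff ℝ |>.2 ?_
      rintro g rfl
      rw [LinearMap.coprod_apply, add_mul, mul_add, hTS, hΛS]
    exact Subalgebra.mem_centralizer_iff ℝ |>.1 (hle (hψ' s)) _ rfl
  have hcomm : ∀ a s, Commute (χ a) (ψ s) := by
    intro a s
    induction a using ExteriorAlgebra.induction with
    | algebraMap r => rw [AlgHom.commutes]; exact Algebra.commute_algebraMap_left r _
    | ι m => rw [show χ (ExteriorAlgebra.ι ℝ m) = _ from ExteriorAlgebra.lift_ι_apply ..]; exact hgen m s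
    | mul a b ha hb => rw [map_mul]; exact ha.mul_left hb
    | add a b ha hb => rw [map_add]; exact ha.add_left hb
  refine ⟨(Algebra.TensorProduct.lift χ ψ hcomm : _ →ₐ[ℝ] H), fun ξ => ?_, fun η => ?_, fun η => ?_⟩
  · refine (Algebra.TensorProduct.lift_tmul χ ψ hcomm _ _).trans ?_
    rw [map_one, mul_one]
    refine (ExteriorAlgebra.lift_ι_apply ..).trans ?_
    simp
  · refine (Algebra.TensorProduct.lift_tmul χ ψ hcomm _ _).trans ?_
    rw [map_one, mul_one]
    refine (ExteriorAlgebra.lift_ι_apply ..).trans ?_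
    simp
  · refine (Algebra.TensorProduct.lift_tmul χ ψ hcomm _ _).trans ?_
    rw [map_one, one_mul, hψ]

theorem weilFiber_hom_ext {H : Type*} [Ring H] [Algebra ℝ H] {φ ψ : WeilFiber E A x →ₐ[ℝ] H}
    (hT : ∀ ξ, φ (genT E A x ξ) = ψ (genT E A x ξ))
    (hΛ : ∀ η, φ (genΛ E A x η) = ψ (genΛ E A x η))
    (hS : ∀ η, φ (genS E A x η) = ψ (genS E A x η)) : φ = ψ := by
  have h1 : φ.comp (inclΛ E A x) = ψ.comp (inclΛ E A x) := by
    refine ExteriorAlgebra.hom_ext (LinearMap.ext fun m => ?_)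
    have hm : ExteriorAlgebra.ι ℝ m = ExteriorAlgebra.ι ℝ (LinearMap.inl ℝ _ _ m.1) +
        ExteriorAlgebra.ι ℝ (LinearMap.inr ℝ (Cotan E x) (Module.Dual ℝ (A x)) m.2) := by
      rw [← map_add]; simp
    have hm' : inclΛ E A x (ExteriorAlgebra.ι ℝ m) = genT E A x m.1 + genΛ E A x m.2 := by
      rw [hm, map_add]; rfl
    simp only [LinearMap.comp_apply, AlgHom.toLinearMap_apply, AlgHom.comp_apply, hm', map_add,
      hT, hΛ]
  have h2 : ∀ s, φ (inclS E A x s) = ψ (inclS E A x s) := by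
    intro s
    induction s using SymmetricAlgebra.induction with
    | algebraMap r => simp only [AlgHom.commutes]
    | ι m => exact hS m
    | mul a b ha hb => simp only [map_mul, ha, hb]
    | add a b ha hb => simp only [map_add, ha, hb]
  exact Algebra.TensorProduct.ext h1 (AlgHom.ext h2)

/-- The universal property gives an algebra map into `S` that is the identity on generators.
Followed by the inclusion it is the identity of the fibre, so every element lies in `S`. -/
theorem weilFiber_adjoin_eq_top (S : Subalgebra ℝ (WeilFiber E A x))
    (hT : ∀ ξ, genT E A x ξ ∈ S) (hΛ : ∀ η, genΛ E A x η ∈ S) (hS : ∀ η, genS E A x η ∈ S) :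
    ∀ a, a ∈ S := by
  have sq : ∀ ξ η, (genT E A x ξ + genΛ E A x η) * (genT E A x ξ + genΛ E A x η) = 0 := by
    intro ξ η
    have h : genT E A x ξ + genΛ E A x η = inclΛ E A x (ExteriorAlgebra.ι ℝ (ξ, η)) := by
      have : ((ξ, η) : Cotan E x × Module.Dual ℝ (A x)) = (ξ, 0) + (0, η) := by simp
      rw [this, map_add, map_add]; rfl
    rw [h, ← map_mul, ExteriorAlgebra.ι_sq_zero, map_zero]
  obtain ⟨φ, h1, h2, h3⟩ := exists_weilLift (H := S)
    ((genT E A x).codRestrict (Subalgebra.toSubmodule S) hT)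
    ((genΛ E A x).codRestrict (Subalgebra.toSubmodule S) hΛ)
    ((genS E A x).codRestrict (Subalgebra.toSubmodule S) hS)
    (fun ξ η => Subtype.ext (sq ξ η))
    (fun η η' => Subtype.ext (show genS E A x η * genS E A x η' = _ from by
      change inclS E A x _ * inclS E A x _ = inclS E A x _ * inclS E A x _
      rw [← map_mul, mul_comm, map_mul]))
    (fun ξ η => Subtype.ext (inclΛ_mul_inclS E A x _ _))
    (fun ξ η => Subtype.ext (inclΛ_mul_inclS E A x _ _))
  have h : S.val.comp φ = AlgHom.id ℝ _ := by
    refine weilFiber_hom_ext (fun ξ => ?_) (fun ξ => ?_) (fun ξ => ?_)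
    · rw [AlgHom.comp_apply, h1]; rfl
    · rw [AlgHom.comp_apply, h2]; rfl
    · rw [AlgHom.comp_apply, h3]; rfl
  intro a
  have := congrArg (fun f => f a) h
  have h' : (φ a : WeilFiber E A x) = a := this
  exact h' ▸ (φ a).2

theorem weilFiber_induction {P : WeilFiber E A x → Prop}
    (algebraMap : ∀ r : ℝ, P (algebraMap ℝ _ r))
    (genT : ∀ ξ, P (genT E A x ξ)) (genΛ : ∀ η, P (genΛ E A x η)) (genS : ∀ η, P (genS E A x η))
    (mul : ∀ a b, P a → P b → P (a * b)) (add : ∀ a b, P a → P b → P (a + b)) (a) : P a :=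
  weilFiber_adjoin_eq_top
    { carrier := {a | P a}
      mul_mem' := fun {a b} => mul a b
      add_mem' := fun {a b} => add a b
      algebraMap_mem' := algebraMap } genT genΛ genS a

theorem genT_sq (ξ : Cotan E x) : genT E A x ξ * genT E A x ξ = 0 := by
  change inclΛ E A x _ * inclΛ E A x _ = 0
  rw [← map_mul]
  exact (congrArg _ (ExteriorAlgebra.ι_sq_zero _)).trans (map_zero _)

theorem genΛ_sq (η : Module.Dual ℝ (A x)) : genΛ E A x η * genΛ E A x η = 0 := by
  change inclΛ E A x _ * inclΛ E A x _ = 0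
  rw [← map_mul]
  exact (congrArg _ (ExteriorAlgebra.ι_sq_zero _)).trans (map_zero _)

theorem genT_mul_genΛ (ξ : Cotan E x) (η : Module.Dual ℝ (A x)) :
    genT E A x ξ * genΛ E A x η = -(genΛ E A x η * genT E A x ξ) := by
  have h := ExteriorAlgebra.ι_add_mul_swap (R := ℝ)
    ((ξ, 0) : Cotan E x × Module.Dual ℝ (A x)) (0, η)
  rw [← add_eq_zero_iff_eq_neg]
  have h' := congrArg (inclΛ E A x) h
  rw [map_add, map_mul, map_mul, map_zero] at h'
  exact h'

theorem genT_mul_genT (ξ ξ' : Cotan E x) :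
    genT E A x ξ * genT E A x ξ' = -(genT E A x ξ' * genT E A x ξ) := by
  have h := genT_sq (A := A) (ξ + ξ')
  rw [map_add, add_mul, mul_add, mul_add, genT_sq, genT_sq, zero_add, add_zero] at h
  exact eq_neg_of_add_eq_zero_left h

theorem genΛ_mul_genΛ (η η' : Module.Dual ℝ (A x)) :
    genΛ E A x η * genΛ E A x η' = -(genΛ E A x η' * genΛ E A x η) := by
  have h := genΛ_sq (E := E) (η + η')
  rw [map_add, add_mul, mul_add, mul_add, genΛ_sq, genΛ_sq, zero_add, add_zero] at h
  exact eq_neg_of_add_eq_zero_left h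

theorem genS_mul (η : Module.Dual ℝ (A x)) (a : WeilFiber E A x) :
    genS E A x η * a = a * genS E A x η := by
  induction a using weilFiber_induction with
  | algebraMap r => rw [Algebra.commutes]
  | genT ξ => exact (inclΛ_mul_inclS E A x _ _).symm
  | genΛ ξ => exact (inclΛ_mul_inclS E A x _ _).symm
  | genS η' =>
    change inclS E A x _ * inclS E A x _ = inclS E A x _ * inclS E A x _
    rw [← map_mul, mul_comm, map_mul]
  | mul a b ha hb => rw [← mul_assoc, ha, mul_assoc, hb, mul_assoc]
  | add a b ha hb => rw [mul_add, add_mul, ha, hb]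

/-- Algebra endomorphisms (and morphisms to other fibres) that map generators to odd and even
elements as expected. -/
theorem exists_weilLift_fiber {x' : M}
    (fT : Cotan E x →ₗ[ℝ] Cotan E x') (fΛ fS : Module.Dual ℝ (A x) →ₗ[ℝ] Module.Dual ℝ (A x')) :
    ∃ φ : WeilFiber E A x →ₐ[ℝ] WeilFiber E A x',
      (∀ ξ, φ (genT E A x ξ) = genT E A x' (fT ξ)) ∧
      (∀ η, φ (genΛ E A x η) = genΛ E A x' (fΛ η)) ∧
      (∀ η, φ (genS E A x η) = genS E A x' (fS η)) :=
  exists_weilLift (genT E A x' ∘ₗ fT) (genΛ E A x' ∘ₗ fΛ) (genS E A x' ∘ₗ fS)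
    (fun ξ η => by
      simp only [LinearMap.comp_apply, add_mul, mul_add, genT_sq, genΛ_sq, genT_mul_genΛ]
      abel)
    (fun _ _ => genS_mul _ _) (fun _ _ => (genS_mul _ _).symm) (fun _ _ => (genS_mul _ _).symm)

/-! #### Parity -/

variable (E A x) in
/-- The parity automorphism. -/
def parity : WeilFiber E A x →ₐ[ℝ] WeilFiber E A x :=
  (exists_weilLift_fiber (-LinearMap.id) (-LinearMap.id) LinearMap.id).choose

theorem parity_genT (ξ : Cotan E x) : parity E A x (genT E A x ξ) = -genT E A x ξ :=
  ((exists_weilLift_fiber (-LinearMap.id) (-LinearMap.id) LinearMap.id).choose_spec.1 ξ).trans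
    (by simp)

theorem parity_genΛ (η : Module.Dual ℝ (A x)) : parity E A x (genΛ E A x η) = -genΛ E A x η :=
  ((exists_weilLift_fiber (-LinearMap.id) (-LinearMap.id) LinearMap.id).choose_spec.2.1 η).trans
    (by simp)

theorem parity_genS (η : Module.Dual ℝ (A x)) : parity E A x (genS E A x η) = genS E A x η :=
  (exists_weilLift_fiber (-LinearMap.id) (-LinearMap.id) LinearMap.id).choose_spec.2.2 η

theorem parity_parity (a : WeilFiber E A x) : parity E A x (parity E A x a) = a := by
  have : (parity E A x).comp (parity E A x) = AlgHom.id ℝ _ := weilFiber_hom_ext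
    (fun ξ => by simp [parity_genT]) (fun ξ => by simp [parity_genΛ])
    (fun ξ => by simp [parity_genS])
  exact congrArg (fun f => f a) this

theorem genT_mul (ξ : Cotan E x) (a : WeilFiber E A x) :
    genT E A x ξ * a = parity E A x a * genT E A x ξ := by
  induction a using weilFiber_induction with
  | algebraMap r => rw [AlgHom.commutes, Algebra.commutes]
  | genT ξ' => rw [parity_genT, neg_mul, genT_mul_genT]
  | genΛ η => rw [parity_genΛ, neg_mul, genT_mul_genΛ]
  | genS η => rw [parity_genS, genS_mul]
  | mul a b ha hb => rw [← mul_assoc, ha, mul_assoc, hb, map_mul, mul_assoc]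
  | add a b ha hb => rw [mul_add, map_add, add_mul, ha, hb]

theorem genΛ_mul (η : Module.Dual ℝ (A x)) (a : WeilFiber E A x) :
    genΛ E A x η * a = parity E A x a * genΛ E A x η := by
  induction a using weilFiber_induction with
  | algebraMap r => rw [AlgHom.commutes, Algebra.commutes]
  | genT ξ' => rw [parity_genT, neg_mul, genT_mul_genΛ, neg_neg]
  | genΛ η => rw [parity_genΛ, neg_mul, genΛ_mul_genΛ]
  | genS η => rw [parity_genS, genS_mul]
  | mul a b ha hb => rw [← mul_assoc, ha, mul_assoc, hb, map_mul, mul_assoc]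
  | add a b ha hb => rw [mul_add, map_add, add_mul, ha, hb]

/-! #### Odd derivations -/

/-- The matrix `(s g, δ; 0, g)`. -/
def upperTriangular {G U : Type*} [Ring G] [Algebra ℝ G] [AddCommGroup U] [Module ℝ U] (s : ℝ)
    (g δ : U →ₗ[ℝ] G) : U →ₗ[ℝ] Matrix (Fin 2) (Fin 2) G where
  toFun u := !![s • g u, δ u; 0, g u]
  map_add' u v := by
    ext i j; fin_cases i <;> fin_cases j <;> simp
  map_smul' c u := by
    ext i j; fin_cases i <;> fin_cases j <;> simp [smul_comm s c]

/-- An odd derivation `δ` amounts to an algebra map `a ↦ (parity a, δ a; 0, a)` into `2 × 2`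
matrices: the upper right entry of a product is the graded Leibniz rule. The parity hypotheses make
the matrices of the generators satisfy the relations of `exists_weilLift`. -/
theorem exists_oddDerivation (δT : Cotan E x →ₗ[ℝ] WeilFiber E A x)
    (δΛ δS : Module.Dual ℝ (A x) →ₗ[ℝ] WeilFiber E A x)
    (hT : ∀ ξ, parity E A x (δT ξ) = δT ξ) (hΛ : ∀ η, parity E A x (δΛ η) = δΛ η)
    (hS : ∀ η, parity E A x (δS η) = -δS η) :
    ∃ δ : WeilFiber E A x →ₗ[ℝ] WeilFiber E A x,
      (∀ a b, δ (a * b) = δ a * b + parity E A x a * δ b) ∧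
      (∀ ξ, δ (genT E A x ξ) = δT ξ) ∧ (∀ η, δ (genΛ E A x η) = δΛ η) ∧
      (∀ η, δ (genS E A x η) = δS η) := by
  obtain ⟨Δ, h1, h2, h3⟩ := exists_weilLift (H := Matrix (Fin 2) (Fin 2) (WeilFiber E A x))
    (upperTriangular (-1) (genT E A x) δT) (upperTriangular (-1) (genΛ E A x) δΛ) (upperTriangular 1 (genS E A x) δS)
    (fun ξ η => by
      have e1 := genT_mul ξ (δT ξ)
      have e2 := genT_mul ξ (δΛ η)
      have e3 := genΛ_mul η (δT ξ)
      have e4 := genΛ_mul η (δΛ η)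
      rw [hT] at e1 e3
      rw [hΛ] at e2 e4
      have e5 := genT_mul_genΛ (A := A) ξ η
      have e6 := genT_sq (A := A) ξ
      have e7 := genΛ_sq (E := E) η
      ext i j
      fin_cases i <;> fin_cases j <;>
        simp [upperTriangular, Matrix.mul_apply, Fin.sum_univ_two, add_mul, mul_add, e1, e2, e3, e4, e5, e6, e7]
      abel)
    (fun η η' => by
      have e1 := genS_mul η (genS E A x η')
      have e2 := genS_mul η (δS η')
      have e3 := genS_mul η' (δS η)
      ext i j
      fin_cases i <;> fin_cases j <;>
        simp [upperTriangular, Matrix.mul_apply, Fin.sum_univ_two, e1, e2, e3, add_comm])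
    (fun ξ η => by
      have e1 := genT_mul ξ (δS η)
      have e2 := genS_mul η (genT E A x ξ)
      have e3 := genS_mul η (δT ξ)
      rw [hS] at e1
      ext i j
      fin_cases i <;> fin_cases j <;>
        simp [upperTriangular, Matrix.mul_apply, Fin.sum_univ_two, e1, e2, e3, add_comm])
    (fun ξ η => by
      have e1 := genΛ_mul ξ (δS η)
      have e2 := genS_mul η (genΛ E A x ξ)
      have e3 := genS_mul η (δΛ ξ)
      rw [hS] at e1
      ext i j
      fin_cases i <;> fin_cases j <;>
        simp [upperTriangular, Matrix.mul_apply, Fin.sum_univ_two, e1, e2, e3, add_comm])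
  have key : ∀ a, Δ a 0 0 = parity E A x a ∧ Δ a 1 0 = 0 ∧ Δ a 1 1 = a := by
    intro a
    induction a using weilFiber_induction with
    | algebraMap r => simp [AlgHom.commutes, Matrix.algebraMap_matrix_apply]
    | genT ξ => simp [h1, upperTriangular, parity_genT]
    | genΛ ξ => simp [h2, upperTriangular, parity_genΛ]
    | genS ξ => simp [h3, upperTriangular, parity_genS]
    | mul a b ha hb =>
      simp [Matrix.mul_apply, Fin.sum_univ_two, ha.1, ha.2.1, ha.2.2, hb.1, hb.2.1, hb.2.2]
    | add a b ha hb => simp [ha.1, ha.2.1, ha.2.2, hb.1, hb.2.1, hb.2.2]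
  refine ⟨{ toFun := fun a => Δ a 0 1, map_add' := by simp, map_smul' := by simp }, ?_, ?_, ?_, ?_⟩
  · intro a b
    simp [Matrix.mul_apply, Fin.sum_univ_two, (key a).1, (key b).2.2, add_comm]
  · intro ξ; simp [h1, upperTriangular]
  · intro ξ; simp [h2, upperTriangular]
  · intro ξ; simp [h3, upperTriangular]

/-! #### Gradings -/

section Grading

variable {N : Type*} [AddCommMonoid N]

/-- The map `u ↦ g u ⊗ d`. -/
def gradedLift {G U : Type*} [Ring G] [Algebra ℝ G] [AddCommGroup U] [Module ℝ U] (d : N)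
    (g : U →ₗ[ℝ] G) : U →ₗ[ℝ] AddMonoidAlgebra G N where
  toFun u := AddMonoidAlgebra.single d (g u)
  map_add' u v := by rw [map_add, AddMonoidAlgebra.single_add]
  map_smul' c u := by rw [map_smul]; simp

/-- The map `a ↦ ∑ₙ aₙ ⊗ n` for the grading in which the generators have degrees `dT`, `dΛ`,
`dS`. -/
theorem exists_coaction (dT dΛ dS : N) :
    ∃ φ : WeilFiber E A x →ₐ[ℝ] AddMonoidAlgebra (WeilFiber E A x) N,
      (∀ ξ, φ (genT E A x ξ) = AddMonoidAlgebra.single dT (genT E A x ξ)) ∧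
      (∀ η, φ (genΛ E A x η) = AddMonoidAlgebra.single dΛ (genΛ E A x η)) ∧
      (∀ η, φ (genS E A x η) = AddMonoidAlgebra.single dS (genS E A x η)) := by
  refine exists_weilLift (gradedLift dT (genT E A x)) (gradedLift dΛ (genΛ E A x)) (gradedLift dS (genS E A x)) ?_ ?_ ?_ ?_
  · intro ξ η
    simp only [gradedLift, LinearMap.coe_mk, AddHom.coe_mk, add_mul, mul_add,
      AddMonoidAlgebra.single_mul_single, genT_sq, genΛ_sq, genT_mul_genΛ ξ η, add_comm dT dΛ,
      AddMonoidAlgebra.single_zero, AddMonoidAlgebra.single_neg]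
    abel
  · intro η η'
    simp only [gradedLift, LinearMap.coe_mk, AddHom.coe_mk, AddMonoidAlgebra.single_mul_single,
      genS_mul η]
  · intro ξ η
    simp only [gradedLift, LinearMap.coe_mk, AddHom.coe_mk, AddMonoidAlgebra.single_mul_single,
      genS_mul η, add_comm dT dS]
  · intro ξ η
    simp only [gradedLift, LinearMap.coe_mk, AddHom.coe_mk, AddMonoidAlgebra.single_mul_single,
      genS_mul η, add_comm dΛ dS]

variable (E A x) in
/-- The coaction of the grading with degrees `dT`, `dΛ`, `dS` of the generators. -/
def coaction (dT dΛ dS : N) : WeilFiber E A x →ₐ[ℝ] AddMonoidAlgebra (WeilFiber E A x) N :=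
  (exists_coaction dT dΛ dS).choose

variable (E A x) in
/-- The elements of degree `n`. -/
def fiberGr (dT dΛ dS n : N) : Submodule ℝ (WeilFiber E A x) where
  carrier := {a | coaction E A x dT dΛ dS a = AddMonoidAlgebra.single n a}
  add_mem' {a b} ha hb := by
    simp only [Set.mem_ofPred_eq] at *
    rw [map_add, ha, hb, AddMonoidAlgebra.single_add]
  zero_mem' := by simp
  smul_mem' c a ha := by
    simp only [Set.mem_ofPred_eq] at *
    rw [map_smul, ha]; simp

variable {dT dΛ dS : N}

theorem mem_fiberGr {n : N} {a : WeilFiber E A x} : a ∈ fiberGr E A x dT dΛ dS n ↔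
    coaction E A x dT dΛ dS a = AddMonoidAlgebra.single n a := Iff.rfl

theorem genT_mem_fiberGr (ξ : Cotan E x) : genT E A x ξ ∈ fiberGr E A x dT dΛ dS dT :=
  (exists_coaction dT dΛ dS).choose_spec.1 ξ

theorem genΛ_mem_fiberGr (η : Module.Dual ℝ (A x)) :
    genΛ E A x η ∈ fiberGr E A x dT dΛ dS dΛ :=
  (exists_coaction dT dΛ dS).choose_spec.2.1 η

theorem genS_mem_fiberGr (η : Module.Dual ℝ (A x)) :
    genS E A x η ∈ fiberGr E A x dT dΛ dS dS :=
  (exists_coaction dT dΛ dS).choose_spec.2.2 η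

theorem mul_mem_fiberGr {m n : N} {a b : WeilFiber E A x} (ha : a ∈ fiberGr E A x dT dΛ dS m)
    (hb : b ∈ fiberGr E A x dT dΛ dS n) : a * b ∈ fiberGr E A x dT dΛ dS (m + n) := by
  rw [mem_fiberGr] at *
  rw [map_mul, ha, hb, AddMonoidAlgebra.single_mul_single]

theorem algebraMap_mem_fiberGr (r : ℝ) :
    algebraMap ℝ (WeilFiber E A x) r ∈ fiberGr E A x dT dΛ dS 0 := by
  rw [mem_fiberGr, AlgHom.commutes]; rfl

theorem one_mem_fiberGr : 1 ∈ fiberGr E A x dT dΛ dS 0 := by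
  rw [mem_fiberGr, map_one]; rfl

variable (E A x dT dΛ dS) in
/-- The component of degree `n`. -/
def fiberProj (n : N) : WeilFiber E A x →ₗ[ℝ] WeilFiber E A x where
  toFun a := (coaction E A x dT dΛ dS a).coeff n
  map_add' a b := by simp
  map_smul' c a := by simp

theorem fiberProj_of_mem {n : N} {a : WeilFiber E A x} (ha : a ∈ fiberGr E A x dT dΛ dS n) :
    fiberProj E A x dT dΛ dS n a = a := by
  change (coaction E A x dT dΛ dS a).coeff n = a
  rw [mem_fiberGr.1 ha]; simp

theorem fiberProj_of_mem_ne {m n : N} (h : m ≠ n) {a : WeilFiber E A x}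
    (ha : a ∈ fiberGr E A x dT dΛ dS m) : fiberProj E A x dT dΛ dS n a = 0 := by
  change (coaction E A x dT dΛ dS a).coeff n = 0
  rw [mem_fiberGr.1 ha]; simp [h]

theorem mem_iSup_fiberGr (a : WeilFiber E A x) : a ∈ ⨆ n, fiberGr E A x dT dΛ dS n := by
  let S : Subalgebra ℝ (WeilFiber E A x) :=
    Submodule.toSubalgebra (⨆ n, fiberGr E A x dT dΛ dS n)
      (Submodule.mem_iSup_of_mem 0 one_mem_fiberGr)
      (fun a b ha hb => by
        refine Submodule.mul_le.1 ?_ a ha b hb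
        rw [Submodule.iSup_mul]
        refine iSup_le fun m => ?_
        rw [Submodule.mul_iSup]
        exact iSup_le fun n => Submodule.mul_le.2 fun a ha b hb =>
          Submodule.mem_iSup_of_mem (m + n) (mul_mem_fiberGr ha hb))
  exact weilFiber_adjoin_eq_top S
    (fun ξ => Submodule.mem_iSup_of_mem dT (genT_mem_fiberGr ξ))
    (fun ξ => Submodule.mem_iSup_of_mem dΛ (genΛ_mem_fiberGr ξ))
    (fun ξ => Submodule.mem_iSup_of_mem dS (genS_mem_fiberGr ξ)) a

/-- Linear induction on homogeneous elements. -/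
theorem fiberGr_induction (dT dΛ dS : N) {P : WeilFiber E A x → Prop}
    (hom : ∀ n a, a ∈ fiberGr E A x dT dΛ dS n → P a) (zero : P 0)
    (add : ∀ a b, P a → P b → P (a + b)) (a : WeilFiber E A x) : P a :=
  Submodule.iSup_induction (motive := P) _ (mem_iSup_fiberGr (dT := dT) (dΛ := dΛ) (dS := dS) a) hom zero add

theorem fiberProj_mem (n : N) (a : WeilFiber E A x) :
    fiberProj E A x dT dΛ dS n a ∈ fiberGr E A x dT dΛ dS n := by
  classical
  refine fiberGr_induction dT dΛ dS (P := fun a => fiberProj E A x dT dΛ dS n a ∈ _)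
    (fun m a ha => ?_) ?_ (fun a b ha hb => ?_) a
  · by_cases h : m = n
    · subst h; rw [fiberProj_of_mem ha]; exact ha
    · rw [fiberProj_of_mem_ne h ha]; exact zero_mem _
  · rw [map_zero]; exact zero_mem _
  · rw [map_add]; exact add_mem ha hb

end Grading

/-- Stated for an arbitrary multiplicative family of subspaces because it is applied to eigenspaces
of coactions, to eigenspaces of Euler derivations and to loci where an algebra map is a prescribed
scalar. -/
theorem fiberPiece_le_of_mul {N : Type*} [AddCommMonoid N] (V : N → Submodule ℝ (WeilFiber E A x))
    (one : 1 ∈ V 0) (mul : ∀ m n a b, a ∈ V m → b ∈ V n → a * b ∈ V (m + n)) {dT dΛ dS : N}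
    (hT : ∀ ξ, genT E A x ξ ∈ V dT) (hΛ : ∀ η, genΛ E A x η ∈ V dΛ)
    (hS : ∀ η, genS E A x η ∈ V dS) (u v w : ℕ) :
    fiberPiece E A u v w x ≤ V (u • dT + v • dS + w • dΛ) := by
  have pow : ∀ (d : N) (P : Submodule ℝ (WeilFiber E A x)), P ≤ V d →
      ∀ n : ℕ, P ^ n ≤ V (n • d) := by
    intro d P hP n
    induction n with
    | zero =>
      rw [pow_zero, zero_smul, Submodule.one_le]
      exact one
    | succ n ih =>
      rw [pow_succ, succ_nsmul]
      exact Submodule.mul_le.2 fun a ha b hb => mul _ _ _ _ (ih ha) (hP hb)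
  refine Submodule.mul_le.2 fun a ha b hb => mul _ _ _ _
    (Submodule.mul_le.2 (fun a ha b hb => mul _ _ _ _ ?_ ?_) ha) ?_
  · exact pow dT _ (by rintro _ ⟨ξ, rfl⟩; exact hT ξ) u ha
  · exact pow dS _ (by rintro _ ⟨ξ, rfl⟩; exact hS ξ) v hb
  · exact pow dΛ _ (by rintro _ ⟨ξ, rfl⟩; exact hΛ ξ) w hb

theorem fiberPiece_le_fiberGr {N : Type*} [AddCommMonoid N] (dT dΛ dS : N) (u v w : ℕ) :
    fiberPiece E A u v w x ≤ fiberGr E A x dT dΛ dS (u • dT + v • dS + w • dΛ) :=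
  fiberPiece_le_of_mul (fiberGr E A x dT dΛ dS) one_mem_fiberGr
    (fun _ _ _ _ => mul_mem_fiberGr) genT_mem_fiberGr genΛ_mem_fiberGr genS_mem_fiberGr u v w

variable (E A x) in
/-- The tridegree `(u, v, w)` part, as an eigenspace of a coaction. -/
abbrev triGr (t : ℕ × ℕ × ℕ) : Submodule ℝ (WeilFiber E A x) :=
  fiberGr E A x ((1, 0, 0) : ℕ × ℕ × ℕ) (0, 0, 1) (0, 1, 0) t

variable (E A x) in
/-- The bidegree `(p, q)` part, as an eigenspace of a coaction. -/
abbrev biGr (t : ℤ × ℤ) : Submodule ℝ (WeilFiber E A x) :=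
  fiberGr E A x ((0, 1) : ℤ × ℤ) (1, 0) (1, 1) t

variable (E A x) in
/-- The component of bidegree `t`. -/
abbrev biProj (t : ℤ × ℤ) : WeilFiber E A x →ₗ[ℝ] WeilFiber E A x :=
  fiberProj E A x ((0, 1) : ℤ × ℤ) (1, 0) (1, 1) t

variable (E A x) in
/-- The component of tridegree `t`. -/
abbrev triProj (t : ℕ × ℕ × ℕ) : WeilFiber E A x →ₗ[ℝ] WeilFiber E A x :=
  fiberProj E A x ((1, 0, 0) : ℕ × ℕ × ℕ) (0, 0, 1) (0, 1, 0) t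

theorem fiberPiece_le_triGr (u v w : ℕ) : fiberPiece E A u v w x ≤ triGr E A x (u, v, w) := by
  have h := fiberPiece_le_fiberGr (E := E) (A := A) (x := x) ((1, 0, 0) : ℕ × ℕ × ℕ) (0, 0, 1)
    (0, 1, 0) u v w
  simpa using h

theorem fiberPiece_le_biGr (u v w : ℕ) :
    fiberPiece E A u v w x ≤ biGr E A x ((v : ℤ) + w, (u : ℤ) + v) := by
  have h := fiberPiece_le_fiberGr (E := E) (A := A) (x := x) ((0, 1) : ℤ × ℤ) (1, 0) (1, 1) u v w
  simpa [add_comm (w : ℤ) v] using h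

theorem mem_iSup_fiberPiece (a : WeilFiber E A x) :
    a ∈ ⨆ t : ℕ × ℕ × ℕ, fiberPiece E A t.1 t.2.1 t.2.2 x := by
  let S : Subalgebra ℝ (WeilFiber E A x) :=
    Submodule.toSubalgebra (⨆ t : ℕ × ℕ × ℕ, fiberPiece E A t.1 t.2.1 t.2.2 x)
      (Submodule.mem_iSup_of_mem (0, 0, 0) (one_mem_fiberPiece E A x))
      (fun a b ha hb => by
        refine Submodule.mul_le.1 ?_ a ha b hb
        rw [Submodule.iSup_mul]
        refine iSup_le fun m => ?_
        rw [Submodule.mul_iSup]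
        exact iSup_le fun n => (fiberPiece_mul E A x _ _ _ _ _ _).le.trans
          (le_iSup (fun t : ℕ × ℕ × ℕ => fiberPiece E A t.1 t.2.1 t.2.2 x) (m + n)))
  refine weilFiber_adjoin_eq_top S (fun ξ => Submodule.mem_iSup_of_mem (1, 0, 0) ?_)
    (fun ξ => Submodule.mem_iSup_of_mem (0, 0, 1) ?_)
    (fun ξ => Submodule.mem_iSup_of_mem (0, 1, 0) ?_) a
  · simp [fiberPiece]
  · simp [fiberPiece]
  · simp [fiberPiece]

/-- The spans of monomials lie in the eigenspaces and together exhaust the fibre. The projection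
onto one eigenspace keeps the matching span and kills the others, so it maps the whole fibre into
that span. -/
theorem fiberPiece_eq_triGr (u v w : ℕ) : fiberPiece E A u v w x = triGr E A x (u, v, w) := by
  refine le_antisymm (fiberPiece_le_triGr u v w) fun a ha => ?_
  rw [← fiberProj_of_mem ha]
  -- The claim about the projection is now proved for every `a`, so that induction over the
  -- decomposition applies.
  clear ha
  refine Submodule.iSup_induction (motive := fun a => triProj E A x (u, v, w) a ∈ _) _
    (mem_iSup_fiberPiece a) (fun t a ha => ?_) ?_ (fun a b ha hb => ?_)
  · by_cases h : t = (u, v, w)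
    · subst h; rw [fiberProj_of_mem (fiberPiece_le_triGr _ _ _ ha)]; exact ha
    · rw [fiberProj_of_mem_ne h (fiberPiece_le_triGr _ _ _ ha)]; exact zero_mem _
  · rw [map_zero]; exact zero_mem _
  · rw [map_add]; exact add_mem ha hb

theorem triGr_le_biGr (t : ℕ × ℕ × ℕ) :
    triGr E A x t ≤ biGr E A x ((t.2.1 : ℤ) + t.2.2, (t.1 : ℤ) + t.2.1) :=
  (fiberPiece_eq_triGr t.1 t.2.1 t.2.2).ge.trans (fiberPiece_le_biGr _ _ _)

/-- The tridegrees that contribute to the bidegree `n`. -/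
def biFiber (n : ℤ × ℤ) : Finset (ℕ × ℕ × ℕ) :=
  (Finset.range (n.2.toNat + 1) ×ˢ Finset.range (n.1.toNat + 1) ×ˢ
    Finset.range (n.1.toNat + 1)).filter
      fun t => ((t.2.1 : ℤ) + t.2.2, (t.1 : ℤ) + t.2.1) = n

theorem mem_biFiber {n : ℤ × ℤ} {t : ℕ × ℕ × ℕ} :
    t ∈ biFiber n ↔ ((t.2.1 : ℤ) + t.2.2, (t.1 : ℤ) + t.2.1) = n := by
  simp only [biFiber, Finset.mem_filter, Finset.mem_product, Finset.mem_range, and_iff_right_iff_imp]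
  rintro rfl
  simp only
  omega

/-- The bidegree is a function of the tridegree, and only finitely many tridegrees lie over a given
bidegree. -/
theorem biProj_eq_sum (n : ℤ × ℤ) (a : WeilFiber E A x) :
    biProj E A x n a = ∑ t ∈ biFiber n, triProj E A x t a := by
  refine fiberGr_induction ((1, 0, 0) : ℕ × ℕ × ℕ) (0, 0, 1) (0, 1, 0)
    (P := fun a => biProj E A x n a = ∑ t ∈ biFiber n, triProj E A x t a)
    (fun t a ha => ?_) (by simp) (fun a b ha hb => by
      simp only [map_add, ha, hb, Finset.sum_add_distrib]) a
  by_cases h : t ∈ biFiber n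
  · rw [Finset.sum_eq_single t (fun s _ hs => fiberProj_of_mem_ne hs.symm ha)
      (fun h' => absurd h h'), fiberProj_of_mem ha]
    have h2 := triGr_le_biGr t ha
    rw [mem_biFiber.1 h] at h2
    exact fiberProj_of_mem h2
  · rw [Finset.sum_eq_zero fun s hs => fiberProj_of_mem_ne (by rintro rfl; exact h hs) ha]
    exact fiberProj_of_mem_ne (fun h' => h (mem_biFiber.2 h')) (triGr_le_biGr t ha)

/-! #### Properties of derivations -/

theorem weilFiber_mem_span (a : WeilFiber E A x) :
    a ∈ Submodule.span ℝ (Submonoid.closure (Set.range (genT E A x) ∪ Set.range (genΛ E A x) ∪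
      Set.range (genS E A x)) : Set (WeilFiber E A x)) := by
  rw [← Algebra.adjoin_eq_span]
  exact weilFiber_adjoin_eq_top _
    (fun ξ => Algebra.subset_adjoin (Or.inl (Or.inl ⟨ξ, rfl⟩)))
    (fun ξ => Algebra.subset_adjoin (Or.inl (Or.inr ⟨ξ, rfl⟩)))
    (fun ξ => Algebra.subset_adjoin (Or.inr ⟨ξ, rfl⟩)) a

/-- The Leibniz rule for odd operators on a fibre. -/
def IsOddFiberDer (δ : WeilFiber E A x →ₗ[ℝ] WeilFiber E A x) : Prop :=
  ∀ a b, δ (a * b) = δ a * b + parity E A x a * δ b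

theorem IsOddFiberDer.map_algebraMap {δ : WeilFiber E A x →ₗ[ℝ] WeilFiber E A x}
    (hδ : IsOddFiberDer δ) (r : ℝ) : δ (algebraMap ℝ _ r) = 0 := by
  have h := hδ 1 1
  rw [map_one (parity E A x), mul_one, mul_one, one_mul, left_eq_add] at h
  rw [Algebra.algebraMap_eq_smul_one, map_smul, h, smul_zero]

theorem IsOddFiberDer.ext {δ δ' : WeilFiber E A x →ₗ[ℝ] WeilFiber E A x}
    (hδ : IsOddFiberDer δ) (hδ' : IsOddFiberDer δ') (hT : ∀ ξ, δ (genT E A x ξ) = δ' (genT E A x ξ))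
    (hΛ : ∀ ξ, δ (genΛ E A x ξ) = δ' (genΛ E A x ξ))
    (hS : ∀ ξ, δ (genS E A x ξ) = δ' (genS E A x ξ)) : δ = δ' := by
  refine LinearMap.ext fun a => ?_
  induction a using weilFiber_induction with
  | algebraMap r => rw [hδ.map_algebraMap, hδ'.map_algebraMap]
  | genT ξ => exact hT ξ
  | genΛ ξ => exact hΛ ξ
  | genS ξ => exact hS ξ
  | mul a b ha hb => rw [hδ, hδ', ha, hb]
  | add a b ha hb => rw [map_add, map_add, ha, hb]

theorem parity_mem_fiberGr {N : Type*} [AddCommMonoid N] {dT dΛ dS n : N} {a : WeilFiber E A x}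
    (ha : a ∈ fiberGr E A x dT dΛ dS n) : parity E A x a ∈ fiberGr E A x dT dΛ dS n := by
  rw [mem_fiberGr] at *
  have key : ∀ a, coaction E A x dT dΛ dS (parity E A x a) =
      AddMonoidAlgebra.mapAlgHom N (parity E A x) (coaction E A x dT dΛ dS a) := by
    intro a
    refine congrArg (fun f => f a) (weilFiber_hom_ext
      (φ := (coaction E A x dT dΛ dS).comp (parity E A x))
      (ψ := (AddMonoidAlgebra.mapAlgHom N (parity E A x)).comp (coaction E A x dT dΛ dS))
      (fun ξ => ?_) (fun ξ => ?_) (fun ξ => ?_))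
    · simp only [AlgHom.comp_apply, parity_genT, map_neg, mem_fiberGr.1 (genT_mem_fiberGr ξ),
        AddMonoidAlgebra.mapAlgHom_single, AddMonoidAlgebra.single_neg]
    · simp only [AlgHom.comp_apply, parity_genΛ, map_neg, mem_fiberGr.1 (genΛ_mem_fiberGr ξ),
        AddMonoidAlgebra.mapAlgHom_single, AddMonoidAlgebra.single_neg]
    · simp only [AlgHom.comp_apply, parity_genS, mem_fiberGr.1 (genS_mem_fiberGr ξ),
        AddMonoidAlgebra.mapAlgHom_single]
  rw [key, ha, AddMonoidAlgebra.mapAlgHom_single]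

/-- A linear map which shifts degrees on monomials shifts degrees. -/
theorem mem_fiberGr_of_monomials {N : Type*} [AddCommGroup N] {dT dΛ dS c : N} {x' : M}
    (δ : WeilFiber E A x →ₗ[ℝ] WeilFiber E A x')
    (h : ∀ m ∈ Submonoid.closure (Set.range (genT E A x) ∪ Set.range (genΛ E A x) ∪
      Set.range (genS E A x)), ∃ n, m ∈ fiberGr E A x dT dΛ dS n ∧
        δ m ∈ fiberGr E A x' dT dΛ dS (n + c)) {n : N} {a : WeilFiber E A x}
    (ha : a ∈ fiberGr E A x dT dΛ dS n) : δ a ∈ fiberGr E A x' dT dΛ dS (n + c) := by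
  -- The projections intertwine `δ` on monomials, which span. Cancelling the shift `c` is why `N` is
  -- a group; bidegrees are taken in `ℤ × ℤ` since contractions lower them.
  have key : ∀ a, δ (fiberProj E A x dT dΛ dS n a) = fiberProj E A x' dT dΛ dS (n + c) (δ a) := by
    intro a
    refine Submodule.span_induction (fun m hm => ?_) (by simp) (fun a b _ _ ha hb => ?_)
      (fun r a _ ha => ?_) (weilFiber_mem_span a)
    · obtain ⟨k, h1, h2⟩ := h m hm
      by_cases hk : k = n
      · subst hk; rw [fiberProj_of_mem h1, fiberProj_of_mem h2]
      · rw [fiberProj_of_mem_ne hk h1, fiberProj_of_mem_ne (by simpa using hk) h2, map_zero]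
    · simp only [map_add, ha, hb]
    · simp only [map_smul, ha]
  rw [← fiberProj_of_mem ha, key]
  exact fiberProj_mem _ _

theorem IsOddFiberDer.mem_fiberGr {N : Type*} [AddCommGroup N] {dT dΛ dS c : N}
    {δ : WeilFiber E A x →ₗ[ℝ] WeilFiber E A x} (hδ : IsOddFiberDer δ)
    (hT : ∀ ξ, δ (genT E A x ξ) ∈ fiberGr E A x dT dΛ dS (dT + c))
    (hΛ : ∀ ξ, δ (genΛ E A x ξ) ∈ fiberGr E A x dT dΛ dS (dΛ + c))
    (hS : ∀ ξ, δ (genS E A x ξ) ∈ fiberGr E A x dT dΛ dS (dS + c)) {n : N} {a : WeilFiber E A x}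
    (ha : a ∈ fiberGr E A x dT dΛ dS n) : δ a ∈ fiberGr E A x dT dΛ dS (n + c) := by
  refine mem_fiberGr_of_monomials δ (fun m hm => ?_) ha
  induction hm using Submonoid.closure_induction with
  | mem m hm =>
    rcases hm with (⟨ξ, rfl⟩ | ⟨ξ, rfl⟩) | ⟨ξ, rfl⟩
    · exact ⟨_, genT_mem_fiberGr ξ, hT ξ⟩
    · exact ⟨_, genΛ_mem_fiberGr ξ, hΛ ξ⟩
    · exact ⟨_, genS_mem_fiberGr ξ, hS ξ⟩
  | one =>
    refine ⟨0, one_mem_fiberGr, ?_⟩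
    have h := hδ.map_algebraMap 1
    rw [map_one] at h
    rw [h]; exact zero_mem _
  | mul m m' _ _ h h' =>
    obtain ⟨k, h1, h2⟩ := h
    obtain ⟨k', h1', h2'⟩ := h'
    refine ⟨k + k', mul_mem_fiberGr h1 h1', ?_⟩
    rw [hδ]
    refine add_mem ?_ ?_
    · rw [add_right_comm]; exact mul_mem_fiberGr h2 h1'
    · rw [add_assoc]; exact mul_mem_fiberGr (parity_mem_fiberGr h1) h2'

theorem algHom_mem_fiberGr {N : Type*} [AddCommGroup N] {dT dΛ dS : N} {x' : M}
    {φ : WeilFiber E A x →ₐ[ℝ] WeilFiber E A x'}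
    (hT : ∀ ξ, φ (genT E A x ξ) ∈ fiberGr E A x' dT dΛ dS dT)
    (hΛ : ∀ ξ, φ (genΛ E A x ξ) ∈ fiberGr E A x' dT dΛ dS dΛ)
    (hS : ∀ ξ, φ (genS E A x ξ) ∈ fiberGr E A x' dT dΛ dS dS) {n : N} {a : WeilFiber E A x}
    (ha : a ∈ fiberGr E A x dT dΛ dS n) : φ a ∈ fiberGr E A x' dT dΛ dS n := by
  rw [← add_zero n]
  refine mem_fiberGr_of_monomials φ.toLinearMap (fun m hm => ?_) ha
  simp only [add_zero]
  induction hm using Submonoid.closure_induction with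
  | mem m hm =>
    rcases hm with (⟨ξ, rfl⟩ | ⟨ξ, rfl⟩) | ⟨ξ, rfl⟩
    · exact ⟨_, genT_mem_fiberGr ξ, hT ξ⟩
    · exact ⟨_, genΛ_mem_fiberGr ξ, hΛ ξ⟩
    · exact ⟨_, genS_mem_fiberGr ξ, hS ξ⟩
  | one => exact ⟨0, one_mem_fiberGr, by simpa using! one_mem_fiberGr⟩
  | mul m m' _ _ h h' =>
    obtain ⟨k, h1, h2⟩ := h
    obtain ⟨k', h1', h2'⟩ := h'
    exact ⟨k + k', mul_mem_fiberGr h1 h1', by simpa using! mul_mem_fiberGr h2 h2'⟩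

/-! #### Contractions -/

variable (E A x) in
theorem exists_contr (v : TangentSpace 𝓘(ℝ, E) x) (a : A x) :
    ∃ δ : WeilFiber E A x →ₗ[ℝ] WeilFiber E A x, IsOddFiberDer δ ∧
      (∀ ξ, δ (genT E A x ξ) = algebraMap ℝ _ (ξ v)) ∧
      (∀ η, δ (genΛ E A x η) = algebraMap ℝ _ (η a)) ∧ (∀ η, δ (genS E A x η) = 0) :=
  exists_oddDerivation
    ((Algebra.linearMap ℝ _) ∘ₗ Module.Dual.eval ℝ (TangentSpace 𝓘(ℝ, E) x) v)
    ((Algebra.linearMap ℝ _) ∘ₗ Module.Dual.eval ℝ (A x) a) 0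
    (fun ξ => (parity E A x).commutes _) (fun ξ => (parity E A x).commutes _) (by simp)

variable (E A x) in
/-- The contraction with a tangent vector and an element of `A`. -/
def contr (v : TangentSpace 𝓘(ℝ, E) x) (a : A x) : WeilFiber E A x →ₗ[ℝ] WeilFiber E A x :=
  (exists_contr E A x v a).choose

section

variable (v : TangentSpace 𝓘(ℝ, E) x) (a : A x)

theorem contr_isOddFiberDer : IsOddFiberDer (contr E A x v a) :=
  (exists_contr E A x v a).choose_spec.1

theorem contr_genT (ξ : Cotan E x) : contr E A x v a (genT E A x ξ) = algebraMap ℝ _ (ξ v) :=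
  (exists_contr E A x v a).choose_spec.2.1 ξ

theorem contr_genΛ (η : Module.Dual ℝ (A x)) :
    contr E A x v a (genΛ E A x η) = algebraMap ℝ _ (η a) :=
  (exists_contr E A x v a).choose_spec.2.2.1 η

theorem contr_genS (η : Module.Dual ℝ (A x)) : contr E A x v a (genS E A x η) = 0 :=
  (exists_contr E A x v a).choose_spec.2.2.2 η

end

-- The part `θ_η ↦ μ_η` of the vertical differential is inverted by this operator up to a degree
-- count. It serves both as contracting homotopy and as a detector for the `S¹A*` component.
variable (E A x) in
theorem exists_koszulH : ∃ δ : WeilFiber E A x →ₗ[ℝ] WeilFiber E A x, IsOddFiberDer δ ∧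
      (∀ ξ, δ (genT E A x ξ) = 0) ∧ (∀ η, δ (genΛ E A x η) = 0) ∧
      (∀ η, δ (genS E A x η) = genΛ E A x η) :=
  exists_oddDerivation 0 0 (genΛ E A x) (by simp) (by simp) parity_genΛ

variable (E A x) in
/-- The Koszul operator: the odd derivation that maps `S¹ A*` to `Λ¹ A*`. -/
def koszulH : WeilFiber E A x →ₗ[ℝ] WeilFiber E A x := (exists_koszulH E A x).choose

theorem koszulH_isOddFiberDer : IsOddFiberDer (koszulH E A x) :=
  (exists_koszulH E A x).choose_spec.1

theorem koszulH_genT (ξ : Cotan E x) : koszulH E A x (genT E A x ξ) = 0 :=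
  (exists_koszulH E A x).choose_spec.2.1 ξ

theorem koszulH_genΛ (η : Module.Dual ℝ (A x)) : koszulH E A x (genΛ E A x η) = 0 :=
  (exists_koszulH E A x).choose_spec.2.2.1 η

theorem koszulH_genS (η : Module.Dual ℝ (A x)) :
    koszulH E A x (genS E A x η) = genΛ E A x η :=
  (exists_koszulH E A x).choose_spec.2.2.2 η

end Fibre

/-! ### Smooth sections, frames and tensoriality -/

section Sections

variable {E : Type*} [NormedAddCommGroup E] [NormedSpace ℝ E] [FiniteDimensional ℝ E]
  {M : Type*} [TopologicalSpace M] [ChartedSpace E M] [IsManifold 𝓘(ℝ, E) ∞ M]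

/-- One derivative is lost in passing to the tangent bundle, but `∞ + 1` is `∞`. -/
instance : ContMDiffVectorBundle ∞ E (TangentSpace 𝓘(ℝ, E) : M → Type _) 𝓘(ℝ, E) := by
  have : IsManifold 𝓘(ℝ, E) (((⊤ : ℕ∞) : ℕ∞ω) + 1) M := ‹IsManifold 𝓘(ℝ, E) ∞ M›
  exact TangentBundle.contMDiffVectorBundle

/-! #### Directional derivatives -/

theorem Fn.mdifferentiableAt (f : Fn E M) (x : M) : MDifferentiableAt 𝓘(ℝ, E) 𝓘(ℝ, ℝ) f x :=
  (f.contMDiff x).mdifferentiableAt (by simp)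

theorem dirDeriv_add (f g : Fn E M) {x : M} (v : TangentSpace 𝓘(ℝ, E) x) :
    dirDeriv (f + g : Fn E M) v = dirDeriv f v + dirDeriv g v :=
  congrArg (fun l => l v) (mvfderiv_fun_add (f.mdifferentiableAt x) (g.mdifferentiableAt x))

theorem dirDeriv_const (c : ℝ) {x : M} (v : TangentSpace 𝓘(ℝ, E) x) :
    dirDeriv (fun _ : M => c) v = 0 := by
  simp [dirDeriv, mvfderiv_const]

theorem dirDeriv_mul (f g : Fn E M) {x : M} (v : TangentSpace 𝓘(ℝ, E) x) :
    dirDeriv (f * g : Fn E M) v = f x * dirDeriv g v + g x * dirDeriv f v :=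
  congrArg (fun l => l v) (mvfderiv_fun_mul (f.mdifferentiableAt x) (g.mdifferentiableAt x))

/-- A constant function. -/
def constFn (c : ℝ) : Fn E M := ⟨fun _ => c, contMDiff_const⟩

theorem dirDeriv_smul (c : ℝ) (f : Fn E M) {x : M} (v : TangentSpace 𝓘(ℝ, E) x) :
    dirDeriv (c • f : Fn E M) v = c * dirDeriv f v := by
  have h := dirDeriv_mul (constFn c) f v
  have h0 : dirDeriv (constFn c : Fn E M) v = 0 := dirDeriv_const c v
  rw [h0, mul_zero, add_zero] at h
  exact h

theorem dirDeriv_neg (f : Fn E M) {x : M} (v : TangentSpace 𝓘(ℝ, E) x) :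
    dirDeriv (-f : Fn E M) v = -dirDeriv f v := by
  rw [← neg_one_smul ℝ f, dirDeriv_smul, neg_one_mul]

theorem dirDeriv_sub (f g : Fn E M) {x : M} (v : TangentSpace 𝓘(ℝ, E) x) :
    dirDeriv (f - g : Fn E M) v = dirDeriv f v - dirDeriv g v := by
  rw [sub_eq_add_neg, dirDeriv_add, dirDeriv_neg, sub_eq_add_neg]

theorem dirDeriv_vadd (f : M → ℝ) {x : M} (v w : TangentSpace 𝓘(ℝ, E) x) :
    dirDeriv f (v + w) = dirDeriv f v + dirDeriv f w := map_add _ _ _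

theorem dirDeriv_vsmul (f : M → ℝ) {x : M} (c : ℝ) (v : TangentSpace 𝓘(ℝ, E) x) :
    dirDeriv f (c • v) = c * dirDeriv f v := map_smul _ _ _

theorem dirDeriv_congr {f g : M → ℝ} {x : M} (h : ∀ᶠ y in 𝓝 x, f y = g y)
    (v : TangentSpace 𝓘(ℝ, E) x) : dirDeriv f v = dirDeriv g v := by
  have h1 : mfderiv 𝓘(ℝ, E) 𝓘(ℝ, ℝ) f x = mfderiv 𝓘(ℝ, E) 𝓘(ℝ, ℝ) g x :=
    Filter.EventuallyEq.mfderiv_eq h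
  exact congrArg (fun l : TangentSpace 𝓘(ℝ, E) x →L[ℝ] ℝ => l v) h1

/-- The derivative of `f` along the vector field `X`. -/
def lieFn (X : VF E M) (f : Fn E M) : Fn E M :=
  ⟨fun x => dirDeriv f (X x), by
    have h : ContMDiff 𝓘(ℝ, E).tangent 𝓘(ℝ, ℝ).tangent ∞ (tangentMap 𝓘(ℝ, E) 𝓘(ℝ, ℝ) f) :=
      f.contMDiff.contMDiff_tangentMap le_rfl
    have h2 := (contMDiff_snd_tangentBundle_modelSpace ℝ 𝓘(ℝ, ℝ) (n := ∞)).comp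
      (h.comp X.contMDiff)
    exact h2⟩

theorem lieFn_apply (X : VF E M) (f : Fn E M) (x : M) : lieFn X f x = dirDeriv f (X x) := rfl

variable {FB : Type*} [NormedAddCommGroup FB] [NormedSpace ℝ FB]
  {B : M → Type*} [TopologicalSpace (TotalSpace FB B)] [∀ x, AddCommGroup (B x)]
  [∀ x, Module ℝ (B x)] [∀ x, TopologicalSpace (B x)] [FiberBundle FB B] [VectorBundle ℝ FB B]

theorem smulSec_apply (f : Fn E M) (s : Sec E FB B) (x : M) : smulSec f s x = f x • s x := rfl

theorem Sec.sum_apply {ι : Type*} (t : Finset ι) (s : ι → Sec E FB B) (x : M) :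
    (∑ i ∈ t, s i) x = ∑ i ∈ t, s i x := by
  rw [← ContMDiffSection.coeAddHom_apply, map_sum, Finset.sum_apply]; rfl

theorem Sec.add_apply (s t : Sec E FB B) (x : M) : (s + t) x = s x + t x := rfl

theorem Sec.sub_apply (s t : Sec E FB B) (x : M) : (s - t) x = s x - t x := rfl

variable (E FB B) in
/-- The smooth sections of the dual bundle. -/
def smoothDuals : Submodule ℝ (∀ x, Module.Dual ℝ (B x)) where
  carrier := {ν | IsSmoothDual (E := E) FB B ν}
  add_mem' h h' s := (h s).add (h' s)
  zero_mem' _ := contMDiff_const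
  smul_mem' c _ h s := (contMDiff_const (I := 𝓘(ℝ, E)) (I' := 𝓘(ℝ, ℝ)) (c := c)).smul (h s)

variable (E FB B) in
/-- The space of smooth sections of the dual bundle. -/
abbrev SDual := smoothDuals E FB B

/-- The pairing of smooth sections of the dual bundle with smooth sections. -/
def pair (ν : SDual E FB B) (s : Sec E FB B) : Fn E M := ⟨fun x => ν.1 x (s x), ν.2 s⟩

theorem pair_apply (ν : SDual E FB B) (s : Sec E FB B) (x : M) : pair ν s x = ν.1 x (s x) := rfl

/-- The product of a smooth function and a smooth section of the dual bundle. -/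
def smulDual (f : Fn E M) (ν : SDual E FB B) : SDual E FB B :=
  ⟨fun x => f x • ν.1 x, fun s => f.contMDiff.mul (ν.2 s)⟩

theorem smulDual_apply (f : Fn E M) (ν : SDual E FB B) (x : M) :
    (smulDual f ν).1 x = f x • ν.1 x := rfl

theorem SDual.sum_apply {ι : Type*} (t : Finset ι) (ν : ι → SDual E FB B) (x : M) :
    (∑ i ∈ t, ν i).1 x = ∑ i ∈ t, (ν i).1 x := by
  rw [show (∑ i ∈ t, ν i).1 = ∑ i ∈ t, (ν i).1 from map_sum (smoothDuals E FB B).subtype _ _,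
    Finset.sum_apply]

/-! #### Bump functions and local frames -/

variable [T2Space M]

theorem exists_bump {x : M} {U : Set M} (hU : U ∈ 𝓝 x) :
    ∃ χ : Fn E M, (∀ᶠ y in 𝓝 x, χ y = 1) ∧ tsupport χ ⊆ U := by
  obtain ⟨f, -, hf⟩ := (SmoothBumpFunction.nhds_basis_tsupport (I := 𝓘(ℝ, E)) x).mem_iff.1 hU
  exact ⟨⟨f, f.contMDiff⟩, f.eventuallyEq_one, hf⟩

/-- Extension of a locally defined smooth function by zero, after multiplication by a cut-off. -/
def cutFn (χ : Fn E M) (U : Set M) (hU : IsOpen U) (hχ : tsupport χ ⊆ U) (f : M → ℝ)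
    (hf : ContMDiffOn 𝓘(ℝ, E) 𝓘(ℝ, ℝ) ∞ f U) : Fn E M :=
  ⟨fun y => χ y * f y, by
    refine contMDiff_of_tsupport fun x hx => ?_
    have hx' : x ∈ U := hχ (tsupport_mul_subset_left hx)
    exact (χ.contMDiff x).mul (hf.contMDiffAt (hU.mem_nhds hx'))⟩

variable [FiniteDimensional ℝ FB] [ContMDiffVectorBundle ∞ FB B 𝓘(ℝ, E)]

variable (FB B) in
/-- Global sections of `B` and of `B*` which are dual frames near `x`. -/
theorem exists_dualFrame (x : M) :
    ∃ (s : Fin (Module.finrank ℝ FB) → Sec E FB B) (ν : Fin (Module.finrank ℝ FB) → SDual E FB B),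
      ∀ᶠ y in 𝓝 x, ∃ b : Module.Basis (Fin (Module.finrank ℝ FB)) ℝ (B y),
        (∀ i, s i y = b i) ∧ ∀ i, (ν i).1 y = b.coord i := by
  have : ContMDiffVectorBundle 1 FB B 𝓘(ℝ, E) :=
    ContMDiffVectorBundle.of_le (n := ∞) (by simp)
  let e := trivializationAt FB B x
  have he : e.baseSet ∈ 𝓝 x := e.open_baseSet.mem_nhds (FiberBundle.mem_baseSet_trivializationAt FB B x)
  obtain ⟨χ, hχ1, hχ⟩ := exists_bump (E := E) he
  let b := Module.finBasis ℝ FB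
  -- The frame of the trivialization and its coefficient functionals, both multiplied by a cut-off
  -- that equals `1` near `x` and is supported in the base set.
  refine ⟨fun i => ⟨(χ : M → ℝ) • e.localFrame b i, ?_⟩, fun i =>
    ⟨fun y => χ y • e.localFrameCoeff 𝓘(ℝ, E) b i y, fun s => ?_⟩, ?_⟩
  · exact ContMDiffOn.smul_section_of_tsupport (χ.contMDiff.contMDiffOn)
      e.open_baseSet hχ (e.contMDiffOn_localFrame_baseSet ∞ b i)
  · exact (cutFn χ e.baseSet e.open_baseSet hχ _
      (contMDiffOn_localFrameCoeff b e.open_baseSet subset_rfl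
        (s.contMDiff.contMDiffOn) i)).contMDiff
  · filter_upwards [hχ1, he] with y hy hy'
    refine ⟨e.basisAt b hy', fun i => ?_, fun i => ?_⟩
    · change χ y • e.localFrame b i y = _
      rw [hy, one_smul, e.localFrame_apply_of_mem_baseSet b hy']
    · ext v
      change χ y • e.localFrameCoeff 𝓘(ℝ, E) b i y v = _
      rw [hy, one_smul]
      -- Coefficient functionals are described through sections, so the vector is extended
      -- arbitrarily; no smoothness is needed.
      obtain ⟨s, rfl⟩ : ∃ s : ∀ z, B z, s y = v := by
        classical exact ⟨Function.update 0 y v, by simp⟩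
      rw [e.localFrameCoeff_apply_of_mem_baseSet b hy' s i]
      rfl

theorem exists_sec (x : M) (v : B x) : ∃ s : Sec E FB B, s x = v := by
  obtain ⟨s, ν, h⟩ := exists_dualFrame (E := E) FB B x
  obtain ⟨b, hb, -⟩ := h.self_of_nhds
  refine ⟨∑ i, b.repr v i • s i, ?_⟩
  rw [Sec.sum_apply]
  refine Eq.trans ?_ (b.sum_repr v)
  exact Finset.sum_congr rfl fun i _ => by rw [← hb]; rfl

theorem exists_sdual (x : M) (η : Module.Dual ℝ (B x)) : ∃ ν : SDual E FB B, ν.1 x = η := by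
  obtain ⟨s, ν, h⟩ := exists_dualFrame (E := E) FB B x
  obtain ⟨b, -, hb⟩ := h.self_of_nhds
  refine ⟨∑ i, η (b i) • ν i, ?_⟩
  rw [SDual.sum_apply]
  refine b.ext fun j => ?_
  rw [LinearMap.sum_apply]
  simp [hb, Finsupp.single_apply]

variable (E FB B) in
theorem exists_frameAt (x : M) : Nonempty (FrameAt (E := E) FB B x) := by
  obtain ⟨s, ν, h⟩ := exists_dualFrame (E := E) FB B x
  obtain ⟨b, hb, -⟩ := h.self_of_nhds
  exact ⟨⟨s, b, hb⟩⟩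

/-! #### Tensoriality -/

section Tensorial

variable {W : Type*} [AddCommGroup W] [Module ℝ W]

/-- A cut-off `χ` supported where `s` vanishes has `χ s = 0`, while tensoriality gives `T (χ s) =
χ(x) T s = T s`. -/
theorem tensorial_local {x : M} (T : Sec E FB B →+ W)
    (hT : ∀ f s, T (smulSec f s) = f x • T s) {s : Sec E FB B} (hs : ∀ᶠ y in 𝓝 x, s y = 0) :
    T s = 0 := by
  obtain ⟨χ, h1, h2⟩ := exists_bump (E := E) hs
  have h : smulSec χ s = 0 := ContMDiffSection.ext fun y => by
    rw [smulSec_apply]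
    by_cases hy : y ∈ tsupport χ
    · rw [show s y = 0 from h2 hy, smul_zero]; rfl
    · rw [image_eq_zero_of_notMem_tsupport hy, zero_smul]; rfl
  have h' := hT χ s
  rw [h, map_zero, h1.self_of_nhds, one_smul] at h'
  exact h'.symm

/-- By locality `s` may be replaced by its expansion in a frame of global sections, and the
coefficients of that expansion vanish at `x`. -/
theorem tensorial_apply {x : M} (T : Sec E FB B →+ W)
    (hT : ∀ f s, T (smulSec f s) = f x • T s) {s : Sec E FB B} (hs : s x = 0) : T s = 0 := by
  obtain ⟨e, ν, h⟩ := exists_dualFrame (E := E) FB B x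
  have h0 : T (s - ∑ i, smulSec (pair (ν i) s) (e i)) = 0 := by
    refine tensorial_local T hT ?_
    filter_upwards [h] with y hy
    obtain ⟨b, hb, hb'⟩ := hy
    rw [Sec.sub_apply, Sec.sum_apply, sub_eq_zero]
    simp only [smulSec_apply, pair_apply, hb, hb', Module.Basis.coord_apply]
    exact (b.sum_repr (s y)).symm
  rw [map_sub, map_sum, sub_eq_zero] at h0
  rw [h0]
  refine Finset.sum_eq_zero fun i _ => ?_
  rw [hT, pair_apply, hs, map_zero, zero_smul]

theorem tensorial_congr {x : M} (T : Sec E FB B →+ W)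
    (hT : ∀ f s, T (smulSec f s) = f x • T s) {s t : Sec E FB B} (hs : s x = t x) : T s = T t := by
  rw [← sub_eq_zero, ← map_sub]
  exact tensorial_apply T hT (by rw [Sec.sub_apply, hs, sub_self])

/-- A functional on sections that is tensorial at `x` comes from a linear map on the fibre. -/
theorem exists_fibre_map {x : M} (T : Sec E FB B →+ W)
    (hT : ∀ f s, T (smulSec f s) = f x • T s) :
    ∃ t : B x →ₗ[ℝ] W, ∀ s, T s = t (s x) := by
  choose e he using fun v : B x => exists_sec (E := E) (FB := FB) x v
  refine ⟨{ toFun := fun v => T (e v), map_add' := fun v w => ?_, map_smul' := fun c v => ?_ },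
    fun s => tensorial_congr T hT (he _).symm⟩
  · rw [← map_add]
    exact tensorial_congr T hT (by rw [Sec.add_apply, he, he, he])
  · rw [RingHom.id_apply]
    have := hT (constFn c) (e v)
    refine Eq.trans ?_ this
    exact tensorial_congr T hT (by rw [smulSec_apply, he, he]; rfl)

/-- A function-linear map on sections is given by a smooth section of the dual bundle. -/
theorem exists_sdual_of_tensorial (T : Sec E FB B → Fn E M)
    (hadd : ∀ s t, T (s + t) = T s + T t) (hT : ∀ f s, T (smulSec f s) = f * T s) :
    ∃ ν : SDual E FB B, ∀ s, pair ν s = T s := by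
  have h : ∀ x, ∃ t : B x →ₗ[ℝ] ℝ, ∀ s, T s x = t (s x) := fun x =>
    exists_fibre_map (x := x) (AddMonoidHom.mk' (fun s => T s x) (fun s t => by rw [hadd]; rfl))
      (fun f s => by simp only [AddMonoidHom.mk'_apply, hT]; rfl)
  choose t ht using h
  refine ⟨⟨t, fun s => (T s).contMDiff.congr fun x => (ht x s).symm⟩, fun s => ?_⟩
  exact ContMDiffMap.ext fun x => (ht x s).symm

theorem SDual.ext_pair {ν ν' : SDual E FB B} (h : ∀ s, pair ν s = pair ν' s) : ν = ν' := by
  refine Subtype.ext (funext fun x => LinearMap.ext fun v => ?_)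
  obtain ⟨s, rfl⟩ := exists_sec (E := E) (FB := FB) x v
  exact congrArg (fun f : Fn E M => f x) (h s)

end Tensorial

/-- Every covector is the differential of a smooth function. -/
theorem exists_fn_dirDeriv (x : M) (ξ : Cotan E x) :
    ∃ g : Fn E M, ∀ v : TangentSpace 𝓘(ℝ, E) x, dirDeriv g v = ξ v := by
  obtain ⟨χ, h1, h2⟩ := exists_bump (E := E) ((chartAt E x).open_source.mem_nhds
    (mem_chart_source E x))
  let l : E →L[ℝ] ℝ := LinearMap.toContinuousLinearMap (show E →ₗ[ℝ] ℝ from ξ)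
  have hs : ContMDiffOn 𝓘(ℝ, E) 𝓘(ℝ, ℝ) ∞ (fun y => l (extChartAt 𝓘(ℝ, E) x y))
      (chartAt E x).source :=
    l.contDiff.contMDiff.comp_contMDiffOn contMDiffOn_extChartAt
  refine ⟨cutFn χ _ (chartAt E x).open_source h2 _ hs, fun v => ?_⟩
  have e1 : dirDeriv (cutFn χ _ (chartAt E x).open_source h2 _ hs) v =
      dirDeriv (fun y => l (extChartAt 𝓘(ℝ, E) x y)) v := by
    refine dirDeriv_congr ?_ v
    filter_upwards [h1] with y hy
    change χ y * _ = _
    rw [hy, one_mul]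
  rw [e1]
  have h3 : MDifferentiableAt 𝓘(ℝ, E) 𝓘(ℝ, E) (extChartAt 𝓘(ℝ, E) x) x :=
    (contMDiffAt_extChartAt (n := 1)).mdifferentiableAt (by simp)
  have h4 : mfderiv 𝓘(ℝ, E) 𝓘(ℝ, ℝ) (l ∘ extChartAt 𝓘(ℝ, E) x) x =
      (mfderiv 𝓘(ℝ, E) 𝓘(ℝ, ℝ) l (extChartAt 𝓘(ℝ, E) x x)).comp
        (mfderiv 𝓘(ℝ, E) 𝓘(ℝ, E) (extChartAt 𝓘(ℝ, E) x) x) :=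
    mfderiv_comp x (l.mdifferentiableAt) h3
  -- The tangent space at `x` is identified with `E` by the chart at `x` itself, so a linear
  -- functional of this chart has that same functional as differential at `x`.
  have h5 : mfderiv 𝓘(ℝ, E) 𝓘(ℝ, E) (extChartAt 𝓘(ℝ, E) x) x = ContinuousLinearMap.id ℝ _ :=
    mfderiv_extChartAt_self
  have h6 : mfderiv 𝓘(ℝ, E) 𝓘(ℝ, ℝ) l (extChartAt 𝓘(ℝ, E) x x) = l := l.mfderiv_eq
  rw [h5, h6] at h4
  exact congrArg (fun l : TangentSpace 𝓘(ℝ, E) x →L[ℝ] ℝ => l v) h4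

end Sections

/-! ### The algebra of sections -/

section WeilSections

variable {E : Type*} [NormedAddCommGroup E] [NormedSpace ℝ E] [FiniteDimensional ℝ E]
  {M : Type*} [TopologicalSpace M] [ChartedSpace E M] [IsManifold 𝓘(ℝ, E) ∞ M]
  {FA : Type*} [NormedAddCommGroup FA] [NormedSpace ℝ FA]
  {A : M → Type*} [TopologicalSpace (TotalSpace FA A)] [∀ x, AddCommGroup (A x)]
  [∀ x, Module ℝ (A x)] [∀ x, TopologicalSpace (A x)] [FiberBundle FA A] [VectorBundle ℝ FA A]

variable (E M) in
/-- The smooth `1`-forms on `M`. -/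
abbrev Form1 := SDual E E (TangentSpace 𝓘(ℝ, E) : M → Type _)

variable (E FA A) in
/-- Sections that are locally polynomial in the smooth generators. -/
def locPoly : Subalgebra ℝ (RawWeil E A) where
  carrier := {s | ∀ x, ∃ t ∈ polySections E FA A, ∀ᶠ y in 𝓝 x, s y = t y}
  mul_mem' h h' x := by
    obtain ⟨t, ht, e⟩ := h x
    obtain ⟨t', ht', e'⟩ := h' x
    exact ⟨t * t', mul_mem ht ht', by
      filter_upwards [e, e'] with y hy hy'
      rw [RawWeil.mul_apply, RawWeil.mul_apply, hy, hy']⟩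
  add_mem' h h' x := by
    obtain ⟨t, ht, e⟩ := h x
    obtain ⟨t', ht', e'⟩ := h' x
    exact ⟨t + t', add_mem ht ht', by
      filter_upwards [e, e'] with y hy hy'
      rw [RawWeil.add_apply, RawWeil.add_apply, hy, hy']⟩
  algebraMap_mem' r x := ⟨_, Subalgebra.algebraMap_mem _ r, by simp⟩

theorem polySections_le_locPoly : polySections E FA A ≤ locPoly E FA A :=
  fun s hs _ => ⟨s, hs, by simp⟩

theorem mem_locPoly_of_local {s : RawWeil E A}
    (h : ∀ x, ∃ t ∈ locPoly E FA A, ∀ᶠ y in 𝓝 x, s y = t y) : s ∈ locPoly E FA A := fun x => by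
  obtain ⟨t, ht, e⟩ := h x
  obtain ⟨t', ht', e'⟩ := ht x
  exact ⟨t', ht', by filter_upwards [e, e'] with y hy hy'; rw [hy, hy']⟩

/-- Induction on polynomial sections. -/
theorem polySections_induction {P : RawWeil E A → Prop}
    (fn : ∀ f : Fn E M, P (fun x => algebraMap ℝ (WeilFiber E A x) (f x)))
    (genT : ∀ ν : Form1 E M, P (fun x => genT E A x (ν.1 x)))
    (genΛ : ∀ ν : SDual E FA A, P (fun x => genΛ E A x (ν.1 x)))
    (genS : ∀ ν : SDual E FA A, P (fun x => genS E A x (ν.1 x)))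
    (mul : ∀ s t, s ∈ polySections E FA A → t ∈ polySections E FA A → P s → P t → P (s * t))
    (add : ∀ s t, P s → P t → P (s + t)) {s : RawWeil E A} (hs : s ∈ polySections E FA A) :
    P s := by
  refine Algebra.adjoin_induction (fun s hs => ?_) (fun r => ?_) (fun s t _ _ => add s t)
    (fun s t hs ht => mul s t hs ht) hs
  · rcases hs with ((⟨f, rfl⟩ | ⟨ν, hν, rfl⟩) | ⟨ν, hν, rfl⟩) | ⟨ν, hν, rfl⟩
    · exact fn f
    · exact genT ⟨ν, hν⟩
    · exact genΛ ⟨ν, hν⟩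
    · exact genS ⟨ν, hν⟩
  · exact fn (constFn r)

/-- Linear induction on monomial sections. -/
theorem polySections_linear_induction {P : RawWeil E A → Prop}
    (hom : ∀ s, s ∈ polySections E FA A → (∃ t, ∀ x, s x ∈ triGr E A x t) → P s)
    (add : ∀ s t, P s → P t → P (s + t)) {s : RawWeil E A} (hs : s ∈ polySections E FA A) :
    P s := by
  have h1 := hs
  rw [polySections, ← Subalgebra.mem_toSubmodule, Algebra.adjoin_eq_span] at h1
  have h0 : P 0 := hom 0 (zero_mem _) ⟨0, fun x => zero_mem _⟩
  have h2 : s ∈ Submodule.span ℝ {s : RawWeil E A | s ∈ polySections E FA A ∧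
      ∃ t, ∀ x, s x ∈ triGr E A x t} := by
    refine Submodule.span_mono ?_ h1
    intro m hm
    induction hm using Submonoid.closure_induction with
    | mem m hm =>
      refine ⟨Algebra.subset_adjoin hm, ?_⟩
      rcases hm with ((⟨f, rfl⟩ | ⟨ν, hν, rfl⟩) | ⟨ν, hν, rfl⟩) | ⟨ν, hν, rfl⟩
      · exact ⟨_, fun x => algebraMap_mem_fiberGr _⟩
      · exact ⟨_, fun x => genT_mem_fiberGr _⟩
      · exact ⟨_, fun x => genΛ_mem_fiberGr _⟩
      · exact ⟨_, fun x => genS_mem_fiberGr _⟩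
    | one => exact ⟨one_mem _, 0, fun x => one_mem_fiberGr⟩
    | mul m m' _ _ h h' =>
      obtain ⟨h1, t, ht⟩ := h
      obtain ⟨h1', t', ht'⟩ := h'
      exact ⟨mul_mem h1 h1', t + t', fun x => mul_mem_fiberGr (ht x) (ht' x)⟩
  refine Submodule.closure_induction (p := fun s _ => P s) h0 (fun s t _ _ => add s t) ?_ h2
  rintro r s ⟨h1, t, ht⟩
  exact hom _ (Subalgebra.smul_mem _ h1 r) ⟨t, fun x => Submodule.smul_mem _ r (ht x)⟩

/-- Polynomial sections are sums of trihomogeneous polynomial sections, and a projection keeps or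
kills each of these. Hence the components of a smooth section are smooth. -/
theorem triProj_mem_polySections {s : RawWeil E A} (hs : s ∈ polySections E FA A)
    (t : ℕ × ℕ × ℕ) : (fun x => triProj E A x t (s x) : RawWeil E A) ∈ polySections E FA A := by
  refine polySections_linear_induction (P := fun s => (fun x => triProj E A x t (s x) :
    RawWeil E A) ∈ polySections E FA A) (fun s hs h => ?_) (fun s s' h h' => ?_) hs
  · obtain ⟨t', ht'⟩ := h
    by_cases h : t' = t
    · subst h
      have e : (fun x => triProj E A x t' (s x) : RawWeil E A) = s :=
        funext fun x => fiberProj_of_mem (ht' x)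
      rw [e]
      exact hs
    · have e : (fun x => triProj E A x t (s x) : RawWeil E A) = 0 :=
        funext fun x => fiberProj_of_mem_ne h (ht' x)
      rw [e]
      exact zero_mem _
  · have e : (fun x => triProj E A x t ((s + s') x) : RawWeil E A) =
        (fun x => triProj E A x t (s x) : RawWeil E A) + fun x => triProj E A x t (s' x) :=
      funext fun x => map_add (triProj E A x t) _ _
    rw [e]
    exact add_mem h h'

theorem triProj_mem_locPoly {s : RawWeil E A} (hs : s ∈ locPoly E FA A)
    (t : ℕ × ℕ × ℕ) : (fun x => triProj E A x t (s x) : RawWeil E A) ∈ locPoly E FA A := fun x => by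
  obtain ⟨p, hp, e⟩ := hs x
  exact ⟨_, triProj_mem_polySections hp t, by filter_upwards [e] with y hy; rw [hy]⟩

theorem mem_weilSections {s : RawWeil E A} {t : ℕ × ℕ × ℕ} :
    s ∈ weilSections E FA A t.1 t.2.1 t.2.2 ↔
      (∀ x, s x ∈ triGr E A x t) ∧ s ∈ locPoly E FA A := by
  refine and_congr (forall_congr' fun x => ?_) Iff.rfl
  rw [fiberPiece_eq_triGr]

theorem weilSections_le_weil (t : ℕ × ℕ × ℕ) :
    weilSections E FA A t.1 t.2.1 t.2.2 ≤ Subalgebra.toSubmodule (Weil E FA A) :=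
  le_iSup (fun t : ℕ × ℕ × ℕ => weilSections E FA A t.1 t.2.1 t.2.2) t

theorem polySections_le_weil : polySections E FA A ≤ Weil E FA A := fun s hs => by
  refine polySections_linear_induction (P := fun s => s ∈ Weil E FA A) (fun s hs h => ?_)
    (fun _ _ => add_mem) hs
  obtain ⟨t, ht⟩ := h
  exact weilSections_le_weil t (mem_weilSections.2 ⟨ht, polySections_le_locPoly hs⟩)

theorem weil_le_locPoly : Weil E FA A ≤ locPoly E FA A := by
  have : (⨆ t : ℕ × ℕ × ℕ, weilSections E FA A t.1 t.2.1 t.2.2) ≤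
      Subalgebra.toSubmodule (locPoly E FA A) :=
    iSup_le fun t s hs => (mem_weilSections.1 hs).2
  exact this

theorem weil_ext {a b : Weil E FA A} (h : ∀ x, a.1 x = b.1 x) : a = b :=
  Subtype.ext (funext h)

theorem RawWeil.sum_apply {ι : Type*} (t : Finset ι) (f : ι → RawWeil E A) (x : M) :
    (∑ i ∈ t, f i) x = ∑ i ∈ t, f i x :=
  map_sum (LinearMap.proj (R := ℝ) (φ := WeilFiber E A) x : RawWeil E A →ₗ[ℝ] WeilFiber E A x) f t

section
variable (a b : Weil E FA A) (x : M)
theorem weil_add_apply : (a + b).1 x = a.1 x + b.1 x := rfl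
theorem weil_sub_apply : (a - b).1 x = a.1 x - b.1 x := rfl
theorem weil_neg_apply : (-a).1 x = -a.1 x := rfl
theorem weil_zero_apply : (0 : Weil E FA A).1 x = 0 := rfl
theorem weil_mul_apply : (a * b).1 x = a.1 x * b.1 x := rfl
theorem weil_smul_apply (c : ℝ) : (c • a).1 x = c • a.1 x := rfl
theorem weil_sum_apply {ι : Type*} (t : Finset ι) (f : ι → Weil E FA A) :
    (∑ i ∈ t, f i).1 x = ∑ i ∈ t, (f i).1 x := by
  rw [show (∑ i ∈ t, f i).1 = ∑ i ∈ t, (f i).1 from map_sum (Weil E FA A).val _ _]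
  exact RawWeil.sum_apply t (fun i => (f i).1) x
end

/-- A homogeneous locally polynomial section is an element of `W`. -/
theorem mem_weil_of_biGr {s : RawWeil E A} {n : ℤ × ℤ} (hs : s ∈ locPoly E FA A)
    (hn : ∀ x, s x ∈ biGr E A x n) :
    s ∈ ⨆ t : ℕ × ℕ × ℕ, ⨆ _ : ((t.2.1 : ℤ) + t.2.2, (t.1 : ℤ) + t.2.1) = n,
      weilSections E FA A t.1 t.2.1 t.2.2 := by
  have h : s = ∑ t ∈ biFiber n, (fun x => triProj E A x t (s x) : RawWeil E A) := by
    funext x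
    refine (fiberProj_of_mem (hn x)).symm.trans ?_
    refine (biProj_eq_sum n (s x)).trans ?_
    exact (RawWeil.sum_apply (biFiber n) (fun t => (fun x => triProj E A x t (s x) : RawWeil E A)) x).symm
  rw [h]
  refine Submodule.sum_mem _ fun t ht => Submodule.mem_iSup_of_mem t
    (Submodule.mem_iSup_of_mem (mem_biFiber.1 ht) ?_)
  exact mem_weilSections.2 ⟨fun x => fiberProj_mem _ _, triProj_mem_locPoly hs t⟩

/-- A locally polynomial section may have components in infinitely many degrees over a noncompact
base, and then it is not in the direct sum. Homogeneity for a fixed bidegree leaves only finitely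
many tridegrees. -/
theorem mem_weil_of_biGr' {s : RawWeil E A} {n : ℤ × ℤ} (hs : s ∈ locPoly E FA A)
    (hn : ∀ x, s x ∈ biGr E A x n) : s ∈ Weil E FA A := by
  refine (iSup_le fun t => iSup_le fun _ => ?_ : _ ≤ Subalgebra.toSubmodule (Weil E FA A))
    (mem_weil_of_biGr hs hn)
  exact weilSections_le_weil t

theorem mem_weilPiece {p q : ℕ} {a : Weil E FA A} :
    a ∈ weilPiece E FA A p q ↔ ∀ x, a.1 x ∈ biGr E A x ((p : ℤ), (q : ℤ)) := by
  constructor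
  · intro ha x
    have h : (⨆ t : ℕ × ℕ × ℕ, ⨆ _ : t.2.1 + t.2.2 = p ∧ t.1 + t.2.1 = q,
        weilSections E FA A t.1 t.2.1 t.2.2) ≤ (biGr E A x ((p : ℤ), (q : ℤ))).comap
          (LinearMap.proj (R := ℝ) (φ := WeilFiber E A) x) := by
      refine iSup_le fun t => iSup_le fun ht s hs => ?_
      have h := triGr_le_biGr t ((mem_weilSections.1 hs).1 x)
      rw [← ht.1, ← ht.2]
      push_cast
      exact h
    exact h ha
  · intro ha
    have h := mem_weil_of_biGr (weil_le_locPoly a.2) ha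
    refine (iSup_le fun t => iSup_le fun ht => ?_ : _ ≤ (⨆ t : ℕ × ℕ × ℕ,
      ⨆ _ : t.2.1 + t.2.2 = p ∧ t.1 + t.2.1 = q, weilSections E FA A t.1 t.2.1 t.2.2)) h
    refine le_iSup_of_le t (le_iSup_of_le ?_ le_rfl)
    simp only [Prod.mk.injEq] at ht
    omega

theorem weil_eq_iSup : (⨆ pq : ℕ × ℕ, weilPiece E FA A pq.1 pq.2) = ⊤ := by
  refine eq_top_iff.2 fun a _ => ?_
  have h : ∀ s (hs : s ∈ (⨆ t : ℕ × ℕ × ℕ, weilSections E FA A t.1 t.2.1 t.2.2)),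
      ∃ h : s ∈ Weil E FA A, (⟨s, h⟩ : Weil E FA A) ∈ ⨆ pq : ℕ × ℕ, weilPiece E FA A pq.1 pq.2 := by
    intro s hs
    induction hs using Submodule.iSup_induction' with
    | mem t s hs =>
      refine ⟨weilSections_le_weil t hs, Submodule.mem_iSup_of_mem (t.2.1 + t.2.2, t.1 + t.2.1) ?_⟩
      refine mem_weilPiece.2 fun x => ?_
      have h := triGr_le_biGr t ((mem_weilSections.1 hs).1 x)
      push_cast
      exact h
    | zero => exact ⟨zero_mem _, zero_mem _⟩
    | add s t _ _ h h' => exact ⟨add_mem h.1 h'.1, add_mem h.2 h'.2⟩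
  exact (h a.1 a.2).2

/-- Linear induction on bihomogeneous elements. -/
theorem weil_induction {P : Weil E FA A → Prop}
    (hom : ∀ p q a, a ∈ weilPiece E FA A p q → P a) (add : ∀ a b, P a → P b → P (a + b))
    (a : Weil E FA A) : P a :=
  Submodule.iSup_induction (motive := P) _ (weil_eq_iSup.ge (trivial : a ∈ ⊤))
    (fun _ a ha => hom _ _ a ha) (hom 0 0 0 (zero_mem _)) add

/-! #### Generators -/

variable (FA A) in
/-- Smooth functions as elements of `W`. -/
def wF : Fn E M →ₐ[ℝ] Weil E FA A where
  toFun f := ⟨fun x => algebraMap ℝ (WeilFiber E A x) (f x),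
    polySections_le_weil (Algebra.subset_adjoin (Or.inl (Or.inl (Or.inl ⟨f, rfl⟩))))⟩
  map_one' := weil_ext fun x => map_one (algebraMap ℝ (WeilFiber E A x))
  map_mul' f g := weil_ext fun x => map_mul (algebraMap ℝ (WeilFiber E A x)) _ _
  map_zero' := weil_ext fun x => map_zero (algebraMap ℝ (WeilFiber E A x))
  map_add' f g := weil_ext fun x => map_add (algebraMap ℝ (WeilFiber E A x)) _ _
  commutes' r := weil_ext fun x => rfl

variable (FA A) in
/-- Smooth `1`-forms on `M` as elements of `W`. -/
def wT : Form1 E M →ₗ[ℝ] Weil E FA A where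
  toFun ν := ⟨fun x => genT E A x (ν.1 x),
    polySections_le_weil (Algebra.subset_adjoin (Or.inl (Or.inl (Or.inr ⟨ν.1, ν.2, rfl⟩))))⟩
  map_add' ν ν' := weil_ext fun x => map_add _ _ _
  map_smul' c ν := weil_ext fun x => (genT E A x).map_smul _ _

/-- Sections of `A*` as elements of `Γ(Λ¹ A*)`. -/
def wΛ : SDual E FA A →ₗ[ℝ] Weil E FA A where
  toFun ν := ⟨fun x => genΛ E A x (ν.1 x),
    polySections_le_weil (Algebra.subset_adjoin (Or.inl (Or.inr ⟨ν.1, ν.2, rfl⟩)))⟩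
  map_add' ν ν' := weil_ext fun x => map_add _ _ _
  map_smul' c ν := weil_ext fun x => (genΛ E A x).map_smul _ _

/-- Sections of `A*` as elements of `Γ(S¹ A*)`. -/
def wS : SDual E FA A →ₗ[ℝ] Weil E FA A where
  toFun ν := ⟨fun x => genS E A x (ν.1 x),
    polySections_le_weil (Algebra.subset_adjoin (Or.inr ⟨ν.1, ν.2, rfl⟩))⟩
  map_add' ν ν' := weil_ext fun x => map_add _ _ _
  map_smul' c ν := weil_ext fun x => (genS E A x).map_smul _ _

theorem wF_apply (f : Fn E M) (x : M) :
    (wF FA A f).1 x = algebraMap ℝ (WeilFiber E A x) (f x) := rfl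

theorem wT_apply (ν : Form1 E M) (x : M) : (wT FA A ν).1 x = genT E A x (ν.1 x) := rfl

theorem wΛ_apply (ν : SDual E FA A) (x : M) : (wΛ ν).1 x = genΛ E A x (ν.1 x) := rfl

theorem wS_apply (ν : SDual E FA A) (x : M) : (wS ν).1 x = genS E A x (ν.1 x) := rfl

theorem wF_mul_apply (f : Fn E M) (a : Weil E FA A) (x : M) :
    (wF FA A f * a).1 x = f x • a.1 x := by
  rw [weil_mul_apply, wF_apply, ← Algebra.smul_def]

theorem wF_mul_comm (f : Fn E M) (a : Weil E FA A) : wF FA A f * a = a * wF FA A f :=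
  weil_ext fun _ => Algebra.commutes _ _

theorem wΛ_smul (f : Fn E M) (ν : SDual E FA A) : wΛ (smulDual f ν) = wF FA A f * wΛ ν :=
  weil_ext fun x => by rw [wF_mul_apply]; exact (genΛ E A x).map_smul _ _

/-! #### Local operators -/

/-- Two operators that agree on generators locally agree, if equality is stable under products. -/
def IsLocalOp (D : Weil E FA A →ₗ[ℝ] Weil E FA A) : Prop :=
  ∀ a x, (∀ᶠ y in 𝓝 x, a.1 y = 0) → (D a).1 x = 0

theorem IsLocalOp.eventually {D : Weil E FA A →ₗ[ℝ] Weil E FA A} (hD : IsLocalOp D)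
    {a : Weil E FA A} {x : M} (h : ∀ᶠ y in 𝓝 x, a.1 y = 0) : ∀ᶠ y in 𝓝 x, (D a).1 y = 0 := by
  filter_upwards [h.eventually_nhds] with y hy using hD a y hy

theorem IsLocalOp.congr {D : Weil E FA A →ₗ[ℝ] Weil E FA A} (hD : IsLocalOp D)
    {a b : Weil E FA A} {x : M} (h : ∀ᶠ y in 𝓝 x, a.1 y = b.1 y) : (D a).1 x = (D b).1 x := by
  have h' := hD (a - b) x (by filter_upwards [h] with y hy; rw [weil_sub_apply, hy, sub_self])
  rw [map_sub, weil_sub_apply, sub_eq_zero] at h'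
  exact h'

theorem IsLocalOp.comp {D D' : Weil E FA A →ₗ[ℝ] Weil E FA A} (hD : IsLocalOp D)
    (hD' : IsLocalOp D') : IsLocalOp (D ∘ₗ D') := fun _ x h => hD _ x (hD'.eventually h)

theorem IsLocalOp.sub {D D' : Weil E FA A →ₗ[ℝ] Weil E FA A} (hD : IsLocalOp D)
    (hD' : IsLocalOp D') : IsLocalOp (D - D') := fun a x h => by
  rw [LinearMap.sub_apply, weil_sub_apply, hD a x h, hD' a x h, sub_zero]

theorem isLocalOp_zero : IsLocalOp (0 : Weil E FA A →ₗ[ℝ] Weil E FA A) := fun _ _ _ => rfl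

/-- A subspace of `W` which is local, closed under products and contains the generators is `W`. -/
theorem weil_generation (K : Weil E FA A → Prop)
    (loc : ∀ a, (∀ x, ∃ b, K b ∧ ∀ᶠ y in 𝓝 x, a.1 y = b.1 y) → K a)
    (mul : ∀ a b, K a → K b → K (a * b)) (add : ∀ a b, K a → K b → K (a + b))
    (fn : ∀ f, K (wF FA A f)) (gT : ∀ ν, K (wT FA A ν)) (gΛ : ∀ ν, K (wΛ ν))
    (gS : ∀ ν, K (wS ν)) (a : Weil E FA A) : K a := by
  refine loc a fun x => ?_
  obtain ⟨t, ht, e⟩ := weil_le_locPoly a.2 x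
  have h : ∃ h : t ∈ Weil E FA A, K ⟨t, h⟩ :=
    polySections_induction (P := fun t => ∃ h : t ∈ Weil E FA A, K ⟨t, h⟩)
      (fun f => ⟨_, fn f⟩) (fun f => ⟨_, gT f⟩) (fun f => ⟨_, gΛ f⟩) (fun f => ⟨_, gS f⟩)
      (fun s t _ _ h h' => ⟨mul_mem h.1 h'.1, mul _ _ h.2 h'.2⟩)
      (fun s t h h' => ⟨add_mem h.1 h'.1, add _ _ h.2 h'.2⟩) ht
  exact ⟨⟨t, h.1⟩, h.2, e⟩

/-- No product rule is built in: compatibility with products enters only through `mul`. The lemma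
therefore serves for odd and even derivations, algebra maps and intertwining relations alike. -/
theorem weil_op_eq {D D' : Weil E FA A →ₗ[ℝ] Weil E FA A} (hD : IsLocalOp D) (hD' : IsLocalOp D')
    (mul : ∀ a b, D a = D' a → D b = D' b → D (a * b) = D' (a * b))
    (fn : ∀ f, D (wF FA A f) = D' (wF FA A f)) (gT : ∀ ν, D (wT FA A ν) = D' (wT FA A ν))
    (gΛ : ∀ ν, D (wΛ ν) = D' (wΛ ν)) (gS : ∀ ν, D (wS ν) = D' (wS ν)) (a) : D a = D' a :=
  weil_generation (fun a => D a = D' a)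
    (fun a h => weil_ext fun x => by
      obtain ⟨b, hb, e⟩ := h x
      rw [hD.congr e, hb, hD'.congr e])
    mul (fun a b h h' => by rw [map_add, map_add, h, h']) fn gT gΛ gS a

/-! #### Operators induced by operators on the fibres -/

/-- The operator on `W` induced by linear maps on the fibres. -/
theorem exists_fibrewise (φ : ∀ x, WeilFiber E A x →ₗ[ℝ] WeilFiber E A x) (c : ℤ × ℤ)
    (hpoly : ∀ t ∈ polySections E FA A, (fun x => φ x (t x) : RawWeil E A) ∈ locPoly E FA A)
    (hgr : ∀ x n a, a ∈ biGr E A x n → φ x a ∈ biGr E A x (n + c)) :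
    ∃ D : Weil E FA A →ₗ[ℝ] Weil E FA A, ∀ a x, (D a).1 x = φ x (a.1 x) := by
  have h : ∀ a : Weil E FA A, (fun x => φ x (a.1 x) : RawWeil E A) ∈ Weil E FA A := by
    refine weil_induction (fun p q a ha => ?_) (fun a b ha hb => ?_)
    · refine mem_weil_of_biGr' (fun x => ?_) (fun x => hgr x _ _ (mem_weilPiece.1 ha x))
      obtain ⟨t, ht, e⟩ := weil_le_locPoly a.2 x
      obtain ⟨t', ht', e'⟩ := hpoly t ht x
      exact ⟨t', ht', by filter_upwards [e, e'] with y hy hy'; rw [hy, ← hy']⟩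
    · have e : (fun x => φ x ((a + b).1 x) : RawWeil E A) =
          (fun x => φ x (a.1 x) : RawWeil E A) + fun x => φ x (b.1 x) :=
        funext fun x => (φ x).map_add _ _
      rw [e]
      exact add_mem ha hb
  exact ⟨{ toFun := fun a => ⟨_, h a⟩
           map_add' := fun a b => weil_ext fun x => (φ x).map_add _ _
           map_smul' := fun c a => weil_ext fun x => (φ x).map_smul _ _ }, fun a x => rfl⟩

theorem isLocalOp_of_fibrewise {φ : ∀ x, WeilFiber E A x →ₗ[ℝ] WeilFiber E A x}
    {D : Weil E FA A →ₗ[ℝ] Weil E FA A} (h : ∀ a x, (D a).1 x = φ x (a.1 x)) : IsLocalOp D :=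
  fun a x ha => by rw [h, ha.self_of_nhds, map_zero]

theorem parity_mem_polySections {t : RawWeil E A} (ht : t ∈ polySections E FA A) :
    (fun x => parity E A x (t x) : RawWeil E A) ∈ polySections E FA A := by
  refine polySections_induction (P := fun t => (fun x => parity E A x (t x) : RawWeil E A) ∈
    polySections E FA A) (fun f => ?_) (fun f => ?_) (fun f => ?_) (fun f => ?_)
    (fun s t _ _ hs ht => ?_) (fun s t hs ht => ?_) ht
  · simp only [AlgHom.commutes]
    exact Algebra.subset_adjoin (Or.inl (Or.inl (Or.inl ⟨f, rfl⟩)))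
  · simp only [parity_genT]
    have h : (fun x => genT E A x (f.1 x) : RawWeil E A) ∈ polySections E FA A :=
      Algebra.subset_adjoin (Or.inl (Or.inl (Or.inr ⟨f.1, f.2, rfl⟩)))
    exact neg_mem h
  · simp only [parity_genΛ]
    have h : (fun x => genΛ E A x (f.1 x) : RawWeil E A) ∈ polySections E FA A :=
      Algebra.subset_adjoin (Or.inl (Or.inr ⟨f.1, f.2, rfl⟩))
    exact neg_mem h
  · simp only [parity_genS]
    exact Algebra.subset_adjoin (Or.inr ⟨f.1, f.2, rfl⟩)
  · have e : (fun x => parity E A x ((s * t) x) : RawWeil E A) =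
        (fun x => parity E A x (s x) : RawWeil E A) * fun x => parity E A x (t x) :=
      funext fun x => map_mul (parity E A x) _ _
    rw [e]
    exact mul_mem hs ht
  · have e : (fun x => parity E A x ((s + t) x) : RawWeil E A) =
        (fun x => parity E A x (s x) : RawWeil E A) + fun x => parity E A x (t x) :=
      funext fun x => map_add (parity E A x) _ _
    rw [e]
    exact add_mem hs ht

theorem exists_wpar : ∃ D : Weil E FA A →ₗ[ℝ] Weil E FA A, ∀ a x, (D a).1 x = parity E A x (a.1 x) :=
  exists_fibrewise (fun x => (parity E A x).toLinearMap) 0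
    (fun _ ht => polySections_le_locPoly (parity_mem_polySections ht))
    (fun x n a ha => by rw [add_zero]; exact parity_mem_fiberGr ha)

/-- The parity operator. -/
def wpar : Weil E FA A →ₗ[ℝ] Weil E FA A := exists_wpar.choose

theorem wpar_apply (a : Weil E FA A) (x : M) : (wpar a).1 x = parity E A x (a.1 x) :=
  exists_wpar.choose_spec a x

theorem wpar_mul (a b : Weil E FA A) : wpar (a * b) = wpar a * wpar b :=
  weil_ext fun x => by simp only [wpar_apply, weil_mul_apply, map_mul]

theorem wpar_wpar (a : Weil E FA A) : wpar (wpar a) = a :=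
  weil_ext fun x => by simp only [wpar_apply, parity_parity]

theorem wpar_wF (f : Fn E M) : wpar (wF FA A f) = wF FA A f :=
  weil_ext fun x => by simp only [wpar_apply, wF_apply, AlgHom.commutes]

theorem wpar_wT (ν : Form1 E M) : wpar (wT FA A ν) = -wT FA A ν :=
  weil_ext fun x => by simp only [wpar_apply, wT_apply, weil_neg_apply, parity_genT]

theorem wpar_wΛ (ν : SDual E FA A) : wpar (wΛ ν) = -wΛ ν :=
  weil_ext fun x => by simp only [wpar_apply, wΛ_apply, weil_neg_apply, parity_genΛ]

theorem wpar_wS (ν : SDual E FA A) : wpar (wS ν) = wS ν :=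
  weil_ext fun x => by simp only [wpar_apply, wS_apply, parity_genS]

theorem isLocalOp_wpar : IsLocalOp (wpar : Weil E FA A →ₗ[ℝ] Weil E FA A) :=
  isLocalOp_of_fibrewise (φ := fun x => (parity E A x).toLinearMap) wpar_apply

theorem isLocalOp_id : IsLocalOp (LinearMap.id : Weil E FA A →ₗ[ℝ] Weil E FA A) :=
  fun _ _ h => h.self_of_nhds

/-! #### Odd and even derivations -/

/-- The Leibniz rule for odd operators. -/
def IsOddDer (D : Weil E FA A →ₗ[ℝ] Weil E FA A) : Prop :=
  ∀ a b, D (a * b) = D a * b + wpar a * D b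

/-- The Leibniz rule for even operators. -/
def IsEvenDer (D : Weil E FA A →ₗ[ℝ] Weil E FA A) : Prop :=
  ∀ a b, D (a * b) = D a * b + a * D b

/-- `D` reverses parity. -/
def ParityRev (D : Weil E FA A →ₗ[ℝ] Weil E FA A) : Prop := ∀ a, D (wpar a) = -wpar (D a)

/-- `D` preserves parity. -/
def ParityPres (D : Weil E FA A →ₗ[ℝ] Weil E FA A) : Prop := ∀ a, D (wpar a) = wpar (D a)

theorem isOddDer_of_fibrewise {φ : ∀ x, WeilFiber E A x →ₗ[ℝ] WeilFiber E A x}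
    (hφ : ∀ x, IsOddFiberDer (φ x))
    {D : Weil E FA A →ₗ[ℝ] Weil E FA A} (h : ∀ a x, (D a).1 x = φ x (a.1 x)) : IsOddDer D :=
  fun a b => weil_ext fun x => by
    rw [h, weil_mul_apply, hφ x, weil_add_apply, weil_mul_apply, weil_mul_apply, wpar_apply, h, h]

/-- The total degree is `u + 2v + w`, which has the parity of the number `u + w` of odd factors. -/
theorem weil_parity_of_mem {p q : ℕ} {a : Weil E FA A} (ha : a ∈ weilPiece E FA A p q) :
    wpar a = (-1 : ℝ) ^ (p + q) • a := by
  refine weil_ext fun x => ?_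
  rw [wpar_apply, weil_smul_apply]
  have h : ∀ t : ℕ × ℕ × ℕ, ∀ a ∈ triGr E A x t,
      parity E A x a = (-1 : ℝ) ^ (t.2.1 + t.2.2 + (t.1 + t.2.1)) • a := by
    intro t a ha
    rw [show (-1 : ℝ) ^ (t.2.1 + t.2.2 + (t.1 + t.2.1)) = (-1) ^ t.1 * (-1) ^ t.2.2 by
      rw [show t.2.1 + t.2.2 + (t.1 + t.2.1) = 2 * t.2.1 + (t.1 + t.2.2) by ring, pow_add, pow_mul,
        neg_one_sq, one_pow, one_mul, pow_add]]
    have hp := (fiberPiece_eq_triGr t.1 t.2.1 t.2.2).ge ha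
    let V : ℝ → Submodule ℝ (WeilFiber E A x) := fun c =>
      { carrier := {a | parity E A x a = c • a}
        add_mem' := fun {a b} ha hb => by
          simp only [Set.mem_ofPred_eq] at *; rw [map_add, ha, hb, smul_add]
        zero_mem' := by simp
        smul_mem' := fun r a ha => by
          simp only [Set.mem_ofPred_eq] at *; rw [map_smul, ha, smul_comm] }
    have hV : ∀ c d, V c * V d ≤ V (c * d) := fun c d => Submodule.mul_le.2 fun a ha b hb => by
      change parity E A x (a * b) = _
      rw [map_mul, show parity E A x a = c • a from ha, show parity E A x b = d • b from hb,
        smul_mul_smul_comm]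
    have hVp : ∀ c (P : Submodule ℝ (WeilFiber E A x)), P ≤ V c → ∀ n : ℕ, P ^ n ≤ V (c ^ n) := by
      intro c P hP n
      induction n with
      | zero =>
        rw [pow_zero, pow_zero, Submodule.one_le]
        change parity E A x 1 = _
        rw [map_one, one_smul]
      | succ n ih =>
        rw [pow_succ, pow_succ]
        exact (mul_le_mul' ih hP).trans (hV _ _)
    have h1 := hVp (-1) (LinearMap.range (genT E A x)) (by
      rintro _ ⟨ξ, rfl⟩; change parity E A x _ = _; rw [parity_genT, neg_one_smul]) t.1
    have h2 := hVp 1 (LinearMap.range (genS E A x)) (by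
      rintro _ ⟨ξ, rfl⟩; change parity E A x _ = _; rw [parity_genS, one_smul]) t.2.1
    have h3 := hVp (-1) (LinearMap.range (genΛ E A x)) (by
      rintro _ ⟨ξ, rfl⟩; change parity E A x _ = _; rw [parity_genΛ, neg_one_smul]) t.2.2
    have h4 := (mul_le_mul' ((mul_le_mul' h1 h2).trans (hV _ _)) h3).trans (hV _ _) hp
    have h5 : parity E A x a = ((-1) ^ t.1 * 1 ^ t.2.1 * (-1) ^ t.2.2 : ℝ) • a := h4
    rw [h5, one_pow, mul_one]
  have ha' := mem_weilPiece.1 ha x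
  rw [← fiberProj_of_mem ha', biProj_eq_sum, map_sum, Finset.smul_sum]
  refine Finset.sum_congr rfl fun t ht => ?_
  rw [h t _ (fiberProj_mem _ _)]
  have ht' := mem_biFiber.1 ht
  simp only [Prod.mk.injEq] at ht'
  rw [show t.2.1 + t.2.2 + (t.1 + t.2.1) = p + q by omega]

/-- With the parity operator the sign rule becomes an identity for all elements instead of
homogeneous ones; additivity passes from one form to the other. -/
theorem isGradedDerivation_iff {d : Weil E FA A →ₗ[ℝ] Weil E FA A} :
    IsGradedDerivation d ↔ IsOddDer d := by
  constructor
  · intro h a b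
    refine weil_induction (P := fun a => d (a * b) = d a * b + wpar a * d b)
      (fun p q a ha => ?_) (fun a a' h h' => ?_) a
    · rw [h p q a b ha, weil_parity_of_mem ha, smul_mul_assoc]
    · rw [add_mul, map_add, h, h', map_add, map_add]; noncomm_ring
  · intro h p q a b ha
    rw [h, weil_parity_of_mem ha, smul_mul_assoc]

end WeilSections

/-! ### Existence of derivations with prescribed values on generators -/

section Existence

variable {E : Type*} [NormedAddCommGroup E] [NormedSpace ℝ E] [FiniteDimensional ℝ E]
  {M : Type*} [TopologicalSpace M] [ChartedSpace E M] [IsManifold 𝓘(ℝ, E) ∞ M]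
  {FA : Type*} [NormedAddCommGroup FA] [NormedSpace ℝ FA]
  {A : M → Type*} [TopologicalSpace (TotalSpace FA A)] [∀ x, AddCommGroup (A x)]
  [∀ x, Module ℝ (A x)] [∀ x, TopologicalSpace (A x)] [FiberBundle FA A] [VectorBundle ℝ FA A]

/-- The differential of a function at a point. -/
def diffAt (f : M → ℝ) (x : M) : Cotan E x :=
  (mvfderiv 𝓘(ℝ, E) f x).toLinearMap

/-- The differential at a point, as a linear map. -/
def diffₗ (x : M) : Fn E M →ₗ[ℝ] Cotan E x where
  toFun f := diffAt f x
  map_add' f g := LinearMap.ext fun v => dirDeriv_add f g v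
  map_smul' c f := LinearMap.ext fun v => dirDeriv_smul c f v

theorem diffₗ_mul (x : M) (f g : Fn E M) :
    diffₗ x (f * g) = f x • diffₗ x g + g x • diffₗ x f :=
  LinearMap.ext fun v => dirDeriv_mul f g v

variable (E FA A) in
/-- Prescribed values of a derivation on functions and on the generators of `W`. -/
structure DerivationData where
  k : ∀ x, Cotan E x →ₗ[ℝ] WeilFiber E A x
  k_mul : ∀ x ξ a, k x ξ * a = parity E A x a * k x ξ
  κ : Fn E M → Weil E FA A
  κ_apply : ∀ f x, (κ f).1 x = k x (diffₗ x f)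
  OT : Form1 E M →ₗ[ℝ] Weil E FA A
  OΛ : SDual E FA A →ₗ[ℝ] Weil E FA A
  OS : SDual E FA A →ₗ[ℝ] Weil E FA A
  OT_smul : ∀ f ν, OT (smulDual f ν) = wF FA A f * OT ν + κ f * wT FA A ν
  OΛ_smul : ∀ f ν, OΛ (smulDual f ν) = wF FA A f * OΛ ν + κ f * wΛ ν
  OS_smul : ∀ f ν, OS (smulDual f ν) = wF FA A f * OS ν + κ f * wS ν
  OT_parity : ∀ ν, wpar (OT ν) = OT ν
  OΛ_parity : ∀ ν, wpar (OΛ ν) = OΛ ν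
  OS_parity : ∀ ν, wpar (OS ν) = -OS ν
  c : ℤ × ℤ
  k_mem : ∀ x ξ, k x ξ ∈ biGr E A x c
  OT_mem : ∀ ν x, (OT ν).1 x ∈ biGr E A x ((0, 1) + c)
  OΛ_mem : ∀ ν x, (OΛ ν).1 x ∈ biGr E A x ((1, 0) + c)
  OS_mem : ∀ ν x, (OS ν).1 x ∈ biGr E A x ((1, 1) + c)

section Local

variable {FB : Type*} [NormedAddCommGroup FB] [NormedSpace ℝ FB]
  {B : M → Type*} [TopologicalSpace (TotalSpace FB B)] [∀ x, AddCommGroup (B x)]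
  [∀ x, Module ℝ (B x)] [∀ x, TopologicalSpace (B x)] [FiberBundle FB B] [VectorBundle ℝ FB B]

theorem SDual.eq_zero_of_smul {χ : Fn E M} {ν : SDual E FB B} {U : Set M}
    (h2 : tsupport χ ⊆ U) (hU : ∀ y ∈ U, ν.1 y = 0) : smulDual χ ν = 0 :=
  Subtype.ext (funext fun y => by
    rw [smulDual_apply]
    by_cases hy : y ∈ tsupport χ
    · rw [hU y (h2 hy), smul_zero]; rfl
    · rw [image_eq_zero_of_notMem_tsupport hy, zero_smul]; rfl)

theorem diffₗ_congr {f g : Fn E M} {x : M} (h : ∀ᶠ y in 𝓝 x, f y = g y) :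
    diffₗ x f = diffₗ x g :=
  LinearMap.ext fun v => dirDeriv_congr h v

theorem diffₗ_const (c : ℝ) (x : M) : diffₗ x (constFn c : Fn E M) = 0 :=
  LinearMap.ext fun v => dirDeriv_const c v

/-- An operator satisfying the Leibniz rule is local. -/
theorem leibniz_local [T2Space M] {k : ∀ x, Cotan E x →ₗ[ℝ] WeilFiber E A x}
    {κ : Fn E M → Weil E FA A} (hκ : ∀ f x, (κ f).1 x = k x (diffₗ x f))
    {g : SDual E FB B → Weil E FA A} {O : SDual E FB B →ₗ[ℝ] Weil E FA A}
    (hO : ∀ f ν, O (smulDual f ν) = wF FA A f * O ν + κ f * g ν) {ν : SDual E FB B} {x : M}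
    (h : ∀ᶠ y in 𝓝 x, ν.1 y = 0) : (O ν).1 x = 0 := by
  obtain ⟨χ, h1, h2⟩ := exists_bump (E := E) h
  have h3 := hO χ ν
  rw [SDual.eq_zero_of_smul h2 (fun y hy => hy), map_zero] at h3
  have h4 : (0 : Weil E FA A).1 x = (wF FA A χ * O ν + κ χ * g ν).1 x := by rw [h3]
  have h5 : diffₗ x χ = 0 := (diffₗ_congr (g := constFn 1) h1).trans (diffₗ_const 1 x)
  rw [weil_zero_apply, weil_add_apply, wF_mul_apply, h1.self_of_nhds, one_smul,
    weil_mul_apply, hκ, h5, map_zero, zero_mul, add_zero] at h4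
  exact h4.symm

end Local

/-! #### Jets -/

variable (E A) in
/-- Smooth functions with values in (a finite-dimensional subspace of) the fibre at `x`. -/
abbrev Jet (x : M) := Fn E M ⊗[ℝ] WeilFiber E A x

/-- Evaluation of a function at a point, as an algebra homomorphism. -/
def evalFn (y : M) : Fn E M →ₐ[ℝ] ℝ where
  toFun f := f y
  map_one' := rfl
  map_mul' _ _ := rfl
  map_zero' := rfl
  map_add' _ _ := rfl
  commutes' _ := rfl

/-- The value at `y`. -/
def jetEval (x y : M) : Jet E A x →ₐ[ℝ] WeilFiber E A x :=
  Algebra.TensorProduct.lift ((Algebra.ofId ℝ (WeilFiber E A x)).comp (evalFn y))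
    (AlgHom.id ℝ _) (by intro f a; exact Algebra.commute_algebraMap_left (f y) a)

theorem jetEval_tmul (x y : M) (f : Fn E M) (a : WeilFiber E A x) :
    jetEval x y (f ⊗ₜ[ℝ] a) = f y • a :=
  (Algebra.TensorProduct.lift_tmul _ _ _ f a).trans (Algebra.smul_def (f y) a).symm

/-- The derivative `f ⊗ a ↦ k(df) a`. -/
def jetDer {x : M} (k : Cotan E x →ₗ[ℝ] WeilFiber E A x) : Jet E A x →ₗ[ℝ] WeilFiber E A x :=
  TensorProduct.lift ((LinearMap.mul ℝ (WeilFiber E A x)).comp (k ∘ₗ diffₗ x))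

theorem jetDer_tmul {x : M} (k : Cotan E x →ₗ[ℝ] WeilFiber E A x) (f : Fn E M)
    (a : WeilFiber E A x) : jetDer k (f ⊗ₜ[ℝ] a) = k (diffₗ x f) * a := rfl

/-- The product rule for functions produces `k(dg)` in front of the first factor; moving it past
that factor costs the parity automorphism. -/
theorem jetDer_mul {x : M} (k : Cotan E x →ₗ[ℝ] WeilFiber E A x)
    (hk : ∀ ξ a, k ξ * a = parity E A x a * k ξ) (c c' : Jet E A x) :
    jetDer k (c * c') = jetDer k c * jetEval x x c' +
      parity E A x (jetEval x x c) * jetDer k c' := by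
  induction c using TensorProduct.induction_on with
  | zero => simp
  | add c d hc hd => simp only [add_mul, map_add, hc, hd]; abel
  | tmul f a =>
    induction c' using TensorProduct.induction_on with
    | zero => simp
    | add c d hc hd => simp only [mul_add, map_add, hc, hd]; abel
    | tmul g b =>
      simp only [Algebra.TensorProduct.tmul_mul_tmul, jetDer_tmul, jetEval_tmul, diffₗ_mul, map_add,
        map_smul, add_mul, smul_mul_assoc, mul_smul_comm]
      rw [← mul_assoc, hk (diffₗ x g) a, ← mul_assoc, add_comm,
        mul_assoc (parity E A x a)]

/-- In a basis of the fibre the coefficient functions vanish near `x`, so their differentials vanish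
at `x`. This makes the derivative depend only on the germ and not on the tensor representing it. -/
theorem jetDer_eq_zero {x : M} (k : Cotan E x →ₗ[ℝ] WeilFiber E A x) {c : Jet E A x}
    (h : ∀ᶠ y in 𝓝 x, jetEval x y c = 0) : jetDer k c = 0 := by
  let b := Module.Basis.ofVectorSpace ℝ (WeilFiber E A x)
  obtain ⟨f, rfl⟩ := TensorProduct.eq_repr_basis_right b c
  rw [Finsupp.sum, map_sum]
  refine Finset.sum_eq_zero fun i hi => ?_
  have h1 : diffₗ x (f i) = diffₗ x (constFn 0) := by
    refine diffₗ_congr ?_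
    filter_upwards [h] with y hy
    simp only [Finsupp.sum, map_sum, jetEval_tmul] at hy
    exact linearIndependent_iff'.1 b.linearIndependent f.support (fun i => f i y) hy i hi
  rw [jetDer_tmul, h1, diffₗ_const, map_zero, zero_mul]

theorem jetDer_proj_mem {x : M} {k : Cotan E x →ₗ[ℝ] WeilFiber E A x} {d : ℤ × ℤ}
    (hk : ∀ ξ, k ξ ∈ biGr E A x d) (n : ℤ × ℤ) (c : Jet E A x) :
    jetDer k (LinearMap.lTensor _ (biProj E A x n) c) ∈ biGr E A x (n + d) := by
  induction c using TensorProduct.induction_on with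
  | zero => simp
  | add c d hc hd => simp only [map_add]; exact add_mem hc hd
  | tmul f a =>
    rw [LinearMap.lTensor_tmul, jetDer_tmul, add_comm]
    exact mul_mem_fiberGr (hk _) (fiberProj_mem _ _)

theorem jetEval_proj (x y : M) (n : ℤ × ℤ) (c : Jet E A x) :
    jetEval x y (LinearMap.lTensor _ (biProj E A x n) c) = biProj E A x n (jetEval x y c) := by
  induction c using TensorProduct.induction_on with
  | zero => simp
  | add c d hc hd => simp only [map_add, hc, hd]
  | tmul f a => rw [LinearMap.lTensor_tmul, jetEval_tmul, jetEval_tmul, map_smul]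

/-! #### The derivation at a point -/

variable [T2Space M] [FiniteDimensional ℝ FA] [ContMDiffVectorBundle ∞ FA A 𝓘(ℝ, E)]

theorem exists_dual_map {ι V W : Type*} [Fintype ι] [AddCommGroup V] [Module ℝ V]
    [AddCommGroup W] [Module ℝ W] (v : ι → V) (w : ι → W) :
    ∃ δ : Module.Dual ℝ V →ₗ[ℝ] W, ∀ η, δ η = ∑ i, η (v i) • w i := by
  refine ⟨∑ i, (LinearMap.toSpanSingleton ℝ _ (w i)) ∘ₗ (LinearMap.applyₗ (v i)), fun η => ?_⟩
  simp only [LinearMap.sum_apply, LinearMap.comp_apply, LinearMap.toSpanSingleton_apply]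
  rfl

/-- The maps `τ y` match a dual frame at `y` with the one at `x`. They are defined and linear for
all `y`, although the frame expansion of dual sections holds only near `x`. -/
theorem exists_transport {FB : Type*} [NormedAddCommGroup FB] [NormedSpace ℝ FB]
    {B : M → Type*} [TopologicalSpace (TotalSpace FB B)] [∀ x, AddCommGroup (B x)]
    [∀ x, Module ℝ (B x)] [∀ x, TopologicalSpace (B x)] [FiberBundle FB B] [VectorBundle ℝ FB B]
    [FiniteDimensional ℝ FB] [ContMDiffVectorBundle ∞ FB B 𝓘(ℝ, E)] (x : M) :
    ∃ (s : Fin (Module.finrank ℝ FB) → Sec E FB B) (ν : Fin (Module.finrank ℝ FB) → SDual E FB B)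
      (τ : ∀ y, Module.Dual ℝ (B y) →ₗ[ℝ] Module.Dual ℝ (B x)),
      (∀ y η, τ y η = ∑ i, η (s i y) • (ν i).1 x) ∧ τ x = LinearMap.id ∧
      ∀ η : SDual E FB B, ∀ᶠ y in 𝓝 x, η.1 y = (∑ i, smulDual (pair η (s i)) (ν i)).1 y := by
  obtain ⟨s, ν, h⟩ := exists_dualFrame (E := E) FB B x
  refine ⟨s, ν, fun y => ∑ i, (LinearMap.toSpanSingleton ℝ _ ((ν i).1 x)) ∘ₗ
    (LinearMap.applyₗ (s i y)), fun y η => ?_, ?_, fun η => ?_⟩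
  · simp only [LinearMap.sum_apply, LinearMap.comp_apply, LinearMap.toSpanSingleton_apply]
    rfl
  · obtain ⟨b, hb, hb'⟩ := h.self_of_nhds
    refine LinearMap.ext fun η => b.ext fun j => ?_
    simp [LinearMap.sum_apply, hb, hb']
  · filter_upwards [h] with y hy
    obtain ⟨b, hb, hb'⟩ := hy
    refine b.ext fun j => ?_
    simp [SDual.sum_apply, smulDual_apply, pair_apply, hb, hb']

namespace DerivationData

variable (D : DerivationData E FA A)

/-- The relation "`z` is the value at `x` of the derivation `D` applied to `t`". -/
def IsValue (x : M) (R : RawWeil E A → WeilFiber E A x → Prop) : Prop :=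
  (∀ s t z, (∀ᶠ y in 𝓝 x, s y = t y) → R s z → R t z) ∧
  (∀ s z z', R s z → R s z' → z = z') ∧
  (∀ f : Fn E M, R (wF FA A f).1 ((D.κ f).1 x)) ∧
  (∀ ν : Form1 E M, R (wT FA A ν).1 ((D.OT ν).1 x)) ∧
  (∀ ν : SDual E FA A, R (wΛ ν).1 ((D.OΛ ν).1 x)) ∧
  (∀ ν : SDual E FA A, R (wS ν).1 ((D.OS ν).1 x)) ∧
  (∀ s t z z', R s z → R t z' → R (s + t) (z + z')) ∧
  (∀ s t z z', R s z → R t z' → R (s * t) (z * t x + parity E A x (s x) * z')) ∧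
  (∀ s z n, (∀ᶠ y in 𝓝 x, s y ∈ biGr E A y n) → R s z → z ∈ biGr E A x (n + D.c))

/-- The Leibniz rule applied to the frame expansion of `η`: differentiating the coefficients gives
the `jetDer` term, and the coefficients times the values on the frame give the part of the fibre
derivation. -/
theorem value_generator {x : M} {FB : Type*} [NormedAddCommGroup FB] [NormedSpace ℝ FB]
    {B : M → Type*} [TopologicalSpace (TotalSpace FB B)] [∀ x, AddCommGroup (B x)]
    [∀ x, Module ℝ (B x)] [∀ x, TopologicalSpace (B x)] [FiberBundle FB B] [VectorBundle ℝ FB B]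
    (s : Fin (Module.finrank ℝ FB) → Sec E FB B) (ν : Fin (Module.finrank ℝ FB) → SDual E FB B)
    (g : SDual E FB B →ₗ[ℝ] Weil E FA A) (gx : Module.Dual ℝ (B x) →ₗ[ℝ] WeilFiber E A x)
    (O : SDual E FB B →ₗ[ℝ] Weil E FA A) (η : SDual E FB B)
    (hg : ∀ ν, (g ν).1 x = gx (ν.1 x))
    (hO : ∀ f ν, O (smulDual f ν) = wF FA A f * O ν + D.κ f * g ν)
    (hη : ∀ᶠ y in 𝓝 x, η.1 y = (∑ i, smulDual (pair η (s i)) (ν i)).1 y) :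
    jetDer (D.k x) (∑ i, pair η (s i) ⊗ₜ[ℝ] gx ((ν i).1 x)) +
      ∑ i, η.1 x (s i x) • (O (ν i)).1 x = (O η).1 x := by
  have e : (O η).1 x = (O (∑ i, smulDual (pair η (s i)) (ν i))).1 x := by
    rw [← sub_eq_zero, ← weil_sub_apply, ← map_sub]
    refine leibniz_local D.κ_apply hO ?_
    filter_upwards [hη] with y hy
    exact sub_eq_zero.2 hy
  rw [e, map_sum O, weil_sum_apply, map_sum, ← Finset.sum_add_distrib]
  refine Finset.sum_congr rfl fun i _ => ?_
  rw [hO, weil_add_apply, wF_mul_apply, weil_mul_apply, D.κ_apply, jetDer_tmul, hg, add_comm]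
  rfl

/-- Transport by frames, `Ψ y`, turns a section near `x` into a function with values in the fibre at
`x`, represented by a jet `c`. On it the derivation is `jetDer`, which differentiates coefficients,
plus the fibre derivation `δ` with the prescribed values on the frame. A relation is used because a
general section is not given with a jet; uniqueness is `jetDer_eq_zero`. -/
theorem exists_isValue (x : M) : ∃ R, D.IsValue x R := by
  obtain ⟨sT, νT, τT, hτT, hxT, hlT⟩ :=
    exists_transport (E := E) (FB := E) (B := (TangentSpace 𝓘(ℝ, E) : M → Type _)) x
  obtain ⟨sA, νA, τA, hτA, hxA, hlA⟩ := exists_transport (E := E) (FB := FA) (B := A) x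
  choose Ψ hΨT hΨΛ hΨS using fun y => exists_weilLift_fiber (τT y) (τA y) (τA y)
  have hΨx : Ψ x = AlgHom.id ℝ _ := weilFiber_hom_ext
    (fun ξ => by rw [hΨT, hxT]; rfl) (fun ξ => by rw [hΨΛ, hxA]; rfl)
    (fun ξ => by rw [hΨS, hxA]; rfl)
  have hpar : ∀ {w : Weil E FA A} {r : ℝ}, wpar w = r • w → parity E A x (w.1 x) = r • w.1 x := by
    intro w r h
    rw [← wpar_apply, h]; rfl
  have hsum : ∀ {ι : Type _} (s : Finset ι) (c : ι → ℝ) (w : ι → WeilFiber E A x) (r : ℝ),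
      (∀ i, parity E A x (w i) = r • w i) →
      parity E A x (∑ i ∈ s, c i • w i) = r • ∑ i ∈ s, c i • w i := by
    intro ι s c w r h
    rw [map_sum, Finset.smul_sum]
    exact Finset.sum_congr rfl fun i _ => by rw [map_smul, h, smul_comm]
  obtain ⟨δT, hδT⟩ := exists_dual_map (fun i => sT i x) (fun i => (D.OT (νT i)).1 x)
  obtain ⟨δΛ, hδΛ⟩ := exists_dual_map (fun i => sA i x) (fun i => (D.OΛ (νA i)).1 x)
  obtain ⟨δS, hδS⟩ := exists_dual_map (fun i => sA i x) (fun i => (D.OS (νA i)).1 x)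
  obtain ⟨δ, h1, h2, h3, h4⟩ := exists_oddDerivation δT δΛ δS
    (fun ξ => by
      rw [hδT, hsum _ _ _ 1 fun i => hpar (by rw [D.OT_parity, one_smul]), one_smul])
    (fun ξ => by
      rw [hδΛ, hsum _ _ _ 1 fun i => hpar (by rw [D.OΛ_parity, one_smul]), one_smul])
    (fun ξ => by
      rw [hδS, hsum _ _ _ (-1) fun i => hpar (by rw [D.OS_parity, neg_one_smul]), neg_one_smul])
  have h1' : IsOddFiberDer δ := h1
  refine ⟨fun t z => ∃ c : Jet E A x, (∀ᶠ y in 𝓝 x, Ψ y (t y) = jetEval x y c) ∧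
    z = jetDer (D.k x) c + δ (t x), ?_, ?_, ?_, ?_, ?_, ?_, ?_, ?_, ?_⟩
  · rintro s t z h ⟨c, hc, rfl⟩
    refine ⟨c, ?_, by rw [h.self_of_nhds]⟩
    filter_upwards [h, hc] with y hy hy'
    rw [← hy, hy']
  · rintro s z z' ⟨c, hc, rfl⟩ ⟨c', hc', rfl⟩
    congr 1
    rw [← sub_eq_zero, ← map_sub]
    refine jetDer_eq_zero _ ?_
    filter_upwards [hc, hc'] with y hy hy'
    rw [map_sub, ← hy, ← hy', sub_self]
  · intro f
    refine ⟨f ⊗ₜ[ℝ] 1, Filter.Eventually.of_forall fun y => ?_, ?_⟩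
    · rw [wF_apply, AlgHom.commutes, jetEval_tmul, Algebra.algebraMap_eq_smul_one]
    · rw [wF_apply, h1'.map_algebraMap, jetDer_tmul, mul_one, add_zero, D.κ_apply]
  · intro ν
    refine ⟨∑ i, pair ν (sT i) ⊗ₜ[ℝ] genT E A x ((νT i).1 x),
      Filter.Eventually.of_forall fun y => ?_, ?_⟩
    · simp only [wT_apply, hΨT, hτT, map_sum, map_smul, jetEval_tmul, pair_apply]
    · rw [wT_apply, h2, hδT]
      exact (D.value_generator sT νT (wT FA A) (genT E A x) D.OT ν (fun _ => rfl) D.OT_smul (hlT ν)).symm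
  · intro ν
    refine ⟨∑ i, pair ν (sA i) ⊗ₜ[ℝ] genΛ E A x ((νA i).1 x),
      Filter.Eventually.of_forall fun y => ?_, ?_⟩
    · simp only [wΛ_apply, hΨΛ, hτA, map_sum, map_smul, jetEval_tmul, pair_apply]
    · rw [wΛ_apply, h3, hδΛ]
      exact (D.value_generator sA νA wΛ (genΛ E A x) D.OΛ ν (fun _ => rfl) D.OΛ_smul (hlA ν)).symm
  · intro ν
    refine ⟨∑ i, pair ν (sA i) ⊗ₜ[ℝ] genS E A x ((νA i).1 x),
      Filter.Eventually.of_forall fun y => ?_, ?_⟩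
    · simp only [wS_apply, hΨS, hτA, map_sum, map_smul, jetEval_tmul, pair_apply]
    · rw [wS_apply, h4, hδS]
      exact (D.value_generator sA νA wS (genS E A x) D.OS ν (fun _ => rfl) D.OS_smul (hlA ν)).symm
  · rintro s t z z' ⟨c, hc, rfl⟩ ⟨c', hc', rfl⟩
    refine ⟨c + c', ?_, by rw [RawWeil.add_apply, map_add, map_add]; abel⟩
    filter_upwards [hc, hc'] with y hy hy'
    rw [RawWeil.add_apply, map_add, map_add, hy, hy']
  · rintro s t z z' ⟨c, hc, rfl⟩ ⟨c', hc', rfl⟩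
    refine ⟨c * c', ?_, ?_⟩
    · filter_upwards [hc, hc'] with y hy hy'
      rw [RawWeil.mul_apply, map_mul, map_mul, hy, hy']
    · have e := hc.self_of_nhds
      have e' := hc'.self_of_nhds
      rw [hΨx, AlgHom.id_apply] at e e'
      rw [RawWeil.mul_apply, h1, jetDer_mul _ (D.k_mul x), ← e, ← e', add_mul, mul_add]
      abel
  · rintro s z n hs ⟨c, hc, rfl⟩
    have hgr : ∀ y (a : WeilFiber E A y), a ∈ biGr E A y n → Ψ y a ∈ biGr E A x n :=
      fun y a ha => algHom_mem_fiberGr (fun ξ => by rw [hΨT]; exact genT_mem_fiberGr _)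
        (fun ξ => by rw [hΨΛ]; exact genΛ_mem_fiberGr _)
        (fun ξ => by rw [hΨS]; exact genS_mem_fiberGr _) ha
    -- The jet can be replaced by its component of degree `n`: since `Ψ y` preserves degrees, both
    -- have the same values near `x`.
    have e : jetDer (D.k x) c = jetDer (D.k x) (LinearMap.lTensor _ (biProj E A x n) c) := by
      rw [← sub_eq_zero, ← map_sub]
      refine jetDer_eq_zero _ ?_
      filter_upwards [hc, hs] with y hy hy'
      rw [map_sub, jetEval_proj, ← hy, fiberProj_of_mem (hgr y _ hy'), sub_self]
    rw [e]
    refine add_mem (jetDer_proj_mem (D.k_mem x) n c) (h1'.mem_fiberGr (fun ξ => ?_) (fun ξ => ?_)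
      (fun ξ => ?_) hs.self_of_nhds)
    · rw [h2, hδT]
      exact Submodule.sum_mem _ fun i _ => Submodule.smul_mem _ _ (D.OT_mem _ _)
    · rw [h3, hδΛ]
      exact Submodule.sum_mem _ fun i _ => Submodule.smul_mem _ _ (D.OΛ_mem _ _)
    · rw [h4, hδS]
      exact Submodule.sum_mem _ fun i _ => Submodule.smul_mem _ _ (D.OS_mem _ _)

/-- There is an odd derivation with prescribed values on generators. -/
theorem exists_derivation : ∃ d : Weil E FA A →ₗ[ℝ] Weil E FA A, IsOddDer d ∧
    (∀ f, d (wF FA A f) = D.κ f) ∧ (∀ ν, d (wT FA A ν) = D.OT ν) ∧ (∀ ν, d (wΛ ν) = D.OΛ ν) ∧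
    (∀ ν, d (wS ν) = D.OS ν) ∧
    ∀ a (n : ℤ × ℤ), (∀ x, a.1 x ∈ biGr E A x n) → ∀ x, (d a).1 x ∈ biGr E A x (n + D.c) := by
  choose R hloc huniq hF hT hΛ hS hadd hmul hgr using D.exists_isValue
  -- Values exist on the generators and persist under sums and products, and they form a locally
  -- polynomial section. All of `W` follows by locality.
  have hpoly : ∀ t ∈ polySections E FA A, ∃ t' ∈ locPoly E FA A, ∀ x, R x t (t' x) := by
    intro t ht
    refine polySections_induction (P := fun t => ∃ t' ∈ locPoly E FA A, ∀ x, R x t (t' x))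
      (fun f => ⟨_, weil_le_locPoly (D.κ f).2, fun x => hF x f⟩)
      (fun f => ⟨_, weil_le_locPoly (D.OT f).2, fun x => hT x f⟩)
      (fun f => ⟨_, weil_le_locPoly (D.OΛ f).2, fun x => hΛ x f⟩)
      (fun f => ⟨_, weil_le_locPoly (D.OS f).2, fun x => hS x f⟩) ?_ ?_ ht
    · rintro s t hs ht ⟨s', hs', h⟩ ⟨t', ht', h'⟩
      let p : RawWeil E A := fun x => parity E A x (s x)
      exact ⟨s' * t + p * t',
        add_mem (mul_mem hs' (polySections_le_locPoly ht))
          (mul_mem (polySections_le_locPoly (parity_mem_polySections hs)) ht'),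
        fun x => hmul x _ _ _ _ (h x) (h' x)⟩
    · rintro s t ⟨s', hs', h⟩ ⟨t', ht', h'⟩
      exact ⟨s' + t', add_mem hs' ht', fun x => hadd x _ _ _ _ (h x) (h' x)⟩
  have hex : ∀ (a : Weil E FA A) x, ∃ z, R x a.1 z := by
    intro a x
    obtain ⟨t, ht, e⟩ := weil_le_locPoly a.2 x
    obtain ⟨t', ht', h⟩ := hpoly t ht
    exact ⟨t' x, hloc x _ _ _ (by filter_upwards [e] with y hy using hy.symm) (h x)⟩
  choose d hd using hex
  have hdl : ∀ a, (d a : RawWeil E A) ∈ locPoly E FA A := by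
    intro a
    refine mem_locPoly_of_local fun x => ?_
    obtain ⟨t, ht, e⟩ := weil_le_locPoly a.2 x
    obtain ⟨t', ht', h⟩ := hpoly t ht
    refine ⟨t', ht', ?_⟩
    filter_upwards [e.eventually_nhds] with y hy
    exact huniq y _ _ _ (hloc y _ _ _ hy (hd a y)) (h y)
  have hdadd : ∀ a b, (d (a + b) : RawWeil E A) = (d a : RawWeil E A) + (d b : RawWeil E A) :=
    fun a b => funext fun x => huniq x _ _ _ (hd (a + b) x) (hadd x _ _ _ _ (hd a x) (hd b x))
  have hdgr : ∀ a (n : ℤ × ℤ), (∀ x, a.1 x ∈ biGr E A x n) → ∀ x, d a x ∈ biGr E A x (n + D.c) :=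
    fun a n h x => hgr x _ _ _ (Filter.Eventually.of_forall h) (hd a x)
  have hdW : ∀ a, (d a : RawWeil E A) ∈ Weil E FA A := by
    refine weil_induction (fun p q a ha => ?_) (fun a b ha hb => ?_)
    · exact mem_weil_of_biGr' (hdl a) (hdgr a _ (mem_weilPiece.1 ha))
    · rw [hdadd]; exact add_mem ha hb
  have hdmul : ∀ a b, (⟨d (a * b), hdW _⟩ : Weil E FA A) = ⟨d a, hdW a⟩ * b + wpar a * ⟨d b, hdW b⟩ :=
    fun a b => weil_ext fun x => by
      refine huniq x _ _ _ (hd (a * b) x) ?_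
      have h := hmul x _ _ _ _ (hd a x) (hd b x)
      rw [← wpar_apply] at h
      exact h
  have hdF : ∀ f, (⟨d (wF FA A f), hdW _⟩ : Weil E FA A) = D.κ f := fun f =>
    weil_ext fun x => huniq x _ _ _ (hd _ x) (hF x f)
  refine ⟨{ toFun := fun a => ⟨d a, hdW a⟩
            map_add' := fun a b => Subtype.ext (hdadd a b)
            map_smul' := fun r a => ?_ }, hdmul, hdF,
    fun ν => weil_ext fun x => huniq x _ _ _ (hd _ x) (hT x ν),
    fun ν => weil_ext fun x => huniq x _ _ _ (hd _ x) (hΛ x ν),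
    fun ν => weil_ext fun x => huniq x _ _ _ (hd _ x) (hS x ν), hdgr⟩
  -- Homogeneity over `ℝ` is the Leibniz rule for a constant function, whose differential is zero.
  have e : r • a = wF FA A (constFn r) * a := weil_ext fun x => by
    rw [wF_mul_apply]; rfl
  have e0 : D.κ (constFn r) = 0 := weil_ext fun x => by
    rw [D.κ_apply, diffₗ_const, map_zero]; rfl
  rw [e, hdmul, hdF, e0, zero_mul, zero_add, wpar_wF]
  exact weil_ext fun x => by rw [wF_mul_apply]; rfl

end DerivationData

end Existence

/-! ### Structure operators of tensorial two-term operators -/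

section Structure

variable {E : Type*} [NormedAddCommGroup E] [NormedSpace ℝ E] [FiniteDimensional ℝ E]
  {M : Type*} [TopologicalSpace M] [ChartedSpace E M] [IsManifold 𝓘(ℝ, E) ∞ M]

/-! #### Calculus of sections -/

theorem lieFn_add (X : VF E M) (f g : Fn E M) : lieFn X (f + g) = lieFn X f + lieFn X g :=
  ContMDiffMap.ext fun x => dirDeriv_add f g (X x)

theorem lieFn_sub (X : VF E M) (f g : Fn E M) : lieFn X (f - g) = lieFn X f - lieFn X g :=
  ContMDiffMap.ext fun x => dirDeriv_sub f g (X x)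

theorem lieFn_mul (X : VF E M) (f g : Fn E M) : lieFn X (f * g) = f * lieFn X g + g * lieFn X f :=
  ContMDiffMap.ext fun x => dirDeriv_mul f g (X x)

theorem lieFn_vadd (X Y : VF E M) (f : Fn E M) : lieFn (X + Y) f = lieFn X f + lieFn Y f :=
  ContMDiffMap.ext fun x => dirDeriv_vadd f (X x) (Y x)

theorem lieFn_vsmul (g : Fn E M) (X : VF E M) (f : Fn E M) :
    lieFn (smulSec g X) f = g * lieFn X f :=
  ContMDiffMap.ext fun x => dirDeriv_vsmul f (g x) (X x)

section SecAlgebra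

variable {FB : Type*} [NormedAddCommGroup FB] [NormedSpace ℝ FB]
  {B : M → Type*} [TopologicalSpace (TotalSpace FB B)] [∀ x, AddCommGroup (B x)]
  [∀ x, Module ℝ (B x)] [∀ x, TopologicalSpace (B x)] [FiberBundle FB B] [VectorBundle ℝ FB B]

theorem smulSec_add (f : Fn E M) (s t : Sec E FB B) :
    smulSec f (s + t) = smulSec f s + smulSec f t :=
  ContMDiffSection.ext fun x => smul_add (f x) (s x) (t x)

theorem smulSec_sub (f : Fn E M) (s t : Sec E FB B) :
    smulSec f (s - t) = smulSec f s - smulSec f t :=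
  ContMDiffSection.ext fun x => smul_sub (f x) (s x) (t x)

theorem smulSec_neg (f : Fn E M) (s : Sec E FB B) : smulSec f (-s) = -smulSec f s :=
  ContMDiffSection.ext fun x => smul_neg (f x) (s x)

theorem add_smulSec (f g : Fn E M) (s : Sec E FB B) :
    smulSec (f + g) s = smulSec f s + smulSec g s :=
  ContMDiffSection.ext fun x => add_smul (f x) (g x) (s x)

theorem sub_smulSec (f g : Fn E M) (s : Sec E FB B) :
    smulSec (f - g) s = smulSec f s - smulSec g s :=
  ContMDiffSection.ext fun x => sub_smul (f x) (g x) (s x)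

theorem pair_add (ν : SDual E FB B) (s t : Sec E FB B) : pair ν (s + t) = pair ν s + pair ν t :=
  ContMDiffMap.ext fun x => (ν.1 x).map_add (s x) (t x)

theorem pair_sub (ν : SDual E FB B) (s t : Sec E FB B) : pair ν (s - t) = pair ν s - pair ν t :=
  ContMDiffMap.ext fun x => (ν.1 x).map_sub (s x) (t x)

theorem pair_neg (ν : SDual E FB B) (s : Sec E FB B) : pair ν (-s) = -pair ν s :=
  ContMDiffMap.ext fun x => (ν.1 x).map_neg (s x)

theorem pair_smul (ν : SDual E FB B) (f : Fn E M) (s : Sec E FB B) :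
    pair ν (smulSec f s) = f * pair ν s :=
  ContMDiffMap.ext fun x => (ν.1 x).map_smul (f x) (s x)

theorem add_pair (ν ν' : SDual E FB B) (s : Sec E FB B) :
    pair (ν + ν') s = pair ν s + pair ν' s := rfl

theorem sub_pair (ν ν' : SDual E FB B) (s : Sec E FB B) :
    pair (ν - ν') s = pair ν s - pair ν' s := rfl

theorem neg_pair (ν : SDual E FB B) (s : Sec E FB B) : pair (-ν) s = -pair ν s := rfl

theorem smulDual_pair (f : Fn E M) (ν : SDual E FB B) (s : Sec E FB B) :
    pair (smulDual f ν) s = f * pair ν s := rfl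

variable (L : LieAlgebroid E FB B)

theorem LieAlgebroid.rho_add (a b : Sec E FB B) : L.rho (a + b) = L.rho a + L.rho b :=
  ContMDiffSection.ext fun x => (L.anchor x).map_add (a x) (b x)

theorem LieAlgebroid.rho_smul (f : Fn E M) (a : Sec E FB B) :
    L.rho (smulSec f a) = smulSec f (L.rho a) :=
  ContMDiffSection.ext fun x => (L.anchor x).map_smul (f x) (a x)

theorem LieAlgebroid.bracket_smul (a b : Sec E FB B) (f : Fn E M) :
    L.bracket a (smulSec f b) = smulSec f (L.bracket a b) + smulSec (lieFn (L.rho a) f) b :=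
  ContMDiffSection.ext fun x => L.leibniz a b f x

theorem LieAlgebroid.bracket_skew (a b : Sec E FB B) : L.bracket a b = -L.bracket b a := by
  have h := L.bracket_self (a + b)
  rw [map_add, map_add, LinearMap.add_apply, LinearMap.add_apply, L.bracket_self, L.bracket_self,
    zero_add, add_zero] at h
  exact eq_neg_of_add_eq_zero_right h

theorem LieAlgebroid.bracket_smul_left (a b : Sec E FB B) (f : Fn E M) :
    L.bracket (smulSec f a) b = smulSec f (L.bracket a b) - smulSec (lieFn (L.rho b) f) a := by
  rw [L.bracket_skew, L.bracket_smul, L.bracket_skew b a, smulSec_neg]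
  abel

variable [T2Space M] [FiniteDimensional ℝ FB] [ContMDiffVectorBundle ∞ FB B 𝓘(ℝ, E)]

/-- The anchor is compatible with the brackets, acting on functions. -/
theorem LieAlgebroid.lieFn_bracket (a b : Sec E FB B) (f : Fn E M) :
    lieFn (L.rho (L.bracket a b)) f =
      lieFn (L.rho a) (lieFn (L.rho b) f) - lieFn (L.rho b) (lieFn (L.rho a) f) := by
  -- In the Jacobi identity for `a`, `b` and `f c` the terms with brackets cancel and leave the
  -- defect of compatibility, a function, times `c`.
  have key : ∀ c : Sec E FB B, smulSec (lieFn (L.rho a) (lieFn (L.rho b) f) -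
      lieFn (L.rho b) (lieFn (L.rho a) f) - lieFn (L.rho (L.bracket a b)) f) c = 0 := by
    intro c
    have h := L.jacobi a b (smulSec f c)
    simp only [L.bracket_smul, map_add, L.jacobi a b c, smulSec_add] at h
    simp only [sub_smulSec]
    rw [← sub_eq_zero] at h
    rw [← h]
    abel
  refine ContMDiffMap.ext fun x => ?_
  -- Over a zero fibre no `c` is nonzero at `x`, but then the anchor vanishes at `x` and so do all
  -- three terms.
  by_cases h : ∀ v : B x, v = 0
  · have h0 : ∀ (c : Sec E FB B) (g : Fn E M), lieFn (L.rho c) g x = 0 := fun c g => by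
      have e : L.rho c x = 0 := by
        change L.anchor x (c x) = 0
        rw [h (c x), map_zero]
      rw [lieFn_apply, e]
      exact (diffAt g x).map_zero
    rw [h0]
    change _ = lieFn (L.rho a) (lieFn (L.rho b) f) x - lieFn (L.rho b) (lieFn (L.rho a) f) x
    rw [h0, h0, sub_zero]
  · obtain ⟨v, hv⟩ := not_forall.1 h
    obtain ⟨c, rfl⟩ := exists_sec (E := E) (FB := FB) x v
    have h1 := congrArg (fun s : Sec E FB B => s x) (key c)
    have h2 := (smul_eq_zero.1 h1).resolve_right hv
    exact (sub_eq_zero.1 h2).symm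

end SecAlgebra

/-! #### One-forms with values in `W` -/

section OneForms

variable {FA : Type*} [NormedAddCommGroup FA] [NormedSpace ℝ FA]
  {A : M → Type*} [TopologicalSpace (TotalSpace FA A)] [∀ x, AddCommGroup (A x)]
  [∀ x, Module ℝ (A x)] [∀ x, TopologicalSpace (A x)] [FiberBundle FA A] [VectorBundle ℝ FA A]

/-- Generators of `W` of a given degree, indexed by the dual of a vector bundle. -/
structure Gens (E : Type*) [NormedAddCommGroup E] [NormedSpace ℝ E] [FiniteDimensional ℝ E]
    {M : Type*} [TopologicalSpace M] [ChartedSpace E M] [IsManifold 𝓘(ℝ, E) ∞ M]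
    (FA : Type*) [NormedAddCommGroup FA] [NormedSpace ℝ FA]
    (A : M → Type*) [TopologicalSpace (TotalSpace FA A)] [∀ x, AddCommGroup (A x)]
    [∀ x, Module ℝ (A x)] [∀ x, TopologicalSpace (A x)] [FiberBundle FA A] [VectorBundle ℝ FA A]
    (FB : Type*) [NormedAddCommGroup FB] [NormedSpace ℝ FB]
    (B : M → Type*) [TopologicalSpace (TotalSpace FB B)] [∀ x, AddCommGroup (B x)]
    [∀ x, Module ℝ (B x)] [∀ x, TopologicalSpace (B x)] [FiberBundle FB B]
    [VectorBundle ℝ FB B] where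
  g : ∀ x, Module.Dual ℝ (B x) →ₗ[ℝ] WeilFiber E A x
  w : SDual E FB B →ₗ[ℝ] Weil E FA A
  w_apply : ∀ ν x, (w ν).1 x = g x (ν.1 x)
  deg : ℤ × ℤ
  mem : ∀ x ν, g x ν ∈ biGr E A x deg

variable (E FA A) in
/-- The generators in `T*M`. -/
def gensT : Gens E FA A E (TangentSpace 𝓘(ℝ, E) : M → Type _) :=
  ⟨genT E A, wT FA A, fun _ _ => rfl, (0, 1), fun _ _ => genT_mem_fiberGr _⟩

variable (E FA A) in
/-- The generators in `Λ¹A*`. -/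
def gensΛ : Gens E FA A FA A :=
  ⟨genΛ E A, wΛ, fun _ _ => rfl, (1, 0), fun _ _ => genΛ_mem_fiberGr _⟩

variable (E FA A) in
/-- The generators in `S¹A*`. -/
def gensS : Gens E FA A FA A :=
  ⟨genS E A, wS, fun _ _ => rfl, (1, 1), fun _ _ => genS_mem_fiberGr _⟩

variable {FB : Type*} [NormedAddCommGroup FB] [NormedSpace ℝ FB]
  {B : M → Type*} [TopologicalSpace (TotalSpace FB B)] [∀ x, AddCommGroup (B x)]
  [∀ x, Module ℝ (B x)] [∀ x, TopologicalSpace (B x)] [FiberBundle FB B] [VectorBundle ℝ FB B]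

/-- Odd generators. -/
structure Gens.IsOdd (G : Gens E FA A FB B) : Prop where
  parity : ∀ x ν, parity E A x (G.g x ν) = -G.g x ν
  mul : ∀ x ν a, G.g x ν * a = WeilModel.parity E A x a * G.g x ν

/-- Even generators. -/
structure Gens.IsEven (G : Gens E FA A FB B) : Prop where
  parity : ∀ x ν, parity E A x (G.g x ν) = G.g x ν
  mul : ∀ x ν a, G.g x ν * a = a * G.g x ν

theorem gensT_isOdd : (gensT E FA A).IsOdd := ⟨fun _ _ => parity_genT _, fun _ _ _ => genT_mul _ _⟩

theorem gensΛ_isOdd : (gensΛ E FA A).IsOdd := ⟨fun _ _ => parity_genΛ _, fun _ _ _ => genΛ_mul _ _⟩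

theorem gensS_isEven : (gensS E FA A).IsEven :=
  ⟨fun _ _ => parity_genS _, fun _ _ _ => genS_mul _ _⟩

theorem Gens.w_smul (G : Gens E FA A FB B) (f : Fn E M) (ν : SDual E FB B) :
    G.w (smulDual f ν) = wF FA A f * G.w ν :=
  weil_ext fun x => by
    rw [wF_mul_apply, G.w_apply, G.w_apply]
    exact (G.g x).map_smul _ _

theorem Gens.IsOdd.wpar {G : Gens E FA A FB B} (hG : G.IsOdd) (ν : SDual E FB B) :
    wpar (G.w ν) = -G.w ν :=
  weil_ext fun x => by rw [wpar_apply, G.w_apply, weil_neg_apply, G.w_apply, hG.parity]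

theorem Gens.IsEven.wpar {G : Gens E FA A FB B} (hG : G.IsEven) (ν : SDual E FB B) :
    wpar (G.w ν) = G.w ν :=
  weil_ext fun x => by rw [wpar_apply, G.w_apply, hG.parity]

theorem Gens.IsOdd.w_mul {G : Gens E FA A FB B} (hG : G.IsOdd) (ν : SDual E FB B)
    (a : Weil E FA A) : G.w ν * a = WeilModel.wpar a * G.w ν :=
  weil_ext fun x => by rw [weil_mul_apply, weil_mul_apply, wpar_apply, G.w_apply, hG.mul]

/-- The contraction of a bilinear map with the identity is independent of the basis. -/
theorem sum_basis_eq {ι V W : Type*} [Fintype ι] [AddCommGroup V] [Module ℝ V]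
    [AddCommGroup W] [Module ℝ W] (β : Module.Dual ℝ V →ₗ[ℝ] V →ₗ[ℝ] W)
    (b b' : Module.Basis ι ℝ V) :
    ∑ i, β (b.coord i) (b i) = ∑ i, β (b'.coord i) (b' i) := by
  classical
  have h1 : ∀ i, b' i = ∑ j, b.coord j (b' i) • b j := fun i => (b.sum_repr (b' i)).symm
  have h2 : ∀ j, b.coord j = ∑ i, b.coord j (b' i) • b'.coord i := fun j => by
    refine b'.ext fun k => ?_
    rw [LinearMap.sum_apply]
    simp [Finsupp.single_apply]
  calc ∑ j, β (b.coord j) (b j)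
      = ∑ j, ∑ i, b.coord j (b' i) • β (b'.coord i) (b j) := by
        refine Finset.sum_congr rfl fun j _ => ?_
        conv_lhs => rw [h2 j]
        rw [map_sum, LinearMap.sum_apply]
        exact Finset.sum_congr rfl fun i _ => by rw [map_smul, LinearMap.smul_apply]
    _ = ∑ i, ∑ j, b.coord j (b' i) • β (b'.coord i) (b j) := Finset.sum_comm
    _ = ∑ i, β (b'.coord i) (b' i) := by
        refine Finset.sum_congr rfl fun i _ => ?_
        conv_rhs => rw [h1 i]
        rw [map_sum]
        exact Finset.sum_congr rfl fun j _ => by rw [map_smul]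

/-- `T` is a function-linear, homogeneous map with values in `W`. -/
structure IsTensor (T : Sec E FB B → Weil E FA A) : Prop where
  add : ∀ s t, T (s + t) = T s + T t
  smul : ∀ f s, T (smulSec f s) = wF FA A f * T s
  deg : ∃ n, ∀ s x, (T s).1 x ∈ biGr E A x n

/-- `w = ∑ bⁱ T(bᵢ)`. -/
def IsOneForm (G : Gens E FA A FB B) (T : Sec E FB B → Weil E FA A) (w : Weil E FA A) : Prop :=
  ∀ x (b : FrameAt (E := E) FB B x), w.1 x = ∑ i, G.g x (b.basis.coord i) * (T (b.sec i)).1 x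

open Classical in
/-- The element `∑ bⁱ T(bᵢ)` of `W`. -/
def oneForm (G : Gens E FA A FB B) (T : Sec E FB B → Weil E FA A) : Weil E FA A :=
  if h : ∃ w, IsOneForm G T w then h.choose else 0

variable [T2Space M] [FiniteDimensional ℝ FB] [ContMDiffVectorBundle ∞ FB B 𝓘(ℝ, E)]

/-- The sum contracts the bilinear map `(η, v) ↦ g(η) T(v)` with the identity of the fibre, so it is
independent of the basis. Near a point it can therefore be computed with one smooth dual frame,
which shows that it is locally polynomial. -/
theorem IsTensor.exists_oneForm {T : Sec E FB B → Weil E FA A} (hT : IsTensor T)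
    (G : Gens E FA A FB B) : ∃ w, IsOneForm G T w := by
  have h1 : ∀ x, ∃ t : B x →ₗ[ℝ] WeilFiber E A x, ∀ s, (T s).1 x = t (s x) := fun x =>
    exists_fibre_map (x := x) (AddMonoidHom.mk' (fun s => (T s).1 x)
      (fun s t => by rw [hT.add]; rfl))
      (fun f s => by
        change (T (smulSec f s)).1 x = f x • (T s).1 x
        rw [hT.smul, wF_mul_apply])
  choose t ht using h1
  have b₀ : ∀ x, FrameAt (E := E) FB B x := fun x => (exists_frameAt E FB B x).some
  let β : ∀ x, Module.Dual ℝ (B x) →ₗ[ℝ] B x →ₗ[ℝ] WeilFiber E A x := fun x =>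
    (LinearMap.mul ℝ (WeilFiber E A x)).compl₁₂ (G.g x) (t x)
  have hβ : ∀ x (b : Module.Basis (Fin (Module.finrank ℝ FB)) ℝ (B x)),
      ∑ i, G.g x (b.coord i) * t x (b i) =
        ∑ i, G.g x ((b₀ x).basis.coord i) * t x ((b₀ x).basis i) := fun x b =>
    sum_basis_eq (β x) b (b₀ x).basis
  obtain ⟨n, hn⟩ := hT.deg
  let w : RawWeil E A := fun x => ∑ i, G.g x ((b₀ x).basis.coord i) * t x ((b₀ x).basis i)
  have hw : w ∈ Weil E FA A := by
    refine mem_weil_of_biGr' (n := G.deg + n) (mem_locPoly_of_local fun x => ?_) (fun x => ?_)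
    · obtain ⟨s, ν, h⟩ := exists_dualFrame (E := E) FB B x
      let u : Weil E FA A := ∑ i, G.w (ν i) * T (s i)
      refine ⟨u.1, weil_le_locPoly u.2, ?_⟩
      filter_upwards [h] with y hy
      obtain ⟨b, hb, hb'⟩ := hy
      refine Eq.trans ?_ (weil_sum_apply y _ _).symm
      refine (hβ y b).symm.trans (Finset.sum_congr rfl fun i _ => ?_)
      rw [weil_mul_apply, G.w_apply, hb', ht, hb]
    · refine Submodule.sum_mem _ fun i _ => mul_mem_fiberGr (G.mem _ _) ?_
      rw [← (b₀ x).sec_apply, ← ht]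
      exact hn _ _
  refine ⟨⟨w, hw⟩, fun x b => (hβ x b.basis).symm.trans (Finset.sum_congr rfl fun i _ => ?_)⟩
  rw [ht, b.sec_apply]

theorem IsTensor.oneForm_apply {T : Sec E FB B → Weil E FA A} (hT : IsTensor T)
    (G : Gens E FA A FB B) (x : M) (b : FrameAt (E := E) FB B x) :
    (oneForm G T).1 x = ∑ i, G.g x (b.basis.coord i) * (T (b.sec i)).1 x := by
  have h := hT.exists_oneForm G
  rw [oneForm, dif_pos h]
  exact h.choose_spec x b

theorem IsTensor.oneForm_eq {T : Sec E FB B → Weil E FA A} (hT : IsTensor T)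
    (G : Gens E FA A FB B) {w : Weil E FA A} (hw : IsOneForm G T w) : oneForm G T = w :=
  weil_ext fun x => by
    obtain ⟨b⟩ := exists_frameAt E FB B x
    rw [hT.oneForm_apply G x b, hw x b]

theorem IsTensor.oneForm_isOneForm {T : Sec E FB B → Weil E FA A} (hT : IsTensor T)
    (G : Gens E FA A FB B) : IsOneForm G T (oneForm G T) := hT.oneForm_apply G

theorem IsOneForm.unique {G : Gens E FA A FB B} {T : Sec E FB B → Weil E FA A} {w w' : Weil E FA A}
    (hw : IsOneForm G T w) (hw' : IsOneForm G T w') : w = w' :=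
  weil_ext fun x => by
    obtain ⟨b⟩ := exists_frameAt E FB B x
    rw [hw x b, hw' x b]

section
variable {G : Gens E FA A FB B} {T T' : Sec E FB B → Weil E FA A} {w w' : Weil E FA A}

theorem IsOneForm.add (h : IsOneForm G T w) (h' : IsOneForm G T' w') :
    IsOneForm G (fun b => T b + T' b) (w + w') := fun x b => by
  simp only [weil_add_apply, h x b, h' x b, mul_add, Finset.sum_add_distrib]

theorem IsOneForm.sub (h : IsOneForm G T w) (h' : IsOneForm G T' w') :
    IsOneForm G (fun b => T b - T' b) (w - w') := fun x b => by
  simp only [weil_sub_apply, h x b, h' x b, mul_sub, Finset.sum_sub_distrib]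

theorem IsOneForm.smul (h : IsOneForm G T w) (c : ℝ) : IsOneForm G (fun b => c • T b) (c • w) :=
  fun x b => by
    simp only [weil_smul_apply, h x b, mul_smul_comm, Finset.smul_sum]

theorem IsOneForm.wF_mul (h : IsOneForm G T w) (f : Fn E M) :
    IsOneForm G (fun b => wF FA A f * T b) (wF FA A f * w) := fun x b => by
  simp only [wF_mul_apply, h x b, mul_smul_comm, Finset.smul_sum]

theorem IsOneForm.mul_right (h : IsOneForm G T w) (a : Weil E FA A) :
    IsOneForm G (fun b => T b * a) (w * a) := fun x b => by
  simp only [weil_mul_apply, h x b, Finset.sum_mul, mul_assoc]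

theorem isOneForm_pair (G : Gens E FA A FB B) (ν : SDual E FB B) :
    IsOneForm G (fun b => wF FA A (pair ν b)) (G.w ν) := fun x b => by
  have h : ν.1 x = ∑ i, ν.1 x (b.basis i) • b.basis.coord i := by
    refine b.basis.ext fun k => ?_
    rw [LinearMap.sum_apply]
    simp [Finsupp.single_apply]
  rw [G.w_apply]
  conv_lhs => rw [h]
  rw [map_sum]
  refine Finset.sum_congr rfl fun i _ => ?_
  rw [map_smul, wF_apply, pair_apply, b.sec_apply, Algebra.smul_def, Algebra.commutes]

theorem IsOneForm.congr (h : IsOneForm G T w) (h' : ∀ b, T b = T' b) : IsOneForm G T' w := by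
  rwa [show T' = T from funext fun b => (h' b).symm]

theorem IsOneForm.mem (h : IsOneForm G T w) {n : ℤ × ℤ} (hn : ∀ s x, (T s).1 x ∈ biGr E A x n)
    (x : M) : w.1 x ∈ biGr E A x (G.deg + n) := by
  obtain ⟨b⟩ := exists_frameAt E FB B x
  rw [h x b]
  exact Submodule.sum_mem _ fun i _ => mul_mem_fiberGr (G.mem _ _) (hn _ _)

theorem IsOneForm.wpar (h : IsOneForm G T w) (hG : G.IsOdd) :
    IsOneForm G (fun b => -wpar (T b)) (wpar w) := fun x b => by
  simp only [wpar_apply, h x b, map_sum, map_mul, hG.parity, weil_neg_apply, mul_neg, neg_mul]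

end

end OneForms

end Structure

/-! ### Dual connections and the intrinsic values of a structure operator on generators. -/

section StructureOperators

variable {E : Type*} [NormedAddCommGroup E] [NormedSpace ℝ E] [FiniteDimensional ℝ E]
  {M : Type*} [TopologicalSpace M] [ChartedSpace E M] [IsManifold 𝓘(ℝ, E) ∞ M]
  {FA : Type*} [NormedAddCommGroup FA] [NormedSpace ℝ FA]
  {A : M → Type*} [TopologicalSpace (TotalSpace FA A)] [∀ x, AddCommGroup (A x)]
  [∀ x, Module ℝ (A x)] [∀ x, TopologicalSpace (A x)] [FiberBundle FA A] [VectorBundle ℝ FA A]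
  {FB : Type*} [NormedAddCommGroup FB] [NormedSpace ℝ FB]
  {B : M → Type*} [TopologicalSpace (TotalSpace FB B)] [∀ x, AddCommGroup (B x)]
  [∀ x, Module ℝ (B x)] [∀ x, TopologicalSpace (B x)] [FiberBundle FB B] [VectorBundle ℝ FB B]

/-! #### Dual sections -/

open Classical in
/-- The smooth section of the dual bundle given by a function-linear map, if there is one. -/
def dualOf (T : Sec E FB B → Fn E M) : SDual E FB B :=
  if h : ∃ ν : SDual E FB B, ∀ s, pair ν s = T s then h.choose else 0

section
variable [T2Space M] [FiniteDimensional ℝ FB] [ContMDiffVectorBundle ∞ FB B 𝓘(ℝ, E)]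

theorem pair_dualOf {T : Sec E FB B → Fn E M} (hadd : ∀ s t, T (s + t) = T s + T t)
    (hT : ∀ f s, T (smulSec f s) = f * T s) (s : Sec E FB B) : pair (dualOf T) s = T s := by
  have h := exists_sdual_of_tensorial T hadd hT
  rw [dualOf, dif_pos h]
  exact h.choose_spec s

theorem Gens.g_expand (G : Gens E FA A FB B) (ν : SDual E FB B) {x : M}
    (b : FrameAt (E := E) FB B x) :
    G.g x (ν.1 x) = ∑ j, pair ν (b.sec j) x • G.g x (b.basis.coord j) := by
  have h := isOneForm_pair G ν x b
  rw [G.w_apply] at h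
  rw [h]
  exact Finset.sum_congr rfl fun i _ => by
    rw [wF_apply, ← Algebra.commutes, ← Algebra.smul_def]

theorem IsTensor.of_sdual {FV : Type*} [NormedAddCommGroup FV] [NormedSpace ℝ FV]
    {V : M → Type*} [TopologicalSpace (TotalSpace FV V)] [∀ x, AddCommGroup (V x)]
    [∀ x, Module ℝ (V x)] [∀ x, TopologicalSpace (V x)] [FiberBundle FV V] [VectorBundle ℝ FV V]
    (G : Gens E FA A FV V) {σ : Sec E FB B → SDual E FV V}
    (hadd : ∀ s t, σ (s + t) = σ s + σ t) (hsmul : ∀ f s, σ (smulSec f s) = smulDual f (σ s)) :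
    IsTensor (fun b => G.w (σ b)) :=
  ⟨fun s t => by rw [hadd, map_add], fun f s => by rw [hsmul, G.w_smul],
    G.deg, fun s x => by rw [G.w_apply]; exact G.mem _ _⟩

end

/-- The `1`-form `df ∘ ρ` on `B`. -/
def dFn (L : LieAlgebroid E FB B) (f : Fn E M) : SDual E FB B :=
  ⟨fun x => diffₗ x f ∘ₗ L.anchor x, fun s => (lieFn (L.rho s) f).contMDiff⟩

theorem pair_dFn (L : LieAlgebroid E FB B) (f : Fn E M) (s : Sec E FB B) :
    pair (dFn L f) s = lieFn (L.rho s) f := rfl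

/-- The `1`-form `dν(b, ·)`, where `d` is the differential of the Lie algebroid. -/
def extD (L : LieAlgebroid E FB B) (ν : SDual E FB B) (b : Sec E FB B) : SDual E FB B :=
  dualOf fun b' => lieFn (L.rho b) (pair ν b') - lieFn (L.rho b') (pair ν b)
    - pair ν (L.bracket b b')

section
variable [T2Space M] [FiniteDimensional ℝ FB] [ContMDiffVectorBundle ∞ FB B 𝓘(ℝ, E)]
  (L : LieAlgebroid E FB B)

theorem pair_extD (ν : SDual E FB B) (b b' : Sec E FB B) :
    pair (extD L ν b) b' = lieFn (L.rho b) (pair ν b') - lieFn (L.rho b') (pair ν b)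
      - pair ν (L.bracket b b') := by
  refine pair_dualOf (T := fun b' => lieFn (L.rho b) (pair ν b') - lieFn (L.rho b') (pair ν b)
    - pair ν (L.bracket b b')) (fun s t => ?_) (fun f s => ?_) b'
  · simp only [pair_add, lieFn_add, L.rho_add, lieFn_vadd, map_add]; ring
  · simp only [pair_smul, lieFn_mul, L.rho_smul, lieFn_vsmul, L.bracket_smul, pair_add]; ring

theorem extD_add_right (ν : SDual E FB B) (b b' : Sec E FB B) :
    extD L ν (b + b') = extD L ν b + extD L ν b' := SDual.ext_pair fun s => by
  simp only [add_pair, pair_extD, L.rho_add, lieFn_vadd, pair_add, lieFn_add, map_add,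
    LinearMap.add_apply]
  ring

theorem extD_smul_right (ν : SDual E FB B) (f : Fn E M) (b : Sec E FB B) :
    extD L ν (smulSec f b) = smulDual f (extD L ν b) := SDual.ext_pair fun s => by
  simp only [smulDual_pair, pair_extD, L.rho_smul, lieFn_vsmul, pair_smul, lieFn_mul,
    L.bracket_smul_left, pair_sub]
  ring

theorem extD_add (ν ν' : SDual E FB B) (b : Sec E FB B) :
    extD L (ν + ν') b = extD L ν b + extD L ν' b := SDual.ext_pair fun s => by
  simp only [add_pair, pair_extD, lieFn_add]
  ring

theorem extD_smul (f : Fn E M) (ν : SDual E FB B) (b : Sec E FB B) :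
    extD L (smulDual f ν) b = smulDual f (extD L ν b) + smulDual (lieFn (L.rho b) f) ν -
      smulDual (pair ν b) (dFn L f) := SDual.ext_pair fun s => by
  simp only [add_pair, sub_pair, smulDual_pair, pair_extD, lieFn_mul, pair_dFn]
  ring

end

section Conn

variable {FV : Type*} [NormedAddCommGroup FV] [NormedSpace ℝ FV]
  {V : M → Type*} [TopologicalSpace (TotalSpace FV V)] [∀ x, AddCommGroup (V x)]
  [∀ x, Module ℝ (V x)] [∀ x, TopologicalSpace (V x)] [FiberBundle FV V] [VectorBundle ℝ FV V]

/-- `conn` is a `B`-connection on `V`. -/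
structure IsConn (L : LieAlgebroid E FB B) (conn : Sec E FB B → Sec E FV V → Sec E FV V) :
    Prop where
  add_left : ∀ b b' s, conn (b + b') s = conn b s + conn b' s
  smul_left : ∀ f b s, conn (smulSec f b) s = smulSec f (conn b s)
  add_right : ∀ b s t, conn b (s + t) = conn b s + conn b t
  leibniz : ∀ f b s, conn b (smulSec f s) = smulSec f (conn b s) + smulSec (lieFn (L.rho b) f) s

/-- The dual connection. -/
def connDual (L : LieAlgebroid E FB B) (conn : Sec E FB B → Sec E FV V → Sec E FV V)
    (b : Sec E FB B) (η : SDual E FV V) : SDual E FV V :=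
  dualOf fun v => lieFn (L.rho b) (pair η v) - pair η (conn b v)

variable [T2Space M] [FiniteDimensional ℝ FV] [ContMDiffVectorBundle ∞ FV V 𝓘(ℝ, E)]
  {L : LieAlgebroid E FB B} {conn : Sec E FB B → Sec E FV V → Sec E FV V} (h : IsConn L conn)
include h

theorem IsConn.pair_connDual (b : Sec E FB B) (η : SDual E FV V) (v : Sec E FV V) :
    pair (connDual L conn b η) v = lieFn (L.rho b) (pair η v) - pair η (conn b v) := by
  refine pair_dualOf (T := fun v => lieFn (L.rho b) (pair η v) - pair η (conn b v))
    (fun s t => ?_) (fun f s => ?_) v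
  · simp only [pair_add, lieFn_add, h.add_right]; ring
  · simp only [pair_smul, lieFn_mul, h.leibniz, pair_add]; ring

theorem IsConn.connDual_add_left (b b' : Sec E FB B) (η : SDual E FV V) :
    connDual L conn (b + b') η = connDual L conn b η + connDual L conn b' η :=
  SDual.ext_pair fun s => by
    simp only [add_pair, h.pair_connDual, L.rho_add, lieFn_vadd, h.add_left, pair_add]; ring

theorem IsConn.connDual_smul_left (f : Fn E M) (b : Sec E FB B) (η : SDual E FV V) :
    connDual L conn (smulSec f b) η = smulDual f (connDual L conn b η) :=
  SDual.ext_pair fun s => by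
    simp only [smulDual_pair, h.pair_connDual, L.rho_smul, lieFn_vsmul, h.smul_left, pair_smul]
    ring

theorem IsConn.connDual_add (b : Sec E FB B) (η η' : SDual E FV V) :
    connDual L conn b (η + η') = connDual L conn b η + connDual L conn b η' :=
  SDual.ext_pair fun s => by
    simp only [add_pair, h.pair_connDual, lieFn_add]; ring

theorem IsConn.connDual_smul (b : Sec E FB B) (f : Fn E M) (η : SDual E FV V) :
    connDual L conn b (smulDual f η) = smulDual f (connDual L conn b η) +
      smulDual (lieFn (L.rho b) f) η :=
  SDual.ext_pair fun s => by
    simp only [add_pair, smulDual_pair, h.pair_connDual, lieFn_mul]; ring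

end Conn

/-! #### The operators on generators -/

variable {F₀ : Type*} [NormedAddCommGroup F₀] [NormedSpace ℝ F₀]
  {V₀ : M → Type*} [TopologicalSpace (TotalSpace F₀ V₀)] [∀ x, AddCommGroup (V₀ x)]
  [∀ x, Module ℝ (V₀ x)] [∀ x, TopologicalSpace (V₀ x)] [FiberBundle F₀ V₀] [VectorBundle ℝ F₀ V₀]
  {F₁ : Type*} [NormedAddCommGroup F₁] [NormedSpace ℝ F₁]
  {V₁ : M → Type*} [TopologicalSpace (TotalSpace F₁ V₁)] [∀ x, AddCommGroup (V₁ x)]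
  [∀ x, Module ℝ (V₁ x)] [∀ x, TopologicalSpace (V₁ x)] [FiberBundle F₁ V₁] [VectorBundle ℝ F₁ V₁]

/-- The components of `D` are smooth and function-linear, up to the Leibniz rule. -/
structure TwoTermOperator.IsTensorial (L : LieAlgebroid E FB B)
    (D : TwoTermOperator E FB B F₀ V₀ F₁ V₁) : Prop where
  bd : ∀ s : Sec E F₀ V₀, ∃ t : Sec E F₁ V₁, ∀ x, t x = D.bd x (s x)
  conn₀ : IsConn L D.conn₀
  conn₁ : IsConn L D.conn₁
  K_add₁ : ∀ b b' c s, D.K (b + b') c s = D.K b c s + D.K b' c s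
  K_add₂ : ∀ b c c' s, D.K b (c + c') s = D.K b c s + D.K b c' s
  K_add₃ : ∀ b c s t, D.K b c (s + t) = D.K b c s + D.K b c t
  K_smul₁ : ∀ f b c s, D.K (smulSec f b) c s = smulSec f (D.K b c s)
  K_smul₂ : ∀ f b c s, D.K b (smulSec f c) s = smulSec f (D.K b c s)
  K_smul₃ : ∀ f b c s, D.K b c (smulSec f s) = smulSec f (D.K b c s)

open Classical in
/-- The form `η ∘ ∂`. -/
def TwoTermOperator.bdDual (D : TwoTermOperator E FB B F₀ V₀ F₁ V₁) (η : SDual E F₁ V₁) :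
    SDual E F₀ V₀ :=
  if h : (fun x => η.1 x ∘ₗ D.bd x) ∈ smoothDuals E F₀ V₀ then ⟨_, h⟩ else 0

/-- The form `η ∘ K(b, c)`. -/
def TwoTermOperator.KDual (D : TwoTermOperator E FB B F₀ V₀ F₁ V₁) (b c : Sec E FB B)
    (η : SDual E F₀ V₀) : SDual E F₁ V₁ :=
  dualOf fun v => pair η (D.K b c v)

variable (L : LieAlgebroid E FB B) (D : TwoTermOperator E FB B F₀ V₀ F₁ V₁)
  (GB : Gens E FA A FB B) (G₀ : Gens E FA A F₀ V₀) (G₁ : Gens E FA A F₁ V₁)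

/-- The value of the structure operator on `1`-forms on `B`. -/
def strForm (ν : SDual E FB B) : Weil E FA A :=
  -- The double sum over a basis counts each unordered pair of indices twice.
  (1 / 2 : ℝ) • oneForm GB (fun b => GB.w (extD L ν b))

/-- The value of the structure operator on sections of `V₁*`. -/
def str₁ (η : SDual E F₁ V₁) : Weil E FA A :=
  G₀.w (D.bdDual η) + oneForm GB (fun b => G₁.w (connDual L D.conn₁ b η))

/-- The value of the structure operator on sections of `V₀*`. -/
def str₀ (η : SDual E F₀ V₀) : Weil E FA A :=
  oneForm GB (fun b => G₀.w (connDual L D.conn₀ b η))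
    - (1 / 2 : ℝ) • oneForm GB (fun b => oneForm GB (fun c => G₁.w (D.KDual b c η)))

variable {L D GB G₀ G₁}
variable [T2Space M] [FiniteDimensional ℝ FB] [ContMDiffVectorBundle ∞ FB B 𝓘(ℝ, E)]
  [FiniteDimensional ℝ F₀] [ContMDiffVectorBundle ∞ F₀ V₀ 𝓘(ℝ, E)]
  [FiniteDimensional ℝ F₁] [ContMDiffVectorBundle ∞ F₁ V₁ 𝓘(ℝ, E)]

theorem isTensor_extD (ν : SDual E FB B) : IsTensor (fun b => GB.w (extD L ν b)) :=
  IsTensor.of_sdual GB (extD_add_right L ν) (extD_smul_right L ν)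

theorem IsConn.isTensor {FV : Type*} [NormedAddCommGroup FV] [NormedSpace ℝ FV]
    {V : M → Type*} [TopologicalSpace (TotalSpace FV V)] [∀ x, AddCommGroup (V x)]
    [∀ x, Module ℝ (V x)] [∀ x, TopologicalSpace (V x)] [FiberBundle FV V] [VectorBundle ℝ FV V]
    [FiniteDimensional ℝ FV] [ContMDiffVectorBundle ∞ FV V 𝓘(ℝ, E)]
    {conn : Sec E FB B → Sec E FV V → Sec E FV V} (h : IsConn L conn)
    (G : Gens E FA A FV V) (η : SDual E FV V) : IsTensor (fun b => G.w (connDual L conn b η)) :=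
  IsTensor.of_sdual G (fun s t => h.connDual_add_left s t η) (fun f s => h.connDual_smul_left f s η)

namespace TwoTermOperator.IsTensorial

variable (hD : D.IsTensorial L)
include hD

theorem bdDual_apply (η : SDual E F₁ V₁) (x : M) : (D.bdDual η).1 x = η.1 x ∘ₗ D.bd x := by
  have h : (fun x => η.1 x ∘ₗ D.bd x) ∈ smoothDuals E F₀ V₀ := fun s => by
    obtain ⟨t, ht⟩ := hD.bd s
    refine (pair η t).contMDiff.congr fun x => ?_
    rw [pair_apply, ht]
    rfl
  rw [bdDual, dif_pos h]

theorem pair_KDual (b c : Sec E FB B) (η : SDual E F₀ V₀) (v : Sec E F₁ V₁) :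
    pair (D.KDual b c η) v = pair η (D.K b c v) := by
  refine pair_dualOf (T := fun v => pair η (D.K b c v)) (fun s t => ?_) (fun f s => ?_) v
  · rw [hD.K_add₃, pair_add]
  · rw [hD.K_smul₃, pair_smul]

theorem isTensor_K' (b : Sec E FB B) (η : SDual E F₀ V₀) :
    IsTensor (fun c => G₁.w (D.KDual b c η)) :=
  IsTensor.of_sdual G₁
    (fun s t => SDual.ext_pair fun v => by
      simp only [add_pair, hD.pair_KDual, hD.K_add₂, pair_add])
    (fun f s => SDual.ext_pair fun v => by
      simp only [smulDual_pair, hD.pair_KDual, hD.K_smul₂, pair_smul])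

theorem isTensor_K (η : SDual E F₀ V₀) :
    IsTensor (fun b => oneForm GB (fun c => G₁.w (D.KDual b c η))) where
  add s t := (hD.isTensor_K' (s + t) η).oneForm_eq GB
    ((((hD.isTensor_K' s η).oneForm_isOneForm GB).add
      ((hD.isTensor_K' t η).oneForm_isOneForm GB)).congr fun c => by
        rw [← map_add]
        congr 1
        exact SDual.ext_pair fun v => by
          simp only [add_pair, hD.pair_KDual, hD.K_add₁, pair_add])
  smul f s := (hD.isTensor_K' (smulSec f s) η).oneForm_eq GB
    ((((hD.isTensor_K' s η).oneForm_isOneForm GB).wF_mul f).congr fun c => by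
        rw [← G₁.w_smul]
        congr 1
        exact SDual.ext_pair fun v => by
          simp only [smulDual_pair, hD.pair_KDual, hD.K_smul₁, pair_smul])
  deg := ⟨GB.deg + G₁.deg, fun s x => ((hD.isTensor_K' s η).oneForm_isOneForm GB).mem
    (fun s x => by rw [G₁.w_apply]; exact G₁.mem _ _) x⟩

/-- The structure operators are the odd derivations with the prescribed values on generators. -/
theorem isDualStructureOperator_iff {d : Weil E FA A →ₗ[ℝ] Weil E FA A} :
    IsDualStructureOperator L D GB.g G₀.g G₁.g d ↔ IsOddDer d ∧
      (∀ f, d (wF FA A f) = GB.w (dFn L f)) ∧ (∀ ν, d (GB.w ν) = strForm L GB ν) ∧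
      (∀ η, d (G₁.w η) = str₁ L D GB G₀ G₁ η) ∧ (∀ η, d (G₀.w η) = str₀ L D GB G₀ G₁ η) := by
  -- The formulas `e1` to `e4` expand the intrinsic values in frames at `x`; they turn the
  -- coordinate clauses of the definition into equations in `W`.
  have e1 : ∀ (f : Fn E M) x (b : FrameAt (E := E) FB B x), (GB.w (dFn L f)).1 x =
      ∑ i, dirDeriv f (L.anchor x (b.basis i)) • GB.g x (b.basis.coord i) := fun f x b => by
    rw [GB.w_apply, GB.g_expand _ b]
    exact Finset.sum_congr rfl fun i _ => by rw [pair_dFn, lieFn_apply, ← b.sec_apply]; rfl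
  have e2 : ∀ (ν : SDual E FB B) x (b : FrameAt (E := E) FB B x), (strForm L GB ν).1 x =
      (1 / 2 : ℝ) • ∑ i, ∑ j,
        (dirDeriv (fun y => ν.1 y (b.sec j y)) (L.anchor x (b.basis i))
          - dirDeriv (fun y => ν.1 y (b.sec i y)) (L.anchor x (b.basis j))
          - ν.1 x (L.bracket (b.sec i) (b.sec j) x)) •
        (GB.g x (b.basis.coord i) * GB.g x (b.basis.coord j)) := fun ν x b => by
    rw [strForm, weil_smul_apply, (isTensor_extD ν).oneForm_apply GB x b]
    congr 1
    refine Finset.sum_congr rfl fun i _ => ?_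
    rw [GB.w_apply, GB.g_expand _ b, Finset.mul_sum]
    refine Finset.sum_congr rfl fun j _ => ?_
    rw [mul_smul_comm, pair_extD, ← b.sec_apply, ← b.sec_apply]
    rfl
  have e3 : ∀ (η : SDual E F₁ V₁) x (b : FrameAt (E := E) FB B x) (v : FrameAt (E := E) F₁ V₁ x),
      (str₁ L D GB G₀ G₁ η).1 x = G₀.g x (η.1 x ∘ₗ D.bd x) + ∑ i, ∑ j,
        (dirDeriv (fun y => η.1 y (v.sec j y)) (L.anchor x (b.basis i))
          - η.1 x (D.conn₁ (b.sec i) (v.sec j) x)) •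
        (GB.g x (b.basis.coord i) * G₁.g x (v.basis.coord j)) := fun η x b v => by
    rw [str₁, weil_add_apply, G₀.w_apply, hD.bdDual_apply, (hD.conn₁.isTensor G₁ η).oneForm_apply GB x b]
    congr 1
    refine Finset.sum_congr rfl fun i _ => ?_
    rw [G₁.w_apply, G₁.g_expand _ v, Finset.mul_sum]
    refine Finset.sum_congr rfl fun j _ => ?_
    rw [mul_smul_comm, hD.conn₁.pair_connDual, ← b.sec_apply]
    rfl
  have e4 : ∀ (η : SDual E F₀ V₀) x (b : FrameAt (E := E) FB B x) (v : FrameAt (E := E) F₀ V₀ x)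
      (v' : FrameAt (E := E) F₁ V₁ x), (str₀ L D GB G₀ G₁ η).1 x = ∑ i, ∑ j,
        (dirDeriv (fun y => η.1 y (v.sec j y)) (L.anchor x (b.basis i))
          - η.1 x (D.conn₀ (b.sec i) (v.sec j) x)) •
        (GB.g x (b.basis.coord i) * G₀.g x (v.basis.coord j))
        - (1 / 2 : ℝ) • ∑ i, ∑ k, ∑ j, η.1 x (D.K (b.sec i) (b.sec k) (v'.sec j) x) •
          (GB.g x (b.basis.coord i) * GB.g x (b.basis.coord k) * G₁.g x (v'.basis.coord j)) := by
    intro η x b v v'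
    rw [str₀, weil_sub_apply, weil_smul_apply, (hD.conn₀.isTensor G₀ η).oneForm_apply GB x b,
      (hD.isTensor_K η).oneForm_apply GB x b]
    congr 1
    · refine Finset.sum_congr rfl fun i _ => ?_
      rw [G₀.w_apply, G₀.g_expand _ v, Finset.mul_sum]
      refine Finset.sum_congr rfl fun j _ => ?_
      rw [mul_smul_comm, hD.conn₀.pair_connDual, ← b.sec_apply]
      rfl
    · congr 1
      refine Finset.sum_congr rfl fun i _ => ?_
      rw [(hD.isTensor_K' _ η).oneForm_apply GB x b, Finset.mul_sum]
      refine Finset.sum_congr rfl fun k _ => ?_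
      rw [G₁.w_apply, G₁.g_expand _ v', Finset.mul_sum, Finset.mul_sum]
      refine Finset.sum_congr rfl fun j _ => ?_
      rw [mul_smul_comm, mul_smul_comm, hD.pair_KDual, mul_assoc]
      rfl
  have hB := fun x => (exists_frameAt E FB B x).some
  have h₀ := fun x => (exists_frameAt E F₀ V₀ x).some
  have h₁ := fun x => (exists_frameAt E F₁ V₁ x).some
  constructor
  · intro h
    refine ⟨isGradedDerivation_iff.1 h.derivation, fun f => weil_ext fun x => ?_,
      fun ν => weil_ext fun x => ?_, fun ν => weil_ext fun x => ?_, fun ν => weil_ext fun x => ?_⟩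
    · rw [h.on_functions f _ (fun _ => rfl) x (hB x), e1]
    · rw [h.on_forms ν.1 _ ν.2 (GB.w_apply ν) x (hB x), e2]
    · rw [h.on_dual₁ ν.1 _ ν.2 (G₁.w_apply ν) x (hB x) (h₁ x), e3]
    · rw [h.on_dual₀ ν.1 _ ν.2 (G₀.w_apply ν) x (hB x) (h₀ x) (h₁ x), e4]
  · rintro ⟨h1, h2, h3, h4, h5⟩
    refine ⟨isGradedDerivation_iff.2 h1, fun f w hw x b => ?_, fun ν w hν hw x b => ?_,
      fun ν w hν hw x b v => ?_, fun ν w hν hw x b v v' => ?_⟩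
    · rw [show w = wF FA A f from weil_ext hw, h2, e1]
    · rw [show w = GB.w ⟨ν, hν⟩ from weil_ext fun x => by rw [hw, GB.w_apply], h3, e2 _ x b]
    · rw [show w = G₁.w ⟨ν, hν⟩ from weil_ext fun x => by rw [hw, G₁.w_apply], h4, e3 _ x b v]
    · rw [show w = G₀.w ⟨ν, hν⟩ from weil_ext fun x => by rw [hw, G₀.w_apply], h5, e4 _ x b v v']

end TwoTermOperator.IsTensorial

end StructureOperators

/-! ### Leibniz rules, parities and degrees of the prescribed values; existence and uniqueness of
both differentials. -/

section StructureExistence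

variable {E : Type*} [NormedAddCommGroup E] [NormedSpace ℝ E] [FiniteDimensional ℝ E]
  {M : Type*} [TopologicalSpace M] [ChartedSpace E M] [IsManifold 𝓘(ℝ, E) ∞ M]
  {FA : Type*} [NormedAddCommGroup FA] [NormedSpace ℝ FA]
  {A : M → Type*} [TopologicalSpace (TotalSpace FA A)] [∀ x, AddCommGroup (A x)]
  [∀ x, Module ℝ (A x)] [∀ x, TopologicalSpace (A x)] [FiberBundle FA A] [VectorBundle ℝ FA A]

section Leibniz

variable {FB : Type*} [NormedAddCommGroup FB] [NormedSpace ℝ FB]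
  {B : M → Type*} [TopologicalSpace (TotalSpace FB B)] [∀ x, AddCommGroup (B x)]
  [∀ x, Module ℝ (B x)] [∀ x, TopologicalSpace (B x)] [FiberBundle FB B] [VectorBundle ℝ FB B]
  {F₀ : Type*} [NormedAddCommGroup F₀] [NormedSpace ℝ F₀]
  {V₀ : M → Type*} [TopologicalSpace (TotalSpace F₀ V₀)] [∀ x, AddCommGroup (V₀ x)]
  [∀ x, Module ℝ (V₀ x)] [∀ x, TopologicalSpace (V₀ x)] [FiberBundle F₀ V₀] [VectorBundle ℝ F₀ V₀]
  {F₁ : Type*} [NormedAddCommGroup F₁] [NormedSpace ℝ F₁]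
  {V₁ : M → Type*} [TopologicalSpace (TotalSpace F₁ V₁)] [∀ x, AddCommGroup (V₁ x)]
  [∀ x, Module ℝ (V₁ x)] [∀ x, TopologicalSpace (V₁ x)] [FiberBundle F₁ V₁] [VectorBundle ℝ F₁ V₁]
  (L : LieAlgebroid E FB B) {D : TwoTermOperator E FB B F₀ V₀ F₁ V₁}
  (GB : Gens E FA A FB B) (G₀ : Gens E FA A F₀ V₀) (G₁ : Gens E FA A F₁ V₁)

theorem Gens.w_sub (ν ν' : SDual E FB B) : GB.w (ν - ν') = GB.w ν - GB.w ν' :=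
  weil_ext fun x => by
    rw [weil_sub_apply, GB.w_apply, GB.w_apply, GB.w_apply]
    exact (GB.g x).map_sub _ _

theorem Gens.w_neg (ν : SDual E FB B) : GB.w (-ν) = -GB.w ν :=
  weil_ext fun x => by
    rw [weil_neg_apply, GB.w_apply, GB.w_apply]
    exact (GB.g x).map_neg _

theorem dFn_const (c : ℝ) : dFn L (constFn c : Fn E M) = 0 :=
  Subtype.ext (funext fun x => by
    change diffₗ x (constFn c : Fn E M) ∘ₗ L.anchor x = 0
    rw [diffₗ_const, LinearMap.zero_comp])

/-- An additive map satisfying the Leibniz rule is linear. -/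
def linearOfLeibniz {FV : Type*} [NormedAddCommGroup FV] [NormedSpace ℝ FV]
    {V : M → Type*} [TopologicalSpace (TotalSpace FV V)] [∀ x, AddCommGroup (V x)]
    [∀ x, Module ℝ (V x)] [∀ x, TopologicalSpace (V x)] [FiberBundle FV V] [VectorBundle ℝ FV V]
    (g O : SDual E FV V → Weil E FA A) (hadd : ∀ ν ν', O (ν + ν') = O ν + O ν')
    (hO : ∀ f ν, O (smulDual f ν) = wF FA A f * O ν + GB.w (dFn L f) * g ν) :
    SDual E FV V →ₗ[ℝ] Weil E FA A where
  toFun := O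
  map_add' := hadd
  map_smul' c ν := by
    have h := hO (constFn c) ν
    rw [dFn_const, map_zero, zero_mul, add_zero] at h
    exact h.trans (weil_ext fun x => by rw [wF_mul_apply]; rfl)

variable [T2Space M] [FiniteDimensional ℝ FB] [ContMDiffVectorBundle ∞ FB B 𝓘(ℝ, E)]
  [FiniteDimensional ℝ F₀] [ContMDiffVectorBundle ∞ F₀ V₀ 𝓘(ℝ, E)]
  [FiniteDimensional ℝ F₁] [ContMDiffVectorBundle ∞ F₁ V₁ 𝓘(ℝ, E)]

theorem strForm_add (ν ν' : SDual E FB B) :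
    strForm L GB (ν + ν') = strForm L GB ν + strForm L GB ν' := by
  rw [strForm, strForm, strForm, ← smul_add]
  congr 1
  refine (isTensor_extD _).oneForm_eq GB ((((isTensor_extD ν).oneForm_isOneForm GB).add
    ((isTensor_extD ν').oneForm_isOneForm GB)).congr fun b => ?_)
  rw [extD_add, map_add]

variable {GB}

/-- Without the factor one half, the form acquires the two terms `df ν - ν df`. Odd generators
anticommute, so these add up to `2 df ν`. -/
theorem strForm_smul (hB : GB.IsOdd) (f : Fn E M) (ν : SDual E FB B) :
    strForm L GB (smulDual f ν) = wF FA A f * strForm L GB ν + GB.w (dFn L f) * GB.w ν := by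
  have h : oneForm GB (fun b => GB.w (extD L (smulDual f ν) b)) =
      wF FA A f * oneForm GB (fun b => GB.w (extD L ν b)) + GB.w (dFn L f) * GB.w ν
        - GB.w ν * GB.w (dFn L f) := by
    refine (isTensor_extD _).oneForm_eq GB ((((((isTensor_extD ν).oneForm_isOneForm GB).wF_mul
      f).add ((isOneForm_pair GB (dFn L f)).mul_right (GB.w ν))).sub
        ((isOneForm_pair GB ν).mul_right (GB.w (dFn L f)))).congr fun b => ?_)
    rw [extD_smul, GB.w_sub, map_add, GB.w_smul, GB.w_smul, GB.w_smul, pair_dFn]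
  have h' : GB.w ν * GB.w (dFn L f) = -(GB.w (dFn L f) * GB.w ν) := by
    rw [hB.w_mul, hB.wpar, neg_mul]
  rw [strForm, strForm, h, h', sub_neg_eq_add, add_assoc, ← two_smul ℝ, smul_add, smul_smul,
    mul_smul_comm]
  norm_num

theorem strForm_parity (hB : GB.IsOdd) (ν : SDual E FB B) :
    wpar (strForm L GB ν) = strForm L GB ν := by
  rw [strForm, map_smul]
  congr 1
  refine (((isTensor_extD ν).oneForm_isOneForm GB).wpar hB).unique
    (((isTensor_extD ν).oneForm_isOneForm GB).congr fun b => ?_)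
  rw [hB.wpar, neg_neg]

theorem strForm_mem (ν : SDual E FB B) (x : M) :
    (strForm L GB ν).1 x ∈ biGr E A x (GB.deg + GB.deg) := by
  rw [strForm, weil_smul_apply]
  exact Submodule.smul_mem _ _ (((isTensor_extD ν).oneForm_isOneForm GB).mem
    (fun s x => by rw [GB.w_apply]; exact GB.mem _ _) x)

variable {L} (hD : D.IsTensorial L)
include hD
variable {G₀ G₁}

theorem str₁_add (η η' : SDual E F₁ V₁) :
    str₁ L D GB G₀ G₁ (η + η') = str₁ L D GB G₀ G₁ η + str₁ L D GB G₀ G₁ η' := by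
  have h : D.bdDual (η + η') = D.bdDual η + D.bdDual η' := Subtype.ext (funext fun x => by
    rw [hD.bdDual_apply]
    change _ = (D.bdDual η).1 x + (D.bdDual η').1 x
    rw [hD.bdDual_apply, hD.bdDual_apply]
    rfl)
  have h' : oneForm GB (fun b => G₁.w (connDual L D.conn₁ b (η + η'))) =
      oneForm GB (fun b => G₁.w (connDual L D.conn₁ b η)) +
        oneForm GB (fun b => G₁.w (connDual L D.conn₁ b η')) :=
    (hD.conn₁.isTensor G₁ _).oneForm_eq GB
      ((((hD.conn₁.isTensor G₁ η).oneForm_isOneForm GB).add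
        ((hD.conn₁.isTensor G₁ η').oneForm_isOneForm GB)).congr fun b => by
          rw [hD.conn₁.connDual_add, map_add])
  rw [str₁, str₁, str₁, h, h', map_add]
  abel

/-- The part coming from `∂` is linear over functions; only the dual connection contributes the term
with `df`. -/
theorem str₁_smul (f : Fn E M) (η : SDual E F₁ V₁) :
    str₁ L D GB G₀ G₁ (smulDual f η) =
      wF FA A f * str₁ L D GB G₀ G₁ η + GB.w (dFn L f) * G₁.w η := by
  have h : D.bdDual (smulDual f η) = smulDual f (D.bdDual η) := Subtype.ext (funext fun x => by
    rw [hD.bdDual_apply, smulDual_apply, smulDual_apply, hD.bdDual_apply]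
    rfl)
  have h' : oneForm GB (fun b => G₁.w (connDual L D.conn₁ b (smulDual f η))) =
      wF FA A f * oneForm GB (fun b => G₁.w (connDual L D.conn₁ b η)) +
        GB.w (dFn L f) * G₁.w η :=
    (hD.conn₁.isTensor G₁ _).oneForm_eq GB
      ((((hD.conn₁.isTensor G₁ η).oneForm_isOneForm GB).wF_mul f).add
        ((isOneForm_pair GB (dFn L f)).mul_right (G₁.w η)) |>.congr fun b => by
          rw [hD.conn₁.connDual_smul, map_add, G₁.w_smul, G₁.w_smul, pair_dFn])
  rw [str₁, str₁, h, h', G₀.w_smul, mul_add, add_assoc]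

theorem str₁_parity (hB : GB.IsOdd) (h₀ : G₀.IsEven) (h₁ : G₁.IsOdd) (η : SDual E F₁ V₁) :
    wpar (str₁ L D GB G₀ G₁ η) = str₁ L D GB G₀ G₁ η := by
  rw [str₁, map_add, h₀.wpar]
  congr 1
  refine (((hD.conn₁.isTensor G₁ η).oneForm_isOneForm GB).wpar hB).unique
    (((hD.conn₁.isTensor G₁ η).oneForm_isOneForm GB).congr fun b => ?_)
  rw [h₁.wpar, neg_neg]

theorem str₁_mem (hdeg : G₀.deg = G₁.deg + GB.deg) (η : SDual E F₁ V₁) (x : M) :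
    (str₁ L D GB G₀ G₁ η).1 x ∈ biGr E A x (G₁.deg + GB.deg) := by
  rw [str₁, weil_add_apply]
  refine add_mem ?_ ?_
  · rw [← hdeg, G₀.w_apply]; exact G₀.mem _ _
  · rw [add_comm]
    exact ((hD.conn₁.isTensor G₁ η).oneForm_isOneForm GB).mem
      (fun s x => by rw [G₁.w_apply]; exact G₁.mem _ _) x

theorem str₀_add (η η' : SDual E F₀ V₀) :
    str₀ L D GB G₀ G₁ (η + η') = str₀ L D GB G₀ G₁ η + str₀ L D GB G₀ G₁ η' := by
  have h : oneForm GB (fun b => G₀.w (connDual L D.conn₀ b (η + η'))) =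
      oneForm GB (fun b => G₀.w (connDual L D.conn₀ b η)) +
        oneForm GB (fun b => G₀.w (connDual L D.conn₀ b η')) :=
    (hD.conn₀.isTensor G₀ _).oneForm_eq GB
      ((((hD.conn₀.isTensor G₀ η).oneForm_isOneForm GB).add
        ((hD.conn₀.isTensor G₀ η').oneForm_isOneForm GB)).congr fun b => by
          rw [hD.conn₀.connDual_add, map_add])
  have h' : oneForm GB (fun b => oneForm GB (fun c => G₁.w (D.KDual b c (η + η')))) =
      oneForm GB (fun b => oneForm GB (fun c => G₁.w (D.KDual b c η))) +
        oneForm GB (fun b => oneForm GB (fun c => G₁.w (D.KDual b c η'))) :=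
    (hD.isTensor_K _).oneForm_eq GB
      ((((hD.isTensor_K η).oneForm_isOneForm GB).add
        ((hD.isTensor_K η').oneForm_isOneForm GB)).congr fun b =>
          ((hD.isTensor_K' b _).oneForm_eq GB
            ((((hD.isTensor_K' b η).oneForm_isOneForm GB).add
              ((hD.isTensor_K' b η').oneForm_isOneForm GB)).congr fun c => by
                rw [← map_add]
                congr 1
                exact SDual.ext_pair fun v => by simp only [add_pair, hD.pair_KDual])).symm)
  rw [str₀, str₀, str₀, h, h', smul_add]
  abel

theorem str₀_smul (f : Fn E M) (η : SDual E F₀ V₀) :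
    str₀ L D GB G₀ G₁ (smulDual f η) =
      wF FA A f * str₀ L D GB G₀ G₁ η + GB.w (dFn L f) * G₀.w η := by
  have h : oneForm GB (fun b => G₀.w (connDual L D.conn₀ b (smulDual f η))) =
      wF FA A f * oneForm GB (fun b => G₀.w (connDual L D.conn₀ b η)) +
        GB.w (dFn L f) * G₀.w η :=
    (hD.conn₀.isTensor G₀ _).oneForm_eq GB
      ((((hD.conn₀.isTensor G₀ η).oneForm_isOneForm GB).wF_mul f).add
        ((isOneForm_pair GB (dFn L f)).mul_right (G₀.w η)) |>.congr fun b => by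
          rw [hD.conn₀.connDual_smul, map_add, G₀.w_smul, G₀.w_smul, pair_dFn])
  have h' : oneForm GB (fun b => oneForm GB (fun c => G₁.w (D.KDual b c (smulDual f η)))) =
      wF FA A f * oneForm GB (fun b => oneForm GB (fun c => G₁.w (D.KDual b c η))) :=
    (hD.isTensor_K _).oneForm_eq GB
      ((((hD.isTensor_K η).oneForm_isOneForm GB).wF_mul f).congr fun b =>
          ((hD.isTensor_K' b _).oneForm_eq GB
            ((((hD.isTensor_K' b η).oneForm_isOneForm GB).wF_mul f).congr fun c => by
                rw [← G₁.w_smul]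
                congr 1
                exact SDual.ext_pair fun v => by
                  simp only [smulDual_pair, hD.pair_KDual])).symm)
  rw [str₀, str₀, h, h', mul_sub, mul_smul_comm]
  abel

theorem str₀_parity (hB : GB.IsOdd) (h₀ : G₀.IsEven) (h₁ : G₁.IsOdd) (η : SDual E F₀ V₀) :
    wpar (str₀ L D GB G₀ G₁ η) = -str₀ L D GB G₀ G₁ η := by
  have h : wpar (oneForm GB (fun b => G₀.w (connDual L D.conn₀ b η))) =
      (-1 : ℝ) • oneForm GB (fun b => G₀.w (connDual L D.conn₀ b η)) :=
    (((hD.conn₀.isTensor G₀ η).oneForm_isOneForm GB).wpar hB).unique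
      ((((hD.conn₀.isTensor G₀ η).oneForm_isOneForm GB).smul (-1)).congr fun b => by
        rw [h₀.wpar, neg_one_smul])
  have h' : wpar (oneForm GB (fun b => oneForm GB (fun c => G₁.w (D.KDual b c η)))) =
      (-1 : ℝ) • oneForm GB (fun b => oneForm GB (fun c => G₁.w (D.KDual b c η))) :=
    (((hD.isTensor_K η).oneForm_isOneForm GB).wpar hB).unique
      ((((hD.isTensor_K η).oneForm_isOneForm GB).smul (-1)).congr fun b => by
        rw [neg_one_smul]
        congr 1
        refine (((hD.isTensor_K' b η).oneForm_isOneForm GB).unique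
          ((((hD.isTensor_K' b η).oneForm_isOneForm GB).wpar hB).congr fun c => ?_))
        rw [h₁.wpar, neg_neg])
  rw [str₀, map_sub, map_smul, h, h', neg_one_smul, neg_one_smul, smul_neg]
  abel

theorem str₀_mem (hdeg : G₀.deg = G₁.deg + GB.deg) (η : SDual E F₀ V₀) (x : M) :
    (str₀ L D GB G₀ G₁ η).1 x ∈ biGr E A x (G₀.deg + GB.deg) := by
  rw [str₀, weil_sub_apply, weil_smul_apply]
  refine sub_mem ?_ (Submodule.smul_mem _ _ ?_)
  · rw [add_comm]
    exact ((hD.conn₀.isTensor G₀ η).oneForm_isOneForm GB).mem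
      (fun s x => by rw [G₀.w_apply]; exact G₀.mem _ _) x
  · rw [hdeg, add_assoc, add_comm, add_assoc]
    exact ((hD.isTensor_K η).oneForm_isOneForm GB).mem
      (fun b x => ((hD.isTensor_K' b η).oneForm_isOneForm GB).mem
        (fun s x => by rw [G₁.w_apply]; exact G₁.mem _ _) x) x

end Leibniz

/-! #### The double and the adjoint representation are tensorial -/

theorem tangent_rho (X : VF E M) : (LieAlgebroid.tangent E M).rho X = X :=
  ContMDiffSection.ext fun _ => rfl

section Tensoriality

variable {FB : Type*} [NormedAddCommGroup FB] [NormedSpace ℝ FB]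
  {B : M → Type*} [TopologicalSpace (TotalSpace FB B)] [∀ x, AddCommGroup (B x)]
  [∀ x, Module ℝ (B x)] [∀ x, TopologicalSpace (B x)] [FiberBundle FB B] [VectorBundle ℝ FB B]
  {F₀ : Type*} [NormedAddCommGroup F₀] [NormedSpace ℝ F₀]
  {V₀ : M → Type*} [TopologicalSpace (TotalSpace F₀ V₀)] [∀ x, AddCommGroup (V₀ x)]
  [∀ x, Module ℝ (V₀ x)] [∀ x, TopologicalSpace (V₀ x)] [FiberBundle F₀ V₀] [VectorBundle ℝ F₀ V₀]
  {L : LieAlgebroid E FB B} (nab : Connection L F₀ V₀)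

theorem Connection.leibniz (f : Fn E M) (b : Sec E FB B) (s : Sec E F₀ V₀) :
    nab.conn b (smulSec f s) = smulSec f (nab.conn b s) + smulSec (lieFn (L.rho b) f) s :=
  ContMDiffSection.ext fun x => nab.conn_leibniz f b s x

theorem Connection.isConn : IsConn L (fun b s => nab.conn b s) where
  add_left b b' s := by rw [map_add, LinearMap.add_apply]
  smul_left f b s := nab.conn_smul f b s
  add_right b s t := map_add _ _ _
  leibniz f b s := nab.leibniz f b s

variable [T2Space M] [FiniteDimensional ℝ FB] [ContMDiffVectorBundle ∞ FB B 𝓘(ℝ, E)]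

/-- Tensoriality of the curvature. In the last slot the second derivatives of `f` cancel because the
anchor is compatible with brackets on functions. -/
theorem double_isTensorial : (double nab).IsTensorial L where
  bd s := ⟨s, fun x => rfl⟩
  conn₀ := nab.isConn
  conn₁ := nab.isConn
  K_add₁ b b' c s := by
    simp only [double, Connection.curvature, map_add, LinearMap.add_apply]; abel
  K_add₂ b b' c s := by
    simp only [double, Connection.curvature, map_add, LinearMap.add_apply]; abel
  K_add₃ b b' c s := by
    simp only [double, Connection.curvature, map_add]; abel
  K_smul₁ f b c s := by
    simp only [double, Connection.curvature, nab.conn_smul, nab.leibniz, L.bracket_smul_left,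
      map_sub, LinearMap.sub_apply, smulSec_neg, smulSec_sub]
    abel
  K_smul₂ f b c s := by
    simp only [double, Connection.curvature, nab.conn_smul, nab.leibniz, L.bracket_smul,
      map_add, LinearMap.add_apply, smulSec_neg, smulSec_sub]
    abel
  K_smul₃ f b c s := by
    simp only [double, Connection.curvature, nab.leibniz, map_add, smulSec_neg, smulSec_sub,
      L.lieFn_bracket, sub_smulSec]
    abel

end Tensoriality

variable [T2Space M] [FiniteDimensional ℝ FA] [ContMDiffVectorBundle ∞ FA A 𝓘(ℝ, E)]
  (L : LieAlgebroid E FA A) (nab : Connection (LieAlgebroid.tangent E M) FA A)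

theorem lieFn_bracket_VF (X Y : VF E M) (f : Fn E M) :
    lieFn ((LieAlgebroid.tangent E M).bracket X Y) f = lieFn X (lieFn Y f) - lieFn Y (lieFn X f) :=
  (LieAlgebroid.tangent E M).lieFn_bracket X Y f

theorem bracket_VF_smul (X Y : VF E M) (f : Fn E M) :
    (LieAlgebroid.tangent E M).bracket X (smulSec f Y) =
      smulSec f ((LieAlgebroid.tangent E M).bracket X Y) + smulSec (lieFn X f) Y :=
  (LieAlgebroid.tangent E M).bracket_smul X Y f

theorem bracket_VF_smul_left (X Y : VF E M) (f : Fn E M) :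
    (LieAlgebroid.tangent E M).bracket (smulSec f X) Y =
      smulSec f ((LieAlgebroid.tangent E M).bracket X Y) - smulSec (lieFn Y f) X :=
  (LieAlgebroid.tangent E M).bracket_smul_left X Y f

theorem nab_leibniz (f : Fn E M) (X : VF E M) (s : Sec E FA A) :
    nab.conn X (smulSec f s) = smulSec f (nab.conn X s) + smulSec (lieFn X f) s :=
  nab.leibniz f X s

theorem basicConnA_isConn : IsConn L (basicConnA L nab) where
  add_left b b' s := by
    simp only [basicConnA, map_add, LinearMap.add_apply]; abel
  smul_left f b s := by
    simp only [basicConnA, nab_leibniz, L.bracket_smul_left, smulSec_add]; abel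
  add_right b s t := by
    simp only [basicConnA, L.rho_add, map_add, LinearMap.add_apply]; abel
  leibniz f b s := by
    simp only [basicConnA, L.rho_smul, nab.conn_smul, L.bracket_smul, smulSec_add]; abel

theorem basicConnT_isConn : IsConn L (basicConnT L nab) where
  add_left b b' s := by
    simp only [basicConnT, L.rho_add, map_add, LinearMap.add_apply]; abel
  smul_left f b s := by
    simp only [basicConnT, nab_leibniz, L.rho_add, L.rho_smul, bracket_VF_smul_left, smulSec_add]
    abel
  add_right b s t := by
    simp only [basicConnT, L.rho_add, map_add, LinearMap.add_apply]; abel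
  leibniz f b s := by
    simp only [basicConnT, nab.conn_smul, L.rho_smul, bracket_VF_smul, smulSec_add]; abel

/-- Linearity in the second section is deduced from linearity in the first by means of this
symmetry. -/
theorem basicCurvature_skew (α β : Sec E FA A) (X : VF E M) :
    basicCurvature L nab α β X = -basicCurvature L nab β α X := by
  simp only [basicCurvature]
  rw [L.bracket_skew β α, L.bracket_skew (nab.conn X β) α, L.bracket_skew β (nab.conn X α), map_neg]
  abel

theorem basicCurvature_add (α α' β : Sec E FA A) (X : VF E M) :
    basicCurvature L nab (α + α') β X = basicCurvature L nab α β X + basicCurvature L nab α' β X := by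
  simp only [basicCurvature, (basicConnT_isConn L nab).add_left, map_add, LinearMap.add_apply]
  abel

/-- The derivatives of `f` along `ρ(∇_X β)` and along `[ρ(β), X]`, produced by the first three
terms, are cancelled by the derivative along `∇^bas_β X`, which is the sum of these two vector
fields. -/
theorem basicCurvature_smul (f : Fn E M) (α β : Sec E FA A) (X : VF E M) :
    basicCurvature L nab (smulSec f α) β X = smulSec f (basicCurvature L nab α β X) := by
  simp only [basicCurvature, (basicConnT_isConn L nab).smul_left, nab_leibniz, map_add, map_sub,
    LinearMap.add_apply, L.bracket_smul_left, nab.conn_smul, smulSec_add,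
    smulSec_sub]
  rw [basicConnT, basicConnT]
  simp only [lieFn_vadd, lieFn_bracket_VF, add_smulSec, sub_smulSec]
  abel

theorem basicCurvature_smul_VF (f : Fn E M) (α β : Sec E FA A) (X : VF E M) :
    basicCurvature L nab α β (smulSec f X) = smulSec f (basicCurvature L nab α β X) := by
  simp only [basicCurvature, (basicConnT_isConn L nab).leibniz, map_add,
    LinearMap.add_apply, L.bracket_smul_left, L.bracket_smul, nab.conn_smul, smulSec_add,
    smulSec_sub]
  abel

theorem adjoint_conj_isTensorial : (adjoint L nab).conj.IsTensorial L where
  bd s := ⟨-L.rho s, fun x => rfl⟩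
  conn₀ := basicConnA_isConn L nab
  conn₁ := basicConnT_isConn L nab
  K_add₁ b b' c s := by
    simp only [adjoint, TwoTermOperator.conj, basicCurvature_add]; abel
  K_add₂ b b' c s := by
    simp only [adjoint, TwoTermOperator.conj]
    rw [basicCurvature_skew, basicCurvature_add, basicCurvature_skew L nab b b',
      basicCurvature_skew L nab b c]
    abel
  K_add₃ b b' c s := by
    simp only [adjoint, TwoTermOperator.conj, basicCurvature, (basicConnT_isConn L nab).add_right,
      map_add, LinearMap.add_apply]
    abel
  K_smul₁ f b c s := by
    simp only [adjoint, TwoTermOperator.conj, basicCurvature_smul, smulSec_neg]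
  K_smul₂ f b c s := by
    simp only [adjoint, TwoTermOperator.conj]
    rw [basicCurvature_skew, basicCurvature_smul, basicCurvature_skew L nab b c]
    simp only [smulSec_neg]
  K_smul₃ f b c s := by
    simp only [adjoint, TwoTermOperator.conj, basicCurvature_smul_VF, smulSec_neg]

/-! #### Existence and uniqueness -/

/-- Values of the vertical differential on generators. -/
theorem isVerticalDifferential_iff {d : Weil E FA A →ₗ[ℝ] Weil E FA A} :
    IsVerticalDifferential nab d ↔ IsOddDer d ∧
      (∀ f, d (wF FA A f) = wT FA A (dFn (LieAlgebroid.tangent E M) f)) ∧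
      (∀ ν, d (wT FA A ν) = strForm (LieAlgebroid.tangent E M) (gensT E FA A) ν) ∧
      (∀ η, d (wΛ η) = str₁ (LieAlgebroid.tangent E M) (double nab) (gensT E FA A) (gensS E FA A)
        (gensΛ E FA A) η) ∧
      (∀ η, d (wS η) = str₀ (LieAlgebroid.tangent E M) (double nab) (gensT E FA A) (gensS E FA A)
        (gensΛ E FA A) η) :=
  (double_isTensorial nab).isDualStructureOperator_iff (GB := gensT E FA A)
    (G₀ := gensS E FA A) (G₁ := gensΛ E FA A)

/-- Values of the horizontal differential on generators. -/
theorem isHorizontalDifferential_iff {d : Weil E FA A →ₗ[ℝ] Weil E FA A} :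
    IsHorizontalDifferential L nab d ↔ IsOddDer d ∧
      (∀ f, d (wF FA A f) = wΛ (dFn L f)) ∧
      (∀ ν, d (wΛ ν) = strForm L (gensΛ E FA A) ν) ∧
      (∀ η, d (wT FA A η) = str₁ L (adjoint L nab).conj (gensΛ E FA A) (gensS E FA A)
        (gensT E FA A) η) ∧
      (∀ η, d (wS η) = str₀ L (adjoint L nab).conj (gensΛ E FA A) (gensS E FA A)
        (gensT E FA A) η) :=
  (adjoint_conj_isTensorial L nab).isDualStructureOperator_iff (GB := gensΛ E FA A)
    (G₀ := gensS E FA A) (G₁ := gensT E FA A)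

/-- If `a` vanishes near `x` and `χ` is a cut-off supported there, then `0 = d(χ a) = d(χ) a + χ
d(a)`, which at `x` reads `d(a) = 0`. -/
theorem IsOddDer.isLocalOp {d : Weil E FA A →ₗ[ℝ] Weil E FA A} (hd : IsOddDer d) :
    IsLocalOp d := fun a x ha => by
  obtain ⟨χ, h1, h2⟩ := exists_bump (E := E) ha
  have h : wF FA A χ * a = 0 := weil_ext fun y => by
    rw [wF_mul_apply]
    by_cases hy : y ∈ tsupport χ
    · rw [show a.1 y = 0 from h2 hy, smul_zero]; rfl
    · rw [image_eq_zero_of_notMem_tsupport hy, zero_smul]; rfl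
  have h' := hd (wF FA A χ) a
  rw [h, map_zero, wpar_wF] at h'
  have h3 : (0 : Weil E FA A).1 x = (d (wF FA A χ) * a + wF FA A χ * d a).1 x := by rw [← h']
  rw [weil_zero_apply, weil_add_apply, weil_mul_apply, ha.self_of_nhds, mul_zero, zero_add,
    wF_mul_apply, h1.self_of_nhds, one_smul] at h3
  exact h3.symm

theorem IsOddDer.ext {d d' : Weil E FA A →ₗ[ℝ] Weil E FA A} (hd : IsOddDer d) (hd' : IsOddDer d')
    (hF : ∀ f, d (wF FA A f) = d' (wF FA A f)) (hT : ∀ ν, d (wT FA A ν) = d' (wT FA A ν))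
    (hΛ : ∀ ν, d (wΛ ν) = d' (wΛ ν)) (hS : ∀ ν, d (wS ν) = d' (wS ν)) : d = d' :=
  LinearMap.ext (weil_op_eq hd.isLocalOp hd'.isLocalOp
    (fun a b ha hb => by rw [hd, hd', ha, hb]) hF hT hΛ hS)

/-- The vertical derivation data. -/
def verticalData : DerivationData E FA A where
  k := genT E A
  k_mul x ξ a := genT_mul ξ a
  κ f := wT FA A (dFn (LieAlgebroid.tangent E M) f)
  κ_apply f x := rfl
  OT := linearOfLeibniz (LieAlgebroid.tangent E M) (gensT E FA A) _ _ (strForm_add _ _)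
    (strForm_smul _ gensT_isOdd)
  OΛ := linearOfLeibniz (LieAlgebroid.tangent E M) (gensT E FA A) _ _
    (str₁_add (GB := gensT E FA A) (G₀ := gensS E FA A) (G₁ := gensΛ E FA A)
      (double_isTensorial nab)) (str₁_smul (double_isTensorial nab))
  OS := linearOfLeibniz (LieAlgebroid.tangent E M) (gensT E FA A) _ _
    (str₀_add (GB := gensT E FA A) (G₀ := gensS E FA A) (G₁ := gensΛ E FA A)
      (double_isTensorial nab)) (str₀_smul (double_isTensorial nab))
  OT_smul := strForm_smul _ gensT_isOdd
  OΛ_smul := str₁_smul (double_isTensorial nab)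
  OS_smul := str₀_smul (double_isTensorial nab)
  OT_parity := strForm_parity _ gensT_isOdd
  OΛ_parity := str₁_parity (double_isTensorial nab) gensT_isOdd gensS_isEven gensΛ_isOdd
  OS_parity := str₀_parity (double_isTensorial nab) gensT_isOdd gensS_isEven gensΛ_isOdd
  c := (0, 1)
  k_mem x ξ := genT_mem_fiberGr ξ
  OT_mem := strForm_mem _
  OΛ_mem := str₁_mem (double_isTensorial nab) rfl
  OS_mem := str₀_mem (double_isTensorial nab) rfl

/-- The horizontal derivation data. -/
def horizontalData : DerivationData E FA A where
  k x := genΛ E A x ∘ₗ (L.anchor x).dualMap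
  k_mul x ξ a := genΛ_mul _ a
  κ f := wΛ (dFn L f)
  κ_apply f x := rfl
  OΛ := linearOfLeibniz L (gensΛ E FA A) _ _ (strForm_add _ _)
    (strForm_smul _ gensΛ_isOdd)
  OT := linearOfLeibniz L (gensΛ E FA A) _ _
    (str₁_add (GB := gensΛ E FA A) (G₀ := gensS E FA A) (G₁ := gensT E FA A)
      (adjoint_conj_isTensorial L nab)) (str₁_smul (adjoint_conj_isTensorial L nab))
  OS := linearOfLeibniz L (gensΛ E FA A) _ _
    (str₀_add (GB := gensΛ E FA A) (G₀ := gensS E FA A) (G₁ := gensT E FA A)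
      (adjoint_conj_isTensorial L nab)) (str₀_smul (adjoint_conj_isTensorial L nab))
  OΛ_smul := strForm_smul _ gensΛ_isOdd
  OT_smul := str₁_smul (adjoint_conj_isTensorial L nab)
  OS_smul := str₀_smul (adjoint_conj_isTensorial L nab)
  OΛ_parity := strForm_parity _ gensΛ_isOdd
  OT_parity := str₁_parity (adjoint_conj_isTensorial L nab) gensΛ_isOdd gensS_isEven gensT_isOdd
  OS_parity := str₀_parity (adjoint_conj_isTensorial L nab) gensΛ_isOdd gensS_isEven gensT_isOdd
  c := (1, 0)
  k_mem x ξ := genΛ_mem_fiberGr _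
  OΛ_mem := strForm_mem _
  OT_mem := str₁_mem (adjoint_conj_isTensorial L nab) rfl
  OS_mem := str₀_mem (adjoint_conj_isTensorial L nab) rfl

/-- `d` shifts bidegrees by `c`. -/
def Shifts (d : Weil E FA A →ₗ[ℝ] Weil E FA A) (c : ℤ × ℤ) : Prop :=
  ∀ a (n : ℤ × ℤ), (∀ x, a.1 x ∈ biGr E A x n) → ∀ x, (d a).1 x ∈ biGr E A x (n + c)

theorem exists_verticalDifferential :
    ∃ d : Weil E FA A →ₗ[ℝ] Weil E FA A, IsVerticalDifferential nab d ∧ Shifts d (0, 1) := by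
  obtain ⟨d, h1, h2, h3, h4, h5, h6⟩ := (verticalData nab).exists_derivation
  exact ⟨d, (isVerticalDifferential_iff nab).2 ⟨h1, h2, h3, h4, h5⟩, h6⟩

theorem exists_horizontalDifferential :
    ∃ d : Weil E FA A →ₗ[ℝ] Weil E FA A, IsHorizontalDifferential L nab d ∧ Shifts d (1, 0) := by
  obtain ⟨d, h1, h2, h3, h4, h5, h6⟩ := (horizontalData L nab).exists_derivation
  exact ⟨d, (isHorizontalDifferential_iff L nab).2 ⟨h1, h2, h4, h3, h5⟩, h6⟩

theorem verticalDifferential_unique {d d' : Weil E FA A →ₗ[ℝ] Weil E FA A}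
    (h : IsVerticalDifferential nab d) (h' : IsVerticalDifferential nab d') : d = d' := by
  obtain ⟨h1, h2, h3, h4, h5⟩ := (isVerticalDifferential_iff nab).1 h
  obtain ⟨h1', h2', h3', h4', h5'⟩ := (isVerticalDifferential_iff nab).1 h'
  exact h1.ext h1' (fun f => by rw [h2, h2']) (fun f => by rw [h3, h3'])
    (fun f => by rw [h4, h4']) (fun f => by rw [h5, h5'])

theorem horizontalDifferential_unique {d d' : Weil E FA A →ₗ[ℝ] Weil E FA A}
    (h : IsHorizontalDifferential L nab d) (h' : IsHorizontalDifferential L nab d') : d = d' := by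
  obtain ⟨h1, h2, h3, h4, h5⟩ := (isHorizontalDifferential_iff L nab).1 h
  obtain ⟨h1', h2', h3', h4', h5'⟩ := (isHorizontalDifferential_iff L nab).1 h'
  exact h1.ext h1' (fun f => by rw [h2, h2']) (fun f => by rw [h4, h4'])
    (fun f => by rw [h3, h3']) (fun f => by rw [h5, h5'])

/-- The construction records the bidegree shift, and by uniqueness the given operator is the
constructed one. -/
theorem IsVerticalDifferential.shifts {nab : Connection (LieAlgebroid.tangent E M) FA A}
    {d : Weil E FA A →ₗ[ℝ] Weil E FA A} (h : IsVerticalDifferential nab d) : Shifts d (0, 1) := by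
  obtain ⟨d', h1, h2⟩ := exists_verticalDifferential nab
  rwa [verticalDifferential_unique nab h h1]

theorem IsHorizontalDifferential.shifts {L : LieAlgebroid E FA A}
    {nab : Connection (LieAlgebroid.tangent E M) FA A}
    {d : Weil E FA A →ₗ[ℝ] Weil E FA A} (h : IsHorizontalDifferential L nab d) :
    Shifts d (1, 0) := by
  obtain ⟨d', h1, h2⟩ := exists_horizontalDifferential L nab
  rwa [horizontalDifferential_unique L nab h h1]

end StructureExistence

/-! ### Euler operators on the fibres -/

section FibreEuler

variable {E : Type*} [NormedAddCommGroup E] [NormedSpace ℝ E] [FiniteDimensional ℝ E]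
  {M : Type*} [TopologicalSpace M] [ChartedSpace E M] [IsManifold 𝓘(ℝ, E) ∞ M]
  {A : M → Type*} [∀ x, AddCommGroup (A x)] [∀ x, Module ℝ (A x)] [∀ x, TopologicalSpace (A x)]
  {x : M}

/-- An even derivation which is a multiple of the identity on each kind of generators. -/
theorem even_eigen (N : WeilFiber E A x →ₗ[ℝ] WeilFiber E A x)
    (hN : ∀ a b, N (a * b) = N a * b + a * N b) {cT cΛ cS : ℝ}
    (hT : ∀ ξ, N (genT E A x ξ) = cT • genT E A x ξ)
    (hΛ : ∀ ξ, N (genΛ E A x ξ) = cΛ • genΛ E A x ξ)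
    (hS : ∀ ξ, N (genS E A x ξ) = cS • genS E A x ξ) {t : ℕ × ℕ × ℕ} {a : WeilFiber E A x}
    (ha : a ∈ triGr E A x t) : N a = (t.1 * cT + t.2.1 * cS + t.2.2 * cΛ) • a := by
  let V : ℝ → Submodule ℝ (WeilFiber E A x) := fun c => LinearMap.ker (N - c • LinearMap.id)
  have hV : ∀ c a, a ∈ V c ↔ N a = c • a := fun c a => by
    rw [LinearMap.mem_ker, LinearMap.sub_apply, sub_eq_zero, LinearMap.smul_apply, LinearMap.id_apply]
  have h1 : N 1 = 0 := by
    have h := hN 1 1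
    rw [mul_one, mul_one, one_mul, left_eq_add] at h
    exact h
  have h := fiberPiece_le_of_mul V ((hV _ _).2 (by rw [h1, zero_smul]))
    (fun c d a b ha hb => (hV _ _).2 (by
      rw [hN, (hV _ _).1 ha, (hV _ _).1 hb, smul_mul_assoc, mul_smul_comm, add_smul]))
    (fun ξ => (hV _ _).2 (hT ξ)) (fun ξ => (hV _ _).2 (hΛ ξ)) (fun ξ => (hV _ _).2 (hS ξ))
    t.1 t.2.1 t.2.2 ((fiberPiece_eq_triGr t.1 t.2.1 t.2.2).ge ha)
  simpa only [nsmul_eq_mul] using (hV _ _).1 h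

theorem triProj_eq_zero_of_eigen (N : WeilFiber E A x →ₗ[ℝ] WeilFiber E A x) {c : ℕ × ℕ × ℕ → ℝ}
    (hN : ∀ t, ∀ a ∈ triGr E A x t, N a = c t • a) {a : WeilFiber E A x} (ha : N a = 0)
    {t : ℕ × ℕ × ℕ} (ht : c t ≠ 0) : triProj E A x t a = 0 := by
  have h : ∀ a, triProj E A x t (N a) = c t • triProj E A x t a := by
    refine fiberGr_induction ((1, 0, 0) : ℕ × ℕ × ℕ) (0, 0, 1) (0, 1, 0) (fun m a ha => ?_) (by simp) (fun a b ha hb => ?_)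
    · rw [hN m a ha, map_smul]
      by_cases h : m = t
      · rw [h]
      · rw [fiberProj_of_mem_ne h ha, smul_zero, smul_zero]
    · simp only [map_add, ha, hb, smul_add]
  have h' := h a
  rw [ha, map_zero] at h'
  exact (smul_eq_zero.1 h'.symm).resolve_left ht

/-- A form on `A` whose contractions vanish has no component of positive degree. -/
theorem triProj_eq_zero_of_contrΛ {ι : Type*} [Fintype ι] (b : Module.Basis ι ℝ (A x))
    {a : WeilFiber E A x} (ha : ∀ i, contr E A x 0 (b i) a = 0) {t : ℕ × ℕ × ℕ} (ht : t.2.2 ≠ 0) :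
    triProj E A x t a = 0 := by
  -- The Euler operator `∑ bⁱ ι_{bᵢ}` is an even derivation which multiplies by the number `w` of
  -- factors from `Λ¹A*`.
  let N : WeilFiber E A x →ₗ[ℝ] WeilFiber E A x :=
    ∑ i, LinearMap.mulLeft ℝ (genΛ E A x (b.coord i)) ∘ₗ contr E A x 0 (b i)
  have hN : ∀ a, N a = ∑ i, genΛ E A x (b.coord i) * contr E A x 0 (b i) a := fun a => by
    simp only [N, LinearMap.sum_apply, LinearMap.comp_apply, LinearMap.mulLeft_apply]
  refine triProj_eq_zero_of_eigen N (c := fun t => t.1 * 0 + t.2.1 * 0 + t.2.2 * 1)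
    (fun t a ha => even_eigen N (fun y z => ?_) (fun ξ => ?_) (fun η => ?_) (fun η => ?_) ha)
    (by rw [hN]; exact Finset.sum_eq_zero fun i _ => by rw [ha, mul_zero])
    (by simpa using! ht)
  · simp only [hN, Finset.sum_mul, Finset.mul_sum, ← Finset.sum_add_distrib]
    refine Finset.sum_congr rfl fun i _ => ?_
    rw [contr_isOddFiberDer, mul_add, ← mul_assoc, ← mul_assoc, genΛ_mul (b.coord i) (parity E A x y),
      parity_parity, mul_assoc y]
  · rw [hN, zero_smul]
    exact Finset.sum_eq_zero fun i _ => by rw [contr_genT, map_zero, map_zero, mul_zero]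
  · have h : η = ∑ i, η (b i) • b.coord i := by
      refine b.ext fun k => ?_
      classical
      rw [LinearMap.sum_apply]
      simp [Finsupp.single_apply]
    rw [hN, one_smul]
    conv_rhs => rw [h]
    rw [map_sum]
    exact Finset.sum_congr rfl fun i _ => by
      rw [contr_genΛ, ← Algebra.commutes, ← Algebra.smul_def, map_smul]
  · rw [hN, zero_smul]
    exact Finset.sum_eq_zero fun i _ => by rw [contr_genS, mul_zero]

/-- A form on `M` whose contractions vanish has no component of positive degree. -/
theorem triProj_eq_zero_of_contrT {ι : Type*} [Fintype ι]
    (b : Module.Basis ι ℝ (TangentSpace 𝓘(ℝ, E) x))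
    {a : WeilFiber E A x} (ha : ∀ i, contr E A x (b i) 0 a = 0) {t : ℕ × ℕ × ℕ} (ht : t.1 ≠ 0) :
    triProj E A x t a = 0 := by
  let N : WeilFiber E A x →ₗ[ℝ] WeilFiber E A x :=
    ∑ i, LinearMap.mulLeft ℝ (genT E A x (b.coord i)) ∘ₗ contr E A x (b i) 0
  have hN : ∀ a, N a = ∑ i, genT E A x (b.coord i) * contr E A x (b i) 0 a := fun a => by
    simp only [N, LinearMap.sum_apply, LinearMap.comp_apply, LinearMap.mulLeft_apply]
  refine triProj_eq_zero_of_eigen N (c := fun t => t.1 * 1 + t.2.1 * 0 + t.2.2 * 0)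
    (fun t a ha => even_eigen N (fun y z => ?_) (fun ξ => ?_) (fun η => ?_) (fun η => ?_) ha)
    (by rw [hN]; exact Finset.sum_eq_zero fun i _ => by rw [ha, mul_zero])
    (by simpa using! ht)
  · simp only [hN, Finset.sum_mul, Finset.mul_sum, ← Finset.sum_add_distrib]
    refine Finset.sum_congr rfl fun i _ => ?_
    rw [contr_isOddFiberDer, mul_add, ← mul_assoc, ← mul_assoc, genT_mul (b.coord i) (parity E A x y),
      parity_parity, mul_assoc y]
  · have h : ξ = ∑ i, ξ (b i) • b.coord i := by
      refine b.ext fun k => ?_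
      classical
      rw [LinearMap.sum_apply]
      simp [Finsupp.single_apply]
    rw [hN, one_smul]
    conv_rhs => rw [h]
    rw [map_sum]
    exact Finset.sum_congr rfl fun i _ => by
      rw [contr_genT, ← Algebra.commutes, ← Algebra.smul_def, map_smul]
  · rw [hN, zero_smul]
    exact Finset.sum_eq_zero fun i _ => by rw [contr_genΛ, map_zero, map_zero, mul_zero]
  · rw [hN, zero_smul]
    exact Finset.sum_eq_zero fun i _ => by rw [contr_genS, mul_zero]

theorem biGr_eq_zero {n : ℤ × ℤ} {a : WeilFiber E A x} (ha : a ∈ biGr E A x n)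
    (h : ∀ t : ℕ × ℕ × ℕ, ((t.2.1 : ℤ) + t.2.2, (t.1 : ℤ) + t.2.1) = n → triProj E A x t a = 0) :
    a = 0 := by
  rw [← fiberProj_of_mem ha, biProj_eq_sum]
  exact Finset.sum_eq_zero fun t ht => h t (mem_biFiber.1 ht)

variable (E A) in
theorem algebraMap_weilFiber_injective (x : M) :
    Function.Injective (algebraMap ℝ (WeilFiber E A x)) :=
  Function.LeftInverse.injective (g := fun a => (exists_weilLift (E := E) (A := A) (x := x)
    (H := ℝ) 0 0 0 (by simp) (by simp) (by simp) (by simp)).choose a) fun r => AlgHom.commutes _ r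

/-- An element `μ_η` is sent to `θ_η`, and the contractions of `θ_η` recover all values of `η`. -/
theorem triGr_S_eq_zero {a : WeilFiber E A x} (ha : a ∈ triGr E A x (0, 1, 0))
    (h : koszulH E A x a = 0) : a = 0 := by
  rw [← fiberPiece_eq_triGr] at ha
  simp only [fiberPiece, pow_zero, pow_one, one_mul, mul_one] at ha
  obtain ⟨η, rfl⟩ := ha
  rw [koszulH_genS] at h
  have : η = 0 := LinearMap.ext fun v => by
    have h' := contr_genΛ (E := E) (x := x) 0 v η
    rw [h, map_zero] at h'
    exact algebraMap_weilFiber_injective E A x (h'.symm.trans (map_zero _).symm)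
  rw [this, map_zero]

end FibreEuler

/-! ### Derivations of the algebra of sections -/

section OperatorCalculus

variable {E : Type*} [NormedAddCommGroup E] [NormedSpace ℝ E] [FiniteDimensional ℝ E]
  {M : Type*} [TopologicalSpace M] [ChartedSpace E M] [IsManifold 𝓘(ℝ, E) ∞ M]
  {FA : Type*} [NormedAddCommGroup FA] [NormedSpace ℝ FA]
  {A : M → Type*} [TopologicalSpace (TotalSpace FA A)] [∀ x, AddCommGroup (A x)]
  [∀ x, Module ℝ (A x)] [∀ x, TopologicalSpace (A x)] [FiberBundle FA A] [VectorBundle ℝ FA A]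

/-- An odd derivation of `W`. -/
structure OddD (D : Weil E FA A →ₗ[ℝ] Weil E FA A) : Prop where
  der : IsOddDer D
  rev : ParityRev D

/-- An even derivation of `W`. -/
structure EvenD (D : Weil E FA A →ₗ[ℝ] Weil E FA A) : Prop where
  der : IsEvenDer D
  pres : ParityPres D

variable {D D' N : Weil E FA A →ₗ[ℝ] Weil E FA A}

theorem OddD.mul_eq_zero (hD : OddD D) {a b : Weil E FA A} (ha : D a = 0) (hb : D b = 0) :
    D (a * b) = 0 := by
  rw [hD.der, ha, hb, zero_mul, mul_zero, add_zero]

theorem EvenD.mul_eq_zero (hD : EvenD D) {a b : Weil E FA A} (ha : D a = 0) (hb : D b = 0) :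
    D (a * b) = 0 := by
  rw [hD.der, ha, hb, zero_mul, mul_zero, add_zero]

/-- The anticommutator of two odd derivations. -/
theorem OddD.anti (hD : OddD D) (hD' : OddD D') : EvenD (D ∘ₗ D' + D' ∘ₗ D) where
  der a b := by
    simp only [LinearMap.add_apply, LinearMap.comp_apply]
    rw [hD'.der, hD.der, map_add, map_add, hD.der, hD.der, hD'.der, hD'.der, hD.rev, hD'.rev,
      wpar_wpar]
    simp only [add_mul, mul_add, neg_mul]
    abel
  pres a := by
    simp only [LinearMap.add_apply, LinearMap.comp_apply]
    rw [hD'.rev, hD.rev, map_neg, map_neg, hD'.rev, hD.rev, neg_neg, neg_neg, map_add]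

/-- The commutator of an even and an odd derivation. -/
theorem EvenD.comm (hN : EvenD N) (hD : OddD D) : OddD (N ∘ₗ D - D ∘ₗ N) where
  der a b := by
    simp only [LinearMap.sub_apply, LinearMap.comp_apply]
    rw [hN.der, hD.der, map_add, map_add, hN.der, hN.der, hD.der, hD.der, hN.pres]
    simp only [sub_mul, mul_sub]
    abel
  rev a := by
    simp only [LinearMap.sub_apply, LinearMap.comp_apply]
    rw [hN.pres, hD.rev, map_neg, hN.pres, hD.rev, map_sub]
    abel

theorem OddD.sub (hD : OddD D) (hD' : OddD D') : OddD (D - D') where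
  der a b := by
    simp only [LinearMap.sub_apply]
    rw [hD.der, hD'.der]
    simp only [sub_mul, mul_sub]
    abel
  rev a := by
    simp only [LinearMap.sub_apply]
    rw [hD.rev, hD'.rev, map_sub]
    abel

theorem Shifts.comp {c c' : ℤ × ℤ} (h : Shifts D c) (h' : Shifts D' c') :
    Shifts (D ∘ₗ D') (c' + c) := fun a n ha x => by
  rw [← add_assoc]
  exact h _ _ (h' a n ha) x

theorem Shifts.add {c : ℤ × ℤ} (h : Shifts D c) (h' : Shifts D' c) :
    Shifts (D + D') c := fun a n ha x => add_mem (h a n ha x) (h' a n ha x)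

theorem shifts_of_fibrewise {φ : ∀ x, WeilFiber E A x →ₗ[ℝ] WeilFiber E A x} {c : ℤ × ℤ}
    (h : ∀ a x, (D a).1 x = φ x (a.1 x))
    (hgr : ∀ x n a, a ∈ biGr E A x n → φ x a ∈ biGr E A x (n + c)) : Shifts D c :=
  fun a n ha x => by rw [h]; exact hgr x n _ (ha x)

/-- The common source of the two kinds of contraction and of the Koszul operator: smoothness, degree
and parity have to be checked on generators only, and the Leibniz rule propagates them. -/
theorem exists_op_of_fibrewise {φ : ∀ x, WeilFiber E A x →ₗ[ℝ] WeilFiber E A x}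
    (hφ : ∀ x, IsOddFiberDer (φ x)) (c : ℤ × ℤ)
    (hT : ∀ ν : Form1 E M, (fun x => φ x (genT E A x (ν.1 x)) : RawWeil E A) ∈ polySections E FA A)
    (hΛ : ∀ ν : SDual E FA A,
      (fun x => φ x (genΛ E A x (ν.1 x)) : RawWeil E A) ∈ polySections E FA A)
    (hS : ∀ ν : SDual E FA A,
      (fun x => φ x (genS E A x (ν.1 x)) : RawWeil E A) ∈ polySections E FA A)
    (gT : ∀ x ξ, φ x (genT E A x ξ) ∈ biGr E A x ((0, 1) + c))
    (gΛ : ∀ x ξ, φ x (genΛ E A x ξ) ∈ biGr E A x ((1, 0) + c))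
    (gS : ∀ x ξ, φ x (genS E A x ξ) ∈ biGr E A x ((1, 1) + c))
    (pT : ∀ x ξ, parity E A x (φ x (genT E A x ξ)) = φ x (genT E A x ξ))
    (pΛ : ∀ x ξ, parity E A x (φ x (genΛ E A x ξ)) = φ x (genΛ E A x ξ))
    (pS : ∀ x ξ, parity E A x (φ x (genS E A x ξ)) = -φ x (genS E A x ξ)) :
    ∃ D : Weil E FA A →ₗ[ℝ] Weil E FA A, (∀ a x, (D a).1 x = φ x (a.1 x)) ∧ OddD D ∧ Shifts D c := by
  have hgr : ∀ x n a, a ∈ biGr E A x n → φ x a ∈ biGr E A x (n + c) := fun x n a ha =>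
    (hφ x).mem_fiberGr (gT x) (gΛ x) (gS x) ha
  have hpoly : ∀ t ∈ polySections E FA A,
      (fun x => φ x (t x) : RawWeil E A) ∈ polySections E FA A := fun t ht => by
    refine polySections_induction (P := fun t => (fun x => φ x (t x) : RawWeil E A) ∈
      polySections E FA A) (fun f => ?_) hT hΛ hS (fun s t hs ht hs' ht' => ?_)
      (fun s t hs ht => ?_) ht
    · have e : (fun x => φ x (algebraMap ℝ (WeilFiber E A x) (f x)) : RawWeil E A) = 0 :=
        funext fun x => (hφ x).map_algebraMap _
      rw [e]
      exact zero_mem _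
    · have e : (fun x => φ x ((s * t) x) : RawWeil E A) =
          (show RawWeil E A from fun x => φ x (s x)) * t +
          (show RawWeil E A from fun x => parity E A x (s x)) *
            (show RawWeil E A from fun x => φ x (t x)) := funext fun x => hφ x _ _
      rw [e]
      exact add_mem (mul_mem hs' ht) (mul_mem (parity_mem_polySections hs) ht')
    · have e : (fun x => φ x ((s + t) x) : RawWeil E A) =
          (show RawWeil E A from fun x => φ x (s x)) +
            (show RawWeil E A from fun x => φ x (t x)) := funext fun x => map_add _ _ _
      rw [e]
      exact add_mem hs ht
  obtain ⟨D, hD⟩ := exists_fibrewise φ c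
    (fun t ht => polySections_le_locPoly (hpoly t ht)) hgr
  refine ⟨D, hD, ⟨isOddDer_of_fibrewise hφ hD, fun a => weil_ext fun x => ?_⟩,
    shifts_of_fibrewise hD hgr⟩
  rw [hD, wpar_apply, weil_neg_apply, wpar_apply, hD]
  refine weilFiber_induction (P := fun a => φ x (parity E A x a) = -parity E A x (φ x a))
    (fun r => ?_) (fun ξ => ?_) (fun ξ => ?_) (fun ξ => ?_) (fun a b ha hb => ?_)
    (fun a b ha hb => ?_) (a.1 x)
  · rw [AlgHom.commutes, (hφ x).map_algebraMap, map_zero, neg_zero]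
  · rw [parity_genT, map_neg, pT]
  · rw [parity_genΛ, map_neg, pΛ]
  · rw [parity_genS, pS, neg_neg]
  · rw [map_mul, hφ x, hφ x, ha, hb, map_add, map_mul, map_mul]
    simp only [neg_mul, mul_neg]
    abel
  · rw [map_add, map_add, map_add, map_add, ha, hb, neg_add]

theorem const_mem_polySections (f : Fn E M) :
    (fun x => algebraMap ℝ (WeilFiber E A x) (f x) : RawWeil E A) ∈ polySections E FA A :=
  Algebra.subset_adjoin (Or.inl (Or.inl (Or.inl ⟨f, rfl⟩)))

variable (FA A) in
theorem exists_contrT (X : VF E M) : ∃ D : Weil E FA A →ₗ[ℝ] Weil E FA A,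
    (∀ a x, (D a).1 x = contr E A x (X x) 0 (a.1 x)) ∧ OddD D ∧ Shifts D (0, -1) := by
  refine exists_op_of_fibrewise (fun x => contr_isOddFiberDer _ _) _ (fun ν => ?_) (fun ν => ?_)
    (fun ν => ?_) (fun x ξ => ?_) (fun x ξ => ?_) (fun x ξ => ?_) (fun x ξ => ?_) (fun x ξ => ?_)
    (fun x ξ => ?_)
  · simp only [contr_genT]; exact const_mem_polySections (pair ν X)
  · simp only [contr_genΛ, map_zero]; exact zero_mem _
  · simp only [contr_genS]; exact zero_mem _
  · rw [contr_genT]; exact algebraMap_mem_fiberGr _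
  · rw [contr_genΛ, map_zero, map_zero]; exact zero_mem _
  · rw [contr_genS]; exact zero_mem _
  · rw [contr_genT, AlgHom.commutes]
  · rw [contr_genΛ, AlgHom.commutes]
  · rw [contr_genS, map_zero, neg_zero]

theorem exists_contrΛ (α : Sec E FA A) : ∃ D : Weil E FA A →ₗ[ℝ] Weil E FA A,
    (∀ a x, (D a).1 x = contr E A x 0 (α x) (a.1 x)) ∧ OddD D ∧ Shifts D (-1, 0) := by
  refine exists_op_of_fibrewise (fun x => contr_isOddFiberDer _ _) _ (fun ν => ?_) (fun ν => ?_)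
    (fun ν => ?_) (fun x ξ => ?_) (fun x ξ => ?_) (fun x ξ => ?_) (fun x ξ => ?_) (fun x ξ => ?_)
    (fun x ξ => ?_)
  · simp only [contr_genT, map_zero]; exact zero_mem _
  · simp only [contr_genΛ]; exact const_mem_polySections (pair ν α)
  · simp only [contr_genS]; exact zero_mem _
  · rw [contr_genT, map_zero, map_zero]; exact zero_mem _
  · rw [contr_genΛ]; exact algebraMap_mem_fiberGr _
  · rw [contr_genS]; exact zero_mem _
  · rw [contr_genT, AlgHom.commutes]
  · rw [contr_genΛ, AlgHom.commutes]
  · rw [contr_genS, map_zero, neg_zero]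

theorem exists_koszulOp : ∃ D : Weil E FA A →ₗ[ℝ] Weil E FA A,
    (∀ a x, (D a).1 x = koszulH E A x (a.1 x)) ∧ OddD D ∧ Shifts D (0, -1) := by
  refine exists_op_of_fibrewise (fun x => koszulH_isOddFiberDer) _ (fun ν => ?_) (fun ν => ?_)
    (fun ν => ?_) (fun x ξ => ?_) (fun x ξ => ?_) (fun x ξ => ?_) (fun x ξ => ?_) (fun x ξ => ?_)
    (fun x ξ => ?_)
  · simp only [koszulH_genT]; exact zero_mem _
  · simp only [koszulH_genΛ]; exact zero_mem _
  · simp only [koszulH_genS]; exact Algebra.subset_adjoin (Or.inl (Or.inr ⟨ν.1, ν.2, rfl⟩))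
  · rw [koszulH_genT]; exact zero_mem _
  · rw [koszulH_genΛ]; exact zero_mem _
  · rw [koszulH_genS]; exact genΛ_mem_fiberGr _
  · rw [koszulH_genT, map_zero]
  · rw [koszulH_genΛ, map_zero]
  · rw [koszulH_genS, parity_genΛ]

/-- Contraction with a vector field. -/
def cT (X : VF E M) : Weil E FA A →ₗ[ℝ] Weil E FA A := (exists_contrT FA A X).choose

/-- Contraction of the `Λ A*` factor with a section of `A`. -/
def cΛ (α : Sec E FA A) : Weil E FA A →ₗ[ℝ] Weil E FA A := (exists_contrΛ α).choose

/-- The odd derivation which maps `μ_η` to `θ_η`. -/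
def hOp : Weil E FA A →ₗ[ℝ] Weil E FA A := exists_koszulOp.choose

section
variable (X : VF E M) (α : Sec E FA A) (a : Weil E FA A) (x : M) (f : Fn E M) (ξ : Form1 E M)
  (η : SDual E FA A)

theorem cT_apply : (cT X a).1 x = contr E A x (X x) 0 (a.1 x) :=
  (exists_contrT FA A X).choose_spec.1 a x
theorem cT_oddD : OddD (cT X : Weil E FA A →ₗ[ℝ] Weil E FA A) :=
  (exists_contrT FA A X).choose_spec.2.1
theorem cT_shifts : Shifts (cT X : Weil E FA A →ₗ[ℝ] Weil E FA A) (0, -1) :=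
  (exists_contrT FA A X).choose_spec.2.2
theorem cT_wF : cT X (wF FA A f) = 0 := weil_ext fun x => by
  rw [cT_apply, wF_apply, (contr_isOddFiberDer _ _).map_algebraMap]; rfl
theorem cT_wT : cT X (wT FA A ξ) = wF FA A (pair ξ X) := weil_ext fun x => by
  rw [cT_apply, wT_apply, contr_genT]; rfl
theorem cT_wΛ : cT X (wΛ η) = 0 := weil_ext fun x => by
  rw [cT_apply, wΛ_apply, contr_genΛ, map_zero, map_zero]; rfl
theorem cT_wS : cT X (wS η) = 0 := weil_ext fun x => by
  rw [cT_apply, wS_apply, contr_genS]; rfl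

theorem cΛ_apply : (cΛ α a).1 x = contr E A x 0 (α x) (a.1 x) :=
  (exists_contrΛ α).choose_spec.1 a x
theorem cΛ_oddD : OddD (cΛ α : Weil E FA A →ₗ[ℝ] Weil E FA A) :=
  (exists_contrΛ α).choose_spec.2.1
theorem cΛ_shifts : Shifts (cΛ α : Weil E FA A →ₗ[ℝ] Weil E FA A) (-1, 0) :=
  (exists_contrΛ α).choose_spec.2.2
theorem cΛ_wF : cΛ α (wF FA A f) = 0 := weil_ext fun x => by
  rw [cΛ_apply, wF_apply, (contr_isOddFiberDer _ _).map_algebraMap]; rfl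
theorem cΛ_wT : cΛ α (wT FA A ξ) = 0 := weil_ext fun x => by
  rw [cΛ_apply, wT_apply, contr_genT, map_zero, map_zero]; rfl
theorem cΛ_wΛ : cΛ α (wΛ η) = wF FA A (pair η α) := weil_ext fun x => by
  rw [cΛ_apply, wΛ_apply, contr_genΛ]; rfl
theorem cΛ_wS : cΛ α (wS η) = 0 := weil_ext fun x => by
  rw [cΛ_apply, wS_apply, contr_genS]; rfl

theorem hOp_apply : (hOp a).1 x = koszulH E A x (a.1 x) := exists_koszulOp.choose_spec.1 a x
theorem hOp_oddD : OddD (hOp : Weil E FA A →ₗ[ℝ] Weil E FA A) := exists_koszulOp.choose_spec.2.1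
theorem hOp_shifts : Shifts (hOp : Weil E FA A →ₗ[ℝ] Weil E FA A) (0, -1) :=
  exists_koszulOp.choose_spec.2.2
theorem hOp_wF : hOp (wF FA A f) = 0 := weil_ext fun x => by
  rw [hOp_apply, wF_apply, koszulH_isOddFiberDer.map_algebraMap]; rfl
theorem hOp_wT : hOp (wT FA A ξ) = 0 := weil_ext fun x => by
  rw [hOp_apply, wT_apply, koszulH_genT]; rfl
theorem hOp_wΛ : hOp (wΛ η) = 0 := weil_ext fun x => by
  rw [hOp_apply, wΛ_apply, koszulH_genΛ]; rfl
theorem hOp_wS : hOp (wS η) = wΛ η := weil_ext fun x => by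
  rw [hOp_apply, wS_apply, koszulH_genS]; rfl
end

variable [T2Space M]

theorem EvenD.isLocalOp (hN : EvenD N) : IsLocalOp N := fun a x ha => by
  obtain ⟨χ, h1, h2⟩ := exists_bump (E := E) ha
  have h : wF FA A χ * a = 0 := weil_ext fun y => by
    rw [wF_mul_apply]
    by_cases hy : y ∈ tsupport χ
    · rw [show a.1 y = 0 from h2 hy, smul_zero]; rfl
    · rw [image_eq_zero_of_notMem_tsupport hy, zero_smul]; rfl
  have h' := hN.der (wF FA A χ) a
  rw [h, map_zero] at h'
  have h3 : (0 : Weil E FA A).1 x = (N (wF FA A χ) * a + wF FA A χ * N a).1 x := by rw [← h']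
  rw [weil_zero_apply, weil_add_apply, weil_mul_apply, ha.self_of_nhds, mul_zero, zero_add,
    wF_mul_apply, h1.self_of_nhds, one_smul] at h3
  exact h3.symm

theorem OddD.isLocalOp [FiniteDimensional ℝ FA] [ContMDiffVectorBundle ∞ FA A 𝓘(ℝ, E)]
    (hD : OddD D) : IsLocalOp D := hD.der.isLocalOp

theorem EvenD.ext {N' : Weil E FA A →ₗ[ℝ] Weil E FA A} (hN : EvenD N) (hN' : EvenD N')
    (hF : ∀ f, N (wF FA A f) = N' (wF FA A f)) (hT : ∀ ν, N (wT FA A ν) = N' (wT FA A ν))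
    (hΛ : ∀ ν, N (wΛ ν) = N' (wΛ ν)) (hS : ∀ ν, N (wS ν) = N' (wS ν)) (a : Weil E FA A) :
    N a = N' a :=
  weil_op_eq hN.isLocalOp hN'.isLocalOp
    (fun a b ha hb => by rw [hN.der, hN'.der, ha, hb]) hF hT hΛ hS a

/-- The operators `D ∘ wpar` and `-wpar ∘ D` obey the same twisted product rule, so it suffices to
compare them on functions and generators. -/
theorem IsOddDer.oddD [FiniteDimensional ℝ FA] [ContMDiffVectorBundle ∞ FA A 𝓘(ℝ, E)]
    (hD : IsOddDer D) (hF : ∀ f, wpar (D (wF FA A f)) = -D (wF FA A f))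
    (hT : ∀ ν, wpar (D (wT FA A ν)) = D (wT FA A ν)) (hΛ : ∀ ν, wpar (D (wΛ ν)) = D (wΛ ν))
    (hS : ∀ ν, wpar (D (wS ν)) = -D (wS ν)) : OddD D := by
  refine ⟨hD, fun a => ?_⟩
  have h := weil_op_eq (D := D ∘ₗ wpar) (D' := 0 - wpar ∘ₗ D) (hD.isLocalOp.comp isLocalOp_wpar)
    (isLocalOp_zero.sub (isLocalOp_wpar.comp hD.isLocalOp)) (fun a b ha hb => ?_) (fun f => ?_)
    (fun f => ?_) (fun f => ?_) (fun f => ?_) a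
  · simpa using h
  all_goals simp only [zero_sub, LinearMap.neg_apply, LinearMap.comp_apply] at *
  · rw [wpar_mul, hD, hD, ha, hb, map_add, wpar_mul, wpar_mul]
    simp only [neg_mul, mul_neg]
    abel
  · rw [wpar_wF, hF, neg_neg]
  · rw [wpar_wT, hT, map_neg]
  · rw [wpar_wΛ, hΛ, map_neg]
  · rw [wpar_wS, hS, neg_neg]

/-! ### Derivations applied to one-forms with values in `W`. -/

section OneFormRules

variable {FB : Type*} [NormedAddCommGroup FB] [NormedSpace ℝ FB]
  {B : M → Type*} [TopologicalSpace (TotalSpace FB B)] [∀ x, AddCommGroup (B x)]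
  [∀ x, Module ℝ (B x)] [∀ x, TopologicalSpace (B x)] [FiberBundle FB B] [VectorBundle ℝ FB B]
  [FiniteDimensional ℝ FB] [ContMDiffVectorBundle ∞ FB B 𝓘(ℝ, E)]
  {G : Gens E FA A FB B} {T : Sec E FB B → Weil E FA A}

theorem IsTensor.apply_eq_sum (hT : IsTensor T) {x : M} {ι : Type*} [Fintype ι]
    (b : Module.Basis ι ℝ (B x)) (s : ι → Sec E FB B) (hs : ∀ i, s i x = b i) (t : Sec E FB B) :
    (T t).1 x = ∑ i, b.coord i (t x) • (T (s i)).1 x := by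
  obtain ⟨τ, hτ⟩ := exists_fibre_map (x := x) (AddMonoidHom.mk' (fun s => (T s).1 x)
    (fun s t => by rw [hT.add, weil_add_apply])) (fun f s => by
      show (T (smulSec f s)).1 x = f x • (T s).1 x
      rw [hT.smul, wF_mul_apply])
  have h : ∀ s, (T s).1 x = τ (s x) := hτ
  simp only [h, hs, ← map_smul, ← map_sum]
  congr 1
  exact (b.sum_repr (t x)).symm

/-- Near `x` the invariantly defined one-form is a finite sum of products of elements of `W`, so
local operators can be applied to it term by term. -/
theorem exists_local_oneForm (x : M) :
    ∃ (s : Fin (Module.finrank ℝ FB) → Sec E FB B) (ν : Fin (Module.finrank ℝ FB) → SDual E FB B),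
      (∀ (G : Gens E FA A FB B) (T : Sec E FB B → Weil E FA A), IsTensor T →
        ∀ᶠ y in 𝓝 x, (oneForm G T).1 y = (∑ i, G.w (ν i) * T (s i)).1 y) ∧
      (∀ (T : Sec E FB B → Weil E FA A), IsTensor T → ∀ t,
        (T t).1 x = ∑ i, (ν i).1 x (t x) • (T (s i)).1 x) := by
  obtain ⟨s, ν, h⟩ := exists_dualFrame (E := E) FB B x
  refine ⟨s, ν, fun G T hT => ?_, fun T hT t => ?_⟩
  · filter_upwards [h] with y hy
    obtain ⟨b, h1, h2⟩ := hy
    rw [hT.oneForm_apply G y ⟨s, b, h1⟩, weil_sum_apply]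
    refine Finset.sum_congr rfl fun i _ => ?_
    rw [weil_mul_apply, G.w_apply, h2]
  · obtain ⟨b, h1, h2⟩ := h.self_of_nhds
    rw [hT.apply_eq_sum b s h1]
    simp only [h2]

/-- This permits operators to be discarded on connection terms and exterior derivatives without
computing them. Only the products of the local expression occur, so neither linearity over functions
nor a particular sign rule is required. -/
theorem map_oneForm_eq_zero (hD : IsLocalOp D)
    (hmul : ∀ a b, D a = 0 → D b = 0 → D (a * b) = 0) (hT : IsTensor T)
    (hG : ∀ ν, D (G.w ν) = 0) (h : ∀ s, D (T s) = 0) : D (oneForm G T) = 0 :=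
  weil_ext fun x => by
    obtain ⟨s, ν, h1, -⟩ := exists_local_oneForm (E := E) (FA := FA) (A := A) (FB := FB) (B := B) x
    rw [hD.congr (h1 G T hT), map_sum, Finset.sum_eq_zero fun i _ => hmul _ _ (hG _) (h _)]

theorem IsTensor.map_odd {c : ℤ × ℤ} (hT : IsTensor T) (hD : IsOddDer D) (hc : Shifts D c)
    (h0 : ∀ f, D (wF FA A f) = 0) : IsTensor (fun s => D (T s)) where
  add s t := by rw [hT.add, map_add]
  smul f s := by rw [hT.smul, hD, h0, zero_mul, zero_add, wpar_wF]
  deg := by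
    obtain ⟨n, hn⟩ := hT.deg
    exact ⟨n + c, fun s x => hc _ _ (hn s) x⟩

/-- In `∑ bⁱ T(bᵢ)` the contraction of the factors `bⁱ` reassembles `T b`, and passing the odd `bⁱ`
gives the minus sign of the other term. -/
theorem contr_oneForm [FiniteDimensional ℝ FA] [ContMDiffVectorBundle ∞ FA A 𝓘(ℝ, E)]
    {c : ℤ × ℤ} (hT : IsTensor T) (hG : G.IsOdd) (hD : IsOddDer D)
    (hc : Shifts D c) (h0 : ∀ f, D (wF FA A f) = 0) {b : Sec E FB B}
    (hb : ∀ ν, D (G.w ν) = wF FA A (pair ν b)) :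
    D (oneForm G T) = T b - oneForm G (fun s => D (T s)) :=
  weil_ext fun x => by
    obtain ⟨s, ν, h1, h2⟩ := exists_local_oneForm (E := E) (FA := FA) (A := A) (FB := FB) (B := B) x
    rw [hD.isLocalOp.congr (h1 G T hT), weil_sub_apply,
      (h1 G _ (hT.map_odd hD hc h0)).self_of_nhds, h2 T hT b, map_sum, weil_sum_apply,
      weil_sum_apply, ← Finset.sum_sub_distrib]
    refine Finset.sum_congr rfl fun i _ => ?_
    rw [hD, hb, hG.wpar, weil_add_apply, wF_mul_apply, neg_mul, weil_neg_apply, sub_eq_add_neg]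
    rfl

/-- Contraction by a derivation that kills the form generators. -/
theorem contr_oneForm_zero [FiniteDimensional ℝ FA] [ContMDiffVectorBundle ∞ FA A 𝓘(ℝ, E)]
    {c : ℤ × ℤ} (hT : IsTensor T) (hG : G.IsOdd) (hD : IsOddDer D)
    (hc : Shifts D c) (h0 : ∀ f, D (wF FA A f) = 0) (hb : ∀ ν, D (G.w ν) = 0) :
    D (oneForm G T) = -oneForm G (fun s => D (T s)) := by
  have hT0 : T 0 = 0 := by
    have h := hT.add 0 0
    rw [add_zero, left_eq_add] at h
    exact h
  rw [contr_oneForm (b := 0) hT hG hD hc h0 (fun ν => ?_), hT0, zero_sub]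
  rw [hb, show pair ν (0 : Sec E FB B) = 0 from ContMDiffMap.ext fun x => map_zero (ν.1 x), map_zero]

end OneFormRules

/-! ### Vanishing criteria by contractions and by the Koszul operator. -/

section Separation

variable [FiniteDimensional ℝ FA] [ContMDiffVectorBundle ∞ FA A 𝓘(ℝ, E)]

theorem triProj_eq_zero_of_cΛ {a : Weil E FA A} (h : ∀ α, cΛ α a = 0) (x : M) {t : ℕ × ℕ × ℕ}
    (ht : t.2.2 ≠ 0) : triProj E A x t (a.1 x) = 0 := by
  obtain ⟨b⟩ := exists_frameAt E FA A x
  refine triProj_eq_zero_of_contrΛ b.basis (fun i => ?_) ht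
  rw [← b.sec_apply, ← cΛ_apply, h]
  rfl

theorem triProj_eq_zero_of_cT {a : Weil E FA A} (h : ∀ X, cT X a = 0) (x : M) {t : ℕ × ℕ × ℕ}
    (ht : t.1 ≠ 0) : triProj E A x t (a.1 x) = 0 := by
  obtain ⟨b⟩ := exists_frameAt E E (TangentSpace 𝓘(ℝ, E) : M → Type _) x
  refine triProj_eq_zero_of_contrT b.basis (fun i => ?_) ht
  rw [← b.sec_apply, ← cT_apply, h]
  rfl

/-- For `(p, q) = (v + w, u + v)` the inequality `q < p` says `u < w`. So every component contains a
factor from `Λ¹A*`, and contractions detect it. -/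
theorem eq_zero_of_cΛ {a : Weil E FA A} {n : ℤ × ℤ} (ha : ∀ x, a.1 x ∈ biGr E A x n)
    (hn : n.2 < n.1) (h : ∀ α, cΛ α a = 0) : a = 0 := weil_ext fun x =>
  biGr_eq_zero (ha x) fun t ht => triProj_eq_zero_of_cΛ h x (by
    rw [← ht] at hn; simp only at hn; omega)

theorem eq_zero_of_cT {a : Weil E FA A} {n : ℤ × ℤ} (ha : ∀ x, a.1 x ∈ biGr E A x n)
    (hn : n.1 < n.2) (h : ∀ X, cT X a = 0) : a = 0 := weil_ext fun x =>
  biGr_eq_zero (ha x) fun t ht => triProj_eq_zero_of_cT h x (by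
    rw [← ht] at hn; simp only at hn; omega)

/-- Only the tridegrees `(1,0,1)` and `(0,1,0)` lie over `(1,1)`. Contractions control the first,
and the Koszul operator is injective on the second. -/
theorem biGr_one_one_eq_zero {x : M} {a : WeilFiber E A x} (ha : a ∈ biGr E A x (1, 1))
    (h : triProj E A x (1, 0, 1) a = 0) (hh : koszulH E A x a = 0) : a = 0 := by
  have e : biFiber (1, 1) = {((1, 0, 1) : ℕ × ℕ × ℕ), (0, 1, 0)} := by
    ext ⟨u, v, w⟩
    rw [mem_biFiber]
    simp only [Prod.mk.injEq, Finset.mem_insert, Finset.mem_singleton]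
    omega
  have h1 : a = triProj E A x (0, 1, 0) a := by
    conv_lhs => rw [← fiberProj_of_mem ha, biProj_eq_sum, e, Finset.sum_pair (by simp), h, zero_add]
  refine triGr_S_eq_zero ?_ hh
  rw [h1]
  exact fiberProj_mem _ _

theorem eq_zero_of_cΛ_hOp {a : Weil E FA A} (ha : ∀ x, a.1 x ∈ biGr E A x (1, 1))
    (h : ∀ α, cΛ α a = 0) (hh : hOp a = 0) : a = 0 := weil_ext fun x =>
  biGr_one_one_eq_zero (ha x) (triProj_eq_zero_of_cΛ h x one_ne_zero)
    (by rw [← hOp_apply, hh]; rfl)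

theorem eq_zero_of_cT_hOp {a : Weil E FA A} (ha : ∀ x, a.1 x ∈ biGr E A x (1, 1))
    (h : ∀ X, cT X a = 0) (hh : hOp a = 0) : a = 0 := weil_ext fun x =>
  biGr_one_one_eq_zero (ha x) (triProj_eq_zero_of_cT h x one_ne_zero)
    (by rw [← hOp_apply, hh]; rfl)

end Separation

end OperatorCalculus

/-! ### Contractions and Lie derivatives for a structure operator -/

section LieCalculus

variable {E : Type*} [NormedAddCommGroup E] [NormedSpace ℝ E] [FiniteDimensional ℝ E]
  {M : Type*} [TopologicalSpace M] [ChartedSpace E M] [IsManifold 𝓘(ℝ, E) ∞ M]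
  {FA : Type*} [NormedAddCommGroup FA] [NormedSpace ℝ FA]
  {A : M → Type*} [TopologicalSpace (TotalSpace FA A)] [∀ x, AddCommGroup (A x)]
  [∀ x, Module ℝ (A x)] [∀ x, TopologicalSpace (A x)] [FiberBundle FA A] [VectorBundle ℝ FA A]
  {FB : Type*} [NormedAddCommGroup FB] [NormedSpace ℝ FB]
  {B : M → Type*} [TopologicalSpace (TotalSpace FB B)] [∀ x, AddCommGroup (B x)]
  [∀ x, Module ℝ (B x)] [∀ x, TopologicalSpace (B x)] [FiberBundle FB B] [VectorBundle ℝ FB B]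
  {F₀ : Type*} [NormedAddCommGroup F₀] [NormedSpace ℝ F₀]
  {V₀ : M → Type*} [TopologicalSpace (TotalSpace F₀ V₀)] [∀ x, AddCommGroup (V₀ x)]
  [∀ x, Module ℝ (V₀ x)] [∀ x, TopologicalSpace (V₀ x)] [FiberBundle F₀ V₀] [VectorBundle ℝ F₀ V₀]
  {F₁ : Type*} [NormedAddCommGroup F₁] [NormedSpace ℝ F₁]
  {V₁ : M → Type*} [TopologicalSpace (TotalSpace F₁ V₁)] [∀ x, AddCommGroup (V₁ x)]
  [∀ x, Module ℝ (V₁ x)] [∀ x, TopologicalSpace (V₁ x)] [FiberBundle F₁ V₁] [VectorBundle ℝ F₁ V₁]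

/-- The square of an odd derivation. -/
theorem OddD.sq {D : Weil E FA A →ₗ[ℝ] Weil E FA A} (hD : OddD D) : EvenD (D ∘ₗ D) where
  der a b := by
    simp only [LinearMap.comp_apply]
    rw [hD.der, map_add, hD.der, hD.der, hD.rev, wpar_wpar]
    simp only [neg_mul]
    abel
  pres a := by
    simp only [LinearMap.comp_apply]
    rw [hD.rev, map_neg, hD.rev, neg_neg]

/-- The Lie derivative `[ι, d]` of an odd operator `ι`. -/
def lieOp (ι d : Weil E FA A →ₗ[ℝ] Weil E FA A) : Weil E FA A →ₗ[ℝ] Weil E FA A :=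
  ι ∘ₗ d + d ∘ₗ ι

theorem lieOp_apply (ι d : Weil E FA A →ₗ[ℝ] Weil E FA A) (a : Weil E FA A) :
    lieOp ι d a = ι (d a) + d (ι a) := rfl

variable (L : LieAlgebroid E FB B) (D : TwoTermOperator E FB B F₀ V₀ F₁ V₁)
  (GB : Gens E FA A FB B) (G₀ : Gens E FA A F₀ V₀) (G₁ : Gens E FA A F₁ V₁)

/-- `d` is an odd derivation with the values of the structure operator on generators. -/
structure IsStructureOp (d : Weil E FA A →ₗ[ℝ] Weil E FA A) : Prop where
  odd : OddD d
  fn : ∀ f, d (wF FA A f) = GB.w (dFn L f)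
  form : ∀ ν, d (GB.w ν) = strForm L GB ν
  one : ∀ η, d (G₁.w η) = str₁ L D GB G₀ G₁ η
  zero : ∀ η, d (G₀.w η) = str₀ L D GB G₀ G₁ η

/-- `ι` is the contraction of the form generators with `b`. -/
structure IsFormContr (b : Sec E FB B) (ι : Weil E FA A →ₗ[ℝ] Weil E FA A) : Prop where
  odd : OddD ι
  shifts : ∃ c, Shifts ι c
  fn : ∀ f, ι (wF FA A f) = 0
  form : ∀ ν, ι (GB.w ν) = wF FA A (pair ν b)
  one : ∀ η, ι (G₁.w η) = 0
  zero : ∀ η, ι (G₀.w η) = 0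

/-- `ι` is the contraction of the odd coefficient generators with `v`. -/
structure IsCoeffContr (v : Sec E F₁ V₁) (ι : Weil E FA A →ₗ[ℝ] Weil E FA A) : Prop where
  odd : OddD ι
  shifts : ∃ c, Shifts ι c
  fn : ∀ f, ι (wF FA A f) = 0
  form : ∀ ν, ι (GB.w ν) = 0
  one : ∀ η, ι (G₁.w η) = wF FA A (pair η v)
  zero : ∀ η, ι (G₀.w η) = 0

variable {L D GB G₀ G₁}
variable [T2Space M] [FiniteDimensional ℝ FB] [ContMDiffVectorBundle ∞ FB B 𝓘(ℝ, E)]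
  [FiniteDimensional ℝ F₀] [ContMDiffVectorBundle ∞ F₀ V₀ 𝓘(ℝ, E)]
  [FiniteDimensional ℝ F₁] [ContMDiffVectorBundle ∞ F₁ V₁ 𝓘(ℝ, E)]
  [FiniteDimensional ℝ FA] [ContMDiffVectorBundle ∞ FA A 𝓘(ℝ, E)]

theorem extD_swap (ν : SDual E FB B) (b c : Sec E FB B) :
    pair (extD L ν c) b = -pair (extD L ν b) c := by
  rw [pair_extD, pair_extD, L.bracket_skew c b, pair_neg]
  abel

theorem extD_dFn (f : Fn E M) (b : Sec E FB B) : extD L (dFn L f) b = 0 :=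
  SDual.ext_pair fun c => by
    rw [pair_extD, pair_dFn, pair_dFn, pair_dFn, L.lieFn_bracket, sub_self]
    rfl

theorem oneForm_zero (G : Gens E FA A FB B) :
    oneForm G (fun _ : Sec E FB B => (0 : Weil E FA A)) = 0 :=
  IsTensor.oneForm_eq ⟨fun _ _ => (add_zero _).symm, fun _ _ => (mul_zero _).symm,
    ⟨0, fun _ _ => zero_mem _⟩⟩ G fun x b => by
      simp only [weil_zero_apply, mul_zero, Finset.sum_const_zero]

theorem IsTensor.neg {T : Sec E FB B → Weil E FA A} (hT : IsTensor T) :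
    IsTensor (fun b => -T b) where
  add s t := by rw [hT.add, neg_add]
  smul f s := by rw [hT.smul, mul_neg]
  deg := hT.deg.imp fun n hn s x => neg_mem (hn s x)

theorem IsTensor.oneForm_neg {T : Sec E FB B → Weil E FA A} (hT : IsTensor T)
    (G : Gens E FA A FB B) : oneForm G (fun b => -T b) = -oneForm G T :=
  hT.neg.oneForm_eq G fun x b => by
    rw [weil_neg_apply, hT.oneForm_apply G x b, ← Finset.sum_neg_distrib]
    exact Finset.sum_congr rfl fun i _ => by rw [weil_neg_apply, mul_neg]

theorem isTensor_wF_pair (ν : SDual E FB B) : IsTensor (fun b => wF FA A (pair ν b)) where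
  add s t := by rw [pair_add, map_add]
  smul f s := by rw [pair_smul, map_mul]
  deg := ⟨0, fun s x => algebraMap_mem_fiberGr _⟩

theorem oneForm_pair (G : Gens E FA A FB B) (ν : SDual E FB B) :
    oneForm G (fun b => wF FA A (pair ν b)) = G.w ν :=
  (isTensor_wF_pair ν).oneForm_eq G (isOneForm_pair G ν)

variable {d ι : Weil E FA A →ₗ[ℝ] Weil E FA A}

section FormContr

variable {b : Sec E FB B} (hB : GB.IsOdd) (hd : IsStructureOp L D GB G₀ G₁ d)
  (hι : IsFormContr GB G₀ G₁ b ι)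
include hB hd hι

/-- By antisymmetry both slots of the two-form contribute the same element, which absorbs the factor
one half. -/
theorem IsFormContr.d_form (ν : SDual E FB B) : ι (d (GB.w ν)) = GB.w (extD L ν b) := by
  obtain ⟨c, hc⟩ := hι.shifts
  rw [hd.form, strForm, map_smul, contr_oneForm (isTensor_extD ν) hB hι.odd.der hc hι.fn hι.form]
  have h : oneForm GB (fun s => ι (GB.w (extD L ν s))) = -GB.w (extD L ν b) := by
    rw [← oneForm_pair, ← (isTensor_wF_pair _).oneForm_neg]
    congr 1
    funext s
    rw [hι.form, extD_swap, map_neg]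
  rw [h, sub_neg_eq_add, ← two_smul ℝ, smul_smul]
  norm_num

theorem IsFormContr.lie_fn (f : Fn E M) : lieOp ι d (wF FA A f) = wF FA A (lieFn (L.rho b) f) := by
  rw [lieOp_apply, hd.fn, hι.fn, map_zero, add_zero, hι.form, pair_dFn]

theorem IsFormContr.lie_form (ν : SDual E FB B) :
    lieOp ι d (GB.w ν) = GB.w (extD L ν b + dFn L (pair ν b)) := by
  rw [lieOp_apply, hι.d_form hB hd, hι.form, hd.fn, (GB.w).map_add]

variable (hD : D.IsTensorial L)
include hD

theorem IsFormContr.lie_one (η : SDual E F₁ V₁) :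
    lieOp ι d (G₁.w η) = G₁.w (connDual L D.conn₁ b η) := by
  obtain ⟨c, hc⟩ := hι.shifts
  rw [lieOp_apply, hι.one, map_zero, add_zero, hd.one, str₁, map_add, hι.zero, zero_add,
    contr_oneForm (hD.conn₁.isTensor G₁ η) hB hι.odd.der hc hι.fn hι.form]
  simp only [hι.one]
  rw [oneForm_zero, sub_zero]

/-- Skewness of `K` makes the contractions of its two form slots agree, so the factor one half
disappears again. The surviving `K` term is why this Lie derivative does not preserve the even
generators. -/
theorem IsFormContr.lie_zero (hK : ∀ b c s, D.K b c s = -D.K c b s) (η : SDual E F₀ V₀) :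
    lieOp ι d (G₀.w η) = G₀.w (connDual L D.conn₀ b η) -
      oneForm GB (fun c => G₁.w (D.KDual b c η)) := by
  obtain ⟨c, hc⟩ := hι.shifts
  have h1 : ∀ s, ι (oneForm GB (fun c => G₁.w (D.KDual s c η))) = -G₁.w (D.KDual b s η) :=
    fun s => by
      rw [contr_oneForm (hD.isTensor_K' s η) hB hι.odd.der hc hι.fn hι.form]
      simp only [hι.one]
      rw [oneForm_zero, sub_zero, ← Gens.w_neg]
      congr 1
      refine SDual.ext_pair fun v => ?_
      rw [neg_pair, hD.pair_KDual, hD.pair_KDual, hK, pair_neg]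
  rw [lieOp_apply, hι.zero, map_zero, add_zero, hd.zero, str₀, map_sub, map_smul,
    contr_oneForm (hD.conn₀.isTensor G₀ η) hB hι.odd.der hc hι.fn hι.form,
    contr_oneForm (hD.isTensor_K η) hB hι.odd.der hc hι.fn hι.form]
  simp only [hι.zero, h1]
  rw [oneForm_zero, sub_zero, (hD.isTensor_K' b η).oneForm_neg, sub_neg_eq_add, ← two_smul ℝ,
    smul_smul]
  norm_num

/-- `[L_b, ι_c] = ι_{[b, c]}` on functions, forms and odd coefficients. -/
theorem IsFormContr.comm {c : Sec E FB B} {ι' ι'' : Weil E FA A →ₗ[ℝ] Weil E FA A}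
    (hι' : IsFormContr GB G₀ G₁ c ι') (hι'' : IsFormContr GB G₀ G₁ (L.bracket b c) ι'') :
    OddD (lieOp ι d ∘ₗ ι' - ι' ∘ₗ lieOp ι d - ι'') ∧
    (∀ ν, (lieOp ι d ∘ₗ ι' - ι' ∘ₗ lieOp ι d - ι'') (GB.w ν) = 0) ∧
    ∀ ν, (lieOp ι d ∘ₗ ι' - ι' ∘ₗ lieOp ι d - ι'') (G₁.w ν) = 0 := by
  refine ⟨((hι.odd.anti hd.odd).comm hι'.odd).sub hι''.odd, fun ν => ?_, fun η => ?_⟩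
  · simp only [LinearMap.sub_apply, LinearMap.comp_apply]
    rw [hι'.form, hι.lie_fn hB hd, hι.lie_form hB hd, hι'.form, hι''.form, add_pair, pair_extD,
      pair_dFn, ← map_sub, ← map_sub]
    rw [show lieFn (L.rho b) (pair ν c) - (lieFn (L.rho b) (pair ν c) - lieFn (L.rho c) (pair ν b)
      - pair ν (L.bracket b c) + lieFn (L.rho c) (pair ν b)) - pair ν (L.bracket b c) = 0 by abel,
      map_zero]
  · simp only [LinearMap.sub_apply, LinearMap.comp_apply]
    rw [hι'.one, map_zero, hι.lie_one hB hd hD, hι'.one, hι''.one, sub_zero, sub_zero]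

-- Applied to `d ν`, the rule `[L_b, ι_c] = ι_{[b,c]}` expresses `ι_c ι_b d d ν` by one-forms
-- obtained from `ν`. These cancel by the Jacobi identity and the compatibility of the anchor with
-- brackets.
omit hD in
theorem IsFormContr.contr_sq_form (hD : D.IsTensorial L) {c : Sec E FB B}
    {ι' ι'' : Weil E FA A →ₗ[ℝ] Weil E FA A}
    (hι' : IsFormContr GB G₀ G₁ c ι') (hι'' : IsFormContr GB G₀ G₁ (L.bracket b c) ι'')
    (ν : SDual E FB B) : ι' (ι (d (d (GB.w ν)))) = 0 := by
  obtain ⟨h1, h2, h3⟩ := hι.comm hB hd hD hι' hι''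
  have h4 : (lieOp ι d ∘ₗ ι' - ι' ∘ₗ lieOp ι d - ι'') (d (GB.w ν)) = 0 := by
    rw [hd.form, strForm, map_smul, map_oneForm_eq_zero h1.isLocalOp
      (fun a b ha hb => h1.mul_eq_zero ha hb) (isTensor_extD ν) h2 (fun s => h2 _), smul_zero]
  simp only [LinearMap.sub_apply, LinearMap.comp_apply] at h4
  rw [hι'.d_form hB hd, hι.lie_form hB hd, hι''.d_form hB hd, lieOp_apply ι d (d (GB.w ν)),
    hι.d_form hB hd, ι'.map_add, hι'.d_form hB hd] at h4
  have h5 : GB.w (extD L (extD L ν c) b + dFn L (pair (extD L ν c) b) - extD L ν (L.bracket b c) -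
      extD L (extD L ν b) c) = 0 := by
    rw [show extD L (extD L ν c) b + dFn L (pair (extD L ν c) b) - extD L ν (L.bracket b c) -
      extD L (extD L ν b) c = 0 from ?_, map_zero]
    refine SDual.ext_pair fun e => ?_
    simp only [sub_pair, add_pair, pair_extD, pair_dFn, lieFn_sub, L.lieFn_bracket, pair_add,
      L.jacobi b c e]
    rw [L.bracket_skew c b, pair_neg, show pair (0 : SDual E FB B) e = 0 from rfl]
    ring
  rw [Gens.w_sub, Gens.w_sub] at h5
  have h6 := congrArg₂ (fun x y => x - y) h5 h4
  rw [sub_zero] at h6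
  rw [← h6]
  abel

end FormContr

section CoeffContr

variable {v : Sec E F₁ V₁} (hB : GB.IsOdd) (hd : IsStructureOp L D GB G₀ G₁ d)
  (hι : IsCoeffContr GB G₀ G₁ v ι) (hD : D.IsTensorial L)

variable (L) in
/-- The `1`-form `b ↦ (∇*_b η)(v)`. -/
def connForm (conn : Sec E FB B → Sec E F₁ V₁ → Sec E F₁ V₁) (v : Sec E F₁ V₁) (η : SDual E F₁ V₁) :
    SDual E FB B := dualOf fun b => pair (connDual L conn b η) v

theorem IsConn.pair_connForm {conn : Sec E FB B → Sec E F₁ V₁ → Sec E F₁ V₁} (h : IsConn L conn)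
    (v : Sec E F₁ V₁) (η : SDual E F₁ V₁) (b : Sec E FB B) :
    pair (connForm L conn v η) b = pair (connDual L conn b η) v :=
  pair_dualOf (fun s t => by rw [h.connDual_add_left, add_pair])
    (fun f s => by rw [h.connDual_smul_left, smulDual_pair]) b

include hB hι hD

theorem IsCoeffContr.conn (η : SDual E F₁ V₁) :
    ι (oneForm GB (fun b => G₁.w (connDual L D.conn₁ b η))) = -GB.w (connForm L D.conn₁ v η) := by
  obtain ⟨c, hc⟩ := hι.shifts
  rw [contr_oneForm_zero (hD.conn₁.isTensor G₁ η) hB hι.odd.der hc hι.fn hι.form, ← oneForm_pair]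
  simp only [hι.one, hD.conn₁.pair_connForm]

include hd

theorem IsCoeffContr.lie_fn (f : Fn E M) : lieOp ι d (wF FA A f) = 0 := by
  rw [lieOp_apply, hd.fn, hι.fn, map_zero, add_zero, hι.form]

/-- The one-form that appears is `b ↦ η(∇_b v)`: the derivative of `η(v)` minus the dual connection.
The term from `∂` drops out because the contraction kills even generators. -/
theorem IsCoeffContr.lie_one (η : SDual E F₁ V₁) :
    lieOp ι d (G₁.w η) = GB.w (dFn L (pair η v) - connForm L D.conn₁ v η) := by
  rw [lieOp_apply, hd.one, str₁, map_add, hι.zero, zero_add, hι.conn hB hD, hι.one, hd.fn,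
    Gens.w_sub]
  abel

end CoeffContr

end LieCalculus

/-! ### The differentials have square zero and anticommute -/

section Squares

variable {E : Type*} [NormedAddCommGroup E] [NormedSpace ℝ E] [FiniteDimensional ℝ E]
  {M : Type*} [TopologicalSpace M] [ChartedSpace E M] [IsManifold 𝓘(ℝ, E) ∞ M]
  {FA : Type*} [NormedAddCommGroup FA] [NormedSpace ℝ FA]
  {A : M → Type*} [TopologicalSpace (TotalSpace FA A)] [∀ x, AddCommGroup (A x)]
  [∀ x, Module ℝ (A x)] [∀ x, TopologicalSpace (A x)] [FiberBundle FA A] [VectorBundle ℝ FA A]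

theorem cT_isFormContr (X : VF E M) :
    IsFormContr (gensT E FA A) (gensS E FA A) (gensΛ E FA A) X (cT X) :=
  ⟨cT_oddD X, ⟨_, cT_shifts X⟩, cT_wF X, cT_wT X, cT_wΛ X, cT_wS X⟩

theorem cΛ_isFormContr (α : Sec E FA A) :
    IsFormContr (gensΛ E FA A) (gensS E FA A) (gensT E FA A) α (cΛ α) :=
  ⟨cΛ_oddD α, ⟨_, cΛ_shifts α⟩, cΛ_wF α, cΛ_wΛ α, cΛ_wT α, cΛ_wS α⟩

theorem cΛ_isCoeffContr (α : Sec E FA A) :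
    IsCoeffContr (gensT E FA A) (gensS E FA A) (gensΛ E FA A) α (cΛ α) :=
  ⟨cΛ_oddD α, ⟨_, cΛ_shifts α⟩, cΛ_wF α, cΛ_wT α, cΛ_wΛ α, cΛ_wS α⟩

/-- The dual connection. -/
def nabDual (nab : Connection (LieAlgebroid.tangent E M) FA A) (X : VF E M) (η : SDual E FA A) :
    SDual E FA A := connDual (LieAlgebroid.tangent E M) (fun X s => nab.conn X s) X η

/-- The element `d_{∇*} θ_η`. -/
def covΛ (nab : Connection (LieAlgebroid.tangent E M) FA A) (η : SDual E FA A) : Weil E FA A :=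
  oneForm (gensT E FA A) (fun X => wΛ (nabDual nab X η))

variable [T2Space M] [FiniteDimensional ℝ FA] [ContMDiffVectorBundle ∞ FA A 𝓘(ℝ, E)]
  {L : LieAlgebroid E FA A} {nab : Connection (LieAlgebroid.tangent E M) FA A}
  {dv dh : Weil E FA A →ₗ[ℝ] Weil E FA A}

theorem IsVerticalDifferential.isStructureOp (hv : IsVerticalDifferential nab dv) :
    IsStructureOp (LieAlgebroid.tangent E M) (double nab) (gensT E FA A) (gensS E FA A)
      (gensΛ E FA A) dv := by
  obtain ⟨h, hF, hT, hΛ, hS⟩ := (isVerticalDifferential_iff nab).1 hv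
  refine ⟨h.oddD (fun f => ?_) (fun f => ?_) (fun f => ?_) (fun f => ?_), hF, hT, hΛ, hS⟩
  · rw [hF, wpar_wT]
  · rw [hT, strForm_parity _ gensT_isOdd]
  · rw [hΛ, str₁_parity (double_isTensorial nab) gensT_isOdd gensS_isEven gensΛ_isOdd]
  · rw [hS, str₀_parity (double_isTensorial nab) gensT_isOdd gensS_isEven gensΛ_isOdd]

theorem IsHorizontalDifferential.isStructureOp (hh : IsHorizontalDifferential L nab dh) :
    IsStructureOp L (adjoint L nab).conj (gensΛ E FA A) (gensS E FA A) (gensT E FA A) dh := by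
  obtain ⟨h, hF, hΛ, hT, hS⟩ := (isHorizontalDifferential_iff L nab).1 hh
  refine ⟨h.oddD (fun f => ?_) (fun f => ?_) (fun f => ?_) (fun f => ?_), hF, hΛ, hT, hS⟩
  · rw [hF, wpar_wΛ]
  · rw [hT, str₁_parity (adjoint_conj_isTensorial L nab) gensΛ_isOdd gensS_isEven gensT_isOdd]
  · rw [hΛ, strForm_parity _ gensΛ_isOdd]
  · rw [hS, str₀_parity (adjoint_conj_isTensorial L nab) gensΛ_isOdd gensS_isEven gensT_isOdd]

theorem IsStructureOp.sq_fn {FB : Type*} [NormedAddCommGroup FB] [NormedSpace ℝ FB]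
    {B : M → Type*} [TopologicalSpace (TotalSpace FB B)] [∀ x, AddCommGroup (B x)]
    [∀ x, Module ℝ (B x)] [∀ x, TopologicalSpace (B x)] [FiberBundle FB B] [VectorBundle ℝ FB B]
    [FiniteDimensional ℝ FB] [ContMDiffVectorBundle ∞ FB B 𝓘(ℝ, E)]
    {F₀ : Type*} [NormedAddCommGroup F₀] [NormedSpace ℝ F₀] {V₀ : M → Type*}
    [TopologicalSpace (TotalSpace F₀ V₀)] [∀ x, AddCommGroup (V₀ x)]
    [∀ x, Module ℝ (V₀ x)] [∀ x, TopologicalSpace (V₀ x)] [FiberBundle F₀ V₀]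
    [VectorBundle ℝ F₀ V₀] {F₁ : Type*} [NormedAddCommGroup F₁] [NormedSpace ℝ F₁]
    {V₁ : M → Type*} [TopologicalSpace (TotalSpace F₁ V₁)] [∀ x, AddCommGroup (V₁ x)]
    [∀ x, Module ℝ (V₁ x)] [∀ x, TopologicalSpace (V₁ x)] [FiberBundle F₁ V₁]
    [VectorBundle ℝ F₁ V₁]
    {L : LieAlgebroid E FB B} {D : TwoTermOperator E FB B F₀ V₀ F₁ V₁}
    {GB : Gens E FA A FB B} {G₀ : Gens E FA A F₀ V₀} {G₁ : Gens E FA A F₁ V₁}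
    {d : Weil E FA A →ₗ[ℝ] Weil E FA A}
    (hd : IsStructureOp L D GB G₀ G₁ d) (f : Fn E M) : d (d (wF FA A f)) = 0 := by
  rw [hd.fn, hd.form, strForm]
  simp only [extD_dFn, map_zero]
  rw [oneForm_zero, smul_zero]

theorem pair_nabDual (X : VF E M) (η : SDual E FA A) (s : Sec E FA A) :
    pair (nabDual nab X η) s = lieFn X (pair η s) - pair η (nab.conn X s) := by
  rw [nabDual, nab.isConn.pair_connDual, tangent_rho]

theorem isTensor_nabDual (η : SDual E FA A) :
    IsTensor (fun X : VF E M => (wΛ (nabDual nab X η) : Weil E FA A)) :=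
  nab.isConn.isTensor (gensΛ E FA A) η

section Vertical

variable (hv : IsVerticalDifferential nab dv)
include hv

theorem IsVerticalDifferential.apply_wF (f : Fn E M) :
    dv (wF FA A f) = wT FA A (dFn (LieAlgebroid.tangent E M) f) := hv.isStructureOp.fn f

theorem IsVerticalDifferential.apply_wΛ (η : SDual E FA A) : dv (wΛ η) = wS η + covΛ nab η := by
  have h : dv (wΛ η) = _ := hv.isStructureOp.one η
  rw [h, str₁]
  congr 1
  have h' : (double nab).bdDual η = η := SDual.ext_pair fun s => by
    refine ContMDiffMap.ext fun x => ?_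
    rw [pair_apply, (double_isTensorial nab).bdDual_apply]
    rfl
  rw [h']
  rfl

theorem IsVerticalDifferential.lie_wF (X : VF E M) (f : Fn E M) :
    lieOp (cT X) dv (wF FA A f) = wF FA A (lieFn X f) := by
  have h := (cT_isFormContr X).lie_fn gensT_isOdd hv.isStructureOp f
  rwa [tangent_rho] at h

theorem IsVerticalDifferential.lie_wT (X : VF E M) (ξ : Form1 E M) :
    lieOp (cT X) dv (wT FA A ξ) = wT FA A (extD (LieAlgebroid.tangent E M) ξ X +
      dFn (LieAlgebroid.tangent E M) (pair ξ X)) :=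
  (cT_isFormContr X).lie_form gensT_isOdd hv.isStructureOp ξ

theorem IsVerticalDifferential.lie_wΛ (X : VF E M) (η : SDual E FA A) :
    lieOp (cT X) dv (wΛ η) = wΛ (nabDual nab X η) :=
  (cT_isFormContr X).lie_one gensT_isOdd hv.isStructureOp (double_isTensorial nab) η

theorem IsVerticalDifferential.lie_wS (X : VF E M) (η : SDual E FA A) :
    lieOp (cT X) dv (wS η) = wS (nabDual nab X η) -
      oneForm (gensT E FA A) (fun Y => wΛ ((double nab).KDual X Y η)) :=
  (cT_isFormContr X).lie_zero gensT_isOdd hv.isStructureOp (double_isTensorial nab)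
    (fun X Y s => by
      show -nab.curvature X Y s = - -nab.curvature Y X s
      simp only [Connection.curvature]
      rw [(LieAlgebroid.tangent E M).bracket_skew Y X, map_neg, LinearMap.neg_apply]
      abel) η

theorem IsVerticalDifferential.cT_wΛ (X : VF E M) (η : SDual E FA A) :
    cT X (dv (wΛ η)) = wΛ (nabDual nab X η) := by
  rw [← hv.lie_wΛ, lieOp_apply, WeilModel.cT_wΛ, map_zero, add_zero]

omit hv in
theorem cT_covΛ (X : VF E M) (η : SDual E FA A) :
    cT X (covΛ nab η) = wΛ (nabDual nab X η) := by
  rw [covΛ, contr_oneForm (isTensor_nabDual η) gensT_isOdd (cT_oddD X).der (cT_shifts X) (cT_wF X)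
    (cT_wT X)]
  simp only [WeilModel.cT_wΛ]
  rw [oneForm_zero, sub_zero]

omit hv in
/-- Derivations that kill functions and the odd generators kill `d_{∇*} θ_η`. -/
theorem map_covΛ_eq_zero {D : Weil E FA A →ₗ[ℝ] Weil E FA A} (hD : IsLocalOp D)
    (hmul : ∀ a b, D a = 0 → D b = 0 → D (a * b) = 0) (hT : ∀ ξ, D (wT FA A ξ) = 0)
    (hΛ : ∀ η, D (wΛ η) = 0) (η : SDual E FA A) : D (covΛ nab η) = 0 :=
  map_oneForm_eq_zero hD hmul (isTensor_nabDual η) hT fun _ => hΛ _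

/-- The element has bidegree `(0,3)`; two contractions detect it, and for two contractions the
Cartan calculus gives zero. -/
theorem IsVerticalDifferential.sq_wT (ξ : Form1 E M) : dv (dv (wT FA A ξ)) = 0 := by
  have h0 : ∀ x, (wT FA A ξ).1 x ∈ biGr E A x (0, 1) := fun x => genT_mem_fiberGr _
  have h1 := hv.shifts _ _ (hv.shifts _ _ h0)
  refine eq_zero_of_cT h1 (by norm_num) fun X => ?_
  refine eq_zero_of_cT (cT_shifts X _ _ h1) (by norm_num) fun Y => ?_
  exact (cT_isFormContr X).contr_sq_form gensT_isOdd hv.isStructureOp (double_isTensorial nab)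
    (cT_isFormContr Y) (cT_isFormContr _) ξ

/-- The bidegree is `(1,2)`, so one contraction with `X` detects the element and leads to bidegree
`(1,1)`. There a second contraction leaves the formula for the curvature of the dual connection,
which is satisfied because the two-form of the double is `-R_∇`; the Koszul operator takes care of
the `S¹A*` component. -/
theorem IsVerticalDifferential.sq_wΛ (η : SDual E FA A) : dv (dv (wΛ η)) = 0 := by
  have hd := hv.isStructureOp
  have h0 : ∀ x, (wΛ η : Weil E FA A).1 x ∈ biGr E A x (1, 0) := fun x => genΛ_mem_fiberGr _
  have h1 := hv.shifts _ _ (hv.shifts _ _ h0)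
  refine eq_zero_of_cT h1 (by norm_num) fun X => ?_
  -- Cartan's formula `ι_X d = L_X - d ι_X`, applied to `d θ_η`. The two even elements `μ` of `∇*_X
  -- η` cancel, so only products of odd generators remain.
  have hz : cT X (dv (dv (wΛ η))) = lieOp (cT X) dv (covΛ nab η) -
      oneForm (gensT E FA A) (fun Y => wΛ ((double nab).KDual X Y η)) - covΛ nab (nabDual nab X η) := by
    have h := lieOp_apply (cT X) dv (dv (wΛ η))
    rw [hv.cT_wΛ, hv.apply_wΛ (nabDual nab X η), hv.apply_wΛ, map_add, hv.lie_wS] at h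
    rw [hv.apply_wΛ, ← sub_eq_iff_eq_add.2 h]
    abel
  have hK : IsTensor (fun Y => (wΛ ((double nab).KDual X Y η) : Weil E FA A)) :=
    (double_isTensorial nab).isTensor_K' (G₁ := gensΛ E FA A) X η
  refine eq_zero_of_cT_hOp (cT_shifts X _ _ h1) (fun Y => ?_) ?_
  · rw [hz, map_sub, map_sub, cT_covΛ, contr_oneForm hK gensT_isOdd (cT_oddD Y).der
      (cT_shifts Y) (cT_wF Y) (cT_wT Y)]
    have e : oneForm (gensT E FA A) (fun s => cT Y (wΛ ((double nab).KDual X s η))) = 0 := by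
      rw [← oneForm_zero (gensT E FA A)]
      congr 1
      funext s
      exact WeilModel.cT_wΛ _ _
    obtain ⟨h2, h3, h4⟩ := (cT_isFormContr X).comm gensT_isOdd hd (double_isTensorial nab)
      (cT_isFormContr Y) (cT_isFormContr ((LieAlgebroid.tangent E M).bracket X Y))
    have h5 := map_covΛ_eq_zero (nab := nab) h2.isLocalOp (fun _ _ => h2.mul_eq_zero) h3 h4 η
    simp only [LinearMap.sub_apply, LinearMap.comp_apply] at h5
    rw [cT_covΛ, cT_covΛ, hv.lie_wΛ] at h5
    rw [e, sub_zero]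
    have h6 : cT Y (lieOp (cT X) dv (covΛ nab η)) = wΛ (nabDual nab X (nabDual nab Y η)) -
        wΛ (nabDual nab ((LieAlgebroid.tangent E M).bracket X Y) η) := by
      rw [sub_sub, sub_eq_zero] at h5
      rw [h5]
      abel
    rw [h6]
    show wΛ _ - wΛ _ - wΛ _ - wΛ _ = (0 : Weil E FA A)
    rw [← map_sub, ← map_sub, ← map_sub]
    refine (congrArg wΛ ?_).trans (map_zero _)
    refine SDual.ext_pair fun s => ?_
    rw [sub_pair, sub_pair, sub_pair, (double_isTensorial nab).pair_KDual]
    show _ - pair η (-nab.curvature X Y s) - _ = pair 0 s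
    simp only [pair_nabDual, pair_neg, Connection.curvature, pair_sub, lieFn_sub, lieFn_bracket_VF]
    rw [show pair (0 : SDual E FA A) s = 0 from rfl]
    abel
  · have hh := hOp_oddD (E := E) (FA := FA) (A := A)
    have e1 : ∀ η, hOp (covΛ nab η) = 0 := map_covΛ_eq_zero hh.isLocalOp
      (fun _ _ => hh.mul_eq_zero) hOp_wT hOp_wΛ
    -- The commutator of `L_X` with `h` is an odd derivation, and `L_X` maps covectors to covectors
    -- and `θ` to `θ`. So the commutator kills the odd generators and hence `d_{∇*} θ_η`.
    have h2 := ((cT_oddD X).anti hd.odd).comm hh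
    have h3 := map_covΛ_eq_zero (nab := nab) h2.isLocalOp (fun _ _ => h2.mul_eq_zero) (fun ξ => by
      have := hv.lie_wT X ξ
      simp only [lieOp] at this
      rw [LinearMap.sub_apply, LinearMap.comp_apply, LinearMap.comp_apply, this, hOp_wT, hOp_wT,
        map_zero, sub_zero]) (fun ξ => by
      have := hv.lie_wΛ X ξ
      simp only [lieOp] at this
      rw [LinearMap.sub_apply, LinearMap.comp_apply, LinearMap.comp_apply, this, hOp_wΛ, hOp_wΛ,
        map_zero, sub_zero]) η
    rw [LinearMap.sub_apply, LinearMap.comp_apply, LinearMap.comp_apply, e1, map_zero, zero_sub,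
      neg_eq_zero] at h3
    rw [hz, map_sub, map_sub, e1, sub_zero]
    rw [map_oneForm_eq_zero (G := gensT E FA A) hh.isLocalOp
      (fun _ _ => hh.mul_eq_zero) hK hOp_wT (fun _ => hOp_wΛ _),
      sub_zero]
    exact h3

/-- The square of the vertical differential vanishes. -/
theorem IsVerticalDifferential.sq (a : Weil E FA A) : dv (dv a) = 0 := by
  have h := hv.isStructureOp.odd.sq
  have h1 := h.ext (N' := 0) ⟨fun a b => by simp, fun a => by simp⟩ hv.isStructureOp.sq_fn
    hv.sq_wT hv.sq_wΛ (fun η => ?_) a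
  · exact h1
  -- The even generator is a vertical derivative up to products of odd generators, so its case
  -- reduces to that of `θ_η`.
  · have e : wS η = dv (wΛ η) - covΛ nab η := by rw [hv.apply_wΛ, add_sub_cancel_right]
    rw [e, map_sub, map_covΛ_eq_zero h.isLocalOp (fun _ _ => h.mul_eq_zero) hv.sq_wT hv.sq_wΛ,
      sub_zero, LinearMap.comp_apply, hv.sq_wΛ, map_zero]
    rfl

end Vertical

end Squares

/-! ### Anticommutation of the two differentials and the square of the horizontal one. -/

section Anticommutation

variable {E : Type*} [NormedAddCommGroup E] [NormedSpace ℝ E] [FiniteDimensional ℝ E]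
  {M : Type*} [TopologicalSpace M] [ChartedSpace E M] [IsManifold 𝓘(ℝ, E) ∞ M]
  {FA : Type*} [NormedAddCommGroup FA] [NormedSpace ℝ FA]
  {A : M → Type*} [TopologicalSpace (TotalSpace FA A)] [∀ x, AddCommGroup (A x)]
  [∀ x, Module ℝ (A x)] [∀ x, TopologicalSpace (A x)] [FiberBundle FA A] [VectorBundle ℝ FA A]

/-- The `1`-form on `A` obtained from a `1`-form on `M`. -/
def anchDual (L : LieAlgebroid E FA A) (ξ : Form1 E M) : SDual E FA A :=
  dualOf fun s => pair ξ (L.rho s)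

/-- The basic connection on `T*M`. -/
def basDual (L : LieAlgebroid E FA A) (nab : Connection (LieAlgebroid.tangent E M) FA A)
    (α : Sec E FA A) (ξ : Form1 E M) : Form1 E M := connDual L (basicConnT L nab) α ξ

/-- The element `d_{(∇^bas)*} ξ`. -/
def basT (L : LieAlgebroid E FA A) (nab : Connection (LieAlgebroid.tangent E M) FA A)
    (ξ : Form1 E M) : Weil E FA A :=
  oneForm (gensΛ E FA A) (fun α => wT FA A (basDual L nab α ξ))

/-- The `1`-form `X ↦ (∇*_X η)(α)`. -/
def evForm (nab : Connection (LieAlgebroid.tangent E M) FA A) (α : Sec E FA A) (η : SDual E FA A) :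
    Form1 E M := connForm (LieAlgebroid.tangent E M) (fun X s => nab.conn X s) α η

/-- The `1`-form `X ↦ η(∇_X α)`. -/
def nabForm (nab : Connection (LieAlgebroid.tangent E M) FA A) (α : Sec E FA A)
    (η : SDual E FA A) : Form1 E M :=
  dFn (LieAlgebroid.tangent E M) (pair η α) - evForm nab α η

variable [T2Space M] [FiniteDimensional ℝ FA] [ContMDiffVectorBundle ∞ FA A 𝓘(ℝ, E)]
  {L : LieAlgebroid E FA A} {nab : Connection (LieAlgebroid.tangent E M) FA A}
  {dv dh : Weil E FA A →ₗ[ℝ] Weil E FA A}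

theorem wT_sub (ξ ξ' : Form1 E M) : wT FA A (ξ - ξ') = wT FA A ξ - wT FA A ξ' :=
  (gensT E FA A).w_sub ξ ξ'

theorem pair_anchDual (ξ : Form1 E M) (s : Sec E FA A) :
    pair (anchDual L ξ) s = pair ξ (L.rho s) :=
  pair_dualOf (fun s t => by rw [L.rho_add, pair_add]) (fun f s => by rw [L.rho_smul, pair_smul]) s

theorem anchDual_dFn (f : Fn E M) :
    anchDual L (dFn (LieAlgebroid.tangent E M) f) = dFn L f := SDual.ext_pair fun s => by
  rw [pair_anchDual, pair_dFn, pair_dFn, tangent_rho]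

theorem pair_basDual (α : Sec E FA A) (ξ : Form1 E M) (X : VF E M) :
    pair (basDual L nab α ξ) X = lieFn (L.rho α) (pair ξ X) - pair ξ (basicConnT L nab α X) :=
  (basicConnT_isConn L nab).pair_connDual α ξ X

theorem isTensor_basDual (ξ : Form1 E M) :
    IsTensor (fun α => (wT FA A (basDual L nab α ξ) : Weil E FA A)) :=
  (basicConnT_isConn L nab).isTensor (gensT E FA A) ξ

theorem pair_evForm (α : Sec E FA A) (η : SDual E FA A) (X : VF E M) :
    pair (evForm nab α η) X = pair (nabDual nab X η) α :=
  nab.isConn.pair_connForm α η X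

theorem pair_nabForm (α : Sec E FA A) (η : SDual E FA A) (X : VF E M) :
    pair (nabForm nab α η) X = pair η (nab.conn X α) := by
  rw [nabForm, sub_pair, pair_evForm, pair_nabDual, pair_dFn, tangent_rho]
  abel

theorem lieFn_basicConnT (α : Sec E FA A) (X : VF E M) (f : Fn E M) :
    lieFn (basicConnT L nab α X) f = lieFn (L.rho (nab.conn X α)) f +
      (lieFn (L.rho α) (lieFn X f) - lieFn X (lieFn (L.rho α) f)) := by
  rw [basicConnT, lieFn_vadd, lieFn_bracket_VF]

theorem cΛ_covΛ (α : Sec E FA A) (η : SDual E FA A) :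
    cΛ α (covΛ nab η) = -wT FA A (evForm nab α η) :=
  (cΛ_isCoeffContr α).conn gensT_isOdd (double_isTensorial nab) η

theorem cΛ_basT (α : Sec E FA A) (ξ : Form1 E M) :
    cΛ α (basT L nab ξ) = wT FA A (basDual L nab α ξ) := by
  rw [basT, contr_oneForm (isTensor_basDual ξ) gensΛ_isOdd (cΛ_oddD α).der (cΛ_shifts α) (cΛ_wF α)
    (cΛ_wΛ α)]
  simp only [cΛ_wT]
  rw [oneForm_zero, sub_zero]

/-- Derivations that kill functions and the odd generators kill `d_{(∇^bas)*} ξ`. -/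
theorem map_basT_eq_zero {D : Weil E FA A →ₗ[ℝ] Weil E FA A} (hD : IsLocalOp D)
    (hmul : ∀ a b, D a = 0 → D b = 0 → D (a * b) = 0) (hT : ∀ ξ, D (wT FA A ξ) = 0)
    (hΛ : ∀ η, D (wΛ η) = 0) (ξ : Form1 E M) : D (basT L nab ξ) = 0 :=
  map_oneForm_eq_zero (G := gensΛ E FA A) hD hmul (isTensor_basDual ξ) hΛ fun _ => hT _

/-- An operator which is linear over functions is determined on `1`-forms by exact forms. -/
theorem map_wT_eq_zero {D : Weil E FA A →ₗ[ℝ] Weil E FA A} (hD : IsLocalOp D)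
    (hF : ∀ f a, D (wF FA A f * a) = wF FA A f * D a)
    (h : ∀ f, D (wT FA A (dFn (LieAlgebroid.tangent E M) f)) = 0) (ξ : Form1 E M) :
    D (wT FA A ξ) = 0 := weil_ext fun x => by
  -- An exact form with the same value at `x` is subtracted. By linearity over functions the value
  -- of `D` at `x` sees only the value of the form at `x`, which is then zero.
  obtain ⟨g, hg⟩ := exists_fn_dirDeriv x (ξ.1 x)
  have h0 : ∀ ν : Form1 E M, ν.1 x = 0 → (D (wT FA A ν)).1 x = 0 := fun ν hν => by
    obtain ⟨s, μ, h1, -⟩ := exists_local_oneForm (E := E) (FA := FA) (A := A) (FB := E)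
      (B := (TangentSpace 𝓘(ℝ, E) : M → Type _)) x
    have h2 : wT FA A ν = oneForm (gensT E FA A) (fun b => wF FA A (pair ν b)) :=
      (oneForm_pair (gensT E FA A) ν).symm
    rw [h2, hD.congr (h1 (gensT E FA A) _ (isTensor_wF_pair ν)), map_sum, weil_sum_apply]
    refine Finset.sum_eq_zero fun i _ => ?_
    rw [← wF_mul_comm, hF, wF_mul_apply, pair_apply, hν, LinearMap.zero_apply, zero_smul]
  have h1 := h0 (ξ - dFn (LieAlgebroid.tangent E M) g) (LinearMap.ext fun v => by
    show ξ.1 x v - dirDeriv g v = 0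
    rw [hg, sub_self])
  rw [wT_sub, map_sub, h, sub_zero] at h1
  exact h1

section Horizontal

variable (hh : IsHorizontalDifferential L nab dh)
include hh

theorem IsHorizontalDifferential.apply_wF (f : Fn E M) : dh (wF FA A f) = wΛ (dFn L f) :=
  hh.isStructureOp.fn f

theorem IsHorizontalDifferential.apply_wT (ξ : Form1 E M) :
    dh (wT FA A ξ) = basT L nab ξ - wS (anchDual L ξ) := by
  have h : dh (wT FA A ξ) = _ := hh.isStructureOp.one ξ
  rw [h, str₁]
  have h' : (adjoint L nab).conj.bdDual ξ = -anchDual L ξ := SDual.ext_pair fun s => by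
    refine ContMDiffMap.ext fun x => ?_
    rw [pair_apply, (adjoint_conj_isTensorial L nab).bdDual_apply, neg_pair, pair_anchDual]
    exact map_neg (ξ.1 x) _
  rw [h', Gens.w_neg, add_comm, ← sub_eq_add_neg]
  rfl

theorem IsHorizontalDifferential.lie_wΛ (α : Sec E FA A) (η : SDual E FA A) :
    lieOp (cΛ α) dh (wΛ η) = wΛ (extD L η α + dFn L (pair η α)) :=
  (cΛ_isFormContr α).lie_form gensΛ_isOdd hh.isStructureOp η

theorem IsHorizontalDifferential.lie_wT (α : Sec E FA A) (ξ : Form1 E M) :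
    lieOp (cΛ α) dh (wT FA A ξ) = wT FA A (basDual L nab α ξ) :=
  (cΛ_isFormContr α).lie_one gensΛ_isOdd hh.isStructureOp (adjoint_conj_isTensorial L nab) ξ

theorem IsHorizontalDifferential.lie_wS (α : Sec E FA A) (η : SDual E FA A) :
    lieOp (cΛ α) dh (wS η) = wS (connDual L (basicConnA L nab) α η) -
      oneForm (gensΛ E FA A) (fun β => wT FA A ((adjoint L nab).conj.KDual α β η)) :=
  (cΛ_isFormContr α).lie_zero gensΛ_isOdd hh.isStructureOp (adjoint_conj_isTensorial L nab)
    (fun α β X => by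
      show -basicCurvature L nab α β X = - -basicCurvature L nab β α X
      rw [basicCurvature_skew]) η

theorem IsHorizontalDifferential.cΛ_wΛ (α : Sec E FA A) (η : SDual E FA A) :
    cΛ α (dh (wΛ η)) = wΛ (extD L η α) :=
  (cΛ_isFormContr α).d_form gensΛ_isOdd hh.isStructureOp η

theorem IsHorizontalDifferential.map_d_wΛ_eq_zero {D : Weil E FA A →ₗ[ℝ] Weil E FA A}
    (hD : IsLocalOp D) (hmul : ∀ a b, D a = 0 → D b = 0 → D (a * b) = 0)
    (hΛ : ∀ η, D (wΛ η) = 0) (η : SDual E FA A) : D (dh (wΛ η)) = 0 := by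
  have h : dh (wΛ η) = _ := hh.isStructureOp.form η
  rw [h, strForm, map_smul, map_oneForm_eq_zero (G := gensΛ E FA A) hD hmul
    (isTensor_extD (GB := gensΛ E FA A) η) hΛ (fun _ => hΛ _), smul_zero]

theorem IsHorizontalDifferential.sq_wΛ (η : SDual E FA A) : dh (dh (wΛ η)) = 0 := by
  have h0 : ∀ x, (wΛ η : Weil E FA A).1 x ∈ biGr E A x (1, 0) := fun x => genΛ_mem_fiberGr _
  have h1 := hh.shifts _ _ (hh.shifts _ _ h0)
  refine eq_zero_of_cΛ h1 (by norm_num) fun α => ?_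
  refine eq_zero_of_cΛ (cΛ_shifts α _ _ h1) (by norm_num) fun β => ?_
  exact (cΛ_isFormContr α).contr_sq_form gensΛ_isOdd hh.isStructureOp
    (adjoint_conj_isTensorial L nab) (cΛ_isFormContr β) (cΛ_isFormContr _) η

/-- `L_α` maps covectors to covectors and `θ` to `θ`, all of which `h` kills. So `[L_α, h]` is an
odd derivation vanishing on odd generators, hence on `d_{∇*} θ_η`, and `h` vanishes there too. -/
theorem IsHorizontalDifferential.hOp_lie_covΛ (α : Sec E FA A)
    {nab' : Connection (LieAlgebroid.tangent E M) FA A} (η : SDual E FA A) :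
    hOp (lieOp (cΛ α) dh (covΛ nab' η)) = 0 := by
  have hO := hOp_oddD (E := E) (FA := FA) (A := A)
  have h2 : OddD (lieOp (cΛ α) dh ∘ₗ hOp - hOp ∘ₗ lieOp (cΛ α) dh) :=
    ((cΛ_oddD α).anti hh.isStructureOp.odd).comm hO
  have hT : ∀ ξ, (lieOp (cΛ α) dh ∘ₗ hOp - hOp ∘ₗ lieOp (cΛ α) dh) (wT FA A ξ) = 0 := fun ξ => by
    rw [LinearMap.sub_apply, LinearMap.comp_apply, LinearMap.comp_apply, hh.lie_wT, hOp_wT, hOp_wT,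
      map_zero, sub_zero]
  have hΛ : ∀ ξ, (lieOp (cΛ α) dh ∘ₗ hOp - hOp ∘ₗ lieOp (cΛ α) dh) (wΛ ξ) = 0 := fun ξ => by
    rw [LinearMap.sub_apply, LinearMap.comp_apply, LinearMap.comp_apply, hh.lie_wΛ, hOp_wΛ, hOp_wΛ,
      map_zero, sub_zero]
  have h3 := map_covΛ_eq_zero (nab := nab') h2.isLocalOp (fun _ _ => h2.mul_eq_zero) hT hΛ η
  rwa [LinearMap.sub_apply, LinearMap.comp_apply, LinearMap.comp_apply,
    map_covΛ_eq_zero hO.isLocalOp (fun _ _ => hO.mul_eq_zero) hOp_wT hOp_wΛ, map_zero, zero_sub,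
    neg_eq_zero] at h3

/-- The same argument for a Lie derivative taking `θ` to covectors on `M`; `d_hor θ_η` is quadratic
in the `θ`. It is used with the vertical differential as `d`. -/
theorem IsHorizontalDifferential.hOp_lie_d_wΛ {α : Sec E FA A}
    {d : Weil E FA A →ₗ[ℝ] Weil E FA A} (hd : OddD d) {σ : SDual E FA A → Form1 E M}
    (h : ∀ η, lieOp (cΛ α) d (wΛ η) = wT FA A (σ η)) (η : SDual E FA A) :
    hOp (lieOp (cΛ α) d (dh (wΛ η))) = 0 := by
  have hO := hOp_oddD (E := E) (FA := FA) (A := A)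
  have h2 : OddD (lieOp (cΛ α) d ∘ₗ hOp - hOp ∘ₗ lieOp (cΛ α) d) := ((cΛ_oddD α).anti hd).comm hO
  have hΛ : ∀ ξ, (lieOp (cΛ α) d ∘ₗ hOp - hOp ∘ₗ lieOp (cΛ α) d) (wΛ ξ) = 0 := fun ξ => by
    rw [LinearMap.sub_apply, LinearMap.comp_apply, LinearMap.comp_apply, h, hOp_wΛ, hOp_wT,
      map_zero, sub_zero]
  have h3 := hh.map_d_wΛ_eq_zero h2.isLocalOp (fun _ _ => h2.mul_eq_zero) hΛ η
  rwa [LinearMap.sub_apply, LinearMap.comp_apply, LinearMap.comp_apply,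
    hh.map_d_wΛ_eq_zero hO.isLocalOp (fun _ _ => hO.mul_eq_zero) hOp_wΛ, map_zero, zero_sub,
    neg_eq_zero] at h3

end Horizontal

section Both

variable (hv : IsVerticalDifferential nab dv) (hh : IsHorizontalDifferential L nab dh)
include hv hh

theorem anticomm_shifts : Shifts (lieOp dh dv) (1, 1) := by
  have h1 : Shifts (dh ∘ₗ dv) ((0, 1) + (1, 0)) := Shifts.comp hh.shifts hv.shifts
  have h2 : Shifts (dv ∘ₗ dh) ((1, 0) + (0, 1)) := Shifts.comp hv.shifts hh.shifts
  exact Shifts.add h1 h2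

/-- The `S¹A*` parts `-μ_{df∘ρ}` and `+μ_{df∘ρ}` cancel; this is the role of the conjugation of the
coadjoint representation. The rest, in bidegree `(1,1)`, is the formula for the basic connection on
vector fields. -/
theorem anticomm_wF (f : Fn E M) : lieOp dh dv (wF FA A f) = 0 := by
  have e : lieOp dh dv (wF FA A f) = basT L nab (dFn (LieAlgebroid.tangent E M) f) +
      covΛ nab (dFn L f) := by
    rw [lieOp_apply, hv.apply_wF, hh.apply_wF, hh.apply_wT, hv.apply_wΛ, anchDual_dFn]
    abel
  have h0 : ∀ x, (wF FA A f : Weil E FA A).1 x ∈ biGr E A x 0 := fun x => algebraMap_mem_fiberGr _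
  refine eq_zero_of_cΛ_hOp (anticomm_shifts hv hh _ _ h0)
    (fun α => ?_) ?_
  · rw [e, map_add, cΛ_basT, cΛ_covΛ, ← sub_eq_add_neg, ← map_sub]
    refine (congrArg (wT FA A) ?_).trans (map_zero _)
    refine SDual.ext_pair fun X => ?_
    rw [sub_pair, pair_basDual, pair_evForm, pair_nabDual]
    simp only [pair_dFn]
    rw [tangent_rho, tangent_rho, lieFn_basicConnT, show pair (0 : Form1 E M) X = 0 from rfl]
    abel
  · have hO := hOp_oddD (E := E) (FA := FA) (A := A)
    rw [e, map_add, map_basT_eq_zero hO.isLocalOp (fun _ _ => hO.mul_eq_zero) hOp_wT hOp_wΛ,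
      map_covΛ_eq_zero hO.isLocalOp (fun _ _ => hO.mul_eq_zero) hOp_wT hOp_wΛ, add_zero]

theorem anticomm_evenD : EvenD (lieOp dh dv) := hh.isStructureOp.odd.anti hv.isStructureOp.odd

/-- Only `d_ver² = 0` is used. Together with `μ_η = d_ver θ_η - d_{∇*} θ_η` this leaves functions
and `θ_η` to be checked. -/
theorem anticomm_dv (a : Weil E FA A) : lieOp dh dv (dv a) = dv (lieOp dh dv a) := by
  rw [lieOp_apply, lieOp_apply, hv.sq, map_zero, zero_add, map_add, hv.sq, add_zero]

theorem anticomm_wT (ξ : Form1 E M) : lieOp dh dv (wT FA A ξ) = 0 := by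
  have hP := anticomm_evenD hv hh
  refine map_wT_eq_zero hP.isLocalOp (fun f a => ?_) (fun f => ?_) ξ
  · rw [hP.der, anticomm_wF hv hh, zero_mul, zero_add]
  · rw [← hv.apply_wF, anticomm_dv hv hh, anticomm_wF hv hh, map_zero]

/-- Cartan's formula for `ι_α` and each differential replaces the contraction by Lie derivatives of
products of odd generators. The second derivatives of the function `η(α)` disappear by
anticommutation on functions. -/
theorem cΛ_anticomm (α : Sec E FA A) (η : SDual E FA A) :
    cΛ α (lieOp dh dv (wΛ η)) = lieOp (cΛ α) dh (covΛ nab η) + lieOp (cΛ α) dv (dh (wΛ η)) -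
      oneForm (gensΛ E FA A) (fun β => wT FA A ((adjoint L nab).conj.KDual α β η)) -
      basT L nab (nabForm nab α η) - covΛ nab (extD L η α + dFn L (pair η α)) := by
  have hN : lieOp (cΛ α) dv (wΛ η) = wT FA A (nabForm nab α η) :=
    (cΛ_isCoeffContr α).lie_one gensT_isOdd hv.isStructureOp (double_isTensorial nab) η
  have hP := anticomm_wF hv hh (pair η α)
  rw [lieOp_apply, hh.apply_wF] at hP
  have h1 := lieOp_apply (cΛ α) dh (dv (wΛ η))
  have h2 := lieOp_apply (cΛ α) dv (dh (wΛ η))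
  have h3 : cΛ α (dv (wΛ η)) = wT FA A (nabForm nab α η) - dv (wF FA A (pair η α)) := by
    rw [← hN, lieOp_apply, WeilModel.cΛ_wΛ, add_sub_cancel_right]
  rw [h3, map_sub, hh.apply_wT] at h1
  rw [hh.cΛ_wΛ] at h2
  have h4 : dv (wΛ (extD L η α)) + dv (wΛ (dFn L (pair η α))) =
      wS (extD L η α + dFn L (pair η α)) + covΛ nab (extD L η α + dFn L (pair η α)) := by
    rw [← map_add, ← map_add, hv.apply_wΛ]
  have h5 : lieOp (cΛ α) dh (dv (wΛ η)) = wS (connDual L (basicConnA L nab) α η) -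
      oneForm (gensΛ E FA A) (fun β => wT FA A ((adjoint L nab).conj.KDual α β η)) +
      lieOp (cΛ α) dh (covΛ nab η) := by
    rw [hv.apply_wΛ, map_add, hh.lie_wS]
  -- The definition of the basic connection on `A`, dualized; it makes all terms in `S¹A*` cancel.
  have hS : connDual L (basicConnA L nab) α η + anchDual L (nabForm nab α η) =
      extD L η α + dFn L (pair η α) := SDual.ext_pair fun s => by
    rw [add_pair, add_pair, (basicConnA_isConn L nab).pair_connDual, pair_anchDual,
      pair_nabForm, pair_extD, pair_dFn, basicConnA, pair_add]
    abel
  have hS' := congrArg (wS (E := E) (FA := FA) (A := A)) hS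
  rw [map_add] at hS'
  rw [lieOp_apply, map_add]
  linear_combination (norm := abel) h5 - h1 - h2 + hP - h4 + hS'

-- The bidegree is `(2,1)`, so contraction with `α` detects the element and leads to bidegree
-- `(1,1)`. There the contraction with `β` and the Koszul operator remain; for the latter every term
-- is built from odd generators.
set_option maxHeartbeats 800000 in
theorem anticomm_wΛ (η : SDual E FA A) : lieOp dh dv (wΛ η) = 0 := by
  have hd := hh.isStructureOp
  have h0 : ∀ x, (wΛ η : Weil E FA A).1 x ∈ biGr E A x (1, 0) := fun x => genΛ_mem_fiberGr _
  have h1 := anticomm_shifts hv hh _ _ h0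
  refine eq_zero_of_cΛ h1 (by norm_num) fun α => ?_
  have hz := cΛ_anticomm hv hh α η
  have hDΛ : ∀ η, lieOp (cΛ α) dv (wΛ η) = wT FA A (nabForm nab α η) := by
    have h := (cΛ_isCoeffContr α).lie_one gensT_isOdd hv.isStructureOp (double_isTensorial nab)
    exact h
  have hDF : ∀ f, lieOp (cΛ α) dv (wF FA A f) = 0 := by
    have h := (cΛ_isCoeffContr α).lie_fn gensT_isOdd hv.isStructureOp (double_isTensorial nab)
    exact h
  have hK : IsTensor (fun β => (wT FA A ((adjoint L nab).conj.KDual α β η) : Weil E FA A)) :=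
    (adjoint_conj_isTensorial L nab).isTensor_K' (G₁ := gensT E FA A) α η
  refine eq_zero_of_cΛ_hOp (cΛ_shifts α _ _ h1) (fun β => ?_) ?_
  · obtain ⟨h2, h3, h4⟩ := (cΛ_isFormContr α).comm gensΛ_isOdd hd (adjoint_conj_isTensorial L nab)
      (cΛ_isFormContr β) (cΛ_isFormContr (L.bracket α β))
    have h5 := map_covΛ_eq_zero (nab := nab) h2.isLocalOp (fun _ _ => h2.mul_eq_zero) h4 h3 η
    simp only [LinearMap.sub_apply, LinearMap.comp_apply] at h5
    rw [cΛ_covΛ, cΛ_covΛ, map_neg, hh.lie_wT] at h5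
    have h6 := ((cΛ_oddD α).anti hv.isStructureOp.odd).comm (cΛ_oddD β)
    have h7 := hh.map_d_wΛ_eq_zero h6.isLocalOp (fun _ _ => h6.mul_eq_zero) (fun η => by
      show lieOp (cΛ α) dv (cΛ β (wΛ η)) - cΛ β (lieOp (cΛ α) dv (wΛ η)) = 0
      rw [WeilModel.cΛ_wΛ, hDF, hDΛ, cΛ_wT, sub_zero]) η
    replace h7 : lieOp (cΛ α) dv (cΛ β (dh (wΛ η))) - cΛ β (lieOp (cΛ α) dv (dh (wΛ η))) = 0 := h7
    rw [hh.cΛ_wΛ, hDΛ] at h7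
    have h8 : cΛ β (oneForm (gensΛ E FA A)
        (fun β => wT FA A ((adjoint L nab).conj.KDual α β η))) =
        wT FA A ((adjoint L nab).conj.KDual α β η) := by
      rw [contr_oneForm hK gensΛ_isOdd (cΛ_oddD β).der (cΛ_shifts β) (cΛ_wF β) (WeilModel.cΛ_wΛ β)]
      simp only [cΛ_wT]
      rw [oneForm_zero, sub_zero]
    rw [hz, map_sub, map_sub, map_sub, map_add, h8, cΛ_basT, cΛ_covΛ]
    -- Evaluated on `X`, this is the defining formula of the basic curvature paired with `η`; all
    -- derivatives of pairings cancel.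
    have h9 : evForm nab (L.bracket α β) η - basDual L nab α (evForm nab β η) +
        nabForm nab α (extD L η β) - (adjoint L nab).conj.KDual α β η -
        basDual L nab β (nabForm nab α η) + evForm nab β (extD L η α + dFn L (pair η α)) = 0 :=
      SDual.ext_pair fun X => by
        rw [add_pair, sub_pair, sub_pair, add_pair, sub_pair,
          (adjoint_conj_isTensorial L nab).pair_KDual]
        show _ - pair η (-basicCurvature L nab α β X) - _ + _ = pair (0 : Form1 E M) X
        rw [basicCurvature, show pair (0 : Form1 E M) X = 0 from rfl]
        simp only [pair_evForm, pair_basDual, pair_nabForm, pair_nabDual, pair_extD, pair_dFn,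
          add_pair, pair_neg, pair_sub, pair_add, lieFn_sub, lieFn_add, lieFn_basicConnT]
        rw [L.bracket_skew β, pair_neg]
        abel
    have h9' := congrArg (wT FA A) h9
    rw [map_add, wT_sub, wT_sub, map_add, wT_sub, map_zero] at h9'
    linear_combination (norm := abel) h9' - h5 - h7
  · have hO := hOp_oddD (E := E) (FA := FA) (A := A)
    have e1 : ∀ η, hOp (covΛ nab η) = 0 := map_covΛ_eq_zero hO.isLocalOp
      (fun _ _ => hO.mul_eq_zero) hOp_wT hOp_wΛ
    have h3 := hh.hOp_lie_covΛ (nab' := nab) α η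
    have h5 := hh.hOp_lie_d_wΛ hv.isStructureOp.odd (hDΛ) η
    have e2 : hOp (basT L nab (nabForm nab α η)) = 0 :=
      map_basT_eq_zero hO.isLocalOp (fun _ _ => hO.mul_eq_zero) hOp_wT hOp_wΛ _
    have e3 : hOp (oneForm (gensΛ E FA A)
        (fun β => wT FA A ((adjoint L nab).conj.KDual α β η))) = 0 :=
      map_oneForm_eq_zero (G := gensΛ E FA A) hO.isLocalOp (fun _ _ => hO.mul_eq_zero) hK hOp_wΛ
        (fun _ => hOp_wT _)
    rw [hz, map_sub, map_sub, map_sub, map_add, h3, h5, e1, e2, e3]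
    abel

/-- The horizontal and the vertical differential anticommute. -/
theorem anticomm (a : Weil E FA A) : dh (dv a) + dv (dh a) = 0 := by
  have hP := anticomm_evenD hv hh
  refine hP.ext (N' := 0) ⟨fun a b => by simp, fun a => by simp⟩ (anticomm_wF hv hh)
    (anticomm_wT hv hh) (anticomm_wΛ hv hh) (fun η => ?_) a
  have e : wS η = dv (wΛ η) - covΛ nab η := by rw [hv.apply_wΛ, add_sub_cancel_right]
  rw [e, map_sub, map_covΛ_eq_zero hP.isLocalOp (fun _ _ => hP.mul_eq_zero) (anticomm_wT hv hh)
    (anticomm_wΛ hv hh), sub_zero, anticomm_dv hv hh, anticomm_wΛ hv hh, map_zero]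
  rfl

/-- Anticommuting twice moves `d_ver` through `d_hor²` without a sign. This reduces `d_hor² = 0` to
functions and `θ_η`, so no identity for the basic curvature is needed there. -/
theorem sq_dh_dv (a : Weil E FA A) : dh (dh (dv a)) = dv (dh (dh a)) := by
  have h1 := anticomm hv hh a
  have h2 := anticomm hv hh (dh a)
  have h3 := congrArg dh h1
  rw [map_add, map_zero] at h3
  linear_combination (norm := abel) h3 - h2

/-- The square of the horizontal differential vanishes. -/
theorem IsHorizontalDifferential.sq (a : Weil E FA A) : dh (dh a) = 0 := by
  have hQ := hh.isStructureOp.odd.sq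
  have hF := hh.isStructureOp.sq_fn
  have hT : ∀ ξ, (dh ∘ₗ dh) (wT FA A ξ) = 0 := map_wT_eq_zero hQ.isLocalOp (fun f a => by
      rw [hQ.der, LinearMap.comp_apply, hF, zero_mul, zero_add]) (fun f => by
      rw [← hv.apply_wF, LinearMap.comp_apply, sq_dh_dv hv hh, hF, map_zero])
  refine hQ.ext (N' := 0) ⟨fun a b => by simp, fun a => by simp⟩ hF hT hh.sq_wΛ (fun η => ?_) a
  have e : wS η = dv (wΛ η) - covΛ nab η := by rw [hv.apply_wΛ, add_sub_cancel_right]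
  rw [e, map_sub, map_covΛ_eq_zero hQ.isLocalOp (fun _ _ => hQ.mul_eq_zero) hT hh.sq_wΛ,
    sub_zero, LinearMap.comp_apply, sq_dh_dv hv hh, hh.sq_wΛ, map_zero]
  rfl

end Both

/-! ### The differential bigraded algebra. -/

section DGA

theorem isInternal_weilPiece :
    DirectSum.IsInternal (fun pq : ℕ × ℕ => weilPiece E FA A pq.1 pq.2) := by
  rw [DirectSum.isInternal_submodule_iff_iSupIndep_and_iSup_eq_top]
  refine ⟨?_, weil_eq_iSup⟩
  rw [iSupIndep_def]
  refine fun pq => Submodule.disjoint_def.2 fun a ha ha' => weil_ext fun x => ?_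
  have h1 : ∀ b ∈ (⨆ (j : ℕ × ℕ) (_ : j ≠ pq), weilPiece E FA A j.1 j.2),
      biProj E A x ((pq.1 : ℤ), (pq.2 : ℤ)) (b.1 x) = 0 := by
    let S : Submodule ℝ (Weil E FA A) :=
      { carrier := {b | biProj E A x ((pq.1 : ℤ), (pq.2 : ℤ)) (b.1 x) = 0}
        add_mem' := fun {b c} hb hc => by
          show biProj E A x _ ((b + c).1 x) = 0
          rw [weil_add_apply, map_add, hb, hc, add_zero]
        zero_mem' := by
          show biProj E A x _ ((0 : Weil E FA A).1 x) = 0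
          rw [weil_zero_apply, map_zero]
        smul_mem' := fun r b hb => by
          show biProj E A x _ ((r • b).1 x) = 0
          rw [weil_smul_apply, map_smul, hb, smul_zero] }
    refine fun b hb => (iSup₂_le (fun j hj => ?_) : _ ≤ S) hb
    intro c hc
    refine fiberProj_of_mem_ne (fun h => hj ?_) (mem_weilPiece.1 hc x)
    simp only [Prod.mk.injEq, Nat.cast_inj] at h
    exact Prod.ext h.1 h.2
  rw [← fiberProj_of_mem (mem_weilPiece.1 ha x), h1 a ha']
  rfl

theorem isDifferentialBigradedAlgebra (hh : IsHorizontalDifferential L nab dh)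
    (hv : IsVerticalDifferential nab dv) : IsDifferentialBigradedAlgebra dh dv where
  graded :=
    { one_mem := mem_weilPiece.2 fun x => one_mem_fiberGr
      mul_mem := fun {i j} a b ha hb => mem_weilPiece.2 fun x => by
        have h := mul_mem_fiberGr (mem_weilPiece.1 ha x) (mem_weilPiece.1 hb x)
        rw [weil_mul_apply]
        simpa using h }
  internal := isInternal_weilPiece
  hor_mem p q a ha := mem_weilPiece.2 fun x => by
    simpa using hh.shifts _ _ (mem_weilPiece.1 ha) x
  ver_mem p q a ha := mem_weilPiece.2 fun x => by
    simpa using hv.shifts _ _ (mem_weilPiece.1 ha) x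
  hor_derivation := hh.derivation
  ver_derivation := hv.derivation
  hor_hor := IsHorizontalDifferential.sq hv hh
  ver_ver := hv.sq
  hor_ver := anticomm hv hh

end DGA

end Anticommutation

/-! ### Independence of the connection -/

section Independence

variable {E : Type*} [NormedAddCommGroup E] [NormedSpace ℝ E] [FiniteDimensional ℝ E]
  {M : Type*} [TopologicalSpace M] [ChartedSpace E M] [IsManifold 𝓘(ℝ, E) ∞ M]
  {FA : Type*} [NormedAddCommGroup FA] [NormedSpace ℝ FA]
  {A : M → Type*} [TopologicalSpace (TotalSpace FA A)] [∀ x, AddCommGroup (A x)]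
  [∀ x, Module ℝ (A x)] [∀ x, TopologicalSpace (A x)] [FiberBundle FA A] [VectorBundle ℝ FA A]

/-- Even elements of the fibre are central. -/
theorem mul_comm_of_parity {x : M} {b : WeilFiber E A x} (hb : parity E A x b = b)
    (a : WeilFiber E A x) : a * b = b * a := by
  have h := weilFiber_adjoin_eq_top (Subalgebra.centralizer ℝ {b}) (fun ξ => ?_) (fun ξ => ?_)
    (fun ξ => ?_) a
  · exact ((Subalgebra.mem_centralizer_iff ℝ).1 h b rfl).symm
  all_goals
    refine (Subalgebra.mem_centralizer_iff ℝ).2 fun c hc => ?_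
    rw [Set.mem_singleton_iff.1 hc]
  · rw [genT_mul, hb]
  · rw [genΛ_mul, hb]
  · rw [genS_mul]

variable [T2Space M]

/-- An operator on dual sections which is linear over functions is given by fibrewise maps. -/
theorem exists_dual_fibre_map {FB : Type*} [NormedAddCommGroup FB] [NormedSpace ℝ FB]
    {B : M → Type*} [TopologicalSpace (TotalSpace FB B)] [∀ x, AddCommGroup (B x)]
    [∀ x, Module ℝ (B x)] [∀ x, TopologicalSpace (B x)] [FiberBundle FB B] [VectorBundle ℝ FB B]
    [FiniteDimensional ℝ FB] [ContMDiffVectorBundle ∞ FB B 𝓘(ℝ, E)]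
    (Δ : SDual E FB B →ₗ[ℝ] Weil E FA A) (hΔ : ∀ f ν, Δ (smulDual f ν) = wF FA A f * Δ ν) (x : M) :
    ∃ τ : Module.Dual ℝ (B x) →ₗ[ℝ] WeilFiber E A x, ∀ ν, (Δ ν).1 x = τ (ν.1 x) := by
  obtain ⟨s, μ, h⟩ := exists_dualFrame (E := E) FB B x
  obtain ⟨χ, h1, h2⟩ := exists_bump (E := E) h
  obtain ⟨τ, hτ⟩ := exists_dual_map (fun i => s i x) (fun i => (Δ (μ i)).1 x)
  refine ⟨τ, fun ν => ?_⟩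
  -- Multiplication by a cut-off makes the local frame expansion a global identity, to which
  -- linearity over functions applies directly.
  have h3 : smulDual χ ν = ∑ i, smulDual (χ * pair ν (s i)) (μ i) := Subtype.ext <| funext fun y => by
    rw [SDual.sum_apply, smulDual_apply]
    by_cases hy : y ∈ tsupport χ
    · obtain ⟨b, hb, hb'⟩ := h2 hy
      refine b.ext fun j => ?_
      classical
      rw [LinearMap.sum_apply, LinearMap.smul_apply, Finset.sum_eq_single j]
      · rw [smulDual_apply, hb', LinearMap.smul_apply, b.coord_apply, b.repr_self,
          Finsupp.single_eq_same, ← hb]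
        show χ y * _ = (χ y * ν.1 y (s j y)) * 1
        rw [mul_one]
      · intro i _ hij
        rw [smulDual_apply, hb', LinearMap.smul_apply, b.coord_apply, b.repr_self,
          Finsupp.single_eq_of_ne hij, smul_zero]
      · intro h; exact absurd (Finset.mem_univ _) h
    · have h0 : χ y = 0 := image_eq_zero_of_notMem_tsupport hy
      rw [h0, zero_smul]
      refine (Finset.sum_eq_zero fun i _ => ?_).symm
      rw [smulDual_apply, show (χ * pair ν (s i)) y = χ y * pair ν (s i) y from rfl, h0, zero_mul,
        zero_smul]
  have h4 : (Δ (smulDual χ ν)).1 x = ∑ i, (Δ (smulDual (χ * pair ν (s i)) (μ i))).1 x := by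
    rw [h3, map_sum, weil_sum_apply]
  rw [hΔ, wF_mul_apply, h1.self_of_nhds, one_smul] at h4
  rw [h4, hτ]
  refine Finset.sum_congr rfl fun i _ => ?_
  rw [hΔ, wF_mul_apply, show (χ * pair ν (s i)) x = χ x * ν.1 x (s i x) from rfl,
    h1.self_of_nhds, one_mul]

variable [FiniteDimensional ℝ FA] [ContMDiffVectorBundle ∞ FA A 𝓘(ℝ, E)]
  {L : LieAlgebroid E FA A} {nab nab' : Connection (LieAlgebroid.tangent E M) FA A}

theorem covΛ_add (η η' : SDual E FA A) : covΛ nab (η + η') = covΛ nab η + covΛ nab η' :=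
  (isTensor_nabDual _).oneForm_eq (gensT E FA A)
    ((((isTensor_nabDual (nab := nab) η).oneForm_isOneForm (gensT E FA A)).add
      ((isTensor_nabDual η').oneForm_isOneForm (gensT E FA A))).congr fun X => by
        rw [nabDual, nabDual, nabDual, nab.isConn.connDual_add, map_add])

/-- The inhomogeneous term `df θ_η` does not involve the connection. Therefore the difference for
two connections is linear over functions. -/
theorem covΛ_smul (f : Fn E M) (η : SDual E FA A) : covΛ nab (smulDual f η) =
    wF FA A f * covΛ nab η + wT FA A (dFn (LieAlgebroid.tangent E M) f) * wΛ η :=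
  (isTensor_nabDual _).oneForm_eq (gensT E FA A)
    (((((isTensor_nabDual (nab := nab) η).oneForm_isOneForm (gensT E FA A)).wF_mul f).add
      ((isOneForm_pair (gensT E FA A) (dFn (LieAlgebroid.tangent E M) f)).mul_right
        (wΛ η))).congr fun X => by
        rw [nabDual, nabDual, nab.isConn.connDual_smul, map_add, wΛ_smul, wΛ_smul, pair_dFn])

theorem covΛ_parity (η : SDual E FA A) : wpar (covΛ nab η) = covΛ nab η :=
  (((isTensor_nabDual (nab := nab) η).oneForm_isOneForm (gensT E FA A)).wpar gensT_isOdd).congr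
    (T' := fun X => wΛ (nabDual nab X η)) (fun X => by rw [wpar_wΛ, neg_neg]) |>.unique
    ((isTensor_nabDual η).oneForm_isOneForm (gensT E FA A))

theorem covΛ_mem (η : SDual E FA A) (x : M) : (covΛ nab η).1 x ∈ biGr E A x (1, 1) := by
  have h := ((isTensor_nabDual (nab := nab) η).oneForm_isOneForm (gensT E FA A)).mem
    (n := (1, 0)) (fun s y => genΛ_mem_fiberGr _) x
  exact h

variable (nab nab') in
/-- The algebra homomorphism `μ_η ↦ μ_η + (d_{∇'*} - d_{∇*}) θ_η`. -/
theorem exists_changeConn : ∃ Φ : Weil E FA A →ₗ[ℝ] Weil E FA A, IsLocalOp Φ ∧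
    (∀ a b, Φ (a * b) = Φ a * Φ b) ∧ Shifts Φ 0 ∧ (∀ f, Φ (wF FA A f) = wF FA A f) ∧
    (∀ ξ, Φ (wT FA A ξ) = wT FA A ξ) ∧ (∀ η, Φ (wΛ η) = wΛ η) ∧
    ∀ η, Φ (wS η) = wS η + (covΛ nab' η - covΛ nab η) := by
  let Δ : SDual E FA A →ₗ[ℝ] Weil E FA A :=
    linearOfLeibniz (L := LieAlgebroid.tangent E M) (GB := gensT E FA A) (fun _ => 0)
      (fun η => covΛ nab' η - covΛ nab η)
      (fun η η' => by rw [covΛ_add, covΛ_add]; abel)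
      (fun f η => by rw [covΛ_smul, covΛ_smul, mul_zero, add_zero, mul_sub]; abel)
  have hΔ : ∀ η, Δ η = covΛ nab' η - covΛ nab η := fun _ => rfl
  choose τ hτ using exists_dual_fibre_map Δ (fun f η => by
    rw [hΔ, hΔ, covΛ_smul, covΛ_smul, mul_sub]; abel)
  have hpar : ∀ x η, parity E A x (τ x η) = τ x η := fun x η => by
    obtain ⟨ν, rfl⟩ := exists_sdual (E := E) (FB := FA) x η
    rw [← hτ, ← wpar_apply, hΔ, map_sub, covΛ_parity, covΛ_parity]
  have hmem : ∀ x η, τ x η ∈ biGr E A x (1, 1) := fun x η => by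
    obtain ⟨ν, rfl⟩ := exists_sdual (E := E) (FB := FA) x η
    rw [← hτ, hΔ, weil_sub_apply]
    exact sub_mem (covΛ_mem ν x) (covΛ_mem ν x)
  -- The correction is even, and even elements of the fibre are central; so the modified images of
  -- the even generators satisfy the required relations.
  have hcen : ∀ x η a, a * (genS E A x + τ x) η = (genS E A x + τ x) η * a := fun x η a =>
    mul_comm_of_parity (by rw [LinearMap.add_apply, map_add, parity_genS, hpar]) a
  choose φ hφT hφΛ hφS using fun x => exists_weilLift (E := E) (x := x) (genT E A x) (genΛ E A x)
    (genS E A x + τ x) (fun ξ η => by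
      rw [add_mul, mul_add, mul_add, genT_sq, genΛ_sq, genT_mul_genΛ]; abel)
    (fun η η' => hcen x _ _) (fun ξ η => hcen x _ _) (fun η η' => hcen x _ _)
  obtain ⟨Φ, hΦ⟩ := exists_fibrewise (FA := FA) (fun x => (φ x).toLinearMap) 0 (fun t ht => by
    refine polySections_induction (P := fun t => (fun x => φ x (t x) : RawWeil E A) ∈
      locPoly E FA A) (fun f => ?_) (fun ν => ?_) (fun ν => ?_) (fun ν => ?_)
      (fun s t _ _ hs ht => ?_) (fun s t hs ht => ?_) ht
    · simp only [AlgHom.commutes]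
      exact weil_le_locPoly (wF FA A f).2
    · simp only [hφT]
      exact weil_le_locPoly (wT FA A ν).2
    · simp only [hφΛ]
      exact weil_le_locPoly (wΛ ν).2
    · have e : (fun x => φ x (genS E A x (ν.1 x)) : RawWeil E A) = (wS ν + Δ ν : Weil E FA A).1 :=
        funext fun x => by
          rw [hφS, weil_add_apply, hτ]
          rfl
      rw [e]
      exact weil_le_locPoly (wS ν + Δ ν : Weil E FA A).2
    · have e : (fun x => φ x ((s * t) x) : RawWeil E A) =
          (show RawWeil E A from fun x => φ x (s x)) * (show RawWeil E A from fun x => φ x (t x)) :=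
        funext fun x => map_mul _ _ _
      rw [e]
      exact mul_mem hs ht
    · have e : (fun x => φ x ((s + t) x) : RawWeil E A) =
          (show RawWeil E A from fun x => φ x (s x)) + (show RawWeil E A from fun x => φ x (t x)) :=
        funext fun x => map_add _ _ _
      rw [e]
      exact add_mem hs ht) (fun x n a ha => by
    rw [add_zero]
    refine algHom_mem_fiberGr (φ := φ x) (fun ξ => ?_) (fun ξ => ?_) (fun ξ => ?_) ha
    · rw [hφT]; exact genT_mem_fiberGr _
    · rw [hφΛ]; exact genΛ_mem_fiberGr _
    · rw [hφS]; exact add_mem (genS_mem_fiberGr _) (hmem x ξ))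
  refine ⟨Φ, isLocalOp_of_fibrewise hΦ, fun a b => weil_ext fun x => ?_, fun a n ha x => ?_,
    fun f => weil_ext fun x => ?_, fun f => weil_ext fun x => ?_, fun f => weil_ext fun x => ?_,
    fun f => weil_ext fun x => ?_⟩
  · rw [weil_mul_apply, hΦ, hΦ, hΦ, weil_mul_apply]
    exact map_mul (φ x) _ _
  · rw [hΦ, add_zero]
    refine algHom_mem_fiberGr (φ := φ x) (fun ξ => ?_) (fun ξ => ?_) (fun ξ => ?_) (ha x)
    · rw [hφT]; exact genT_mem_fiberGr _
    · rw [hφΛ]; exact genΛ_mem_fiberGr _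
    · rw [hφS]; exact add_mem (genS_mem_fiberGr _) (hmem x ξ)
  · rw [hΦ]; exact AlgHom.commutes _ _
  · rw [hΦ]; exact hφT _ _
  · rw [hΦ]; exact hφΛ _ _
  · rw [hΦ, weil_add_apply, ← hΔ, hτ]; exact hφS _ _

section Transform

variable {Φ d d' : Weil E FA A →ₗ[ℝ] Weil E FA A}

theorem shifts_zero_parity (h : Shifts Φ 0) (a : Weil E FA A) : Φ (wpar a) = wpar (Φ a) := by
  refine weil_induction (P := fun a => Φ (wpar a) = wpar (Φ a)) (fun p q a ha => ?_)
    (fun a b ha hb => ?_) a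
  · rw [weil_parity_of_mem ha, map_smul, weil_parity_of_mem (p := p) (q := q) (a := Φ a)]
    exact mem_weilPiece.2 fun x => by simpa using h a _ (mem_weilPiece.1 ha) x
  · simp only [map_add, ha, hb]

/-- The difference `Φ d - d' Φ` is a derivation only in a sense twisted by `Φ`, but its kernel is
closed under products, which is all that is required. -/
theorem intertwine_mul (hmul : ∀ a b, Φ (a * b) = Φ a * Φ b) (h0 : Shifts Φ 0) (hd : IsOddDer d)
    (hd' : IsOddDer d') (a b : Weil E FA A) (ha : (Φ ∘ₗ d - d' ∘ₗ Φ) a = 0)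
    (hb : (Φ ∘ₗ d - d' ∘ₗ Φ) b = 0) : (Φ ∘ₗ d - d' ∘ₗ Φ) (a * b) = 0 := by
  simp only [LinearMap.sub_apply, LinearMap.comp_apply, sub_eq_zero] at *
  rw [hd, map_add, hmul, hmul, hmul, hd', ha, hb, shifts_zero_parity h0]

/-- A multiplicative operator which fixes the odd generators. -/
theorem fix_mul (hmul : ∀ a b, Φ (a * b) = Φ a * Φ b) (a b : Weil E FA A)
    (ha : (Φ - (LinearMap.id : Weil E FA A →ₗ[ℝ] Weil E FA A)) a = 0) (hb : (Φ - (LinearMap.id : Weil E FA A →ₗ[ℝ] Weil E FA A)) b = 0) :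
    (Φ - (LinearMap.id : Weil E FA A →ₗ[ℝ] Weil E FA A)) (a * b) = 0 := by
  simp only [LinearMap.sub_apply, LinearMap.id_apply, sub_eq_zero] at *
  rw [hmul, ha, hb]

end Transform

/-- After contraction with `β` and evaluation on `X`, the connection enters both summands through
`ξ(ρ(∇_X β))`, with opposite signs. -/
theorem basT_add_covΛ (ξ : Form1 E M) :
    basT L nab ξ + covΛ nab (anchDual L ξ) = basT L nab' ξ + covΛ nab' (anchDual L ξ) := by
  rw [← sub_eq_zero]
  have hO := hOp_oddD (E := E) (FA := FA) (A := A)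
  have e1 : ∀ nab : Connection (LieAlgebroid.tangent E M) FA A, ∀ η, hOp (covΛ nab η) = 0 :=
    fun nab => map_covΛ_eq_zero hO.isLocalOp (fun _ _ => hO.mul_eq_zero) hOp_wT hOp_wΛ
  have e2 : ∀ nab : Connection (LieAlgebroid.tangent E M) FA A, ∀ η, hOp (basT L nab η) = 0 :=
    fun nab => map_basT_eq_zero hO.isLocalOp (fun _ _ => hO.mul_eq_zero) hOp_wT hOp_wΛ
  have e3 : ∀ nab : Connection (LieAlgebroid.tangent E M) FA A, ∀ x,
      (basT L nab ξ).1 x ∈ biGr E A x (1, 1) := fun nab x =>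
    ((isTensor_basDual (L := L) (nab := nab) ξ).oneForm_isOneForm (gensΛ E FA A)).mem
      (n := (0, 1)) (fun s y => genT_mem_fiberGr _) x
  refine eq_zero_of_cΛ_hOp (fun x => ?_) (fun β => ?_) ?_
  · rw [weil_sub_apply, weil_add_apply, weil_add_apply]
    exact sub_mem (add_mem (e3 _ _) (covΛ_mem _ _)) (add_mem (e3 _ _) (covΛ_mem _ _))
  · have h : basDual L nab β ξ - evForm nab β (anchDual L ξ) =
        basDual L nab' β ξ - evForm nab' β (anchDual L ξ) := SDual.ext_pair fun X => by
      rw [sub_pair, sub_pair, pair_basDual, pair_basDual, pair_evForm, pair_evForm, pair_nabDual,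
        pair_nabDual, basicConnT, basicConnT, pair_anchDual, pair_anchDual, pair_anchDual, pair_add,
        pair_add]
      abel
    have h' := congrArg (wT FA A) h
    rw [wT_sub, wT_sub] at h'
    rw [map_sub, map_add, map_add, cΛ_basT, cΛ_basT, cΛ_covΛ, cΛ_covΛ, ← sub_eq_add_neg,
      ← sub_eq_add_neg, h', sub_self]
  · rw [map_sub, map_add, map_add, e1, e1, e2, e2, add_zero, sub_self]

variable {dh dv dh' dv' : Weil E FA A →ₗ[ℝ] Weil E FA A}

theorem changeConn_commutes (hh : IsHorizontalDifferential L nab dh)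
    (hv : IsVerticalDifferential nab dv) (hh' : IsHorizontalDifferential L nab' dh')
    (hv' : IsVerticalDifferential nab' dv') {Φ : Weil E FA A →ₗ[ℝ] Weil E FA A}
    (hloc : IsLocalOp Φ) (hmul : ∀ a b, Φ (a * b) = Φ a * Φ b) (h0 : Shifts Φ 0)
    (hF : ∀ f, Φ (wF FA A f) = wF FA A f) (hT : ∀ ξ, Φ (wT FA A ξ) = wT FA A ξ)
    (hΛ : ∀ η, Φ (wΛ η) = wΛ η) (hS : ∀ η, Φ (wS η) = wS η + (covΛ nab' η - covΛ nab η)) :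
    (∀ a, Φ (dh a) = dh' (Φ a)) ∧ ∀ a, Φ (dv a) = dv' (Φ a) := by
  have hfl : IsLocalOp (Φ - (LinearMap.id : Weil E FA A →ₗ[ℝ] Weil E FA A)) := hloc.sub isLocalOp_id
  have hfT : ∀ ξ, (Φ - (LinearMap.id : Weil E FA A →ₗ[ℝ] Weil E FA A)) (wT FA A ξ) = 0 := fun ξ => by
    rw [LinearMap.sub_apply, hT, LinearMap.id_apply, sub_self]
  have hfΛ : ∀ ξ, (Φ - (LinearMap.id : Weil E FA A →ₗ[ℝ] Weil E FA A)) (wΛ ξ) = 0 := fun ξ => by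
    rw [LinearMap.sub_apply, hΛ, LinearMap.id_apply, sub_self]
  have hfC : ∀ η, Φ (covΛ nab η) = covΛ nab η := fun η =>
    sub_eq_zero.1 (map_covΛ_eq_zero hfl (fix_mul hmul) hfT hfΛ η)
  have hfB : ∀ ξ, Φ (basT L nab ξ) = basT L nab ξ := fun η =>
    sub_eq_zero.1 (map_basT_eq_zero hfl (fix_mul hmul) hfT hfΛ η)
  -- The generators `μ_η` are exchanged for `d_ver θ_η`. The difference is a sum of products of odd
  -- generators, on which the intertwining relation is already known.
  have key : ∀ d d' : Weil E FA A →ₗ[ℝ] Weil E FA A, OddD d → OddD d' →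
      (∀ f, Φ (d (wF FA A f)) = d' (Φ (wF FA A f))) →
      (∀ f, Φ (d (wT FA A f)) = d' (Φ (wT FA A f))) →
      (∀ f, Φ (d (wΛ f)) = d' (Φ (wΛ f))) →
      (∀ η, Φ (d (dv (wΛ η))) = d' (Φ (dv (wΛ η)))) → ∀ a, Φ (d a) = d' (Φ a) := by
    intro d d' hd hd' kF kT kΛ kS
    have hl : IsLocalOp (Φ ∘ₗ d - d' ∘ₗ Φ) := (hloc.comp hd.isLocalOp).sub (hd'.isLocalOp.comp hloc)
    have kT' : ∀ ξ, (Φ ∘ₗ d - d' ∘ₗ Φ) (wT FA A ξ) = 0 := fun ξ => sub_eq_zero.2 (kT ξ)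
    have kΛ' : ∀ ξ, (Φ ∘ₗ d - d' ∘ₗ Φ) (wΛ ξ) = 0 := fun ξ => sub_eq_zero.2 (kΛ ξ)
    have hm := intertwine_mul hmul h0 hd.der hd'.der
    intro a
    rw [← sub_eq_zero]
    refine weil_op_eq (D' := 0) hl isLocalOp_zero (fun a b ha hb => hm a b ha hb)
      (fun f => sub_eq_zero.2 (kF f)) kT' kΛ' (fun η => ?_) a
    have e : wS η = dv (wΛ η) - covΛ nab η := by rw [hv.apply_wΛ, add_sub_cancel_right]
    rw [e, map_sub, map_covΛ_eq_zero hl hm kT' kΛ', sub_zero]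
    exact sub_eq_zero.2 (kS η)
  have kdvΛ : ∀ η, Φ (dv (wΛ η)) = dv' (Φ (wΛ η)) := fun η => by
    rw [hv.apply_wΛ, map_add, hS, hfC, hΛ, hv'.apply_wΛ]
    abel
  have hdv : ∀ a, Φ (dv a) = dv' (Φ a) := by
    refine key dv dv' hv.isStructureOp.odd hv'.isStructureOp.odd (fun f => ?_) (fun ξ => ?_) kdvΛ
      (fun η => ?_)
    · rw [hv.apply_wF, hT, hF, hv'.apply_wF]
    · rw [hT]
      have h1 : dv (wT FA A ξ) = _ := hv.isStructureOp.form ξ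
      have h2 : dv' (wT FA A ξ) = _ := hv'.isStructureOp.form ξ
      rw [h1, h2, strForm, map_smul]
      congr 1
      exact sub_eq_zero.1 (map_oneForm_eq_zero (G := gensT E FA A) hfl (fix_mul hmul)
        (isTensor_extD (GB := gensT E FA A) ξ) hfT (fun _ => hfT _))
    · rw [hv.sq, kdvΛ, hv'.sq, map_zero]
  refine ⟨?_, hdv⟩
  have kΛ : ∀ η, Φ (dh (wΛ η)) = dh' (Φ (wΛ η)) := fun η => by
    rw [hΛ]
    have h1 : dh (wΛ η) = _ := hh.isStructureOp.form η
    have h2 : dh' (wΛ η) = _ := hh'.isStructureOp.form η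
    rw [h1, h2, strForm, map_smul]
    congr 1
    exact sub_eq_zero.1 (map_oneForm_eq_zero (G := gensΛ E FA A) hfl (fix_mul hmul)
      (isTensor_extD (GB := gensΛ E FA A) η) hfΛ (fun _ => hfΛ _))
  refine key dh dh' hh.isStructureOp.odd hh'.isStructureOp.odd (fun f => ?_) (fun ξ => ?_) kΛ
    (fun η => ?_)
  · rw [hh.apply_wF, hΛ, hF, hh'.apply_wF]
  · rw [hT, hh.apply_wT, hh'.apply_wT, map_sub, hfB, hS]
    have h := basT_add_covΛ (L := L) (nab := nab) (nab' := nab') ξ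
    linear_combination (norm := abel) h
  -- On `d_ver θ_η` the horizontal differentials are moved past the vertical ones on both sides,
  -- where `Φ` is known to intertwine.
  · have h1 := anticomm hv hh (wΛ η)
    have h2 := anticomm hv' hh' (wΛ η)
    have h3 := congrArg Φ h1
    have h4 := hdv (dh (wΛ η))
    rw [kΛ, hΛ] at h4
    rw [map_add, map_zero, h4] at h3
    rw [kdvΛ, hΛ]
    linear_combination (norm := abel) h3 - h2

theorem exists_changeConn_equiv (hh : IsHorizontalDifferential L nab dh)
    (hv : IsVerticalDifferential nab dv) (hh' : IsHorizontalDifferential L nab' dh')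
    (hv' : IsVerticalDifferential nab' dv') :
    ∃ φ : Weil E FA A ≃ₐ[ℝ] Weil E FA A,
      (∀ p q a, φ a ∈ weilPiece E FA A p q ↔ a ∈ weilPiece E FA A p q) ∧
      (∀ a, φ (dh a) = dh' (φ a)) ∧ (∀ a, φ (dv a) = dv' (φ a)) := by
  -- Exchanging the connections inverts the map: the correction terms have opposite signs and are
  -- fixed, being built from odd generators.
  have inv : ∀ (nab nab' : Connection (LieAlgebroid.tangent E M) FA A)
      (Φ Ψ : Weil E FA A →ₗ[ℝ] Weil E FA A), IsLocalOp Φ → IsLocalOp Ψ →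
      (∀ a b, Φ (a * b) = Φ a * Φ b) → (∀ a b, Ψ (a * b) = Ψ a * Ψ b) →
      (∀ f, Φ (wF FA A f) = wF FA A f) → (∀ f, Ψ (wF FA A f) = wF FA A f) →
      (∀ f, Φ (wT FA A f) = wT FA A f) → (∀ f, Ψ (wT FA A f) = wT FA A f) →
      (∀ f, Φ (wΛ f) = wΛ f) → (∀ f, Ψ (wΛ f) = wΛ f) →
      (∀ η, Φ (wS η) = wS η + (covΛ nab' η - covΛ nab η)) →
      (∀ η, Ψ (wS η) = wS η + (covΛ nab η - covΛ nab' η)) → ∀ a, Ψ (Φ a) = a := by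
    intro nab nab' Φ Ψ hl hl' hm hm' hF hF' hT hT' hΛ hΛ' hS hS' a
    have hC : ∀ nab : Connection (LieAlgebroid.tangent E M) FA A, ∀ η,
        Ψ (covΛ nab η) = covΛ nab η := fun nab η =>
      sub_eq_zero.1 (map_covΛ_eq_zero (hl'.sub isLocalOp_id) (fix_mul hm')
        (fun ξ => sub_eq_zero.2 (hT' ξ)) (fun ξ => sub_eq_zero.2 (hΛ' ξ)) η)
    refine weil_op_eq (D := Ψ ∘ₗ Φ) (D' := LinearMap.id) (hl'.comp hl) isLocalOp_id
      (fun a b ha hb => ?_) (fun f => ?_) (fun f => ?_) (fun f => ?_) (fun η => ?_) a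
    all_goals simp only [LinearMap.comp_apply, LinearMap.id_apply] at *
    · rw [hm, hm', ha, hb]
    · rw [hF, hF']
    · rw [hT, hT']
    · rw [hΛ, hΛ']
    · rw [hS, map_add, map_sub, hC, hC, hS']
      abel
  obtain ⟨Φ, hl, hm, h0, hF, hT, hΛ, hS⟩ := exists_changeConn (A := A) nab nab'
  obtain ⟨Ψ, hl', hm', h0', hF', hT', hΛ', hS'⟩ := exists_changeConn (A := A) nab' nab
  have i1 := inv nab nab' Φ Ψ hl hl' hm hm' hF hF' hT hT' hΛ hΛ' hS hS'
  have i2 := inv nab' nab Ψ Φ hl' hl hm' hm hF' hF hT' hT hΛ' hΛ hS' hS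
  obtain ⟨c1, c2⟩ := changeConn_commutes hh hv hh' hv' hl hm h0 hF hT hΛ hS
  have hp : ∀ Φ : Weil E FA A →ₗ[ℝ] Weil E FA A, Shifts Φ 0 → ∀ p q a,
      a ∈ weilPiece E FA A p q → Φ a ∈ weilPiece E FA A p q := fun Φ h p q a ha =>
    mem_weilPiece.2 fun x => by simpa using h a _ (mem_weilPiece.1 ha) x
  refine ⟨AlgEquiv.ofLinearEquiv (LinearEquiv.ofLinearMap Φ Ψ (LinearMap.ext i2) (LinearMap.ext i1))
    (by
      have h := hF 1
      rw [map_one] at h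
      exact h) hm, fun p q a => ⟨fun h => ?_, fun h => hp Φ h0 p q a h⟩, c1, c2⟩
  rw [← i1 a]
  exact hp Ψ h0' p q _ h

end Independence

/-! ### Elements of the fibre algebra as alternating forms, and their products. -/

section FibreForms

variable {E : Type*} [NormedAddCommGroup E] [NormedSpace ℝ E] [FiniteDimensional ℝ E]
  {M : Type*} [TopologicalSpace M] [ChartedSpace E M] [IsManifold 𝓘(ℝ, E) ∞ M]
  {A : M → Type*} [∀ x, AddCommGroup (A x)] [∀ x, Module ℝ (A x)] [∀ x, TopologicalSpace (A x)]
  {x : M}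

variable (E A x) in
theorem exists_augment : ∃ φ : WeilFiber E A x →ₐ[ℝ] ℝ, (∀ ξ, φ (genT E A x ξ) = 0) ∧
    (∀ η, φ (genΛ E A x η) = 0) ∧ (∀ η, φ (genS E A x η) = 0) :=
  exists_weilLift 0 0 0 (by simp) (by simp) (by simp) (by simp)

variable (E A x) in
/-- The augmentation of the fibre algebra, which kills all the generators. -/
def augment : WeilFiber E A x →ₐ[ℝ] ℝ := (exists_augment E A x).choose

theorem augment_genT (ξ : Cotan E x) : augment E A x (genT E A x ξ) = 0 :=
  (exists_augment E A x).choose_spec.1 ξ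

theorem augment_genΛ (η : Module.Dual ℝ (A x)) : augment E A x (genΛ E A x η) = 0 :=
  (exists_augment E A x).choose_spec.2.1 η

theorem augment_genS (η : Module.Dual ℝ (A x)) : augment E A x (genS E A x η) = 0 :=
  (exists_augment E A x).choose_spec.2.2 η

theorem IsOddFiberDer.add {δ δ' : WeilFiber E A x →ₗ[ℝ] WeilFiber E A x}
    (h : IsOddFiberDer δ) (h' : IsOddFiberDer δ') : IsOddFiberDer (δ + δ') := fun a b => by
  simp only [LinearMap.add_apply, h a b, h' a b, add_mul, mul_add]
  abel

theorem IsOddFiberDer.smul {δ : WeilFiber E A x →ₗ[ℝ] WeilFiber E A x}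
    (h : IsOddFiberDer δ) (c : ℝ) : IsOddFiberDer (c • δ) := fun a b => by
  simp only [LinearMap.smul_apply, h a b, smul_add, smul_mul_assoc, mul_smul_comm]

variable (E A x) in
/-- The contraction with a tangent vector, linear in the vector. -/
def contrT : TangentSpace 𝓘(ℝ, E) x →ₗ[ℝ] WeilFiber E A x →ₗ[ℝ] WeilFiber E A x where
  toFun v := contr E A x v 0
  map_add' v w := (contr_isOddFiberDer _ _).ext
    ((contr_isOddFiberDer _ _).add (contr_isOddFiberDer _ _))
    (fun ξ => by simp [contr_genT]) (fun η => by simp [contr_genΛ]) (fun η => by simp [contr_genS])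
  map_smul' c v := (contr_isOddFiberDer _ _).ext ((contr_isOddFiberDer _ _).smul c)
    (fun ξ => by simp [contr_genT, Algebra.smul_def]) (fun η => by simp [contr_genΛ])
    (fun η => by simp [contr_genS])

theorem contrT_apply (v : TangentSpace 𝓘(ℝ, E) x) (a : WeilFiber E A x) :
    contrT E A x v a = contr E A x v 0 a := rfl

theorem contrT_genT_mul (v : TangentSpace 𝓘(ℝ, E) x) (ξ : Cotan E x) (a : WeilFiber E A x) :
    contrT E A x v (genT E A x ξ * a) = ξ v • a - genT E A x ξ * contrT E A x v a := by
  rw [contrT_apply, contr_isOddFiberDer, contr_genT, parity_genT, ← Algebra.smul_def, neg_mul,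
    sub_eq_add_neg, contrT_apply]

theorem contrT_anti (v w : TangentSpace 𝓘(ℝ, E) x) (a : WeilFiber E A x) :
    contrT E A x v (contrT E A x w a) = -contrT E A x w (contrT E A x v a) := by
  have hpar : ∀ (u : TangentSpace 𝓘(ℝ, E) x) b,
      parity E A x (contrT E A x u b) = -contrT E A x u (parity E A x b) := fun u b => by
    induction b using weilFiber_induction with
    | algebraMap r =>
      rw [contrT_apply, AlgHom.commutes, contrT_apply, (contr_isOddFiberDer _ _).map_algebraMap]
      simp
    | genT ξ => simp [contrT_apply, contr_genT, parity_genT]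
    | genΛ η => simp [contrT_apply, contr_genΛ, parity_genΛ]
    | genS η => simp [contrT_apply, contr_genS, parity_genS]
    | mul a b ha hb =>
      simp only [contrT_apply] at *
      simp only [contr_isOddFiberDer _ _ _ _, map_add, map_mul, ha, hb, parity_parity]
      noncomm_ring
    | add a b ha hb => simp only [map_add, ha, hb]; abel
  induction a using weilFiber_induction with
  | algebraMap r => simp [contrT_apply, (contr_isOddFiberDer _ _).map_algebraMap]
  | genT ξ => simp [contrT_apply, contr_genT, (contr_isOddFiberDer _ _).map_algebraMap]
  | genΛ η => simp [contrT_apply, contr_genΛ]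
  | genS η => simp [contrT_apply, contr_genS]
  | mul a b ha hb =>
    have hd : ∀ u b c, contrT E A x u (b * c) =
        contrT E A x u b * c + parity E A x b * contrT E A x u c :=
      fun u => contr_isOddFiberDer u (0 : A x)
    simp only [hd, map_add, ha, hb, hpar, parity_parity]
    noncomm_ring
  | add a b ha hb => simp only [map_add, ha, hb]; abel

theorem contrT_self (v : TangentSpace 𝓘(ℝ, E) x) (a : WeilFiber E A x) :
    contrT E A x v (contrT E A x v a) = 0 := by
  have h := add_eq_zero_iff_eq_neg.2 (contrT_anti v v a)
  rw [← two_smul ℝ] at h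
  exact (smul_eq_zero.1 h).resolve_left two_ne_zero

variable (E A x) in
/-- The evaluation of an element of the fibre algebra on tangent vectors. -/
def fiberEval : (n : ℕ) → WeilFiber E A x →ₗ[ℝ]
    MultilinearMap ℝ (fun _ : Fin n => TangentSpace 𝓘(ℝ, E) x) ℝ
  | 0 =>
    { toFun a := MultilinearMap.constOfIsEmpty ℝ _ (augment E A x a)
      map_add' _ _ := by ext; simp
      map_smul' _ _ := by ext; simp }
  | n + 1 =>
    { toFun a := (fiberEval n ∘ₗ (contrT E A x).flip a).uncurryLeft
      map_add' _ _ := by ext; simp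
      map_smul' _ _ := by ext; simp }

theorem fiberEval_succ {n : ℕ} (a : WeilFiber E A x) (v) :
    fiberEval E A x (n + 1) a v = fiberEval E A x n (contrT E A x (v 0) a) (Fin.tail v) := rfl

theorem fiberEval_contrT {n : ℕ} (a : WeilFiber E A x) (v : Fin n → TangentSpace 𝓘(ℝ, E) x)
    (j : Fin n) : fiberEval E A x n (contrT E A x (v j) a) v = 0 := by
  induction n generalizing a with
  | zero => exact j.elim0
  | succ n ih =>
    rw [fiberEval_succ]
    cases j using Fin.cases with
    | zero => rw [contrT_self, map_zero, zero_apply]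
    | succ j =>
      rw [contrT_anti, map_neg, neg_apply, neg_eq_zero]
      exact ih _ (Fin.tail v) j

theorem fiberEval_eq_zero {n : ℕ} (a : WeilFiber E A x) (v : Fin n → TangentSpace 𝓘(ℝ, E) x)
    {i j : Fin n} (hv : v i = v j) (hij : i ≠ j) : fiberEval E A x n a v = 0 := by
  induction n generalizing a with
  | zero => exact i.elim0
  | succ n ih =>
    rw [fiberEval_succ]
    cases i using Fin.cases with
    | zero =>
      cases j using Fin.cases with
      | zero => exact absurd rfl hij
      | succ j => rw [hv]; exact fiberEval_contrT a (Fin.tail v) j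
    | succ i =>
      cases j using Fin.cases with
      | zero => rw [← hv]; exact fiberEval_contrT a (Fin.tail v) i
      | succ j => exact ih _ (Fin.tail v) (i := i) (j := j) hv fun h => hij (by rw [h])

variable (E A x) in
/-- The alternating form defined by an element of the fibre algebra. -/
def fiberForm (n : ℕ) : WeilFiber E A x →ₗ[ℝ] TangentSpace 𝓘(ℝ, E) x [⋀^Fin n]→ₗ[ℝ] ℝ where
  toFun a := { fiberEval E A x n a with
    map_eq_zero_of_eq' := fun v _ _ hv hij => fiberEval_eq_zero a v hv hij }
  map_add' a b := by ext v; exact congrArg (fun f => f v) (map_add (fiberEval E A x n) a b)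
  map_smul' c b := by ext v; exact congrArg (fun f => f v) (map_smul (fiberEval E A x n) c b)

theorem fiberForm_zero (a : WeilFiber E A x) (v) : fiberForm E A x 0 a v = augment E A x a := rfl

theorem fiberForm_succ {n : ℕ} (a : WeilFiber E A x) (v) :
    fiberForm E A x (n + 1) a v = fiberForm E A x n (contrT E A x (v 0) a) (Fin.tail v) := rfl

/-- Evaluation contracts one vector after another, so the Leibniz rule moves `ξ` through all
arguments. This is the expansion of a determinant along one column, and it is the reason why
products of covectors evaluate to determinants. -/
theorem fiberForm_genT_mul {n : ℕ} (ξ : Cotan E x) (a : WeilFiber E A x)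
    (v : Fin (n + 1) → TangentSpace 𝓘(ℝ, E) x) : fiberForm E A x (n + 1) (genT E A x ξ * a) v =
      ∑ j : Fin (n + 1), (-1) ^ (j : ℕ) * ξ (v j) * fiberForm E A x n a (j.removeNth v) := by
  induction n generalizing a with
  | zero =>
    rw [fiberForm_succ, contrT_genT_mul]
    simp [fiberForm_zero, augment_genT]
  | succ n ih =>
    rw [fiberForm_succ, contrT_genT_mul, map_sub, AlternatingMap.sub_apply, ih,
      Fin.sum_univ_succ (n := n + 1), sub_eq_add_neg, ← Finset.sum_neg_distrib, map_smul]
    congr 1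
    · simp [Fin.removeNth_zero]
    · refine Finset.sum_congr rfl fun j _ => ?_
      rw [fiberForm_succ (v := j.succ.removeNth v)]
      simp only [Fin.val_succ, pow_succ, Fin.tail]
      have h1 : j.succ.removeNth v 0 = v 0 := by simp [Fin.removeNth]
      have h2 : Fin.tail (j.succ.removeNth v) = j.removeNth (Fin.tail v) := by
        funext k; simp [Fin.tail, Fin.removeNth]
      rw [h1, h2]
      ring

theorem fiberForm_prod {n : ℕ} (ξ : Fin n → Cotan E x) (v : Fin n → TangentSpace 𝓘(ℝ, E) x) :
    fiberForm E A x n (List.ofFn fun i => genT E A x (ξ i)).prod v =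
      (Matrix.of fun j i => ξ i (v j)).det := by
  induction n with
  | zero => simp [fiberForm_zero]
  | succ n ih =>
    rw [List.ofFn_succ, List.prod_cons, fiberForm_genT_mul, Matrix.det_succ_column_zero]
    exact Finset.sum_congr rfl fun j _ => by rw [ih]; rfl

/-- The product of linear functionals, as a multilinear form. -/
def tensorForm {ι : Type*} [Fintype ι] (ξ : ι → Cotan E x) :
    MultilinearMap ℝ (fun _ : ι => TangentSpace 𝓘(ℝ, E) x) ℝ :=
  (MultilinearMap.mkPiAlgebra ℝ ι ℝ).compLinearMap ξ

theorem alternatization_tensorForm {ι : Type*} [Fintype ι] [DecidableEq ι] (ξ : ι → Cotan E x)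
    (v : ι → TangentSpace 𝓘(ℝ, E) x) : MultilinearMap.alternatization (tensorForm ξ) v =
      (Matrix.of fun j i => ξ i (v j)).det := by
  rw [MultilinearMap.alternatization_apply, Matrix.det_apply]
  exact Finset.sum_congr rfl fun σ _ => by simp [tensorForm]

-- By bilinearity the factors may be products of covectors. These correspond to alternatizations of
-- tensor products, and `domCoprod` of two alternatizations is the alternatization of the tensor
-- product, so no factorials appear.
open scoped Pointwise in
theorem fiberForm_mul {m n : ℕ} {a b : WeilFiber E A x} (ha : a ∈ triGr E A x (m, 0, 0))
    (hb : b ∈ triGr E A x (n, 0, 0)) : fiberForm E A x (m + n) (a * b) =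
      ((LinearMap.mul' ℝ ℝ).compAlternatingMap
        ((fiberForm E A x m a).domCoprod (fiberForm E A x n b))).domDomCongr finSumFinEquiv := by
  have hspan : ∀ k, triGr E A x (k, 0, 0) = Submodule.span ℝ
      ((LinearMap.range (genT E A x) : Set (WeilFiber E A x)) ^ k) := fun k => by
    rw [← fiberPiece_eq_triGr, fiberPiece, pow_zero, mul_one, pow_zero, mul_one,
      Submodule.pow_eq_span_pow_set]
  rw [hspan] at ha hb
  have hmem : ∀ k (c : WeilFiber E A x),
      c ∈ (LinearMap.range (genT E A x) : Set (WeilFiber E A x)) ^ k →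
      ∃ ξ : Fin k → Cotan E x, c = (List.ofFn fun i => genT E A x (ξ i)).prod := fun k c hc => by
    obtain ⟨f, hf⟩ := Set.mem_pow.1 hc
    choose ξ hξ using fun i => (f i).2
    exact ⟨ξ, by simp only [← hf, hξ]⟩
  have hform : ∀ k (ξ : Fin k → Cotan E x),
      fiberForm E A x k (List.ofFn fun i => genT E A x (ξ i)).prod =
        MultilinearMap.alternatization (tensorForm ξ) := fun k ξ => by
    ext v
    rw [fiberForm_prod, alternatization_tensorForm]
  -- The cases other than products of covectors only spell out bilinearity of `domCoprod`.
  induction ha using Submodule.span_induction with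
  | mem a ha =>
    induction hb using Submodule.span_induction with
    | mem b hb =>
      obtain ⟨ξ, rfl⟩ := hmem _ _ ha
      obtain ⟨ζ, rfl⟩ := hmem _ _ hb
      have happ : ((List.ofFn fun i => genT E A x (ξ i)).prod *
          (List.ofFn fun i => genT E A x (ζ i)).prod) =
          (List.ofFn fun i => genT E A x (Fin.append ξ ζ i)).prod := by
        rw [← List.prod_append, ← List.ofFn_fin_append]
        congr 2
        funext i
        refine Fin.addCases (fun i => ?_) (fun i => ?_) i <;> simp
      have hcop : (LinearMap.mul' ℝ ℝ).compMultilinearMap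
          ((tensorForm ξ).domCoprod (tensorForm ζ)) = tensorForm (Sum.elim ξ ζ) := by
        ext v
        simp [tensorForm]
      rw [happ, hform, hform, hform, ← MultilinearMap.domCoprod_alternization,
        ← LinearMap.compMultilinearMap_alternatization, hcop]
      ext v
      rw [AlternatingMap.domDomCongr_apply, alternatization_tensorForm, alternatization_tensorForm,
        ← Matrix.det_submatrix_equiv_self finSumFinEquiv]
      congr 1
      ext j i
      cases i <;> simp
    | zero =>
      rw [mul_zero, map_zero, map_zero, ← AlternatingMap.domCoprod'_apply, TensorProduct.tmul_zero]
      ext v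
      simp
    | add b b' _ _ h h' => 
      ext v
      rw [mul_add, map_add, h, h', map_add]
      simp [← AlternatingMap.domCoprod'_apply, TensorProduct.tmul_add]
    | smul c b _ h => 
      ext v
      rw [mul_smul_comm, map_smul, h, map_smul]
      simp [← AlternatingMap.domCoprod'_apply]
  | zero => ext v; simp [← AlternatingMap.domCoprod'_apply]
  | add a a' _ _ h h' =>
    ext v
    rw [add_mul, map_add, h, h', map_add]
    simp [← AlternatingMap.domCoprod'_apply, TensorProduct.add_tmul]
  | smul c a _ h =>
    ext v
    rw [smul_mul_assoc, map_smul, h, map_smul, ← AlternatingMap.domCoprod'_apply,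
      ← AlternatingMap.domCoprod'_apply, ← TensorProduct.smul_tmul', map_smul]
    simp

end FibreForms

/-! ### The row `p = 0` of `W` as the algebra of differential forms on `M`. -/

section FormsAsWeil

variable {E : Type*} [NormedAddCommGroup E] [NormedSpace ℝ E] [FiniteDimensional ℝ E]
  {M : Type*} [TopologicalSpace M] [ChartedSpace E M] [IsManifold 𝓘(ℝ, E) ∞ M]
  {A : M → Type*} [∀ x, AddCommGroup (A x)] [∀ x, Module ℝ (A x)] [∀ x, TopologicalSpace (A x)]

section Fibre

variable {x : M}

/-- Since `p = v + w`, the value `p = 0` excludes both copies of `A*`. -/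
theorem triGr_of_biGr_zero {n : ℕ} {a : WeilFiber E A x} (ha : a ∈ biGr E A x (0, (n : ℤ))) :
    a ∈ triGr E A x (n, 0, 0) := by
  rw [← fiberProj_of_mem ha, biProj_eq_sum]
  refine sum_mem fun t ht => ?_
  rw [mem_biFiber, Prod.mk.injEq] at ht
  have : t = (n, 0, 0) := by
    obtain ⟨u, v, w⟩ := t
    simp only [Prod.mk.injEq] at ht ⊢
    omega
  exact this ▸ fiberProj_mem t a

theorem contrT_mem {n : ℤ × ℤ} {a : WeilFiber E A x} (ha : a ∈ biGr E A x n)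
    (v : TangentSpace 𝓘(ℝ, E) x) : contrT E A x v a ∈ biGr E A x (n + (0, -1)) := by
  refine (contr_isOddFiberDer v (0 : A x)).mem_fiberGr (fun ξ => ?_) (fun η => ?_) (fun η => ?_) ha
  · rw [contr_genT]
    exact algebraMap_mem_fiberGr (E := E) (A := A) (x := x) (dT := ((0, 1) : ℤ × ℤ))
      (dΛ := (1, 0)) (dS := (1, 1)) (ξ v)
  · rw [contr_genΛ, map_zero, map_zero]
    exact zero_mem _
  · rw [contr_genS]
    exact zero_mem _

theorem eq_algebraMap_of_biGr_zero {a : WeilFiber E A x} (ha : a ∈ biGr E A x (0, 0)) :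
    a = algebraMap ℝ _ (augment E A x a) := by
  have h := triGr_of_biGr_zero (n := 0) ha
  rw [← fiberPiece_eq_triGr, fiberPiece, pow_zero, pow_zero, pow_zero, mul_one, mul_one,
    Submodule.mem_one] at h
  obtain ⟨r, rfl⟩ := h
  rw [AlgHom.commutes]
  rfl

/-- By induction all contractions of `a` vanish, and the Euler operator of the covector degree then
forces `a = 0` in positive degree. -/
theorem fiberForm_injective {n : ℕ} {a : WeilFiber E A x} (ha : a ∈ biGr E A x (0, (n : ℤ)))
    (h : fiberForm E A x n a = 0) : a = 0 := by
  induction n generalizing a with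
  | zero =>
    rw [eq_algebraMap_of_biGr_zero ha, ← fiberForm_zero (v := Fin.elim0), h]
    simp
  | succ n ih =>
    have hc : ∀ v, contrT E A x v a = 0 := fun v => by
      refine ih (by simpa using contrT_mem ha v) ?_
      ext w
      simpa [fiberForm_succ] using congrArg (fun f => f (Fin.cons v w)) h
    have hb : Module.Basis (Fin (Module.finrank ℝ E)) ℝ (TangentSpace 𝓘(ℝ, E) x) :=
      (Module.finBasis ℝ E : Module.Basis _ ℝ E)
    have ht := triProj_eq_zero_of_contrT hb (fun i => hc (hb i)) (t := (n + 1, 0, 0))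
      (Nat.succ_ne_zero n)
    rwa [triProj, fiberProj_of_mem (triGr_of_biGr_zero ha)] at ht

theorem fiberForm_ext {n : ℕ} {a b : WeilFiber E A x} (ha : a ∈ biGr E A x (0, (n : ℤ)))
    (hb : b ∈ biGr E A x (0, (n : ℤ))) (h : fiberForm E A x n a = fiberForm E A x n b) : a = b :=
  sub_eq_zero.1 (fiberForm_injective (sub_mem ha hb) (by rw [map_sub, h, sub_self]))

theorem prod_genT_mem {n : ℕ} (ξ : Fin n → Cotan E x) :
    (List.ofFn fun i => genT E A x (ξ i)).prod ∈ biGr E A x (0, (n : ℤ)) := by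
  induction n with
  | zero => exact one_mem_fiberGr
  | succ n ih =>
    rw [List.ofFn_succ, List.prod_cons]
    have h := mul_mem_fiberGr (genT_mem_fiberGr (dT := ((0, 1) : ℤ × ℤ)) (dΛ := (1, 0))
      (dS := (1, 1)) (ξ 0)) (ih fun i => ξ i.succ)
    rwa [Prod.mk_add_mk, add_zero, add_comm 1 (n : ℤ), ← Nat.cast_succ] at h

variable (A) in
/-- The element of the fibre algebra with the coefficients of an alternating form. -/
def formToFiber {n : ℕ} {ι : Type*} [Fintype ι] (b : Module.Basis ι ℝ (TangentSpace 𝓘(ℝ, E) x))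
    (τ : TangentSpace 𝓘(ℝ, E) x [⋀^Fin n]→ₗ[ℝ] ℝ) : WeilFiber E A x :=
  -- The sum runs over all index sequences, so every increasing one is counted `n!` times.
  (n.factorial : ℝ)⁻¹ • ∑ I : Fin n → ι,
    τ (fun i => b (I i)) • (List.ofFn fun i => genT E A x (b.coord (I i))).prod

theorem formToFiber_mem {n : ℕ} {ι : Type*} [Fintype ι]
    (b : Module.Basis ι ℝ (TangentSpace 𝓘(ℝ, E) x))
    (τ : TangentSpace 𝓘(ℝ, E) x [⋀^Fin n]→ₗ[ℝ] ℝ) :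
    formToFiber A b τ ∈ biGr E A x (0, (n : ℤ)) :=
  Submodule.smul_mem _ _ (sum_mem fun _ _ => Submodule.smul_mem _ _ (prod_genT_mem _))

theorem fiberForm_formToFiber {n : ℕ} {ι : Type*} [Fintype ι]
    (b : Module.Basis ι ℝ (TangentSpace 𝓘(ℝ, E) x))
    (τ : TangentSpace 𝓘(ℝ, E) x [⋀^Fin n]→ₗ[ℝ] ℝ) :
    fiberForm E A x n (formToFiber A b τ) = τ := by
  classical
  ext v
  have hτ : ∀ w : Fin n → TangentSpace 𝓘(ℝ, E) x,
      ∑ I : Fin n → ι, τ (fun i => b (I i)) * ∏ i, b.coord (I i) (w i) = τ w := fun w => by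
    conv_rhs => rw [show w = fun i => ∑ k, b.coord k (w i) • b k from
      funext fun i => (b.sum_repr (w i)).symm]
    refine Eq.trans ?_ (MultilinearMap.map_sum τ.toMultilinearMap
      fun i k => b.coord k (w i) • b k).symm
    refine Finset.sum_congr rfl fun I _ => ?_
    rw [MultilinearMap.map_smul_univ, smul_eq_mul, mul_comm]
    rfl
  have hdet : ∀ I : Fin n → ι, fiberForm E A x n
      (List.ofFn fun i => genT E A x (b.coord (I i))).prod v =
        ∑ σ : Equiv.Perm (Fin n), (Equiv.Perm.sign σ : ℤ) • ∏ i, b.coord (I i) (v (σ i)) :=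
    fun I => by rw [fiberForm_prod, Matrix.det_apply]; rfl
  have hsum : ∀ (t : Finset (Fin n → ι)) (f : (Fin n → ι) → TangentSpace 𝓘(ℝ, E) x [⋀^Fin n]→ₗ[ℝ] ℝ),
      (∑ I ∈ t, f I) v = ∑ I ∈ t, f I v := fun t f => by
    induction t using Finset.induction_on with
    | empty => simp
    | insert I t hI ih =>
      rw [Finset.sum_insert hI, Finset.sum_insert hI, AlternatingMap.add_apply, ih]
  rw [formToFiber, map_smul, AlternatingMap.smul_apply, map_sum, hsum]
  simp only [map_smul, AlternatingMap.smul_apply, hdet, Finset.mul_sum, smul_eq_mul]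
  rw [Finset.sum_comm]
  -- Each permutation contributes `τ v`: the sign of the determinant term cancels the sign from
  -- permuting the arguments of `τ`. The `n!` equal contributions are absorbed by the normalization.
  have hσ : ∀ σ : Equiv.Perm (Fin n), ∑ I : Fin n → ι, τ (fun i => b (I i)) *
      (Equiv.Perm.sign σ : ℤ) • ∏ i, b.coord (I i) (v (σ i)) = τ v := fun σ => by
    simp only [mul_smul_comm]
    rw [← Finset.smul_sum, hτ (fun i => v (σ i)), show (fun i => v (σ i)) = v ∘ σ from rfl,
      AlternatingMap.map_perm, ← Units.smul_def, smul_smul, Int.units_mul_self, one_smul]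
  simp only [← Finset.mul_sum]
  simp only [hσ]
  rw [Finset.sum_const, Finset.card_univ, Fintype.card_perm, Fintype.card_fin, nsmul_eq_mul,
    inv_mul_cancel_left₀ (by positivity)]

theorem curryLeft_fiberForm {n : ℕ} (a : WeilFiber E A x) (v : TangentSpace 𝓘(ℝ, E) x) :
    (fiberForm E A x (n + 1) a).curryLeft v = fiberForm E A x n (contrT E A x v a) := by
  ext w
  rw [AlternatingMap.curryLeft_apply_apply, fiberForm_succ]
  rfl

end Fibre

variable {FA : Type*} [NormedAddCommGroup FA] [NormedSpace ℝ FA]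
  [TopologicalSpace (TotalSpace FA A)] [FiberBundle FA A] [VectorBundle ℝ FA A]

theorem contMDiff_augment (a : Weil E FA A) : CMDiff ∞ (fun x => augment E A x (a.1 x)) := by
  have hp : ∀ t ∈ polySections E FA A, CMDiff ∞ (fun x => augment E A x (t x)) := fun t ht => by
    refine polySections_induction (P := fun t => CMDiff ∞ (fun x => augment E A x (t x)))
      (fun f => ?_) (fun ν => ?_) (fun ν => ?_) (fun ν => ?_) (fun s t _ _ hs ht => ?_)
      (fun s t hs ht => ?_) ht
    · exact f.contMDiff.congr fun x => AlgHom.commutes (augment E A x) (f x)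
    · simpa only [augment_genT] using contMDiff_const
    · simpa only [augment_genΛ] using contMDiff_const
    · simpa only [augment_genS] using contMDiff_const
    · exact (hs.mul ht).congr fun x => map_mul (augment E A x) (s x) (t x)
    · exact (hs.add ht).congr fun x => map_add (augment E A x) (s x) (t x)
  intro x
  obtain ⟨t, ht, h⟩ := weil_le_locPoly a.2 x
  exact (hp t ht x).congr_of_eventuallyEq (h.mono fun y hy => congrArg (augment E A y) hy)

theorem contMDiff_fiberForm {n : ℕ} (a : Weil E FA A) (s : Fin n → VF E M) :
    CMDiff ∞ (fun x => fiberForm E A x n (a.1 x) (fun i => s i x)) := by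
  induction n generalizing a with
  | zero => exact contMDiff_augment a
  | succ n ih =>
    refine (ih (cT (s 0) a) fun i => s i.succ).congr fun x => ?_
    rw [fiberForm_succ, cT_apply]
    rfl

/-- The alternating forms defined by a section of the Weil bundle. -/
def weilForm (n : ℕ) :
    Weil E FA A →ₗ[ℝ] FormSpace E E (TangentSpace 𝓘(ℝ, E) : M → Type _) n where
  toFun a := ⟨fun x => fiberForm E A x n (a.1 x), contMDiff_fiberForm a⟩
  map_add' a b := Subtype.ext (funext fun x => map_add (fiberForm E A x n) (a.1 x) (b.1 x))
  map_smul' c a := Subtype.ext (funext fun x => map_smul (fiberForm E A x n) c (a.1 x))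

theorem weilForm_apply (n : ℕ) (a : Weil E FA A) (x : M) :
    (weilForm n a).1 x = fiberForm E A x n (a.1 x) := rfl

theorem weilForm_succ {n : ℕ} (a : Weil E FA A) (s : Fin (n + 1) → VF E M) (x : M) :
    (weilForm (n + 1) a).1 x (fun i => s i x) =
      (weilForm n (cT (s 0) a)).1 x (fun i => s i.succ x) := by
  rw [weilForm_apply, weilForm_apply, fiberForm_succ, cT_apply]
  rfl

theorem weilForm_mul {m n : ℕ} {a b : Weil E FA A} (ha : a ∈ weilPiece E FA A 0 m)
    (hb : b ∈ weilPiece E FA A 0 n) :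
    (weilForm (m + n) (a * b)).1 = wedge (weilForm m a).1 (weilForm n b).1 := funext fun x =>
  fiberForm_mul (triGr_of_biGr_zero (mem_weilPiece.1 ha x))
    (triGr_of_biGr_zero (mem_weilPiece.1 hb x))

theorem weilForm_injective {n : ℕ} {a : Weil E FA A} (ha : a ∈ weilPiece E FA A 0 n)
    (h : weilForm n a = 0) : a = 0 := weil_ext fun x =>
  fiberForm_injective (mem_weilPiece.1 ha x)
    (congrFun (congrArg Subtype.val h) x)

theorem list_prod_ofFn_apply {n : ℕ} (f : Fin n → Weil E FA A) (x : M) :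
    (List.ofFn f).prod.1 x = (List.ofFn fun i => (f i).1 x).prod := by
  induction n with
  | zero => rfl
  | succ n ih => rw [List.ofFn_succ, List.ofFn_succ, List.prod_cons, List.prod_cons,
      weil_mul_apply, ih]

variable [T2Space M]

-- The inverse is defined pointwise with unrelated bases. By injectivity of `fiberForm` it does not
-- depend on them, so near a point it is given by one dual frame with smooth coefficients and is
-- locally polynomial.
variable (FA A) in
theorem exists_weilForm_eq {n : ℕ} (τ : FormSpace E E (TangentSpace 𝓘(ℝ, E) : M → Type _) n) :
    ∃ a ∈ weilPiece E FA A 0 n, weilForm n a = τ := by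
  choose s ν hsν using exists_dualFrame (E := E) (M := M) (FB := E)
    (TangentSpace 𝓘(ℝ, E) : M → Type _)
  choose b hb using fun x => (hsν x).self_of_nhds
  let w : RawWeil E A := fun x => formToFiber A (b x) (τ.1 x)
  have hw : w ∈ locPoly E FA A := mem_locPoly_of_local fun x => by
    obtain ⟨F, hF⟩ : ∃ F : (Fin n → Fin (Module.finrank ℝ E)) → Fn E M,
        ∀ I y, F I y = τ.1 y (fun i => s x (I i) y) := ⟨fun I => ⟨_, τ.2 _⟩, fun _ _ => rfl⟩
    let t : Weil E FA A := (n.factorial : ℝ)⁻¹ • ∑ I : Fin n → Fin (Module.finrank ℝ E),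
      wF FA A (F I) *
        (List.ofFn fun i => wT FA A (ν x (I i))).prod
    refine ⟨t.1, weil_le_locPoly t.2, ?_⟩
    filter_upwards [hsν x] with y ⟨c, hc, hc'⟩
    have : t.1 y = formToFiber A c (τ.1 y) := by
      rw [weil_smul_apply, weil_sum_apply, formToFiber]
      refine congrArg _ (Finset.sum_congr rfl fun I _ => ?_)
      rw [wF_mul_apply, list_prod_ofFn_apply, hF]
      simp only [wT_apply, hc']
      exact congrArg (fun v => τ.1 y v • _) (funext fun i => hc (I i))
    rw [this]
    exact fiberForm_ext (formToFiber_mem _ _) (formToFiber_mem _ _)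
      (by rw [fiberForm_formToFiber, fiberForm_formToFiber])
  have hgr : ∀ x, w x ∈ biGr E A x (0, (n : ℤ)) := fun x => formToFiber_mem _ _
  exact ⟨⟨w, mem_weil_of_biGr' hw hgr⟩, mem_weilPiece.2 hgr,
    Subtype.ext (funext fun x => fiberForm_formToFiber (b x) (τ.1 x))⟩

end FormsAsWeil

/-! ### Cartan's formula for the Koszul differential and its comparison with `d_ver`. -/

section KoszulRecursion

variable {E : Type*} [NormedAddCommGroup E] [NormedSpace ℝ E] [FiniteDimensional ℝ E]
  {M : Type*} [TopologicalSpace M] [ChartedSpace E M] [IsManifold 𝓘(ℝ, E) ∞ M]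

section General

variable {FB : Type*} [NormedAddCommGroup FB] [NormedSpace ℝ FB]
  {B : M → Type*} [TopologicalSpace (TotalSpace FB B)] [∀ x, AddCommGroup (B x)]
  [∀ x, Module ℝ (B x)] [∀ x, TopologicalSpace (B x)] [FiberBundle FB B] [VectorBundle ℝ FB B]

/-- The contraction of a form with a section. -/
def contrForm {n : ℕ} (s : Sec E FB B) (τ : RawForm B (n + 1)) : RawForm B n :=
  fun x => (τ x).curryLeft (s x)

theorem contrForm_apply {n : ℕ} (s : Sec E FB B) (τ : RawForm B (n + 1)) (x : M)
    (v : Fin n → B x) : contrForm s τ x v = τ x (Fin.cons (s x) v) := rfl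

theorem map_cons_cons {V : Type*} [AddCommGroup V] [Module ℝ V] {n : ℕ}
    (f : V [⋀^Fin (n + 2)]→ₗ[ℝ] ℝ) (a b : V) (v : Fin n → V) :
    f (Fin.cons a (Fin.cons b v)) = -f (Fin.cons b (Fin.cons a v)) := by
  rw [← f.map_swap _ (i := 0) (j := 1) (by simp)]
  congr 1
  funext k
  refine Fin.cases ?_ (fun k => Fin.cases ?_ (fun k => ?_) k) k
  · simp
  · simp
  · rw [Function.comp_apply, Equiv.swap_apply_of_ne_of_ne (by simp) (by simp [Fin.ext_iff])]
    rfl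

theorem map_update_eq {V : Type*} [AddCommGroup V] [Module ℝ V] {n : ℕ}
    (f : V [⋀^Fin (n + 1)]→ₗ[ℝ] ℝ) (j : Fin (n + 1)) (a : V) (v : Fin (n + 1) → V) :
    f (Function.update v j a) = (-1) ^ j.val * f (Fin.cons a (j.removeNth v)) := by
  have h := f.map_insertNth j a (j.removeNth v)
  rw [Fin.insertNth_removeNth] at h
  simpa [Matrix.vecCons] using h

theorem sum_Ici_succ {n : ℕ} (i : Fin n) (f : Fin (n + 1) → ℝ) :
    ∑ j ∈ Finset.Ici i.succ, f j = ∑ j ∈ Finset.Ici i, f j.succ := by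
  rw [← Fin.map_succEmb_Ici, Finset.sum_map]
  rfl

variable (L : LieAlgebroid E FB B)

/-- For pairs not involving the section `s 0`, that section stays among the arguments just after the
bracket. Exchanging the two, together with the index shift, yields the bracket terms of the
contracted form with a minus sign. -/
theorem koszulBracket_tail {n : ℕ} (τ : RawForm B (n + 1)) (s : Fin (n + 2) → Sec E FB B) (x : M) :
    ∑ i : Fin n, ∑ j ∈ Finset.Ici i.succ, (-1) ^ (i.succ.val + (j.val + 1)) *
      τ x (Fin.cons (L.bracket (s i.succ.castSucc) (s j.succ) x)
        (j.removeNth (i.succ.castSucc.removeNth (fun k => s k x)))) =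
      -koszulBracket L n (contrForm (s 0) τ) (fun k => s k.succ) x := by
  cases n with
  | zero => simp [koszulBracket]
  | succ n =>
    rw [koszulBracket, ← Finset.sum_neg_distrib]
    refine Finset.sum_congr rfl fun i _ => ?_
    rw [sum_Ici_succ, ← Finset.sum_neg_distrib]
    refine Finset.sum_congr rfl fun j _ => ?_
    have h : j.succ.removeNth (i.succ.castSucc.removeNth (fun k => s k x)) =
        Fin.cons (s 0 x) (j.removeNth (i.castSucc.removeNth (fun k => s k.succ x))) := by
      funext k
      refine Fin.cases ?_ (fun k => ?_) k
      · simp [Fin.removeNth]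
      · simp [Fin.removeNth]
    rw [h, map_cons_cons, contrForm_apply, ← Fin.succ_castSucc]
    simp only [Fin.val_succ]
    ring

theorem koszulBracket_succ {n : ℕ} (τ : RawForm B (n + 1)) (s : Fin (n + 2) → Sec E FB B) (x : M) :
    koszulBracket L (n + 1) τ s x =
      -(∑ j : Fin (n + 1), τ x (Function.update (fun k => s k.succ x) j
        (L.bracket (s 0) (s j.succ) x))) -
      koszulBracket L n (contrForm (s 0) τ) (fun k => s k.succ) x := by
  rw [koszulBracket, Fin.sum_univ_succ, koszulBracket_tail, ← sub_eq_add_neg]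
  congr 1
  have h : (Finset.Ici (0 : Fin (n + 1))) = Finset.univ := by ext; simp
  rw [h, ← Finset.sum_neg_distrib]
  refine Finset.sum_congr rfl fun j _ => ?_
  rw [map_update_eq]
  have h' : (Fin.castSucc (0 : Fin (n + 1))).removeNth (fun k => s k x) = fun k => s k.succ x := by
    funext k
    simp [Fin.removeNth]
  rw [h', Fin.castSucc_zero]
  simp only [Fin.val_zero]
  ring

/-- This is `ι_s d = L_s - d ι_s` for the first section `s`. As a recursion in the degree it
determines the Koszul differential. -/
theorem koszulFun_succ {n : ℕ} (τ : RawForm B (n + 1)) (s : Fin (n + 2) → Sec E FB B) (x : M) :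
    koszulFun L τ s x = dirDeriv (fun y => τ y (fun k => s k.succ y)) (L.anchor x (s 0 x)) -
      ∑ j : Fin (n + 1), τ x (Function.update (fun k => s k.succ x) j
        (L.bracket (s 0) (s j.succ) x)) -
      koszulFun L (contrForm (s 0) τ) (fun k => s k.succ) x := by
  have h : ∀ i : Fin (n + 1), (-1) ^ i.succ.val * dirDeriv
      (fun y => τ y (fun k => s (i.succ.succAbove k) y)) (L.anchor x (s i.succ x)) =
      -((-1) ^ i.val * dirDeriv
        (fun y => contrForm (s 0) τ y (fun k => s (i.succAbove k).succ y))
        (L.anchor x (s i.succ x))) := fun i => by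
    have : ∀ y, (fun k => s (i.succ.succAbove k) y) =
        Fin.cons (s 0 y) (fun k => s (i.succAbove k).succ y) := fun y => by
      funext k
      refine Fin.cases ?_ (fun k => ?_) k <;> simp
    simp only [this, contrForm_apply, Fin.val_succ]
    ring
  rw [koszulFun, koszulFun, koszulBracket_succ, Fin.sum_univ_succ]
  simp only [h, Finset.sum_neg_distrib, Fin.val_zero, pow_zero, one_mul, Fin.zero_succAbove]
  ring

end General

section DeRham

variable {FA : Type*} [NormedAddCommGroup FA] [NormedSpace ℝ FA]
  {A : M → Type*} [TopologicalSpace (TotalSpace FA A)] [∀ x, AddCommGroup (A x)]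
  [∀ x, Module ℝ (A x)] [∀ x, TopologicalSpace (A x)] [FiberBundle FA A] [VectorBundle ℝ FA A]

variable (E A) in
theorem exists_killA (x : M) : ∃ φ : WeilFiber E A x →ₐ[ℝ] WeilFiber E A x,
    (∀ ξ, φ (genT E A x ξ) = genT E A x ξ) ∧ (∀ η, φ (genΛ E A x η) = 0) ∧
      ∀ η, φ (genS E A x η) = 0 := by
  obtain ⟨φ, h1, h2, h3⟩ := exists_weilLift_fiber (x := x) (x' := x)
    (LinearMap.id : Cotan E x →ₗ[ℝ] Cotan E x)
    (0 : Module.Dual ℝ (A x) →ₗ[ℝ] Module.Dual ℝ (A x)) 0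
  exact ⟨φ, h1, fun η => by rw [h2]; simp, fun η => by rw [h3]; simp⟩

-- The algebra map that kills both copies of `A*`. It is the projection onto the row `p = 0` along
-- the sum of all other rows.
variable (FA A) in
theorem exists_baseProj : ∃ r : Weil E FA A →ₗ[ℝ] Weil E FA A, IsLocalOp r ∧
    (∀ a b, r (a * b) = r a * r b) ∧ Shifts r 0 ∧ (∀ f, r (wF FA A f) = wF FA A f) ∧
    (∀ ξ, r (wT FA A ξ) = wT FA A ξ) ∧ (∀ η, r (wΛ η) = 0) ∧ (∀ η, r (wS η) = 0) ∧
    (∀ n, ∀ a ∈ weilPiece E FA A 0 n, r a = a) ∧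
    ∀ p q, 0 < p → ∀ a ∈ weilPiece E FA A p q, r a = 0 := by
  choose φ hT hΛ hS using exists_killA (M := M) E A
  have hpoly : ∀ t ∈ polySections E FA A,
      (fun x => φ x (t x) : RawWeil E A) ∈ polySections E FA A := fun t ht => by
    refine polySections_induction
      (P := fun t => (fun x => φ x (t x) : RawWeil E A) ∈ polySections E FA A)
      (fun f => ?_) (fun ν => ?_) (fun ν => ?_) (fun ν => ?_) (fun s t _ _ hs ht => ?_)
      (fun s t hs ht => ?_) ht
    · simpa only [AlgHom.commutes] using const_mem_polySections f
    · simp only [hT]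
      exact Algebra.subset_adjoin (Or.inl (Or.inl (Or.inr ⟨ν.1, ν.2, rfl⟩)))
    · simp only [hΛ]
      exact zero_mem _
    · simp only [hS]
      exact zero_mem _
    · have : (fun x => φ x ((s * t) x) : RawWeil E A) =
          (show RawWeil E A from fun x => φ x (s x)) * (show RawWeil E A from fun x => φ x (t x)) :=
        funext fun x => map_mul (φ x) (s x) (t x)
      rw [this]
      exact mul_mem hs ht
    · have : (fun x => φ x ((s + t) x) : RawWeil E A) =
          (show RawWeil E A from fun x => φ x (s x)) + (show RawWeil E A from fun x => φ x (t x)) :=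
        funext fun x => map_add (φ x) (s x) (t x)
      rw [this]
      exact add_mem hs ht
  have hgr : ∀ x (n : ℤ × ℤ) a, a ∈ biGr E A x n → φ x a ∈ biGr E A x n := fun x n a ha =>
    algHom_mem_fiberGr (fun ξ => by rw [hT]; exact genT_mem_fiberGr ξ)
      (fun η => by rw [hΛ]; exact zero_mem _) (fun η => by rw [hS]; exact zero_mem _) ha
  obtain ⟨r, hr⟩ := exists_fibrewise (fun x => (φ x).toLinearMap) 0
    (fun t ht => polySections_le_locPoly (hpoly t ht))
    (fun x n a ha => by simpa using hgr x n a ha)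
  -- The indicator of the tridegrees `(u, 0, 0)` is multiplicative, so the loci where `φ` acts as
  -- the scalar `c t` form a multiplicative family containing the generators.
  let c : ℕ × ℕ × ℕ → ℝ := fun t => if t.2.1 = 0 ∧ t.2.2 = 0 then 1 else 0
  have hc : ∀ m n, c (m + n) = c m * c n := fun m n => by
    simp only [c, Prod.fst_add, Prod.snd_add, ite_mul, one_mul, zero_mul, Nat.add_eq_zero_iff]
    split_ifs <;> first | rfl | omega
  have hkill : ∀ x (t : ℕ × ℕ × ℕ) a, a ∈ triGr E A x t → φ x a = c t • a := fun x t a ha => by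
    have hV := fiberPiece_le_of_mul (x := x) (dT := (1, 0, 0)) (dΛ := (0, 0, 1)) (dS := (0, 1, 0))
      (fun t : ℕ × ℕ × ℕ => LinearMap.eqLocus (φ x).toLinearMap (c t • LinearMap.id))
      (by simp [c]) (fun m n a b ha hb => ?_) (fun ξ => by simp [c, hT]) (fun η => by simp [c, hΛ])
      (fun η => by simp [c, hS]) t.1 t.2.1 t.2.2
    · rw [← fiberPiece_eq_triGr t.1 t.2.1 t.2.2] at ha
      simpa using hV ha
    · simp only [LinearMap.mem_eqLocus, AlgHom.toLinearMap_apply, LinearMap.smul_apply,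
        LinearMap.id_apply] at ha hb ⊢
      rw [map_mul, ha, hb, smul_mul_smul_comm, hc]
  refine ⟨r, isLocalOp_of_fibrewise hr, fun a b => weil_ext fun x => ?_,
    shifts_of_fibrewise hr (fun x n a ha => by simpa using hgr x n a ha),
    fun f => weil_ext fun x => ?_, fun ξ => weil_ext fun x => ?_, fun η => weil_ext fun x => ?_,
    fun η => weil_ext fun x => ?_, fun n a ha => weil_ext fun x => ?_,
    fun p q hp a ha => weil_ext fun x => ?_⟩
  · rw [weil_mul_apply, hr, hr, hr]
    exact map_mul (φ x) _ _
  · rw [hr]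
    exact AlgHom.commutes (φ x) _
  · rw [hr]; exact hT x _
  · rw [hr]; exact hΛ x _
  · rw [hr]; exact hS x _
  · rw [hr]
    exact (hkill x _ _ (triGr_of_biGr_zero (mem_weilPiece.1 ha x))).trans (by simp [c])
  · rw [hr, ← fiberProj_of_mem (mem_weilPiece.1 ha x), biProj_eq_sum, map_sum]
    refine Finset.sum_eq_zero fun t ht => ?_
    rw [mem_biFiber, Prod.mk.injEq] at ht
    refine (hkill x t _ (fiberProj_mem t _)).trans ?_
    rw [show c t = 0 from if_neg fun h => by omega, zero_smul]

variable [T2Space M] [FiniteDimensional ℝ FA] [ContMDiffVectorBundle ∞ FA A 𝓘(ℝ, E)]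
  {nab : Connection (LieAlgebroid.tangent E M) FA A} {dv : Weil E FA A →ₗ[ℝ] Weil E FA A}

theorem exists_eq_wF {a : Weil E FA A} (ha : a ∈ weilPiece E FA A 0 0) :
    ∃ f, a = wF FA A f ∧ ∀ x, f x = augment E A x (a.1 x) :=
  ⟨⟨_, contMDiff_augment a⟩, weil_ext fun x => eq_algebraMap_of_biGr_zero (mem_weilPiece.1 ha x),
    fun _ => rfl⟩

theorem mem_weilPiece_cT {n : ℕ} {a : Weil E FA A} (ha : a ∈ weilPiece E FA A 0 (n + 1))
    (X : VF E M) : cT X a ∈ weilPiece E FA A 0 n := mem_weilPiece.2 fun x => by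
  simpa using cT_shifts X a _ (mem_weilPiece.1 ha) x

variable (hv : IsVerticalDifferential nab dv)
include hv

/-- The relation `[L_X, ι_Y] = ι_{[X,Y]}` may fail on `μ_η`, where the curvature appears. Composing
with the projection onto the row `p = 0` removes these generators. -/
theorem IsVerticalDifferential.lie_cT (X Y : VF E M) {n : ℕ} {a : Weil E FA A}
    (ha : a ∈ weilPiece E FA A 0 n) : cT Y (lieOp (cT X) dv a) = lieOp (cT X) dv (cT Y a) -
      cT ((LieAlgebroid.tangent E M).bracket X Y) a := by
  obtain ⟨r, hloc, hmul, -, hF, hT, hΛ, hS, hr, -⟩ := exists_baseProj FA A (E := E) (M := M)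
  obtain ⟨hD, h1, -⟩ := (cT_isFormContr X).comm gensT_isOdd hv.isStructureOp
    (double_isTensorial nab) (cT_isFormContr Y) (cT_isFormContr ((LieAlgebroid.tangent E M).bracket X Y))
  set D := lieOp (cT X) dv ∘ₗ cT Y - cT Y ∘ₗ lieOp (cT X) dv -
    cT ((LieAlgebroid.tangent E M).bracket X Y) with hDdef
  have h0 : (D ∘ₗ r) a = 0 := by
    refine weil_op_eq (D' := 0) (hD.isLocalOp.comp hloc) isLocalOp_zero (fun a b ha hb => ?_)
      (fun f => ?_) (fun ξ => ?_) (fun η => ?_) (fun η => ?_) a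
    · rw [LinearMap.comp_apply, hmul]
      exact hD.mul_eq_zero ha hb
    · rw [LinearMap.comp_apply, hF, hDdef]
      simp only [LinearMap.sub_apply, LinearMap.comp_apply, cT_wF, hv.lie_wF, map_zero, sub_zero]
      rfl
    · rw [LinearMap.comp_apply, hT]
      exact h1 ξ
    · rw [LinearMap.comp_apply, hΛ, map_zero]
      rfl
    · rw [LinearMap.comp_apply, hS, map_zero]
      rfl
  rw [LinearMap.comp_apply, hr n a ha, hDdef] at h0
  simp only [LinearMap.sub_apply, LinearMap.comp_apply] at h0
  linear_combination (norm := abel) -h0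

/-- Induction on the degree: commuting `L_X` with the contraction by the first argument produces the
bracket in that argument. -/
theorem IsVerticalDifferential.weilForm_lie {n : ℕ} {a : Weil E FA A}
    (ha : a ∈ weilPiece E FA A 0 n) (X : VF E M) (s : Fin n → VF E M) (x : M) :
    (weilForm n (lieOp (cT X) dv a)).1 x (fun i => s i x) =
      dirDeriv (fun y => (weilForm n a).1 y (fun i => s i y)) (X x) -
        ∑ j, (weilForm n a).1 x (Function.update (fun i => s i x) j
          ((LieAlgebroid.tangent E M).bracket X (s j) x)) := by
  induction n generalizing a with
  | zero =>
    obtain ⟨f, rfl, hf⟩ := exists_eq_wF ha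
    have h : (fun y => (weilForm 0 (wF FA A f)).1 y (fun i => s i y)) = f :=
      funext fun y => (hf y).symm
    rw [h, hv.lie_wF, Finset.univ_eq_empty, Finset.sum_empty, sub_zero]
    exact AlgHom.commutes (augment E A x) _
  | succ n ih =>
    rw [weilForm_succ, hv.lie_cT X (s 0) ha, map_sub, Fin.sum_univ_succ]
    have h1 := ih (mem_weilPiece_cT ha (s 0)) (fun i => s i.succ)
    have h2 : (weilForm (n + 1) a).1 x (Function.update (fun i => s i x) 0
        ((LieAlgebroid.tangent E M).bracket X (s 0) x)) =
        (weilForm n (cT ((LieAlgebroid.tangent E M).bracket X (s 0)) a)).1 x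
          (fun i => s i.succ x) := by
      have := weilForm_succ a (Fin.cons ((LieAlgebroid.tangent E M).bracket X (s 0))
        (fun i => s i.succ)) x
      simp only [Fin.cons_zero, Fin.cons_succ] at this
      rw [← this]
      congr 1
      funext k
      refine Fin.cases ?_ (fun k => ?_) k <;> simp
    have h3 : ∀ j : Fin n, (weilForm (n + 1) a).1 x (Function.update (fun i => s i x) j.succ
        ((LieAlgebroid.tangent E M).bracket X (s j.succ) x)) =
        (weilForm n (cT (s 0) a)).1 x (Function.update (fun i => s i.succ x) j
          ((LieAlgebroid.tangent E M).bracket X (s j.succ) x)) := fun j => by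
      rw [weilForm_apply, weilForm_apply, fiberForm_succ, cT_apply]
      congr 1
      funext k
      simp [Fin.tail, Function.update_apply]
    rw [h2]
    simp only [h3]
    rw [show (weilForm n (lieOp (cT X) dv (cT (s 0) a)) - weilForm n
      (cT ((LieAlgebroid.tangent E M).bracket X (s 0)) a)).1 x (fun i => s i.succ x) =
      (weilForm n (lieOp (cT X) dv (cT (s 0) a))).1 x (fun i => s i.succ x) - (weilForm n
      (cT ((LieAlgebroid.tangent E M).bracket X (s 0)) a)).1 x (fun i => s i.succ x) from rfl, h1]
    simp only [weilForm_succ]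
    ring

/-- Both sides satisfy Cartan's recursion with the same Lie derivative, and they agree on functions.
-/
theorem IsVerticalDifferential.weilForm_d {n : ℕ} {a : Weil E FA A}
    (ha : a ∈ weilPiece E FA A 0 n) (s : Fin (n + 1) → VF E M) (x : M) :
    (weilForm (n + 1) (dv a)).1 x (fun i => s i x) =
      koszulFun (LieAlgebroid.tangent E M) (weilForm n a).1 s x := by
  have h : ∀ {n} (a : Weil E FA A) (s : Fin (n + 1) → VF E M),
      (weilForm (n + 1) (dv a)).1 x (fun i => s i x) =
      (weilForm n (lieOp (cT (s 0)) dv a)).1 x (fun i => s i.succ x) -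
        (weilForm n (dv (cT (s 0) a))).1 x (fun i => s i.succ x) := fun a s => by
    rw [weilForm_succ, show cT (s 0) (dv a) = lieOp (cT (s 0)) dv a - dv (cT (s 0) a) by
      rw [lieOp_apply, add_sub_cancel_right], map_sub]
    rfl
  induction n generalizing a with
  | zero =>
    have h0 : cT (s 0) a = 0 := by
      obtain ⟨f, rfl, -⟩ := exists_eq_wF ha
      exact cT_wF _ _
    have h1 : (weilForm 0 (dv (cT (s 0) a))).1 x (fun i => s i.succ x) = 0 := by
      rw [h0, map_zero, map_zero]
      rfl
    rw [h, hv.weilForm_lie ha, h1, koszulFun, koszulBracket, Fin.sum_univ_succ, Finset.univ_eq_empty (α := Fin 0),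
      Finset.sum_empty, Finset.sum_empty, Fin.val_zero, pow_zero, one_mul, add_zero, add_zero,
      sub_zero, sub_zero]
    rfl
  | succ n ih =>
    have h1 : contrForm (s 0) (weilForm (n + 1) a).1 = (weilForm n (cT (s 0) a)).1 :=
      funext fun y => by
        rw [contrForm, weilForm_apply, curryLeft_fiberForm, weilForm_apply, cT_apply]
        rfl
    have h2 : (weilForm (n + 1) (dv (cT (s 0) a))).1 x (fun i => s i.succ x) =
        koszulFun (LieAlgebroid.tangent E M) (weilForm n (cT (s 0) a)).1 (fun i => s i.succ) x :=
      ih (mem_weilPiece_cT ha (s 0)) _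
    rw [h, hv.weilForm_lie ha, koszulFun_succ, h1, h2]
    rfl

end DeRham

end KoszulRecursion

/-! ### The homotopy formula for the vertical differential. -/

section Euler

variable {E : Type*} [NormedAddCommGroup E] [NormedSpace ℝ E] [FiniteDimensional ℝ E]
  {M : Type*} [TopologicalSpace M] [ChartedSpace E M] [IsManifold 𝓘(ℝ, E) ∞ M]
  {FA : Type*} [NormedAddCommGroup FA] [NormedSpace ℝ FA]
  {A : M → Type*} [TopologicalSpace (TotalSpace FA A)] [∀ x, AddCommGroup (A x)]
  [∀ x, Module ℝ (A x)] [∀ x, TopologicalSpace (A x)] [FiberBundle FA A] [VectorBundle ℝ FA A]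

theorem EvenD.sub {D D' : Weil E FA A →ₗ[ℝ] Weil E FA A} (hD : EvenD D) (hD' : EvenD D') :
    EvenD (D - D') where
  der a b := by
    simp only [LinearMap.sub_apply, hD.der a b, hD'.der a b, sub_mul, mul_sub]
    abel
  pres a := by simp only [LinearMap.sub_apply, hD.pres a, hD'.pres a, map_sub]

theorem mul_mem_weilPiece {p q p' q' : ℕ} {a b : Weil E FA A} (ha : a ∈ weilPiece E FA A p q)
    (hb : b ∈ weilPiece E FA A p' q') : a * b ∈ weilPiece E FA A (p + p') (q + q') :=
  mem_weilPiece.2 fun x => by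
    have h := mul_mem_fiberGr (mem_weilPiece.1 ha x) (mem_weilPiece.1 hb x)
    rw [Prod.mk_add_mk] at h
    push_cast
    exact h

variable [T2Space M] [FiniteDimensional ℝ FA] [ContMDiffVectorBundle ∞ FA A 𝓘(ℝ, E)]

variable (E FA A) in
/-- The operator which multiplies `W^{p,q}` by `p`. -/
theorem exists_eulerOp : ∃ N : Weil E FA A →ₗ[ℝ] Weil E FA A,
    (∀ p q, ∀ a ∈ weilPiece E FA A p q, N a = (p : ℝ) • a) ∧ EvenD N := by
  let e : _ ≃ₗ[ℝ] Weil E FA A := LinearEquiv.ofBijective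
    (DirectSum.coeLinearMap fun pq : ℕ × ℕ => weilPiece E FA A pq.1 pq.2) isInternal_weilPiece
  let N : Weil E FA A →ₗ[ℝ] Weil E FA A := (DirectSum.toModule ℝ (ℕ × ℕ) (Weil E FA A)
    fun pq : ℕ × ℕ => (pq.1 : ℝ) • (weilPiece E FA A pq.1 pq.2).subtype) ∘ₗ e.symm.toLinearMap
  have hN : ∀ p q, ∀ a ∈ weilPiece E FA A p q, N a = (p : ℝ) • a := fun p q a ha => by
    have h : e (DirectSum.lof ℝ (ℕ × ℕ) (fun pq => weilPiece E FA A pq.1 pq.2) (p, q) ⟨a, ha⟩) = a :=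
      DirectSum.coeLinearMap_lof _ _ _
    have h' : e.symm a = DirectSum.lof ℝ (ℕ × ℕ) (fun pq => weilPiece E FA A pq.1 pq.2) (p, q)
        ⟨a, ha⟩ := by rw [LinearEquiv.symm_apply_eq, h]
    change DirectSum.toModule ℝ (ℕ × ℕ) (Weil E FA A) _ (e.symm a) = _
    rw [h', DirectSum.toModule_lof]
    rfl
  refine ⟨N, hN, fun a b => ?_, fun a => ?_⟩
  · induction a using weil_induction with
    | hom p q a ha =>
      induction b using weil_induction with
      | hom p' q' b hb =>
        rw [hN _ _ _ (mul_mem_weilPiece ha hb), hN _ _ _ ha, hN _ _ _ hb, smul_mul_assoc,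
          mul_smul_comm, ← add_smul, Nat.cast_add]
      | add b b' h h' => rw [mul_add, map_add, h, h', map_add, mul_add, mul_add]; abel
    | add a a' h h' => rw [add_mul, map_add, h, h', map_add, add_mul, add_mul]; abel
  · induction a using weil_induction with
    | hom p q a ha => rw [weil_parity_of_mem ha, map_smul, hN _ _ _ ha, map_smul,
        weil_parity_of_mem ha, smul_comm]
    | add a a' h h' => rw [map_add, map_add, h, h', map_add, map_add]

theorem hOp_mem {p q : ℕ} {a : Weil E FA A} (ha : a ∈ weilPiece E FA A p (q + 1)) :
    hOp a ∈ weilPiece E FA A p q := mem_weilPiece.2 fun x => by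
  simpa using hOp_shifts a _ (mem_weilPiece.1 ha) x

theorem hOp_eq_zero {p : ℕ} {a : Weil E FA A} (ha : a ∈ weilPiece E FA A p 0) : hOp a = 0 :=
  weil_ext fun x => biGr_eq_zero (hOp_shifts a _ (mem_weilPiece.1 ha) x) fun t ht => by
    rw [Prod.mk_add_mk, Prod.mk.injEq] at ht
    omega

variable {L : LieAlgebroid E FA A} {nab : Connection (LieAlgebroid.tangent E M) FA A}
  {dv dh : Weil E FA A →ₗ[ℝ] Weil E FA A}

theorem IsVerticalDifferential.mem (hv : IsVerticalDifferential nab dv) {p q : ℕ}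
    {a : Weil E FA A} (ha : a ∈ weilPiece E FA A p q) : dv a ∈ weilPiece E FA A p (q + 1) :=
  mem_weilPiece.2 fun x => by simpa using hv.shifts a _ (mem_weilPiece.1 ha) x

theorem IsHorizontalDifferential.mem (hh : IsHorizontalDifferential L nab dh) {p q : ℕ}
    {a : Weil E FA A} (ha : a ∈ weilPiece E FA A p q) : dh a ∈ weilPiece E FA A (p + 1) q :=
  mem_weilPiece.2 fun x => by simpa using hh.shifts a _ (mem_weilPiece.1 ha) x

/-- The anticommutator of `h` with `d_ver` and the operator counting `p` are even derivations that
commute with `d_ver`. They agree on functions and on `θ_η`, hence on exact forms and on `μ_η`. -/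
theorem IsVerticalDifferential.euler (hv : IsVerticalDifferential nab dv) {p q : ℕ}
    {a : Weil E FA A} (ha : a ∈ weilPiece E FA A p q) :
    hOp (dv a) + dv (hOp a) = (p : ℝ) • a := by
  obtain ⟨N, hN, hNe⟩ := exists_eulerOp E FA A
  have hodd := hv.isStructureOp.odd
  have hmF : ∀ f, wF FA A f ∈ weilPiece E FA A 0 0 := fun f =>
    mem_weilPiece.2 fun x => algebraMap_mem_fiberGr _
  have hmΛ : ∀ η, (wΛ η : Weil E FA A) ∈ weilPiece E FA A 1 0 := fun η =>
    mem_weilPiece.2 fun x => genΛ_mem_fiberGr _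
  set D := lieOp hOp dv - N with hDdef
  have hD : EvenD D := (hOp_oddD.anti hodd).sub hNe
  have happ : ∀ a, D a = hOp (dv a) + dv (hOp a) - N a := fun _ => rfl
  have hNd : ∀ a, N (dv a) = dv (N a) := fun a => by
    induction a using weil_induction with
    | hom p q a ha => rw [hN _ _ _ (hv.mem ha), hN _ _ _ ha, map_smul]
    | add a a' h h' => rw [map_add, map_add, map_add, map_add, h, h']
  have hcomm : ∀ a, D (dv a) = dv (D a) := fun a => by
    rw [happ, happ, hv.sq, map_zero, zero_add, map_sub, map_add, hv.sq, add_zero, hNd]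
  have hDF : ∀ f, D (wF FA A f) = 0 := fun f => by
    rw [happ, hv.apply_wF, hOp_wT, hOp_wF, map_zero, hN _ _ _ (hmF f), Nat.cast_zero, zero_smul,
      add_zero, sub_zero]
  have hDT : ∀ ξ, D (wT FA A ξ) = 0 := map_wT_eq_zero hD.isLocalOp
    (fun f a => by rw [hD.der, hDF, zero_mul, zero_add])
    (fun f => by rw [← hv.apply_wF, hcomm, hDF, map_zero])
  have hDΛ : ∀ η, D (wΛ η) = 0 := fun η => by
    rw [happ, hv.apply_wΛ, map_add, hOp_wS, hOp_wΛ, map_zero, hN _ _ _ (hmΛ η),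
      map_covΛ_eq_zero hOp_oddD.isLocalOp (fun a b => hOp_oddD.mul_eq_zero) hOp_wT hOp_wΛ,
      Nat.cast_one, one_smul, add_zero, add_zero, sub_self]
  have hDS : ∀ η, D (wS η) = 0 := fun η => by
    rw [eq_sub_of_add_eq (hv.apply_wΛ η).symm, map_sub, hcomm, hDΛ, map_zero,
      map_covΛ_eq_zero hD.isLocalOp (fun a b => hD.mul_eq_zero) hDT hDΛ, sub_zero]
  have h0 : D a = 0 := weil_op_eq (D' := 0) hD.isLocalOp isLocalOp_zero
    (fun a b => hD.mul_eq_zero) hDF hDT hDΛ hDS a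
  rw [← hN _ _ _ ha, ← sub_eq_zero, ← happ, h0]

end Euler

/-! ### The filtration by `p`, and acyclicity of its part `p ≥ 1`. -/

section Acyclicity

variable {E : Type*} [NormedAddCommGroup E] [NormedSpace ℝ E] [FiniteDimensional ℝ E]
  {M : Type*} [TopologicalSpace M] [ChartedSpace E M] [IsManifold 𝓘(ℝ, E) ∞ M]
  {FA : Type*} [NormedAddCommGroup FA] [NormedSpace ℝ FA]
  {A : M → Type*} [TopologicalSpace (TotalSpace FA A)] [∀ x, AddCommGroup (A x)]
  [∀ x, Module ℝ (A x)] [∀ x, TopologicalSpace (A x)] [FiberBundle FA A] [VectorBundle ℝ FA A]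

variable (E FA A) in
/-- The elements of total degree `n` with components in `W^{p',q}`, `p' ≥ p`, only. -/
def weilFil (p n : ℕ) : Submodule ℝ (Weil E FA A) :=
  ⨆ pq : ℕ × ℕ, ⨆ _ : pq.1 + pq.2 = n ∧ p ≤ pq.1, weilPiece E FA A pq.1 pq.2

theorem weilFil_le {p n : ℕ} {S : Submodule ℝ (Weil E FA A)}
    (h : ∀ p' q, p' + q = n → p ≤ p' → weilPiece E FA A p' q ≤ S) : weilFil E FA A p n ≤ S :=
  iSup_le fun pq => iSup_le fun hpq => h pq.1 pq.2 hpq.1 hpq.2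

theorem weilPiece_le_weilFil {p p' q n : ℕ} (h : p' + q = n) (hp : p ≤ p') :
    weilPiece E FA A p' q ≤ weilFil E FA A p n :=
  le_iSup₂_of_le (p', q) ⟨h, hp⟩ le_rfl

theorem weilFil_anti {p p' n : ℕ} (h : p ≤ p') : weilFil E FA A p' n ≤ weilFil E FA A p n :=
  weilFil_le fun _ _ hn hp => weilPiece_le_weilFil hn (h.trans hp)

theorem weilFil_eq_bot {p n : ℕ} (h : n < p) : weilFil E FA A p n = ⊥ :=
  eq_bot_iff.2 (weilFil_le fun _ _ hn hp => by omega)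

theorem weilFil_le_sup {p q n : ℕ} (h : p + q = n) :
    weilFil E FA A p n ≤ weilPiece E FA A p q ⊔ weilFil E FA A (p + 1) n :=
  weilFil_le fun p' q' hn hp => by
    rcases hp.eq_or_lt with rfl | hlt
    · obtain rfl : q' = q := by omega
      exact le_sup_left
    · exact (weilPiece_le_weilFil hn hlt).trans le_sup_right

theorem weilFil_le_weilDegree {p n : ℕ} : weilFil E FA A p n ≤ weilDegree E FA A n :=
  weilFil_le fun p' q hn _ => le_iSup₂_of_le (f := fun (pq : ℕ × ℕ) (_ : pq.1 + pq.2 = n) =>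
    weilPiece E FA A pq.1 pq.2) (p', q) hn le_rfl

theorem weilPiece_le_weilDegree (p q : ℕ) : weilPiece E FA A p q ≤ weilDegree E FA A (p + q) :=
  (weilPiece_le_weilFil (p := 0) rfl (Nat.zero_le p)).trans weilFil_le_weilDegree

theorem eq_zero_of_mem_weilFil {p q n : ℕ} {a : Weil E FA A} (ha : a ∈ weilPiece E FA A p q)
    (h : a ∈ weilFil E FA A (p + 1) n) : a = 0 := weil_ext fun x => by
  have hle : weilFil E FA A (p + 1) n ≤
      { carrier := {a | biProj E A x ((p : ℤ), (q : ℤ)) (a.1 x) = 0}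
        add_mem' := fun {a b} ha hb => by
          simp only [Set.mem_ofPred_eq] at ha hb ⊢
          rw [weil_add_apply, map_add, ha, hb, add_zero]
        zero_mem' := map_zero _
        smul_mem' := fun c a ha => by
          simp only [Set.mem_ofPred_eq] at ha ⊢
          rw [weil_smul_apply, map_smul, ha, smul_zero] } :=
    weilFil_le fun p' q' _ hp b hb => fiberProj_of_mem_ne
      (fun h => by rw [Prod.mk.injEq] at h; omega) (mem_weilPiece.1 hb x)
  have h' := hle h
  rwa [← fiberProj_of_mem (mem_weilPiece.1 ha x)]

variable [T2Space M] [FiniteDimensional ℝ FA] [ContMDiffVectorBundle ∞ FA A 𝓘(ℝ, E)]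
  {L : LieAlgebroid E FA A} {nab : Connection (LieAlgebroid.tangent E M) FA A}
  {dv dh : Weil E FA A →ₗ[ℝ] Weil E FA A}
  (hv : IsVerticalDifferential nab dv) (hh : IsHorizontalDifferential L nab dh)
include hv hh

theorem total_sq (a : Weil E FA A) : (dh + dv) ((dh + dv) a) = 0 := by
  simp only [LinearMap.add_apply, map_add, hv.sq, hh.sq hv]
  rw [zero_add, add_zero, add_comm]
  exact anticomm hv hh a

theorem total_mem_weilFil {p n : ℕ} {a : Weil E FA A} (ha : a ∈ weilFil E FA A p n) :
    (dh + dv) a ∈ weilFil E FA A p (n + 1) := by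
  refine (weilFil_le (S := (weilFil E FA A p (n + 1)).comap (dh + dv))
    fun p' q hn hp b hb => show dh b + dv b ∈ weilFil E FA A p (n + 1) from add_mem ?_ ?_) ha
  · exact weilPiece_le_weilFil (by omega) (hp.trans (Nat.le_succ p')) (hh.mem hb)
  · exact weilPiece_le_weilFil (by omega) hp (hv.mem hb)

/-- The component of lowest `p` is closed for `d_ver`, so the homotopy formula gives it a vertical
primitive `b`. Subtracting the total differential of `b` raises the filtration, which is finite in
each total degree. -/
theorem exists_primitive {p n : ℕ} (hp : 0 < p) {a : Weil E FA A}
    (ha : a ∈ weilFil E FA A p (n + 1)) (hd : (dh + dv) a = 0) :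
    ∃ b ∈ weilFil E FA A p n, (dh + dv) b = a := by
  -- In total degree `n + 1` the filtration is zero as soon as `p ≥ n + 2`.
  induction hk : n + 2 - p generalizing p a with
  | zero =>
    rw [weilFil_eq_bot (by omega), Submodule.mem_bot] at ha
    exact ⟨0, zero_mem _, by rw [ha, map_zero]⟩
  | succ k ih =>
    obtain ⟨q, hq⟩ : ∃ q, p + q = n + 1 := ⟨n + 1 - p, by omega⟩
    obtain ⟨a₁, h₁, a₂, h₂, rfl⟩ := Submodule.mem_sup.1 (weilFil_le_sup hq ha)
    -- All other terms of the total differential have first degree at least `p + 1`, so `d_ver a₁`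
    -- must vanish by itself.
    have hdv : dv a₁ = 0 := by
      refine eq_zero_of_mem_weilFil (n := n + 1 + 1) (hv.mem h₁) ?_
      have : dv a₁ = -(dh a₁ + (dh + dv) a₂) := by
        rw [map_add, LinearMap.add_apply] at hd
        linear_combination (norm := abel) hd
      rw [this]
      exact neg_mem (add_mem (weilPiece_le_weilFil (by omega) le_rfl (hh.mem h₁))
        (total_mem_weilFil hv hh h₂))
    have he := hv.euler h₁
    rw [hdv, map_zero, zero_add] at he
    have hb : ∃ b ∈ weilFil E FA A p n, dv b = a₁ ∧ dh b ∈ weilFil E FA A (p + 1) (n + 1) := by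
      have hp' : (p : ℝ) ≠ 0 := Nat.cast_ne_zero.2 hp.ne'
      refine ⟨(p : ℝ)⁻¹ • hOp a₁, ?_, by rw [map_smul, he, inv_smul_smul₀ hp'], ?_⟩
      -- For `q = 0` the operator `h` vanishes on the component for degree reasons, and the
      -- primitive is zero.
      · cases q with
        | zero => rw [hOp_eq_zero h₁, smul_zero]; exact zero_mem _
        | succ q =>
          exact Submodule.smul_mem _ _
            (weilPiece_le_weilFil (by omega) le_rfl (hOp_mem h₁))
      · rw [map_smul]
        cases q with
        | zero => rw [hOp_eq_zero h₁, map_zero, smul_zero]; exact zero_mem _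
        | succ q =>
          exact Submodule.smul_mem _ _
            (weilPiece_le_weilFil (by omega) le_rfl (hh.mem (hOp_mem h₁)))
    obtain ⟨b, hbm, hbv, hbh⟩ := hb
    have hrest : a₁ + a₂ - (dh + dv) b = a₂ - dh b := by
      rw [LinearMap.add_apply, hbv]
      abel
    obtain ⟨b', hbm', hb'⟩ := ih (p := p + 1) (Nat.succ_pos p) (a := a₁ + a₂ - (dh + dv) b)
      (hrest ▸ sub_mem h₂ hbh) (by rw [map_sub, hd, total_sq hv hh, sub_zero]) (by omega)
    exact ⟨b + b', add_mem hbm (weilFil_anti (Nat.le_succ p) hbm'), by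
      rw [map_add, hb', add_sub_cancel]⟩

end Acyclicity

/-! ### Comparison with de Rham cohomology. -/

section Cohomology

variable {E : Type*} [NormedAddCommGroup E] [NormedSpace ℝ E] [FiniteDimensional ℝ E]
  {M : Type*} [TopologicalSpace M] [ChartedSpace E M] [IsManifold 𝓘(ℝ, E) ∞ M]
  {FA : Type*} [NormedAddCommGroup FA] [NormedSpace ℝ FA]
  {A : M → Type*} [TopologicalSpace (TotalSpace FA A)] [∀ x, AddCommGroup (A x)]
  [∀ x, Module ℝ (A x)] [∀ x, TopologicalSpace (A x)] [FiberBundle FA A] [VectorBundle ℝ FA A]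

variable (E FA A) in
/-- The projection of `W` onto `Ω(M)`. -/
def baseProj : Weil E FA A →ₗ[ℝ] Weil E FA A := (exists_baseProj FA A).choose

theorem baseProj_mul (a b : Weil E FA A) :
    baseProj E FA A (a * b) = baseProj E FA A a * baseProj E FA A b :=
  (exists_baseProj FA A).choose_spec.2.1 a b

theorem baseProj_of_mem {n : ℕ} {a : Weil E FA A} (ha : a ∈ weilPiece E FA A 0 n) :
    baseProj E FA A a = a :=
  (exists_baseProj FA A).choose_spec.2.2.2.2.2.2.2.1 n a ha

theorem baseProj_eq_zero {p q : ℕ} (hp : 0 < p) {a : Weil E FA A} (ha : a ∈ weilPiece E FA A p q) :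
    baseProj E FA A a = 0 :=
  (exists_baseProj FA A).choose_spec.2.2.2.2.2.2.2.2 p q hp a ha

theorem baseProj_mem {n : ℕ} {a : Weil E FA A} (ha : a ∈ weilDegree E FA A n) :
    baseProj E FA A a ∈ weilPiece E FA A 0 n := by
  refine (iSup₂_le fun (pq : ℕ × ℕ) (hpq : pq.1 + pq.2 = n) => ?_ :
    weilDegree E FA A n ≤ (weilPiece E FA A 0 n).comap (baseProj E FA A)) ha
  intro b hb
  obtain ⟨p, q⟩ := pq
  rw [Submodule.mem_comap]
  rcases Nat.eq_zero_or_pos p with rfl | hp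
  · obtain rfl : q = n := by simpa using hpq
    rwa [baseProj_of_mem hb]
  · rw [baseProj_eq_zero hp hb]
    exact zero_mem _

theorem sub_baseProj_mem {n : ℕ} {a : Weil E FA A} (ha : a ∈ weilDegree E FA A n) :
    a - baseProj E FA A a ∈ weilFil E FA A 1 n := by
  refine (iSup₂_le fun (pq : ℕ × ℕ) (hpq : pq.1 + pq.2 = n) => ?_ :
    weilDegree E FA A n ≤ (weilFil E FA A 1 n).comap (LinearMap.id - baseProj E FA A)) ha
  intro b hb
  obtain ⟨p, q⟩ := pq
  rw [Submodule.mem_comap, LinearMap.sub_apply, LinearMap.id_apply]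
  rcases Nat.eq_zero_or_pos p with rfl | hp
  · rw [baseProj_of_mem hb, sub_self]
    exact zero_mem _
  · rw [baseProj_eq_zero hp hb, sub_zero]
    exact weilPiece_le_weilFil hpq hp hb

theorem baseProj_of_mem_weilFil {n : ℕ} {a : Weil E FA A} (ha : a ∈ weilFil E FA A 1 n) :
    baseProj E FA A a = 0 :=
  (weilFil_le (S := LinearMap.ker (baseProj E FA A)) fun _ _ _ hp _ hb => baseProj_eq_zero hp hb) ha

theorem mem_weilDegree_of_base {n : ℕ} {a : Weil E FA A} (ha : a ∈ weilPiece E FA A 0 n) :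
    a ∈ weilDegree E FA A n := by
  simpa using weilPiece_le_weilDegree 0 n ha

variable [T2Space M]

theorem evalForm_injective {FB : Type*} [NormedAddCommGroup FB] [NormedSpace ℝ FB]
    {B : M → Type*} [TopologicalSpace (TotalSpace FB B)] [∀ x, AddCommGroup (B x)]
    [∀ x, Module ℝ (B x)] [∀ x, TopologicalSpace (B x)] [FiberBundle FB B] [VectorBundle ℝ FB B]
    [FiniteDimensional ℝ FB] [ContMDiffVectorBundle ∞ FB B 𝓘(ℝ, E)] {n : ℕ} :
    Function.Injective (evalForm (E := E) FB B n) := fun τ τ' h => by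
  refine Subtype.ext (funext fun x => AlternatingMap.ext fun v => ?_)
  choose s hs using fun i => exists_sec (E := E) (FB := FB) x (v i)
  have := congrFun (congrFun h s) x
  change τ.1 x (fun i => s i x) = τ'.1 x (fun i => s i x) at this
  simpa only [hs] using this

variable [FiniteDimensional ℝ FA] [ContMDiffVectorBundle ∞ FA A 𝓘(ℝ, E)]
  {L : LieAlgebroid E FA A} {nab : Connection (LieAlgebroid.tangent E M) FA A}
  {dv dh : Weil E FA A →ₗ[ℝ] Weil E FA A}

section Vertical

variable (hv : IsVerticalDifferential nab dv)
include hv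

theorem IsVerticalDifferential.baseProj_d (a : Weil E FA A) :
    baseProj E FA A (dv a) = dv (baseProj E FA A a) := by
  induction a using weil_induction with
  | hom p q a ha =>
    rcases Nat.eq_zero_or_pos p with rfl | hp
    · rw [baseProj_of_mem ha, baseProj_of_mem (hv.mem ha)]
    · rw [baseProj_eq_zero hp ha, baseProj_eq_zero hp (hv.mem ha), map_zero]
  | add a b ha hb => simp only [map_add, ha, hb]

theorem IsVerticalDifferential.koszul_weilForm {n : ℕ} {a : Weil E FA A}
    (ha : a ∈ weilPiece E FA A 0 n) : koszul (LieAlgebroid.tangent E M) n (weilForm n a) =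
      evalForm E (TangentSpace 𝓘(ℝ, E) : M → Type _) (n + 1) (weilForm (n + 1) (dv a)) :=
  funext fun s => funext fun x => (hv.weilForm_d ha s x).symm

theorem IsVerticalDifferential.weilForm_closed {n : ℕ} {a : Weil E FA A}
    (ha : a ∈ weilPiece E FA A 0 n) :
    weilForm n a ∈ closedForms (LieAlgebroid.tangent E M) n ↔ dv a = 0 := by
  rw [closedForms, LinearMap.mem_ker, hv.koszul_weilForm ha]
  refine ⟨fun h => weilForm_injective (hv.mem ha) (evalForm_injective (h.trans (map_zero _).symm)),
    fun h => ?_⟩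
  rw [h, map_zero, map_zero]

/-- The alternative `a = 0` is there for degree `0`, where no forms of lower degree exist and only
zero is exact. -/
theorem IsVerticalDifferential.weilForm_exact {n : ℕ} {a : Weil E FA A}
    (ha : a ∈ weilPiece E FA A 0 n) :
    weilForm n a ∈ exactForms (LieAlgebroid.tangent E M) n ↔
      a = 0 ∨ ∃ k, ∃ e ∈ weilPiece E FA A 0 k, k + 1 = n ∧ a = dv e := by
  cases n with
  | zero =>
    refine ⟨fun h => Or.inl (weilForm_injective ha h), ?_⟩
    rintro (rfl | ⟨k, -, -, h, -⟩)
    · rw [map_zero]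
      exact zero_mem _
    · exact absurd h (Nat.succ_ne_zero k)
  | succ n =>
    rw [exactForms, Submodule.mem_comap, LinearMap.mem_range]
    constructor
    · rintro ⟨τ, hτ⟩
      obtain ⟨e, he, rfl⟩ := exists_weilForm_eq A FA τ
      rw [hv.koszul_weilForm he] at hτ
      refine Or.inr ⟨n, e, he, rfl, sub_eq_zero.1 (weilForm_injective (sub_mem ha (hv.mem he)) ?_)⟩
      rw [map_sub, ← evalForm_injective hτ, sub_self]
    · rintro (rfl | ⟨k, e, he, hk, rfl⟩)
      · exact ⟨0, by rw [map_zero, map_zero, map_zero]⟩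
      · obtain rfl : k = n := Nat.succ_injective hk
        exact ⟨weilForm k e, hv.koszul_weilForm he⟩

theorem IsVerticalDifferential.weilForm_mul_exact {m n : ℕ} {a b : Weil E FA A}
    (ha : a ∈ weilPiece E FA A 0 m) (hb : b ∈ weilPiece E FA A 0 n)
    (hae : weilForm m a ∈ exactForms (LieAlgebroid.tangent E M) m) (hbc : dv b = 0) :
    weilForm (m + n) (a * b) ∈ exactForms (LieAlgebroid.tangent E M) (m + n) := by
  rw [hv.weilForm_exact (by simpa using mul_mem_weilPiece ha hb)]
  rcases (hv.weilForm_exact ha).1 hae with rfl | ⟨k, e, he, rfl, rfl⟩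
  · exact Or.inl (zero_mul b)
  · refine Or.inr ⟨k + n, e * b, by simpa using mul_mem_weilPiece he hb, by omega, ?_⟩
    rw [hv.derivation _ _ _ _ he, hbc, mul_zero, smul_zero, add_zero]

theorem IsVerticalDifferential.weilForm_mul_exact' {m n : ℕ} {a b : Weil E FA A}
    (ha : a ∈ weilPiece E FA A 0 m) (hb : b ∈ weilPiece E FA A 0 n) (hac : dv a = 0)
    (hbe : weilForm n b ∈ exactForms (LieAlgebroid.tangent E M) n) :
    weilForm (m + n) (a * b) ∈ exactForms (LieAlgebroid.tangent E M) (m + n) := by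
  rw [hv.weilForm_exact (by simpa using mul_mem_weilPiece ha hb)]
  rcases (hv.weilForm_exact hb).1 hbe with rfl | ⟨k, e, he, rfl, rfl⟩
  · exact Or.inl (mul_zero a)
  -- The sign undoes the one in the Leibniz rule for `d_ver (a e)` with `a` closed of degree `m`.
  · refine Or.inr ⟨m + k, (-1 : ℝ) ^ (0 + m) • (a * e),
      Submodule.smul_mem _ _ (by simpa using mul_mem_weilPiece ha he), by omega, ?_⟩
    rw [map_smul, hv.derivation _ _ _ _ ha, hac, zero_mul, zero_add, zero_add, smul_smul, ← mul_pow,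
      neg_one_mul, neg_neg, one_pow, one_smul]

end Vertical

variable (hv : IsVerticalDifferential nab dv) (hh : IsHorizontalDifferential L nab dh)

include hh in
theorem IsHorizontalDifferential.baseProj_d (a : Weil E FA A) : baseProj E FA A (dh a) = 0 := by
  induction a using weil_induction with
  | hom p q a ha => exact baseProj_eq_zero (Nat.succ_pos p) (hh.mem ha)
  | add a b ha hb => rw [map_add, map_add, ha, hb, add_zero]

include hv hh

theorem baseProj_total (a : Weil E FA A) :
    baseProj E FA A ((dh + dv) a) = dv (baseProj E FA A a) := by
  rw [LinearMap.add_apply, map_add, hh.baseProj_d, zero_add, hv.baseProj_d]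

theorem dv_baseProj_eq_zero {a : Weil E FA A} (ha : (dh + dv) a = 0) :
    dv (baseProj E FA A a) = 0 := by
  rw [← baseProj_total hv hh, ha, map_zero]

/-- A cocycle of `W` defines a closed form. -/
theorem exists_cocycleForm (n : ℕ) :
    ∃ Ψ : weilCocycles (dh + dv) n →ₗ[ℝ] closedForms (LieAlgebroid.tangent E M) n,
      ∀ a, (Ψ a).1 = weilForm n (baseProj E FA A a.1) :=
  ⟨((weilForm n ∘ₗ baseProj E FA A) ∘ₗ (weilCocycles (dh + dv) n).subtype).codRestrict _
    fun a => (hv.weilForm_closed (baseProj_mem a.2.2)).2 (dv_baseProj_eq_zero hv hh a.2.1),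
    fun _ => rfl⟩

/-- If the projection of a cocycle is `d_ver e`, then subtracting the total differential of `e`
leaves a cocycle with `p ≥ 1`, which is a coboundary by acyclicity. -/
theorem weilForm_baseProj_exact {n : ℕ} {a : Weil E FA A} (ha : a ∈ weilCocycles (dh + dv) n) :
    weilForm n (baseProj E FA A a) ∈ exactForms (LieAlgebroid.tangent E M) n ↔
      a ∈ weilCoboundaries (dh + dv) n := by
  have hm := baseProj_mem ha.2
  rw [hv.weilForm_exact hm]
  constructor
  · intro hex
    have key : ∀ {k} {e : Weil E FA A}, e ∈ weilPiece E FA A 0 k → k + 1 = n →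
        baseProj E FA A a = dv e → a ∈ weilCoboundaries (dh + dv) n := fun {k e} he hk h => by
      subst hk
      have h1 : a - (dh + dv) e ∈ weilFil E FA A 1 (k + 1) := by
        have : a - (dh + dv) e = (a - baseProj E FA A a) - dh e := by
          rw [LinearMap.add_apply, h]
          abel
        rw [this]
        exact sub_mem (sub_baseProj_mem ha.2)
          (weilPiece_le_weilFil (by omega) le_rfl (hh.mem he))
      obtain ⟨b, hb, hb'⟩ := exists_primitive hv hh Nat.one_pos h1 (by
        rw [map_sub, total_sq hv hh, sub_zero]
        exact ha.1)
      exact ⟨e + b, add_mem (mem_weilDegree_of_base he) (weilFil_le_weilDegree hb), by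
        rw [map_add, hb', add_sub_cancel]⟩
    rcases hex with h | ⟨k, e, he, hk, h⟩
    · cases n with
      | zero =>
        have := sub_baseProj_mem ha.2
        rw [h, sub_zero, weilFil_eq_bot Nat.one_pos] at this
        exact this
      | succ n => exact key (zero_mem _) rfl (h.trans (map_zero dv).symm)
    · exact key he hk h
  · intro h
    cases n with
    | zero => exact Or.inl (by rw [show a = 0 from h, map_zero])
    | succ n =>
      obtain ⟨e, he, rfl⟩ := h
      exact Or.inr ⟨n, _, baseProj_mem he, rfl, baseProj_total hv hh e⟩

/-- A closed form, seen in the row `p = 0`, need not be a cocycle: its total differential is `d_hor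
e`. This has `p ≥ 1`, and a primitive with `p ≥ 1` corrects `e` without changing its projection. -/
theorem exists_cocycle {n : ℕ} {τ : FormSpace E E (TangentSpace 𝓘(ℝ, E) : M → Type _) n}
    (hτ : τ ∈ closedForms (LieAlgebroid.tangent E M) n) :
    ∃ a ∈ weilCocycles (dh + dv) n, weilForm n (baseProj E FA A a) = τ := by
  obtain ⟨e, he, rfl⟩ := exists_weilForm_eq A FA τ
  have hdv := (hv.weilForm_closed he).1 hτ
  have hde : (dh + dv) e = dh e := by rw [LinearMap.add_apply, hdv, add_zero]
  have hm : dh e ∈ weilFil E FA A 1 (n + 1) :=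
    weilPiece_le_weilFil (by omega) le_rfl (hh.mem he)
  obtain ⟨b, hb, hb'⟩ := exists_primitive hv hh Nat.one_pos hm (by rw [← hde, total_sq hv hh])
  refine ⟨e - b, ⟨?_, sub_mem (mem_weilDegree_of_base he) (weilFil_le_weilDegree hb)⟩, ?_⟩
  · change (dh + dv) (e - b) = 0
    rw [map_sub, hb', hde, sub_self]
  · rw [map_sub, baseProj_of_mem he, baseProj_of_mem_weilFil hb, sub_zero]

/-- The map is induced by the projection onto the row `p = 0`. The criterion on representatives is
recorded so that products can be compared for arbitrary choices of cocycles and forms. -/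
theorem exists_cohomologyEquiv (n : ℕ) :
    ∃ Φ : WeilCohomology (dh + dv) n ≃ₗ[ℝ] DeRham E M n, ∀ a σ,
      Φ (Submodule.Quotient.mk a) = Submodule.Quotient.mk σ ↔
        weilForm n (baseProj E FA A a.1) - σ.1 ∈ exactForms (LieAlgebroid.tangent E M) n := by
  obtain ⟨Ψ, hΨ⟩ := exists_cocycleForm hv hh n
  have hΨe : ∀ a, Ψ a ∈ (exactForms (LieAlgebroid.tangent E M) n).submoduleOf
      (closedForms (LieAlgebroid.tangent E M) n) ↔
      a ∈ (weilCoboundaries (dh + dv) n).submoduleOf (weilCocycles (dh + dv) n) := fun a => by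
    rw [Submodule.submoduleOf, Submodule.mem_comap, Submodule.subtype_apply, hΨ,
      weilForm_baseProj_exact hv hh a.2]
    rfl
  have hle : (weilCoboundaries (dh + dv) n).submoduleOf (weilCocycles (dh + dv) n) ≤
      ((exactForms (LieAlgebroid.tangent E M) n).submoduleOf
        (closedForms (LieAlgebroid.tangent E M) n)).comap Ψ := fun a ha => (hΨe a).2 ha
  let Φ₀ : WeilCohomology (dh + dv) n →ₗ[ℝ] DeRham E M n := Submodule.mapQ _ _ Ψ hle
  have hbij : Function.Bijective Φ₀ := by
    refine ⟨(injective_iff_map_eq_zero Φ₀).2 fun c hc => ?_, fun c => ?_⟩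
    · obtain ⟨a, rfl⟩ := Submodule.Quotient.mk_surjective _ c
      exact (Submodule.Quotient.mk_eq_zero _).2
        ((hΨe a).1 ((Submodule.Quotient.mk_eq_zero _).1 hc))
    · obtain ⟨σ, rfl⟩ := Submodule.Quotient.mk_surjective _ c
      obtain ⟨a, ha, haσ⟩ := exists_cocycle hv hh σ.2
      exact ⟨Submodule.Quotient.mk ⟨a, ha⟩,
        congrArg Submodule.Quotient.mk (Subtype.ext ((hΨ ⟨a, ha⟩).trans haσ))⟩
  refine ⟨LinearEquiv.ofBijective Φ₀ hbij, fun a σ => ?_⟩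
  change Submodule.Quotient.mk (Ψ a) = Submodule.Quotient.mk σ ↔ _
  rw [Submodule.Quotient.eq, Submodule.submoduleOf, Submodule.mem_comap, Submodule.subtype_apply,
    Submodule.coe_sub, hΨ]

theorem cohomologyIsDeRham : CohomologyIsDeRham (dh + dv) := by
  choose Φ hΦ using exists_cohomologyEquiv hv hh
  refine ⟨Φ, fun m n a b c σ τ υ hc hυ ha hb => ?_⟩
  rw [hΦ] at ha hb ⊢
  obtain ⟨s, hs, hsσ⟩ := exists_weilForm_eq A FA σ.1
  obtain ⟨t, ht, htτ⟩ := exists_weilForm_eq A FA τ.1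
  have hsc : dv s = 0 := (hv.weilForm_closed hs).1 (hsσ ▸ σ.2)
  have hbc : dv (baseProj E FA A b.1) = 0 := dv_baseProj_eq_zero hv hh b.2.1
  have ham := baseProj_mem a.2.2
  have hbm := baseProj_mem b.2.2
  have hst : weilForm (m + n) (s * t) = υ.1 :=
    Subtype.ext (by rw [weilForm_mul hs ht, hsσ, htτ, hυ])
  -- The difference of the two products is the sum of an exact element times a closed one and a
  -- closed element times an exact one, since the projection is multiplicative.
  have h : baseProj E FA A c.1 - s * t = (baseProj E FA A a.1 - s) * baseProj E FA A b.1 +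
      s * (baseProj E FA A b.1 - t) := by
    rw [hc, baseProj_mul]
    noncomm_ring
  rw [← hst, ← map_sub, h, map_add]
  rw [← hsσ, ← map_sub] at ha
  rw [← htτ, ← map_sub] at hb
  exact add_mem (hv.weilForm_mul_exact (sub_mem ham hs) hbm ha hbc)
    (hv.weilForm_mul_exact' hs (sub_mem hbm ht) hsc hb)

end Cohomology

end WeilModel

end

theorem mainTheorem9
    {E : Type*} [NormedAddCommGroup E] [NormedSpace ℝ E] [FiniteDimensional ℝ E]
    {M : Type*} [TopologicalSpace M] [ChartedSpace E M] [IsManifold 𝓘(ℝ, E) ∞ M]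
    [T2Space M] [SigmaCompactSpace M]
    {FA : Type*} [NormedAddCommGroup FA] [NormedSpace ℝ FA] [FiniteDimensional ℝ FA]
    {A : M → Type*} [TopologicalSpace (TotalSpace FA A)] [∀ x, AddCommGroup (A x)]
    [∀ x, Module ℝ (A x)] [∀ x, TopologicalSpace (A x)] [FiberBundle FA A] [VectorBundle ℝ FA A]
    [ContMDiffVectorBundle ∞ FA A 𝓘(ℝ, E)]
    (L : WeilModel.LieAlgebroid E FA A) :
    -- the vertical and the horizontal differential exist and are unique
    (∀ nab : WeilModel.Connection (WeilModel.LieAlgebroid.tangent E M) FA A,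
      (∃! d, WeilModel.IsVerticalDifferential nab d) ∧
      (∃! d, WeilModel.IsHorizontalDifferential L nab d)) ∧
    -- they make `W` a differential bigraded algebra with the cohomology of `M`
    (∀ (nab : WeilModel.Connection (WeilModel.LieAlgebroid.tangent E M) FA A)
      (dhor dver : WeilModel.Weil E FA A →ₗ[ℝ] WeilModel.Weil E FA A),
      WeilModel.IsHorizontalDifferential L nab dhor → WeilModel.IsVerticalDifferential nab dver →
      WeilModel.IsDifferentialBigradedAlgebra dhor dver ∧
      WeilModel.CohomologyIsDeRham (dhor + dver)) ∧
    -- up to isomorphism, this differential bigraded algebra is independent of the connection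
    (∀ (nab nab' : WeilModel.Connection (WeilModel.LieAlgebroid.tangent E M) FA A)
      (dhor dver dhor' dver' : WeilModel.Weil E FA A →ₗ[ℝ] WeilModel.Weil E FA A),
      WeilModel.IsHorizontalDifferential L nab dhor → WeilModel.IsVerticalDifferential nab dver →
      WeilModel.IsHorizontalDifferential L nab' dhor' →
      WeilModel.IsVerticalDifferential nab' dver' →
      ∃ φ : WeilModel.Weil E FA A ≃ₐ[ℝ] WeilModel.Weil E FA A,
        (∀ p q a, φ a ∈ WeilModel.weilPiece E FA A p q ↔ a ∈ WeilModel.weilPiece E FA A p q) ∧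
        (∀ a, φ (dhor a) = dhor' (φ a)) ∧ (∀ a, φ (dver a) = dver' (φ a))) := by
  refine ⟨fun nab => ⟨?_, ?_⟩, fun nab dhor dver hh hv =>
    ⟨WeilModel.isDifferentialBigradedAlgebra hh hv, WeilModel.cohomologyIsDeRham hv hh⟩,
    fun nab nab' dhor dver dhor' dver' hh hv hh' hv' =>
      WeilModel.exists_changeConn_equiv hh hv hh' hv'⟩
  · obtain ⟨d, hd, -⟩ := WeilModel.exists_verticalDifferential nab
    exact ⟨d, hd, fun d' hd' => WeilModel.verticalDifferential_unique nab hd' hd⟩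
  · obtain ⟨d, hd, -⟩ := WeilModel.exists_horizontalDifferential L nab
    exact ⟨d, hd, fun d' hd' => WeilModel.horizontalDifferential_unique L nab hd' hd⟩
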